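/- A mesh pattern of size $k$ is a pair $p=(\tau,R)$ with $\tau\in S_k$ (its underlying classical pattern) and $R$ a set of unit squares of $[0,k+1]^2$ (the shaded squares), each indexed by its lower-left corner $(i,j)$, $0\le i,j\le k$. A permutation $\pi\in S_n$ contains $p$ if there are positions $1\le x_1<\dots<x_k\le n$ such that $\pi(x_1)\cdots\pi(x_k)$ is order isomorphic to $\tau$ and, for every $(i,j)\in R$, there is no $m$ with $x_i<m<x_{i+1}$ and $y_j<\pi(m)<y_{j+1}$, where $y_1<\dots<y_k$ are the values $\pi(x_1),\dots,\pi(x_k)$ in increasing order and $x_0=y_0=0$, $x_{k+1}=y_{k+1}=n+1$. Otherwise $\pi$ avoids $p$. Two mesh patterns $p$ and $q$ are coincident if they are avoided by exactly the same permutations (of all sizes). Coincidence is an equivalence relation on the set of all mesh patterns; its equivalence classes are the coincidence classes. Theorem (coincidence classification of the mesh patterns of sizes 1, 2 and 3). (1) Coincident mesh patterns have the same underlying classical pattern (in particular the same size). (2) The mesh patterns of size 1 form exactly 8 coincidence classes. (3) For every underlying pattern $\tau$ of size 2 or 3, the number of mesh patterns with underlying pattern $\tau$, the number of their coincidence classes,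 and the number of these classes that have a given number of elements are as follows: $$\begin{array}{l|r|r|r} \tau & 12,\,21 & 123,\,321 & 132,\,213,\,231,\,312\\ \hline \text{mesh patterns} & 512 & 65536 & 65536\\ \text{coincidence classes} & 220 & 33516 & 33350\\ \text{classes of size }1 & 161 & 23908 & 23035\\ \text{classes of size }2 & 37 & 6116 & 6598\\ \text{classes of size }3 & 2 & 132 & 286\\ \text{classes of size }4 & 11 & 1961 & 2182\\ \text{classes of size }5 & 0 & 16 & 46\\ \text{classes of size }6 & 0 & 172 & 164\\ \text{classes of size }7 & 0 & 0 & 0\\ \text{classes of size }\ge 8 & 9 & 1211 & 1039 \end{array}$$ (4) If $p$ and $q$ are mesh patterns whose sizes lie in $\{1,2,3\}$ and which are not coincident, then some permutation of size at most $10$ contains exactly one of $p$ and $q$. -/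

import Mathlib

/-- A permutation of arbitrary size, that is, an element of `⋃ₙ Sₙ`.  Positions and values are
counted from `0`, so `S_n` is `Equiv.Perm (Fin n)`. -/
abbrev Permutation : Type := Σ n : ℕ, Equiv.Perm (Fin n)

/-- A mesh pattern `(τ, R)` of size `k`: a permutation `τ ∈ S_k` with a set `R` of shaded unit
squares of `[0, k + 1]²`, each square being indexed by its lower-left corner. -/
structure MeshPattern where
  size : ℕ
  perm : Equiv.Perm (Fin size)
  shading : Finset (Fin (size + 1) × Fin (size + 1))

namespace MeshPattern

/-- The underlying classical pattern of a mesh pattern. -/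
def underlying (p : MeshPattern) : Permutation := ⟨p.size, p.perm⟩

/-- Let `f` be the increasing choice of positions of a subsequence of `π` that is order isomorphic
to `τ`.  `InSquare τ π f i j m` says that the point `(m, π m)` of `π` lies in the region
corresponding to the square with lower-left corner `(i, j)`: exactly the first `i` points of the
subsequence are to the left of it (and the others are to the right), and exactly the `j` lowest
points of the subsequence are below it (and the others are above).  Points of the subsequence
itself lie in no such region. -/
def InSquare {k n : ℕ} (τ : Equiv.Perm (Fin k)) (π : Equiv.Perm (Fin n)) (f : Fin k ↪o Fin n)
    (i j : Fin (k + 1)) (m : Fin n) : Prop :=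
  (∀ a : Fin k, a.val < i.val → f a < m) ∧
  (∀ a : Fin k, i.val ≤ a.val → m < f a) ∧
  (∀ a : Fin k, (τ a).val < j.val → π (f a) < π m) ∧
  (∀ a : Fin k, j.val ≤ (τ a).val → π m < π (f a))

/-- The subsequence of `π` at the positions `f 0 < f 1 < ⋯` is an occurrence of the mesh
pattern `p`: it is order isomorphic to the underlying classical pattern, and the region
corresponding to each shaded square contains no point of `π`. -/
def IsOccurrence (p : MeshPattern) {n : ℕ} (π : Equiv.Perm (Fin n)) (f : Fin p.size ↪o Fin n) :
    Prop :=
  (∀ a b : Fin p.size, π (f a) < π (f b) ↔ p.perm a < p.perm b) ∧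
  ∀ s ∈ p.shading, ∀ m : Fin n, ¬ InSquare p.perm π f s.1 s.2 m

/-- The permutation `π` contains the mesh pattern `p`. -/
def ContainedIn (p : MeshPattern) (π : Permutation) : Prop :=
  ∃ f : Fin p.size ↪o Fin π.1, p.IsOccurrence π.2 f

/-- `Av(p)`: the permutations, of all sizes, that avoid `p`. -/
def av (p : MeshPattern) : Set Permutation := {π | ¬ p.ContainedIn π}

/-- Two mesh patterns are coincident if they are avoided by the same permutations. -/
def Coincident (p q : MeshPattern) : Prop := p.av = q.av

/-- The coincidence class of `p`, among all mesh patterns. -/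
def coincidenceClass (p : MeshPattern) : Set MeshPattern := {q | p.Coincident q}

/-- The mesh patterns with underlying classical pattern `τ`. -/
def withUnderlying {k : ℕ} (τ : Equiv.Perm (Fin k)) : Set MeshPattern :=
  {p | p.underlying = ⟨k, τ⟩}

/-- The coincidence classes of the mesh patterns with underlying classical pattern `τ`. -/
def coincidenceClasses {k : ℕ} (τ : Equiv.Perm (Fin k)) : Set (Set MeshPattern) :=
  coincidenceClass '' withUnderlying τ

/-- The number of coincidence classes with underlying classical pattern `τ` that consist of
exactly `j` mesh patterns. -/
noncomputable def numClassesOfSize {k : ℕ} (τ : Equiv.Perm (Fin k)) (j : ℕ) : ℕ∞ :=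
  {C ∈ coincidenceClasses τ | C.encard = j}.encard

/-- The number of coincidence classes with underlying classical pattern `τ` that consist of
at least `j` mesh patterns. -/
noncomputable def numClassesOfSizeAtLeast {k : ℕ} (τ : Equiv.Perm (Fin k)) (j : ℕ) : ℕ∞ :=
  {C ∈ coincidenceClasses τ | (j : ℕ∞) ≤ C.encard}.encard

end MeshPattern

/-! ### Point sets in general position -/

/-! Coincident patterns have the same underlying permutation because a permutation contains every
mesh pattern built on it: the full occurrence leaves no point over that could lie in a square. Two
coincident patterns are therefore contained in each other's underlying permutation, and
`MeshPattern.underlying_eq_of_containedIn` applies. What remains is to sort the shadings of one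
fixed pattern of size k, and reversal and complement reduce this to the patterns 1, 12, 123 and 132.

Coincidences are proved by extremal arguments. Given an occurrence, ask whether a union of cells
contains a point. If it does, insert the point of the union that is extreme in some direction and
record that the cells of the union beyond it are empty; if it does not, record that the whole union
is empty. After a few such questions some of the known points form an occurrence with a changed
shading, or an occurrence of the given pattern that is smaller in a lexicographic measure, so that
induction applies. A `Tree` is such an argument. It may also replace two points of a common cell by
a better pair in the same cell; this applies a theorem about pairs to the points of one cell alone,
which is why everything is stated for a `PointSet` and not only for permutations.

One argument usually serves many shadings, so all shadings are treated at once. A shading is a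
number r below 2^((k+1)^2), a family of shadings is a number whose binary digit at r decides
membership, and the bookkeeping of an argument becomes bitwise arithmetic on such numbers.
`Goal.mask` computes the family for which a tree is a valid proof, and `Goal.mask_sound` is its
correctness.

The equivalences found in this way are used to move every shading to a representative, while binary
counters, one for each shading and stored digit by digit as families, record how many shadings have
arrived at each place. `Certificate.check_sound` thus gives an upper bound for the number of classes
together with the sizes of the fibres.

For the lower bound, the shadings for which a given permutation contains the pattern again form a
family. Boolean combinations of a moderate number of such families reproduce, on the
representatives, the truth value of each cell. Two representatives that are contained in the same
permutations of size at most 10 therefore have the same cells and are equal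
(`Separation.eq_of_agree`); no pairwise comparison of representatives is needed.

`Distributed.classified` joins both bounds: the fibres are exactly the coincidence classes, and
since only permutations of size at most 10 served for the separation, patterns with the same
underlying permutation that are not coincident are told apart by one of these. For different
underlying permutations one of those two permutations does it. -/

/-- A bounded set of points of `ℕ × ℕ`, no two of which share a coordinate. -/
structure PointSet where
  pts : Set (ℕ × ℕ)
  bound : ℕ
  lt_bound : ∀ p ∈ pts, p.1 ≤ bound ∧ p.2 ≤ bound
  fst_inj : ∀ p ∈ pts, ∀ q ∈ pts, p.1 = q.1 → p = q
  snd_inj : ∀ p ∈ pts, ∀ q ∈ pts, p.2 = q.2 → p = q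

namespace PointSet

/-- The points `q 0, …, q (n - 1)` lie in `P`, are listed from left to right, and `σ` gives the
order of their heights. -/
structure Config (P : PointSet) (n : ℕ) (σ : ℕ → ℕ) (q : ℕ → ℕ × ℕ) : Prop where
  mem : ∀ a < n, q a ∈ P.pts
  rank_lt : ∀ a < n, σ a < n
  fst_lt : ∀ a < n, ∀ b < n, (q a).1 < (q b).1 ↔ a < b
  snd_lt : ∀ a < n, ∀ b < n, (q a).2 < (q b).2 ↔ σ a < σ b

/-- The point `p` lies strictly inside the cell `(i, j)` of the grid spanned by `q`. -/
def InCell (n : ℕ) (σ : ℕ → ℕ) (q : ℕ → ℕ × ℕ) (i j : ℕ) (p : ℕ × ℕ) : Prop :=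
  ∀ a < n, (a < i → (q a).1 < p.1) ∧ (i ≤ a → p.1 < (q a).1) ∧
    (σ a < j → (q a).2 < p.2) ∧ (j ≤ σ a → p.2 < (q a).2)

/-- The configuration `q` avoids the cells shaded in `R`, where the cell `(i, j)` is encoded by
the binary digit `i * (k + 1) + j` of `R`. -/
def Clear (P : PointSet) (k : ℕ) (τ : ℕ → ℕ) (R : ℕ) (q : ℕ → ℕ × ℕ) : Prop :=
  ∀ i ≤ k, ∀ j ≤ k, R.testBit (i * (k + 1) + j) = true → ∀ p ∈ P.pts, ¬ InCell k τ q i j p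

/-- The point set contains the mesh pattern with underlying pattern `τ` and shading `R`. -/
def Contains (P : PointSet) (k : ℕ) (τ : ℕ → ℕ) (R : ℕ) : Prop :=
  ∃ q, Config P k τ q ∧ Clear P k τ R q

/-- The entries smaller than `v` form an initial segment in the order of ranks, so one threshold
separates them from the others. -/
theorem exists_rank (n : ℕ) (h ρ : ℕ → ℕ) (hρ : ∀ a < n, ρ a < n)
    (hh : ∀ a < n, ∀ b < n, h a < h b ↔ ρ a < ρ b) (v : ℕ) (hv : ∀ a < n, h a ≠ v) :
    ∃ j ≤ n, ∀ a < n, (ρ a < j → h a < v) ∧ (j ≤ ρ a → v < h a) := by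
  classical
  -- The threshold is one more than the largest rank below `v`. The supremum of the empty set is 0,
  -- which is right when nothing lies below.
  refine ⟨((Finset.range n).filter (fun a => h a < v)).sup (fun a => ρ a + 1), ?_, ?_⟩
  · refine Finset.sup_le fun a ha => ?_
    have := hρ a (by simpa using (Finset.mem_filter.1 ha).1)
    omega
  · intro a ha
    constructor
    · intro hlt
      obtain ⟨b, hb, hab⟩ := (Finset.lt_sup_iff (a := ρ a)).1 hlt
      obtain ⟨hb1, hb2⟩ := Finset.mem_filter.1 hb
      have hb1 : b < n := by simpa using hb1
      by_contra hcon
      have h1 := hv a ha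
      have h2 := (hh b hb1 a ha).1 (by omega)
      have h3 := (hh a ha b hb1)
      omega
    · intro hle
      by_contra hcon
      have h1 := hv a ha
      have h2 : a ∈ (Finset.range n).filter (fun a => h a < v) := by
        simp only [Finset.mem_filter, Finset.mem_range]
        exact ⟨ha, by omega⟩
      have h3 := Finset.le_sup (f := fun a => ρ a + 1) h2
      omega

/-- General position enters here: a point of `P` that was not chosen shares no coordinate with a
chosen one, so it lies on no grid line. Emptiness is later proved by locating a hypothetical
offending point in this way. -/
theorem Config.exists_cell {P : PointSet} {n : ℕ} {σ : ℕ → ℕ} {q : ℕ → ℕ × ℕ}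
    (hq : Config P n σ q) (p : ℕ × ℕ) (hp : p ∈ P.pts) :
    (∃ a < n, q a = p) ∨ ∃ i ≤ n, ∃ j ≤ n, InCell n σ q i j p := by
  by_cases h : ∃ a < n, q a = p
  · exact Or.inl h
  · right
    push Not at h
    obtain ⟨i, hi, h1⟩ := exists_rank n (fun a => (q a).1) id (fun a ha => ha)
      (fun a ha b hb => hq.fst_lt a ha b hb) p.1
      (fun a ha e => h a ha (P.fst_inj _ (hq.mem a ha) _ hp e))
    obtain ⟨j, hj, h2⟩ := exists_rank n (fun a => (q a).2) σ hq.rank_lt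
      (fun a ha b hb => hq.snd_lt a ha b hb) p.2
      (fun a ha e => h a ha (P.snd_inj _ (hq.mem a ha) _ hp e))
    exact ⟨i, hi, j, hj, fun a ha => ⟨(h1 a ha).1, (h1 a ha).2, (h2 a ha).1, (h2 a ha).2⟩⟩

/-- Insert an element at position `c` of a sequence. -/
def insFun {α : Type*} (q : ℕ → α) (c : ℕ) (p : α) (m : ℕ) : α :=
  cond (Nat.blt m c) (q m) (cond (Nat.beq m c) p (q (m - 1)))

/-- The position after the insertion of a new element at position `c`. -/
def bump (c v : ℕ) : ℕ := cond (Nat.blt v c) v (v + 1)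

/-- The position before the insertion of a new grid line at position `c`. -/
def unbump (c i : ℕ) : ℕ := cond (Nat.ble i c) i (i - 1)

/-- The heights after the insertion of a new point in the cell `(ci, cj)`. -/
def insRank (σ : ℕ → ℕ) (ci cj m : ℕ) : ℕ :=
  cond (Nat.blt m ci) (bump cj (σ m)) (cond (Nat.beq m ci) cj (bump cj (σ (m - 1))))

/-- Functions to be evaluated by the kernel are written with `cond` and Boolean comparisons, which
reduce without unfolding `Decidable` instances. For reasoning, these lemmas return to `if`. -/
theorem cond_blt {α : Type*} (a b : ℕ) (x y : α) :
    cond (Nat.blt a b) x y = if a < b then x else y := by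
  by_cases h : a < b <;> simp [h, Bool.cond_eq_ite, Nat.blt_eq]

theorem cond_ble {α : Type*} (a b : ℕ) (x y : α) :
    cond (Nat.ble a b) x y = if a ≤ b then x else y := by
  by_cases h : a ≤ b <;> simp [h, Bool.cond_eq_ite]

theorem cond_beq {α : Type*} (a b : ℕ) (x y : α) :
    cond (Nat.beq a b) x y = if a = b then x else y := by
  by_cases h : a = b <;> simp [h, Bool.cond_eq_ite]

theorem bump_eq (c v : ℕ) : bump c v = if v < c then v else v + 1 := cond_blt ..

theorem unbump_eq (c v : ℕ) : unbump c v = if v ≤ c then v else v - 1 := cond_ble ..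

theorem insFun_self {α : Type*} (q : ℕ → α) (c : ℕ) (p : α) : insFun q c p c = p := by
  simp [insFun, cond_blt]

theorem insFun_bump {α : Type*} (q : ℕ → α) (c : ℕ) (p : α) (m : ℕ) :
    insFun q c p (bump c m) = q m := by
  rw [bump_eq, insFun, cond_blt, cond_beq]
  split_ifs <;> first | rfl | omega

theorem insRank_self (σ : ℕ → ℕ) (ci cj : ℕ) : insRank σ ci cj ci = cj := by
  simp [insRank, cond_blt]

theorem insRank_bump (σ : ℕ → ℕ) (ci cj m : ℕ) :
    insRank σ ci cj (bump ci m) = bump cj (σ m) := by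
  rw [bump_eq ci, insRank, cond_blt, cond_beq]
  split_ifs <;> first | rfl | omega

/-- The dichotomy along which all properties of an enlarged configuration are checked: an index is
that of the new point or the shifted index of an old one. -/
theorem eq_or_bump (n c a : ℕ) (ha : a < n + 1) (hc : c ≤ n) :
    a = c ∨ ∃ b < n, a = bump c b := by
  rcases lt_trichotomy a c with h | h | h
  · exact Or.inr ⟨a, by omega, by simp [bump_eq, h]⟩
  · exact Or.inl h
  · refine Or.inr ⟨a - 1, by omega, ?_⟩
    rw [bump_eq]; split_ifs <;> omega

theorem bump_lt_bump (c a b : ℕ) : bump c a < bump c b ↔ a < b := by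
  rw [bump_eq, bump_eq]; split_ifs <;> omega

/-- Comparisons among old points survive because `bump` is strictly monotone, and comparisons with
the new point are what membership in the cell `(ci, cj)` provides. -/
theorem Config.insert {P : PointSet} {n : ℕ} {σ : ℕ → ℕ} {q : ℕ → ℕ × ℕ}
    (hq : Config P n σ q) {ci cj : ℕ} (hi : ci ≤ n) (hj : cj ≤ n) {p : ℕ × ℕ} (hp : p ∈ P.pts)
    (hc : InCell n σ q ci cj p) :
    Config P (n + 1) (insRank σ ci cj) (insFun q ci p) := by
  constructor
  · intro a ha
    rcases eq_or_bump n ci a ha hi with rfl | ⟨b, hb, rfl⟩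
    · rwa [insFun_self]
    · rw [insFun_bump]; exact hq.mem b hb
  · intro a ha
    rcases eq_or_bump n ci a ha hi with rfl | ⟨b, hb, rfl⟩
    · rw [insRank_self]; omega
    · rw [insRank_bump, bump_eq]
      have := hq.rank_lt b hb
      split_ifs <;> omega
  · intro a ha b hb
    rcases eq_or_bump n ci a ha hi with h | ⟨a', ha', rfl⟩ <;>
    rcases eq_or_bump n ci b hb hi with h' | ⟨b', hb', rfl⟩
    · subst h; subst h'; simp
    · subst h
      rw [insFun_self, insFun_bump, bump_eq]
      have := hc b' hb'
      split_ifs <;> omega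
    · subst h'
      rw [insFun_self, insFun_bump, bump_eq]
      have := hc a' ha'
      split_ifs <;> omega
    · rw [insFun_bump, insFun_bump, bump_lt_bump]
      exact hq.fst_lt a' ha' b' hb'
  · intro a ha b hb
    rcases eq_or_bump n ci a ha hi with h | ⟨a', ha', rfl⟩ <;>
    rcases eq_or_bump n ci b hb hi with h' | ⟨b', hb', rfl⟩
    · subst h; subst h'; simp
    · subst h
      rw [insFun_self, insFun_bump, insRank_self, insRank_bump, bump_eq]
      have := hc b' hb'
      split_ifs <;> omega
    · subst h'
      rw [insFun_self, insFun_bump, insRank_self, insRank_bump, bump_eq]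
      have := hc a' ha'
      split_ifs <;> omega
    · rw [insFun_bump, insFun_bump, insRank_bump, insRank_bump, bump_lt_bump]
      exact hq.snd_lt a' ha' b' hb'

/-- Deleting the grid lines through the new point merges the columns `ci` and `ci + 1` and the rows
`cj` and `cj + 1`; `unbump` is this merging. The information lost, the position relative to the new
point, is kept by `InCell.insert_compare`. -/
theorem InCell.of_insert {n : ℕ} {σ : ℕ → ℕ} {q : ℕ → ℕ × ℕ} {ci cj i j : ℕ} {p p' : ℕ × ℕ}
    (h : InCell (n + 1) (insRank σ ci cj) (insFun q ci p) i j p') :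
    InCell n σ q (unbump ci i) (unbump cj j) p' := by
  intro a ha
  have h1 := h (bump ci a) (by rw [bump_eq]; split_ifs <;> omega)
  rw [insFun_bump, insRank_bump] at h1
  refine ⟨fun h2 => h1.1 ?_, fun h2 => h1.2.1 ?_, fun h2 => h1.2.2.1 ?_, fun h2 => h1.2.2.2 ?_⟩ <;>
  · rw [unbump_eq] at h2
    rw [bump_eq]
    split_ifs at h2 ⊢ <;> omega

theorem InCell.insert_compare {n : ℕ} {σ : ℕ → ℕ} {q : ℕ → ℕ × ℕ} {ci cj i j : ℕ} {p p' : ℕ × ℕ}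
    (hi : ci ≤ n) (h : InCell (n + 1) (insRank σ ci cj) (insFun q ci p) i j p') :
    (ci < i → p.1 < p'.1) ∧ (i ≤ ci → p'.1 < p.1) ∧ (cj < j → p.2 < p'.2) ∧
      (j ≤ cj → p'.2 < p.2) := by
  have h1 := h ci (by omega)
  rwa [insFun_self, insRank_self] at h1

/-- Extreme points come from minimising a natural number, so finiteness of the point set is never
needed. To maximise a coordinate one minimises its difference from `bound`. -/
theorem exists_min_key (S : Set (ℕ × ℕ)) (hS : S.Nonempty) (key : ℕ × ℕ → ℕ) :
    ∃ p ∈ S, ∀ p' ∈ S, key p ≤ key p' := by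
  obtain ⟨p, hp, h⟩ := WellFounded.has_min (measure key).wf S hS
  exact ⟨p, hp, fun p' hp' => not_lt.1 (h p' hp')⟩

end PointSet

namespace PointSet

/-! ### Families of shadings as binary numbers -/

/-- The family of all shadings `r < 2 ^ e`. -/
def ones (e : ℕ) : ℕ := Nat.sub (Nat.pow 2 (Nat.pow 2 e)) 1

/-- `Nat.rec` step doubling a family of shadings `m` times. -/
def spread (x w m : ℕ) : ℕ :=
  Nat.rec x (fun i y => Nat.lor y (Nat.shiftLeft y (Nat.pow 2 (Nat.add w i)))) m

/-- The family of all shadings `r < 2 ^ e` with `r.testBit b`. -/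
def var (e b : ℕ) : ℕ :=
  spread (Nat.shiftLeft (ones b) (Nat.pow 2 b)) (b + 1) (Nat.sub e (b + 1))

/-- The complement of a family of shadings. -/
def compl (e x : ℕ) : ℕ := Nat.xor (ones e) x

/-- Bitwise operations are written `Nat.land`, `Nat.lor`, `Nat.xor` instead of with notation, so
that the kernel meets directly the functions for which it has built-in arithmetic. -/
theorem testBit_land (x y r : ℕ) : (Nat.land x y).testBit r = (x.testBit r && y.testBit r) :=
  Nat.testBit_and x y r

theorem testBit_lor (x y r : ℕ) : (Nat.lor x y).testBit r = (x.testBit r || y.testBit r) :=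
  Nat.testBit_or x y r

theorem testBit_xor' (x y r : ℕ) : (Nat.xor x y).testBit r = (x.testBit r ^^ y.testBit r) :=
  Nat.testBit_xor x y r

theorem testBit_ones {e r : ℕ} (hr : r < 2 ^ e) : (ones e).testBit r = true := by
  change (2 ^ 2 ^ e - 1).testBit r = true
  rw [Nat.testBit_two_pow_sub_one]; simpa using hr

theorem testBit_compl {e r : ℕ} (x : ℕ) (hr : r < 2 ^ e) :
    (compl e x).testBit r = !x.testBit r := by
  rw [compl, testBit_xor', testBit_ones hr]; simp

/-- As `f` ignores the digits from `w` to `w + m - 1`, its table of values repeats, and each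
doubling copies the table obtained so far behind itself. The size bound is part of the induction
because the copy has to land on zero digits. -/
theorem testBit_spread (f : ℕ → Bool) (x w : ℕ) (hx : ∀ r < 2 ^ w, x.testBit r = f r)
    (hx' : x < 2 ^ 2 ^ w) (m : ℕ)
    (hf : ∀ i < m, ∀ r < 2 ^ (w + i), f (2 ^ (w + i) + r) = f r) :
    (∀ r < 2 ^ (w + m), (spread x w m).testBit r = f r) ∧ spread x w m < 2 ^ 2 ^ (w + m) := by
  induction m with
  | zero => exact ⟨hx, hx'⟩
  | succ m ih =>
    obtain ⟨h1, h2⟩ := ih (fun i hi => hf i (by omega))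
    have e1 : spread x w (m + 1) = spread x w m ||| (spread x w m) <<< 2 ^ (w + m) := rfl
    have e2 : 2 ^ (w + (m + 1)) = 2 ^ (w + m) + 2 ^ (w + m) := by rw [← Nat.add_assoc, pow_succ]; ring
    constructor
    · intro r hr
      rw [e1, Nat.testBit_or, Nat.testBit_shiftLeft]
      by_cases h : r < 2 ^ (w + m)
      · simp [h1 r h, Nat.not_le.2 h]
      · obtain ⟨r', rfl⟩ := Nat.exists_eq_add_of_le (not_lt.1 h)
        have hr' : r' < 2 ^ (w + m) := by omega
        rw [hf m (by omega) r' hr', Nat.testBit_lt_two_pow (lt_of_lt_of_le h2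
          (Nat.pow_le_pow_right (by norm_num) (by omega)))]
        simp [h1 r' hr']
    · rw [e1]
      have h3 : 2 ^ (w + m) ≤ 2 ^ (w + (m + 1)) := Nat.pow_le_pow_right (by norm_num) (by omega)
      refine Nat.or_lt_two_pow (lt_of_lt_of_le h2 (Nat.pow_le_pow_right (by norm_num) h3)) ?_
      rw [Nat.shiftLeft_eq, e2, pow_add 2 (2 ^ (w + m)) (2 ^ (w + m))]
      exact Nat.mul_lt_mul_of_pos_right h2 (Nat.two_pow_pos _)

/-- The table of the digit `b` consists of `2 ^ b` zeros followed by `2 ^ b` ones, repeated. This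
block is the start value, and the digits above `b` only cause repetitions. -/
theorem testBit_var {e b r : ℕ} (hb : b < e) (hr : r < 2 ^ e) :
    (var e b).testBit r = r.testBit b := by
  have hs : 2 ^ (b + 1) = 2 ^ b + 2 ^ b := by rw [pow_succ]; ring
  have h := (testBit_spread (fun r => r.testBit b) ((2 ^ 2 ^ b - 1) <<< 2 ^ b) (b + 1) ?_ ?_
    (e - (b + 1)) ?_).1 r (by rwa [show b + 1 + (e - (b + 1)) = e by omega])
  · exact h
  · intro r hr
    rw [Nat.testBit_shiftLeft, Nat.testBit_two_pow_sub_one]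
    by_cases h : r < 2 ^ b
    · simp [Nat.testBit_lt_two_pow h, Nat.not_le.2 h]
    · obtain ⟨r', rfl⟩ := Nat.exists_eq_add_of_le (not_lt.1 h)
      have hr' : r' < 2 ^ b := by omega
      simp [Nat.testBit_two_pow_add_eq, Nat.testBit_lt_two_pow hr', hr']
  · rw [Nat.shiftLeft_eq, hs, pow_add]
    refine Nat.mul_lt_mul_of_pos_right ?_ (by positivity)
    exact Nat.sub_lt (by positivity) (by norm_num)
  · intro i _ r _
    exact Nat.testBit_two_pow_add_gt (by omega) r

/-- Conjunction of the families `f 0, …, f (n - 1)`. -/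
def allLT (e : ℕ) (f : ℕ → ℕ) (n : ℕ) : ℕ :=
  Nat.rec (ones e) (fun i y => Nat.land y (f i)) n

theorem testBit_allLT {e n r : ℕ} {f : ℕ → ℕ} (h : (allLT e f n).testBit r = true) :
    ∀ i < n, (f i).testBit r = true := by
  induction n with
  | zero => intro i hi; omega
  | succ n ih =>
    have h' : (Nat.land (allLT e f n) (f n)).testBit r = true := h
    rw [testBit_land, Bool.and_eq_true] at h'
    intro i hi
    rcases Nat.lt_succ_iff_lt_or_eq.1 hi with h2 | rfl
    · exact ih h'.1 i h2
    · exact h'.2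

/-- Boolean conjunction of `f 0, …, f (n - 1)`. -/
def allB (f : ℕ → Bool) (n : ℕ) : Bool := Nat.rec true (fun i y => and (f i) y) n

theorem allB_iff {f : ℕ → Bool} {n : ℕ} : allB f n = true ↔ ∀ i < n, f i = true := by
  induction n with
  | zero => simp [allB]
  | succ n ih =>
    have h' : allB f (n + 1) = (f n && allB f n) := rfl
    rw [h', Bool.and_eq_true, ih]
    constructor
    · intro h i hi
      rcases Nat.lt_succ_iff_lt_or_eq.1 hi with h2 | rfl
      · exact h.2 i h2
      · exact h.1
    · exact fun h => ⟨h n (by omega), fun i hi => h i (by omega)⟩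

/-- Number of entries of a list below a bound. -/
def below (l : List ℕ) (v : ℕ) : ℕ :=
  List.rec 0 (fun a _ c => cond (Nat.blt a v) (Nat.succ c) c) l

/-- Entry of a list. -/
def nth (l : List ℕ) : ℕ → ℕ :=
  List.rec (fun _ => 0) (fun x _ rest a => Nat.rec x (fun b _ => rest b) a) l

theorem nth_eq (l : List ℕ) (a : ℕ) : nth l a = l.getD a 0 := by
  induction l generalizing a with
  | nil => simp [nth]
  | cons x l ih => cases a with
    | zero => rfl
    | succ a => change nth l a = _; simpa using ih a

/-- Membership in a list. -/
def mem (l : List ℕ) (a : ℕ) : Bool := List.rec false (fun b _ c => cond (Nat.beq a b) true c) l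

theorem mem_iff {l : List ℕ} {a : ℕ} : mem l a = true ↔ a ∈ l := by
  induction l with
  | nil => simp [mem]
  | cons b l ih =>
    have : mem (b :: l) a = cond (Nat.beq a b) true (mem l a) := rfl
    rw [this, cond_beq]; split_ifs with h <;> simp [h, ih]

theorem below_cons (a : ℕ) (l : List ℕ) (v : ℕ) :
    below (a :: l) v = if a < v then below l v + 1 else below l v := by
  have : below (a :: l) v = cond (Nat.blt a v) (Nat.succ (below l v)) (below l v) := rfl
  rw [this, cond_blt]

/-- Together with `below_eq` this identifies cells. The column or row of a point is the number of
selected points to its left or below it, and comparisons alone determine that number. -/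
theorem below_congr (l l' : List ℕ) (v v' : ℕ) (hl : l.length = l'.length)
    (h : ∀ a < l.length, nth l a < v ↔ nth l' a < v') : below l v = below l' v' := by
  induction l generalizing l' with
  | nil => cases l' with
    | nil => rfl
    | cons _ _ => simp at hl
  | cons a l ih => cases l' with
    | nil => simp at hl
    | cons a' l' =>
      have h0 := h 0 (by simp)
      simp only [nth_eq, List.getD_cons_zero] at h0
      rw [below_cons, below_cons, ih l' (by simpa using hl)
        (fun a ha => by simpa [nth_eq] using h (a + 1) (by simpa using ha))]
      simp only [h0]

theorem below_eq (l : List ℕ) (v i : ℕ) (hi : i ≤ l.length)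
    (h : ∀ a < l.length, nth l a < v ↔ a < i) : below l v = i := by
  induction l generalizing i with
  | nil => simp at hi; subst hi; rfl
  | cons a l ih =>
    have h0 := h 0 (by simp)
    simp only [nth_eq, List.getD_cons_zero] at h0
    have h1 : ∀ a < l.length, nth l a < v ↔ a + 1 < i := fun a ha => by
      simpa [nth_eq] using h (a + 1) (by simpa using ha)
    rw [below_cons]
    cases i with
    | zero => rw [if_neg (by omega)]; exact ih 0 (by omega) (fun a ha => by rw [h1 a ha]; omega)
    | succ i =>
      rw [if_pos (by omega), ih i (by simpa using hi) (fun a ha => by rw [h1 a ha]; omega)]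

theorem nth_map (l : List ℕ) (σ : ℕ → ℕ) (a : ℕ) (ha : a < l.length) :
    nth (l.map σ) a = σ (nth l a) := by
  simp [nth_eq, ha]

/-! ### Proof trees -/

/-- A certificate that every point set containing a mesh pattern contains one of several others.
`hit g D`: the points at the positions `g` form an occurrence of the pattern whose shading differs
from the given one in `D`.  `descend g`: they form a smaller occurrence of the given pattern.
`split U d t`: consider the extreme point in the direction `d` in the union of the cells `U`; the
children are joined by `kid` and are followed by the tree for the case that `U` is empty.
`drop D i j ρ S t`: keep only the points at the positions `D`, and replace a pair of points in the
cell `(i, j)` by a pair that forms an occurrence of the mesh pattern `(ρ, S)`. -/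
inductive Tree
  | hit (g : List ℕ) (D : ℕ)
  | descend (g : List ℕ)
  | either (s t : Tree)
  | split (U : List (ℕ × ℕ)) (d : ℕ) (t : Tree)
  | kid (s t : Tree)
  | drop (D : List ℕ) (i j ρ S : ℕ) (t : Tree)

/-- The data fixed during the evaluation of a tree: the pattern, the targets, the measure used for
induction, and the pairs available to `drop`. -/
structure Goal where
  k : ℕ
  τ : List ℕ
  targets : List ℕ
  measure : (Bool × ℕ × Bool) × (Bool × ℕ × Bool)
  pairs : List (ℕ × ℕ)

/-- The number of cells. -/
def Goal.cells (C : Goal) : ℕ := Nat.mul (Nat.succ C.k) (Nat.succ C.k)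

/-- What is known about a configuration: the heights of its points, the shadings for which a cell
is known to be empty, and the positions of the original occurrence. -/
structure State where
  n : ℕ
  σ : ℕ → ℕ
  E : ℕ → ℕ → ℕ
  f : List ℕ

/-- Membership in a list of cells. -/
def memCell (U : List (ℕ × ℕ)) (i j : ℕ) : Bool :=
  List.rec false (fun u _ c => cond (and (Nat.beq i u.1) (Nat.beq j u.2)) true c) U

/-- Whether the cell `(i, j)` lies beyond the new point in direction `d`. -/
def beyond (d ci cj i j : ℕ) : Bool :=
  -- The directions 0, 1, 2, 3 mean leftmost, rightmost, lowest, highest. Any other value claims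
  -- nothing; 4 is used for points inserted without an extremal property.
  cond (Nat.beq d 0) (Nat.ble i ci) (cond (Nat.beq d 1) (Nat.blt ci i)
    (cond (Nat.beq d 2) (Nat.ble j cj) (cond (Nat.beq d 3) (Nat.blt cj j) false)))

/-- The state after the insertion of the extreme point of `U` in the cell `c`. -/
def State.insert (e : ℕ) (s : State) (c : ℕ × ℕ) (d : ℕ) (U : List (ℕ × ℕ)) : State where
  n := Nat.succ s.n
  σ := insRank s.σ c.1 c.2
  -- A point in a part of `U` beyond the new point would be more extreme than it, so these cells are
  -- empty for every shading. All other cells inherit what was known about the cell they come from.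
  E := fun i j => cond (and (beyond d c.1 c.2 i j) (memCell U (unbump c.1 i) (unbump c.2 j)))
    (ones e) (s.E (unbump c.1 i) (unbump c.2 j))
  f := s.f.map (bump c.1)

/-- The state in which the cells `U` are empty. -/
def State.clear (e : ℕ) (s : State) (U : List (ℕ × ℕ)) : State where
  n := s.n
  σ := s.σ
  E := fun i j => cond (memCell U i j) (ones e) (s.E i j)
  f := s.f

/-- The order of the heights in the patterns `12` and `21`. -/
def pairRank (ρ : ℕ) (a : ℕ) : ℕ := cond (Nat.beq ρ 0) a (Nat.sub 1 a)

/-- The state that keeps only the points at the positions `D`. -/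
def State.keep (e : ℕ) (s : State) (D : List ℕ) : State where
  n := D.length
  σ := fun a => below (D.map s.σ) (s.σ (nth D a))
  -- A cell of the coarser grid is known to be empty for those shadings for which all fine cells
  -- inside it are, and for no shading if a dropped point lies in it.
  E := fun i j => Nat.land
    (allLT e (fun i' => cond (Nat.beq (below D i') i) (allLT e (fun j' =>
      cond (Nat.beq (below (D.map s.σ) j') j) (s.E i' j') (ones e)) (Nat.succ s.n)) (ones e))
      (Nat.succ s.n))
    (allLT e (fun m => cond (mem D m) (ones e)
      (cond (and (Nat.beq (below D m) i) (Nat.beq (below (D.map s.σ) (s.σ m)) j)) 0 (ones e))) s.n)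
  -- When a point of the original occurrence is dropped, the list becomes empty. In a goal with `k >
  -- 0` its length is then wrong, so `precedes` rejects every descent.
  f := cond (allB (fun a => mem D (nth s.f a)) s.f.length) (s.f.map (below D)) []

/-- The state after the insertion of a pair of points in a cell. -/
def State.insertPair (e : ℕ) (s : State) (ci cj ρ S : ℕ) : State :=
  -- The second point is inserted to the right of the first, above or below it according to `ρ`. The
  -- cell turns into a block of 3 by 3 cells with corner `(ci, cj)`, and those shaded in `S` become
  -- empty.
  let s' := (s.insert e (ci, cj) 4 []).insert e (ci + 1, cond (Nat.beq ρ 0) (cj + 1) cj) 4 []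
  ⟨s'.n, s'.σ, fun i j => cond
      (and (and (Nat.ble ci i) (Nat.ble i (ci + 2))) (and (and (Nat.ble cj j) (Nat.ble j (cj + 2)))
        (Nat.testBit S ((i - ci) * 3 + (j - cj))))) (ones e) (s'.E i j), s'.f⟩

/-- Whether the points at the positions `g` are order isomorphic to `τ`. -/
def isOcc (k : ℕ) (τ : List ℕ) (n : ℕ) (σ : ℕ → ℕ) (g : List ℕ) : Bool :=
  and (Nat.beq g.length k) (allB (fun a => and (Nat.blt (nth g a) n) (allB (fun b =>
    and (cond (Nat.blt a b) (Nat.blt (nth g a) (nth g b)) (Nat.ble (nth g b) (nth g a)))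
      (cond (Nat.blt (nth τ a) (nth τ b)) (Nat.blt (σ (nth g a)) (σ (nth g b)))
        (Nat.ble (σ (nth g b)) (σ (nth g a))))) k)) k)

/-- The family of shadings that do not contain the cell `b` after the change `D`. -/
def unshaded (e D b : ℕ) : ℕ := nth
  ((List.range e).map fun b => cond (Nat.testBit D b) (var e b) (compl e (var e b))) b

/-- The family of shadings `r` for which the points at the positions `g` form an occurrence with
shading `r ^^^ D`. -/
def hitMask (C : Goal) (s : State) (g : List ℕ) (D : ℕ) : ℕ :=
  cond (isOcc C.k C.τ s.n s.σ g)
    (Nat.land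
      (allLT C.cells (fun m => cond (mem g m) (ones C.cells) (unshaded C.cells D
        (Nat.add (Nat.mul (below g m) (Nat.succ C.k)) (below (g.map s.σ) (s.σ m))))) s.n)
      (allLT C.cells (fun i => allLT C.cells (fun j => Nat.lor (s.E i j) (unshaded C.cells D
        (Nat.add (Nat.mul (below g i) (Nat.succ C.k)) (below (g.map s.σ) j))))
          (Nat.succ s.n)) (Nat.succ s.n)))
    0

/-- The rank of a coordinate of a point of an occurrence. -/
def coordRank (σ : ℕ → ℕ) (g : List ℕ) (c : Bool × ℕ × Bool) : ℕ :=
  cond c.1 (σ (nth g c.2.1)) (nth g c.2.1)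

/-- Comparison of coordinates of points of two occurrences. -/
def coordLT (σ : ℕ → ℕ) (g f : List ℕ) (c : Bool × ℕ × Bool) : Bool :=
  cond c.2.2 (Nat.blt (coordRank σ f c) (coordRank σ g c))
    (Nat.blt (coordRank σ g c) (coordRank σ f c))

/-- Whether the occurrence `g` precedes the occurrence `f`. -/
def precedes (C : Goal) (σ : ℕ → ℕ) (g f : List ℕ) : Bool :=
  and (Nat.beq f.length C.k) (or (coordLT σ g f C.measure.1)
    (and (Nat.beq (coordRank σ g C.measure.1) (coordRank σ f C.measure.1))
      (coordLT σ g f C.measure.2)))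

/-- Membership in a list of pairs. -/
def hasPair (s : State) (D : List ℕ) (ci cj ρ : ℕ) : Bool :=
  not (allB (fun m => allB (fun m' => not (and (and (Nat.blt m m')
    (cond (Nat.beq ρ 0) (Nat.blt (s.σ m) (s.σ m')) (Nat.blt (s.σ m') (s.σ m))))
    (and (and (and (not (mem D m)) (not (mem D m')))
      (and (Nat.beq (below D m) ci) (Nat.beq (below D m') ci)))
      (and (Nat.beq (below (D.map s.σ) (s.σ m)) cj)
        (Nat.beq (below (D.map s.σ) (s.σ m')) cj))))) s.n) s.n)

/-- Whether `D` is an increasing list of positions. -/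
def isIncr (n : ℕ) (D : List ℕ) : Bool :=
  allB (fun a => and (Nat.blt (nth D a) n) (allB (fun b =>
    cond (Nat.blt a b) (Nat.blt (nth D a) (nth D b)) true) D.length)) D.length

/-- The family of shadings for which the tree proves the goal. -/
noncomputable def Tree.run (C : Goal) (t : Tree) :
    State → List (ℕ × ℕ) → List (ℕ × ℕ) → ℕ → ℕ :=
  Tree.rec
    (fun g D s pend _ _ =>
      cond (and pend.isEmpty (mem C.targets D)) (hitMask C s g D) 0)
    (fun g s pend _ _ => cond (and pend.isEmpty (precedes C s.σ g s.f)) (hitMask C s g 0) 0)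
    (fun _ _ run₁ run₂ s pend _ _ => cond pend.isEmpty (Nat.lor (run₁ s [] [] 0) (run₂ s [] [] 0)) 0)
    -- A case distinction starts with all cells of `U` pending. Each `kid` below takes one of them
    -- off the list; a tree other than `kid` is only accepted when nothing is pending.
    (fun U d _ run₁ s pend _ _ => cond pend.isEmpty (run₁ s U U d) 0)
    (fun _ _ run₁ run₂ s pend U d => List.rec 0 (fun c cs _ =>
      cond (and (Nat.ble c.1 s.n) (Nat.ble c.2 s.n))
        -- For shadings for which the cell is known to be empty, the extreme point cannot lie there,
        -- so the subtree is not needed. The intersection with the second run makes all cases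
        -- compulsory.
        (Nat.land (Nat.lor (s.E c.1 c.2) (run₁ (s.insert C.cells c d U) [] [] 0))
          (run₂ (cond cs.isEmpty (s.clear C.cells U) s) cs U d)) 0) pend)
    (fun D i j ρ S _ run₁ s pend _ _ =>
      cond (and (and pend.isEmpty (and (isIncr s.n D) (hasPair s D i j ρ)))
        (and (and (Nat.ble i D.length) (Nat.ble j D.length)) (memCell C.pairs ρ S)))
        (run₁ ((s.keep C.cells D).insertPair C.cells i j ρ S) [] [] 0) 0)
    t

/-- The state of a single occurrence. -/
def Goal.start (C : Goal) : State where
  n := C.k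
  σ := nth C.τ
  E := fun i j => nth ((List.range C.cells).map (var C.cells)) (Nat.add (Nat.mul i (Nat.succ C.k)) j)
  f := List.range C.k

/-- The family of shadings for which the tree proves the goal. -/
noncomputable def Goal.mask (C : Goal) (t : Tree) : ℕ := t.run C C.start [] [] 0

end PointSet

/-! ### Soundness of hits, descents and insertions of a single point -/

namespace PointSet

/-- The hypotheses on the data of a goal. -/
structure Goal.WellFormed (C : Goal) : Prop where
  length : C.τ.length = C.k
  -- With the length condition this means that the entries are `0, …, k - 1` in some order, in the
  -- form in which rows of the grid are counted.
  below : ∀ j ≤ C.k, below C.τ j = j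
  fst_lt : C.measure.1.2.1 < C.k
  snd_lt : C.measure.2.2.1 < C.k

/-- The point set contains one of the targets. -/
def Goal.Reached (C : Goal) (P : PointSet) (r : ℕ) : Prop :=
  ∃ D ∈ C.targets, Contains P C.k (nth C.τ) (r ^^^ D)

/-- The value of a coordinate in the measure. -/
def coordKey (B : ℕ) (q : ℕ → ℕ × ℕ) (c : Bool × ℕ × Bool) : ℕ :=
  cond c.2.2 (B - cond c.1 (q c.2.1).2 (q c.2.1).1) (cond c.1 (q c.2.1).2 (q c.2.1).1)

/-- The measure of an occurrence. -/
def Goal.weight (C : Goal) (B : ℕ) (q : ℕ → ℕ × ℕ) : ℕ :=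
  coordKey B q C.measure.1 * (B + 1) + coordKey B q C.measure.2

/-- The configuration `q` satisfies what is known in the state `s`, for the shading `r` and the
original occurrence `q₀`. -/
structure State.Realizes (C : Goal) (P : PointSet) (r : ℕ) (q₀ : ℕ → ℕ × ℕ) (s : State)
    (q : ℕ → ℕ × ℕ) : Prop where
  config : Config P s.n s.σ q
  empty : ∀ i ≤ s.n, ∀ j ≤ s.n, (s.E i j).testBit r = true → ∀ p ∈ P.pts,
    ¬ InCell s.n s.σ q i j p
  orig : s.f.length = C.k → ∀ a < C.k, nth s.f a < s.n ∧ q (nth s.f a) = q₀ a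

theorem testBit_unshaded {e D b r : ℕ} (hb : b < e) (hr : r < 2 ^ e) :
    (unshaded e D b).testBit r = !(r ^^^ D).testBit b := by
  rw [unshaded, nth_eq, List.getD_eq_getElem _ _ (by simpa using hb)]
  simp only [List.getElem_map, List.getElem_range, Nat.testBit_xor]
  cases D.testBit b <;> simp [testBit_compl _ hr, testBit_var hb hr]

theorem isOcc_iff {k n : ℕ} {τ g : List ℕ} {σ : ℕ → ℕ} (h : isOcc k τ n σ g = true) :
    g.length = k ∧ ∀ a < k, nth g a < n ∧ ∀ b < k, (nth g a < nth g b ↔ a < b) ∧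
      (σ (nth g a) < σ (nth g b) ↔ nth τ a < nth τ b) := by
  rw [isOcc, Bool.and_eq_true, allB_iff] at h
  refine ⟨Nat.eq_of_beq_eq_true h.1, fun a ha => ?_⟩
  have h1 := h.2 a ha
  rw [Bool.and_eq_true, allB_iff] at h1
  refine ⟨by simpa [Nat.blt_eq] using h1.1, fun b hb => ?_⟩
  have h2 := h1.2 b hb
  rw [Bool.and_eq_true, cond_blt, cond_blt] at h2
  constructor
  · have h3 := h2.1
    split_ifs at h3 with h4
    · simpa [h4, Nat.blt_eq] using h3
    · simpa [h4] using h3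
  · have h3 := h2.2
    split_ifs at h3 with h4
    · simpa [h4, Nat.blt_eq] using h3
    · simpa [h4] using h3

theorem exists_nth_of_mem {g : List ℕ} {m : ℕ} (h : mem g m = true) :
    ∃ a < g.length, nth g a = m := by
  rw [mem_iff] at h
  obtain ⟨a, ha, hm⟩ := List.getElem_of_mem h
  exact ⟨a, ha, by rw [nth_eq, List.getD_eq_getElem _ _ ha, hm]⟩

theorem nth_mem {g : List ℕ} {a : ℕ} (h : a < g.length) : nth g a ∈ g := by
  rw [nth_eq, List.getD_eq_getElem _ _ h]; exact List.getElem_mem h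

theorem cell_lt {k i j : ℕ} (hi : i ≤ k) (hj : j ≤ k) : i * (k + 1) + j < (k + 1) * (k + 1) := by
  nlinarith

/-- Suppose a point lies in a shaded cell of the grid spanned by `g`. In the finer grid of the whole
configuration it is either a known point or inside a fine cell. A known point outside `g` is
required by the mask to fall into an unshaded cell; a fine cell is required to be empty or to lie in
an unshaded cell. Both contradict the assumption. -/
theorem hitMask_sound {C : Goal} (hC : C.WellFormed) {P : PointSet} {r D : ℕ}
    (hr : r < 2 ^ C.cells) {s : State} {q : ℕ → ℕ × ℕ} {g : List ℕ} (hq : Config P s.n s.σ q)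
    (hE : ∀ i ≤ s.n, ∀ j ≤ s.n, (s.E i j).testBit r = true → ∀ p ∈ P.pts,
      ¬ InCell s.n s.σ q i j p)
    (h : (hitMask C s g D).testBit r = true) :
    Config P C.k (nth C.τ) (fun a => q (nth g a)) ∧
      Clear P C.k (nth C.τ) (r ^^^ D) (fun a => q (nth g a)) ∧ ∀ a < C.k, nth g a < s.n := by
  rw [hitMask, Bool.cond_eq_ite] at h
  split_ifs at h with hocc
  swap
  · simp at h
  rw [testBit_land, Bool.and_eq_true] at h
  obtain ⟨hlen, hg⟩ := isOcc_iff hocc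
  have hrank : ∀ j ≤ C.k, below C.τ j = j := hC.below
  have hτ : ∀ a < C.k, nth C.τ a < C.k := by
    intro a ha
    by_contra hcon
    have h1 := hrank C.k le_rfl
    -- An entry that is at least `v` is not counted, so the count below `v` is less than the length.
    -- For `v = C.k` this contradicts `h1`.
    have h2 : ∀ (l : List ℕ) (v : ℕ), (∃ a < l.length, v ≤ nth l a) → below l v < l.length := by
      intro l v
      induction l with
      | nil => simp
      | cons x l ih =>
        rintro ⟨a, ha, hv⟩
        rw [below_cons]
        have hle : ∀ (l : List ℕ), below l v ≤ l.length := by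
          intro l
          induction l with
          | nil => simp [below]
          | cons y l ih => rw [below_cons]; split_ifs <;> simp <;> omega
        cases a with
        | zero =>
          have : v ≤ x := hv
          rw [if_neg (by omega)]; have := hle l; simp; omega
        | succ a =>
          have := ih ⟨a, by simpa using ha, hv⟩
          split_ifs <;> simp <;> omega
    have h3 := h2 C.τ C.k ⟨a, by rw [hC.length]; exact ha, by omega⟩
    rw [h1, hC.length] at h3
    omega
  refine ⟨⟨fun a ha => hq.mem _ (hg a ha).1, hτ, fun a ha b hb => ?_, fun a ha b hb => ?_⟩, ?_,
    fun a ha => (hg a ha).1⟩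
  · rw [hq.fst_lt _ (hg a ha).1 _ (hg b hb).1]; exact ((hg a ha).2 b hb).1
  · rw [hq.snd_lt _ (hg a ha).1 _ (hg b hb).1]; exact ((hg a ha).2 b hb).2
  intro i hi j hj hbit p hp hcell
  have hb : i * (C.k + 1) + j < C.cells := cell_lt hi hj
  rcases hq.exists_cell p hp with ⟨m, hm, rfl⟩ | ⟨i', hi', j', hj', hc⟩
  -- Here the offending point is known. It cannot belong to `g`, because points of `g` lie on the
  -- grid lines.
  · have h1 := testBit_allLT h.1 m hm
    rw [Bool.cond_eq_ite] at h1
    split_ifs at h1 with hmem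
    · obtain ⟨a, ha, rfl⟩ := exists_nth_of_mem hmem
      have := hcell a (by omega)
      simp only at this
      omega
    · have e1 : below g m = i := below_eq g m i (by omega) fun a ha => by
        have h2 := hcell a (by omega)
        have h3 := hq.fst_lt _ (hg a (by omega)).1 m hm
        have h4 := hq.fst_lt m hm _ (hg a (by omega)).1
        simp only at h2
        omega
      have e2 : below (g.map s.σ) (s.σ m) = j := by
        rw [← hrank j hj]
        refine below_congr _ _ _ _ (by simp [hlen, hC.length]) fun a ha => ?_
        have ha : a < C.k := by simpa [hlen] using ha
        rw [nth_map _ _ _ (by omega)]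
        have h2 := hcell a (by omega)
        have h3 := hq.snd_lt _ (hg a (by omega)).1 m hm
        have h4 := hq.snd_lt m hm _ (hg a (by omega)).1
        simp only at h2
        omega
      rw [e1, e2] at h1
      have h5 := testBit_unshaded (D := D) hb hr
      rw [hbit] at h5
      change (unshaded C.cells D (i * (C.k + 1) + j)).testBit r = true at h1
      rw [h1] at h5
      exact absurd h5 (by simp)
  · have h1 := testBit_allLT (testBit_allLT h.2 i' (Nat.lt_succ_of_le hi')) j' (Nat.lt_succ_of_le hj')
    have e1 : below g i' = i := below_eq g i' i (by omega) fun a ha => by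
      have h2 := hcell a (by omega)
      have h3 := hc _ (hg a (by omega)).1
      simp only at h2
      omega
    have e2 : below (g.map s.σ) j' = j := by
      rw [← hrank j hj]
      refine below_congr _ _ _ _ (by simp [hlen, hC.length]) fun a ha => ?_
      have ha : a < C.k := by simpa [hlen] using ha
      rw [nth_map _ _ _ (by omega)]
      have h2 := hcell a (by omega)
      have h3 := hc _ (hg a (by omega)).1
      simp only at h2
      omega
    rw [e1, e2, testBit_lor, Bool.or_eq_true] at h1
    rcases h1 with h1 | h1
    · exact hE i' hi' j' hj' h1 p hp hc
    · have h5 := testBit_unshaded (D := D) hb hr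
      rw [hbit] at h5
      change (unshaded C.cells D (i * (C.k + 1) + j)).testBit r = true at h1
      rw [h1] at h5
      exact absurd h5 (by simp)

/-- The ranks in the current configuration decide how two coordinates of points of `P` compare,
although the coordinates themselves are unknown. When the coordinate is to be maximised, the bound
of the point set makes truncated subtraction strictly decreasing. -/
theorem coord_compare {P : PointSet} {n : ℕ} {σ : ℕ → ℕ} {q q₀ : ℕ → ℕ × ℕ} {g f : List ℕ}
    {c : Bool × ℕ × Bool} {k : ℕ} (hq : Config P n σ q) (hc : c.2.1 < k)
    (hg : ∀ a < k, nth g a < n) (hf : ∀ a < k, nth f a < n ∧ q (nth f a) = q₀ a) :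
    (coordLT σ g f c = true →
      coordKey P.bound (fun a => q (nth g a)) c < coordKey P.bound q₀ c) ∧
    (Nat.beq (coordRank σ g c) (coordRank σ f c) = true →
      coordKey P.bound (fun a => q (nth g a)) c = coordKey P.bound q₀ c) := by
  obtain ⟨ax, a, sg⟩ := c
  simp only at hc
  have hga := hg a hc
  obtain ⟨hfa, hfa'⟩ := hf a hc
  have b1 := P.lt_bound _ (hq.mem _ hga)
  have b2 := P.lt_bound _ (hq.mem _ hfa)
  have x1 := hq.fst_lt _ hga _ hfa
  have x2 := hq.fst_lt _ hfa _ hga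
  have y1 := hq.snd_lt _ hga _ hfa
  have y2 := hq.snd_lt _ hfa _ hga
  simp only [coordKey, coordLT, coordRank, ← hfa']
  cases ax <;> cases sg <;> simp only [cond_true, cond_false, Nat.blt_eq, Nat.beq_eq] <;>
    constructor <;> intro h <;> omega

/-- The second key is at most `bound`, so multiplying the first by `bound + 1` turns the weight into
a lexicographic order with a single natural number as value. -/
theorem descend_weight {C : Goal} (hC : C.WellFormed) {P : PointSet} {s : State}
    {q q₀ : ℕ → ℕ × ℕ} {g : List ℕ} (hq : Config P s.n s.σ q)
    (hg : ∀ a < C.k, nth g a < s.n)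
    (ho : s.f.length = C.k → ∀ a < C.k, nth s.f a < s.n ∧ q (nth s.f a) = q₀ a)
    (hp : precedes C s.σ g s.f = true) :
    C.weight P.bound (fun a => q (nth g a)) < C.weight P.bound q₀ := by
  rw [precedes, Bool.and_eq_true, Bool.or_eq_true, Bool.and_eq_true] at hp
  have hf := ho (Nat.eq_of_beq_eq_true hp.1)
  have c1 := coord_compare hq hC.fst_lt hg hf
  have c2 := coord_compare hq hC.snd_lt hg hf
  have hb : coordKey P.bound (fun a => q (nth g a)) C.measure.2 ≤ P.bound := by
    have b1 := P.lt_bound _ (hq.mem _ (hg _ hC.snd_lt))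
    generalize C.measure.2 = c at *
    obtain ⟨ax, a, sg⟩ := c
    simp only [coordKey]
    cases ax <;> cases sg <;> simp only [cond_true, cond_false] <;> simp only at b1 <;> omega
  unfold Goal.weight
  rcases hp.2 with h | ⟨h1, h2⟩
  · have := c1.1 h
    nlinarith
  · rw [c1.2 h1]
    have := c2.1 h2
    omega

/-- The quantity minimised by the extreme point in direction `d`. -/
def dirKey (B d : ℕ) (p : ℕ × ℕ) : ℕ :=
  if d = 0 then p.1 else if d = 1 then B - p.1 else if d = 2 then p.2 else B - p.2

theorem memCell_iff {U : List (ℕ × ℕ)} {i j : ℕ} : memCell U i j = true ↔ (i, j) ∈ U := by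
  induction U with
  | nil => simp [memCell]
  | cons u U ih =>
    have : memCell (u :: U) i j =
        cond (and (Nat.beq i u.1) (Nat.beq j u.2)) true (memCell U i j) := rfl
    rw [this, Bool.cond_eq_ite]
    split_ifs with h
    · rw [Bool.and_eq_true, Nat.beq_eq, Nat.beq_eq] at h
      simp [h.1, h.2]
    · rw [ih, List.mem_cons]
      rw [Bool.and_eq_true, Nat.beq_eq, Nat.beq_eq] at h
      constructor
      · exact Or.inr
      · rintro (h' | h')
        · exact absurd (by rw [← h']; exact ⟨rfl, rfl⟩) h
        · exact h'

theorem realizes_clear {C : Goal} {P : PointSet} {r : ℕ} {q₀ q : ℕ → ℕ × ℕ} {s : State}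
    {U : List (ℕ × ℕ)} (h : s.Realizes C P r q₀ q)
    (hU : ∀ u ∈ U, ∀ p ∈ P.pts, ¬ InCell s.n s.σ q u.1 u.2 p) :
    (s.clear C.cells U).Realizes C P r q₀ q := by
  refine ⟨h.config, fun i hi j hj hb p hp => ?_, h.orig⟩
  change (cond (memCell U i j) (ones C.cells) (s.E i j)).testBit r = true at hb
  rw [Bool.cond_eq_ite] at hb
  split_ifs at hb with hm
  · exact hU _ (memCell_iff.1 hm) p hp
  · exact h.empty i hi j hj hb p hp

/-- A point in a refined cell lies in the coarse cell from which it arose. If that cell was known to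
be empty, nothing is left to prove; if it belongs to `U` and the refined cell is beyond the new
point, extremality is violated. -/
theorem realizes_insert {C : Goal} {P : PointSet} {r : ℕ} {q₀ q : ℕ → ℕ × ℕ} {s : State}
    {U : List (ℕ × ℕ)} {c : ℕ × ℕ} {d : ℕ} (h : s.Realizes C P r q₀ q)
    (h1 : c.1 ≤ s.n) (h2 : c.2 ≤ s.n) {p : ℕ × ℕ} (hp : p ∈ P.pts)
    (hc : InCell s.n s.σ q c.1 c.2 p)
    (hext : ∀ u ∈ U, ∀ p' ∈ P.pts, InCell s.n s.σ q u.1 u.2 p' →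
      dirKey P.bound d p ≤ dirKey P.bound d p') :
    (s.insert C.cells c d U).Realizes C P r q₀ (insFun q c.1 p) := by
  refine ⟨h.config.insert h1 h2 hp hc, fun i hi j hj hb p' hp' hcell => ?_, fun hf a ha => ?_⟩
  · change (cond (and (beyond d c.1 c.2 i j) (memCell U (unbump c.1 i) (unbump c.2 j)))
      (ones C.cells) (s.E (unbump c.1 i) (unbump c.2 j))).testBit r = true at hb
    change i ≤ s.n + 1 at hi
    change j ≤ s.n + 1 at hj
    change InCell (s.n + 1) (insRank s.σ c.1 c.2) (insFun q c.1 p) i j p' at hcell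
    have hold := hcell.of_insert
    rw [Bool.cond_eq_ite] at hb
    split_ifs at hb with hm
    · rw [Bool.and_eq_true, memCell_iff] at hm
      have h3 := hext _ hm.2 p' hp' hold
      have h4 := hcell.insert_compare h1
      have h5 := P.lt_bound p hp
      have h6 := P.lt_bound p' hp'
      have h7 := hm.1
      simp only [beyond, cond_beq, dirKey] at h7 h3
      -- The refined cell puts `p'` strictly beyond `p` in direction `d`, against the minimality
      -- `h3`. For directions above 3 the hypothesis `h7` is already absurd.
      split_ifs at h7 h3 <;> (simp [Nat.blt_eq] at h7; omega)
    · refine h.empty _ ?_ _ ?_ hb p' hp' hold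
      · rw [unbump_eq]; split_ifs <;> omega
      · rw [unbump_eq]; split_ifs <;> omega
  · change (s.f.map (bump c.1)).length = C.k at hf
    have hf' : s.f.length = C.k := by simpa using hf
    obtain ⟨h3, h4⟩ := h.orig hf' a ha
    change nth (s.f.map (bump c.1)) a < s.n + 1 ∧ _
    have e : nth (s.insert C.cells c d U).f a = bump c.1 (nth s.f a) :=
      nth_map _ _ _ (by omega)
    constructor
    · rw [nth_map _ _ _ (by omega), bump_eq]; split_ifs <;> omega
    · rw [e, insFun_bump, h4]

end PointSet

/-! ### Restriction of a configuration to selected points -/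

namespace PointSet

/-- The points of `P` in a cell. -/
def cellSet (P : PointSet) (n : ℕ) (σ : ℕ → ℕ) (q : ℕ → ℕ × ℕ) (i j : ℕ) : PointSet where
  pts := {p ∈ P.pts | InCell n σ q i j p}
  bound := P.bound
  lt_bound p hp := P.lt_bound p hp.1
  fst_inj p hp p' hp' := P.fst_inj p hp.1 p' hp'.1
  snd_inj p hp p' hp' := P.snd_inj p hp.1 p' hp'.1

theorem isIncr_iff {n : ℕ} {D : List ℕ} (h : isIncr n D = true) :
    ∀ a < D.length, nth D a < n ∧ ∀ b < D.length, (nth D a < nth D b ↔ a < b) := by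
  rw [isIncr, allB_iff] at h
  have h1 : ∀ a < D.length, nth D a < n ∧ ∀ b < D.length, a < b → nth D a < nth D b := by
    intro a ha
    have h1 := h a ha
    rw [Bool.and_eq_true, allB_iff] at h1
    refine ⟨by simpa [Nat.blt_eq] using h1.1, fun b hb hab => ?_⟩
    have h2 := h1.2 b hb
    rw [cond_blt, if_pos hab] at h2
    simpa [Nat.blt_eq] using h2
  intro a ha
  refine ⟨(h1 a ha).1, fun b hb => ⟨fun hlt => ?_, (h1 a ha).2 b hb⟩⟩
  by_contra hcon
  rcases Nat.lt_or_ge b a with h2 | h2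
  · have := (h1 b hb).2 a ha h2; omega
  · have : a = b := by omega
    subst this; omega

/-- Ranks in the selection `D` are the numbers of selected points below. -/
theorem below_lt_below {l : List ℕ} {x y : ℕ} (hx : x ∈ l) : below l x < below l y ↔ x < y := by
  have hmono : ∀ (l : List ℕ) {x y : ℕ}, x ≤ y → below l x ≤ below l y := by
    intro l x y hxy
    induction l with
    | nil => simp [below]
    | cons a l ih => rw [below_cons, below_cons]; split_ifs <;> omega
  constructor
  · intro h
    by_contra hcon
    have := hmono l (not_lt.1 hcon)
    omega
  · intro h
    induction l with
    | nil => simp at hx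
    | cons a l ih =>
      rw [below_cons, below_cons]
      rcases List.mem_cons.1 hx with rfl | hx
      · have := hmono l h.le
        rw [if_neg (lt_irrefl _), if_pos h]; omega
      · have := ih hx
        split_ifs <;> omega

theorem below_lt_length {l : List ℕ} {x : ℕ} (hx : x ∈ l) : below l x < l.length := by
  have hle : ∀ (l : List ℕ), below l x ≤ l.length := by
    intro l
    induction l with
    | nil => simp [below]
    | cons y l ih => rw [below_cons]; split_ifs <;> simp <;> omega
  induction l with
  | nil => simp at hx
  | cons a l ih =>
    rw [below_cons]
    have := hle l
    rcases List.mem_cons.1 hx with rfl | hx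
    · rw [if_neg (lt_irrefl _)]; simp; omega
    · have := ih hx
      split_ifs <;> simp <;> omega

section keep

variable {P : PointSet} {n : ℕ} {σ : ℕ → ℕ} {q : ℕ → ℕ × ℕ} {D : List ℕ}

/-- Counting the selected points below re-ranks the heights without gaps and, by `below_lt_below`,
without changing their order. -/
theorem Config.keep (hq : Config P n σ q)
    (hD : ∀ a < D.length, nth D a < n ∧ ∀ b < D.length, (nth D a < nth D b ↔ a < b)) :
    Config P D.length (fun a => below (D.map σ) (σ (nth D a))) (fun a => q (nth D a)) := by
  have hm : ∀ a < D.length, σ (nth D a) ∈ D.map σ := fun a ha =>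
    List.mem_map.2 ⟨_, nth_mem ha, rfl⟩
  refine ⟨fun a ha => hq.mem _ (hD a ha).1, fun a ha => ?_, fun a ha b hb => ?_,
    fun a ha b hb => ?_⟩
  · simpa using below_lt_length (hm a ha)
  · rw [hq.fst_lt _ (hD a ha).1 _ (hD b hb).1]; exact (hD a ha).2 b hb
  · rw [hq.snd_lt _ (hD a ha).1 _ (hD b hb).1, below_lt_below (hm a ha)]

/-- A point that lies above exactly the selected points with `σ < v` and to the right of those
before `m` lies in the corresponding cell of the selection. -/
theorem inCell_keep (hD : ∀ a < D.length, nth D a < n ∧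
      ∀ b < D.length, (nth D a < nth D b ↔ a < b)) {p : ℕ × ℕ} {m v : ℕ}
    (h1 : ∀ a ∈ D, (a < m → (q a).1 < p.1) ∧ (m ≤ a → p.1 < (q a).1))
    (h2 : ∀ a ∈ D, (σ a < v → (q a).2 < p.2) ∧ (v ≤ σ a → p.2 < (q a).2)) :
    InCell D.length (fun a => below (D.map σ) (σ (nth D a))) (fun a => q (nth D a))
      (below D m) (below (D.map σ) v) p := by
  intro a ha
  have hm := nth_mem ha
  have hm' : σ (nth D a) ∈ D.map σ := List.mem_map.2 ⟨_, hm, rfl⟩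
  have e1 : below D (nth D a) = a := below_eq _ _ _ ha.le fun b hb => (hD b hb).2 a ha
  have h3 := below_lt_below (y := m) hm
  rw [e1] at h3
  have h4 := below_lt_below (y := v) hm'
  have h5 := h1 _ hm
  have h6 := h2 _ hm
  refine ⟨fun h => ?_, fun h => ?_, fun h => ?_, fun h => ?_⟩ <;> simp only at h ⊢ <;> omega

end keep

/-- A coarse cell is made up of fine cells, of pieces of the deleted grid lines, and of dropped
points on these. By general position the only points of `P` outside the fine cells are the known
ones, so checking fine cells and dropped points suffices. The work lies in showing that the coarse
cell is the one found by counting. -/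
theorem realizes_keep {C : Goal} {P : PointSet} {r : ℕ} {q₀ q : ℕ → ℕ × ℕ} {s : State}
    {D : List ℕ} (h : s.Realizes C P r q₀ q)
    (hD : ∀ a < D.length, nth D a < s.n ∧ ∀ b < D.length, (nth D a < nth D b ↔ a < b)) :
    (s.keep C.cells D).Realizes C P r q₀ (fun a => q (nth D a)) := by
  have hDn : ∀ a ∈ D, a < s.n := fun a ha => by
    obtain ⟨b, hb, rfl⟩ := exists_nth_of_mem (mem_iff.2 ha); exact (hD b hb).1
  refine ⟨h.config.keep hD, fun i hi j hj hb p hp hcell => ?_, fun hf a ha => ?_⟩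
  · change i ≤ D.length at hi
    change j ≤ D.length at hj
    change (Nat.land _ _).testBit r = true at hb
    rw [testBit_land, Bool.and_eq_true] at hb
    change InCell D.length (fun a => below (D.map s.σ) (s.σ (nth D a))) (fun a => q (nth D a))
      i j p at hcell
    -- the grid position of `p` with respect to the selected points
    have key : ∀ m v : ℕ, (∀ a ∈ D, (a < m → (q a).1 < p.1) ∧ (m ≤ a → p.1 < (q a).1)) →
        (∀ a ∈ D, (s.σ a < v → (q a).2 < p.2) ∧ (v ≤ s.σ a → p.2 < (q a).2)) →
        below D m = i ∧ below (D.map s.σ) v = j := by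
      intro m v h1 h2
      constructor
      · refine below_eq _ _ _ hi fun a ha => ?_
        have h3 := hcell a ha
        have h4 := h1 _ (nth_mem ha)
        simp only at h3
        omega
      · have hcount : ∀ (l : List ℕ) (w : ℕ), below l w = l.countP (· < w) := by
          intro l w
          induction l with
          | nil => rfl
          | cons x l ih => rw [below_cons, List.countP_cons, ih]; split_ifs <;> (simp_all; try omega)
        -- compare the ranks of the selected points with `j`
        have h3 : ∀ a < D.length, (s.σ (nth D a) < v ↔ below (D.map s.σ) (s.σ (nth D a)) < j) := by
          intro a ha
          have h3 := hcell a ha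
          have h4 := h2 _ (nth_mem ha)
          simp only at h3
          omega
        -- the ranks are a permutation of `0, …, D.length - 1`
        have hinj : Set.InjOn (fun a => below (D.map s.σ) (s.σ (nth D a)))
            (Finset.range D.length : Set ℕ) := by
          intro a ha b hb hab
          have ha : a < D.length := by simpa using ha
          have hb : b < D.length := by simpa using hb
          have c := h.config.keep hD
          have c1 := c.snd_lt a ha b hb
          have c2 := c.snd_lt b hb a ha
          simp only at hab
          have c3 : q (nth D a) = q (nth D b) := P.snd_inj _ (c.mem a ha) _ (c.mem b hb) (by omega)
          have c4 := c.fst_lt a ha b hb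
          have c5 := c.fst_lt b hb a ha
          rw [c3] at c4 c5
          omega
        have himg : (Finset.range D.length).image
            (fun a => below (D.map s.σ) (s.σ (nth D a))) = Finset.range D.length := by
          refine Finset.eq_of_subset_of_card_le (fun x hx => ?_) ?_
          · obtain ⟨a, ha, rfl⟩ := Finset.mem_image.1 hx
            simpa using (h.config.keep hD).rank_lt a (by simpa using ha)
          · rw [Finset.card_image_of_injOn hinj]
        have hb1 : below (D.map s.σ) v =
            ((Finset.range D.length).filter fun a => s.σ (nth D a) < v).card := by
          rw [hcount, List.countP_map]
          have : D = (List.range D.length).map (nth D) := by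
            refine List.ext_getElem (by simp) fun a h1 h2 => ?_
            simp [nth_eq, h1]
          conv_lhs => rw [this]
          rw [List.countP_map, List.countP_eq_length_filter]
          rfl
        rw [hb1]
        have : ((Finset.range D.length).filter fun a => s.σ (nth D a) < v).image
            (fun a => below (D.map s.σ) (s.σ (nth D a))) = Finset.range j := by
          ext x
          simp only [Finset.mem_image, Finset.mem_filter, Finset.mem_range]
          constructor
          · rintro ⟨a, ⟨ha, hv⟩, rfl⟩; exact (h3 a ha).1 hv
          · intro hx
            have : x ∈ Finset.range D.length := by simp; omega
            rw [← himg] at this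
            obtain ⟨a, ha, rfl⟩ := Finset.mem_image.1 this
            have ha : a < D.length := by simpa using ha
            exact ⟨a, ⟨ha, (h3 a ha).2 hx⟩, rfl⟩
        rw [← Finset.card_image_of_injOn (hinj.mono ?_), this, Finset.card_range]
        intro a ha
        exact Finset.mem_coe.2 (Finset.mem_of_mem_filter a ha)
    -- A selected point lies on a grid line of the coarse grid, so it is in no cell. A dropped point
    -- in the cell would have made the mask zero. Otherwise the fine cell containing `p` has been
    -- recorded as empty.
    rcases h.config.exists_cell p hp with ⟨m, hm, rfl⟩ | ⟨i', hi', j', hj', hc⟩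
    · have h1 := testBit_allLT hb.2 m hm
      rw [Bool.cond_eq_ite] at h1
      split_ifs at h1 with hmem
      · obtain ⟨a, ha, rfl⟩ := exists_nth_of_mem hmem
        have := hcell a ha
        simp only at this
        omega
      · have hmem : m ∉ D := fun h => hmem (mem_iff.2 h)
        have hne : ∀ a ∈ D, a ≠ m := fun a ha e => hmem (e ▸ ha)
        obtain ⟨e1, e2⟩ := key m (s.σ m) (fun a ha => by
          have h2 := h.config.fst_lt a (hDn a ha) m hm
          have h3 := h.config.fst_lt m hm a (hDn a ha)
          have := hne a ha
          omega) (fun a ha => by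
          have h2 := h.config.snd_lt a (hDn a ha) m hm
          have h3 := h.config.snd_lt m hm a (hDn a ha)
          have h4 := hne a ha
          have h5 : (q a).2 ≠ (q m).2 := fun e => by
            have e := P.snd_inj _ (h.config.mem a (hDn a ha)) _ (h.config.mem m hm) e
            have h6 := h.config.fst_lt a (hDn a ha) m hm
            have h7 := h.config.fst_lt m hm a (hDn a ha)
            rw [e] at h6 h7
            omega
          omega)
        rw [e1, e2] at h1
        simp at h1
    · obtain ⟨e1, e2⟩ := key i' j' (fun a ha => ⟨(hc a (hDn a ha)).1, (hc a (hDn a ha)).2.1⟩)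
        (fun a ha => ⟨(hc a (hDn a ha)).2.2.1, (hc a (hDn a ha)).2.2.2⟩)
      have h1 := testBit_allLT hb.1 i' (Nat.lt_succ_of_le hi')
      rw [e1, cond_beq, if_pos rfl] at h1
      have h2 := testBit_allLT h1 j' (Nat.lt_succ_of_le hj')
      rw [e2, cond_beq, if_pos rfl] at h2
      exact h.empty i' hi' j' hj' h2 p hp hc
  · change (cond (allB (fun a => mem D (nth s.f a)) s.f.length) (s.f.map (below D)) []).length =
      C.k at hf
    have e0 : (s.keep C.cells D).f =
      cond (allB (fun a => mem D (nth s.f a)) s.f.length) (s.f.map (below D)) [] := rfl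
    rw [Bool.cond_eq_ite] at hf e0
    split_ifs at hf e0 with hall
    · have hf' : s.f.length = C.k := by simpa using hf
      rw [allB_iff] at hall
      have hm := hall a (by omega)
      obtain ⟨b, hb, hb'⟩ := exists_nth_of_mem hm
      have e1 : below D (nth D b) = b := below_eq _ _ _ hb.le fun c hc => (hD c hc).2 b hb
      have e2 : nth (s.keep C.cells D).f a = b := by
        rw [e0, nth_map _ _ _ (by omega), ← hb', e1]
      rw [e2]
      refine ⟨hb, ?_⟩
      rw [hb']
      exact (h.orig hf' a ha).2
    · simp at hf; omega

end PointSet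

/-! ### Exchange of pairs and soundness of proof trees -/

namespace PointSet

/-- Locates the second point of a pair after the first one, to its left and in the same cell, has
become part of the grid. -/
theorem InCell.insert {n : ℕ} {σ : ℕ → ℕ} {q : ℕ → ℕ × ℕ} {ci cj : ℕ} {p p' : ℕ × ℕ} {i j : ℕ}
    (hi : ci ≤ n) (h : InCell n σ q ci cj p') (hx : p.1 < p'.1 ∧ i = ci + 1)
    (hy : p.2 < p'.2 ∧ j = cj + 1 ∨ p'.2 < p.2 ∧ j = cj) :
    InCell (n + 1) (insRank σ ci cj) (insFun q ci p) i j p' := by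
  intro a ha
  rcases eq_or_bump n ci a ha hi with h1 | ⟨b, hb, rfl⟩
  · subst h1
    rw [insFun_self, insRank_self]
    omega
  · rw [insFun_bump, insRank_bump, bump_eq, bump_eq]
    have := h b hb
    split_ifs <;> omega

theorem not_allB {f : ℕ → Bool} {n : ℕ} (h : (!allB f n) = true) : ∃ i < n, f i = false := by
  by_contra hcon
  push Not at hcon
  have : allB f n = true := allB_iff.2 fun i hi => by simpa using hcon i hi
  rw [this] at h
  simp at h

theorem hasPair_iff {s : State} {D : List ℕ} {ci cj ρ : ℕ} (h : hasPair s D ci cj ρ = true) :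
    ∃ m < s.n, ∃ m' < s.n, m < m' ∧
      (if ρ = 0 then s.σ m < s.σ m' else s.σ m' < s.σ m) ∧ m ∉ D ∧ m' ∉ D ∧
      below D m = ci ∧ below D m' = ci ∧ below (D.map s.σ) (s.σ m) = cj ∧
      below (D.map s.σ) (s.σ m') = cj := by
  obtain ⟨m, hm, h1⟩ := not_allB h
  obtain ⟨m', hm', h2⟩ := not_allB (by rw [h1]; rfl)
  refine ⟨m, hm, m', hm', ?_⟩
  rw [Bool.not_eq_false', Bool.and_eq_true, Bool.and_eq_true, Bool.and_eq_true, Bool.and_eq_true,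
    Bool.and_eq_true, Bool.and_eq_true, Bool.and_eq_true, cond_beq, Nat.beq_eq, Nat.beq_eq, Nat.beq_eq, Nat.beq_eq,
    Nat.blt_eq, Bool.not_eq_true', Bool.not_eq_true', ← Bool.not_eq_true, ← Bool.not_eq_true,
    mem_iff, mem_iff] at h2
  obtain ⟨⟨a, b⟩, ⟨⟨c, d⟩, e, f⟩, g, i⟩ := h2
  refine ⟨a, ?_, c, d, e, f, g, i⟩
  split_ifs at b ⊢ <;> simpa [Nat.blt_eq] using b

/-- The points of `P` in one cell form a point set of their own, and the two dropped points show
that it has a pair ordered as `ρ`. The theorem about pairs, applied inside the cell, returns a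
possibly different pair whose shaded squares contain no point of the cell. In the whole of `P` these
squares are the corresponding parts of the cell. -/
theorem realizes_pair {C : Goal} {P : PointSet} {r : ℕ} {q₀ q : ℕ → ℕ × ℕ} {s : State}
    {D : List ℕ} {ci cj ρ S : ℕ} (h : s.Realizes C P r q₀ q)
    (hD : ∀ a < D.length, nth D a < s.n ∧ ∀ b < D.length, (nth D a < nth D b ↔ a < b))
    (hi : ci ≤ D.length) (hj : cj ≤ D.length) (hpair : hasPair s D ci cj ρ = true)
    (hS : ∀ (Q : PointSet) (q : ℕ → ℕ × ℕ), Config Q 2 (pairRank ρ) q →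
      Contains Q 2 (pairRank ρ) S) :
    ∃ q', ((s.keep C.cells D).insertPair C.cells ci cj ρ S).Realizes C P r q₀ q' := by
  have hDn : ∀ a ∈ D, a < s.n := fun a ha => by
    obtain ⟨b, hb, rfl⟩ := exists_nth_of_mem (mem_iff.2 ha); exact (hD b hb).1
  have hk := realizes_keep h hD
  obtain ⟨m, hm, m', hm', hlt, hσ, hmD, hmD', e1, e2, e3, e4⟩ := hasPair_iff hpair
  have hρ : ∀ a, pairRank ρ a = if ρ = 0 then a else 1 - a := fun a => by
    rw [pairRank, cond_beq]; rfl
  -- both points lie in the cell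
  have hin : ∀ m < s.n, m ∉ D → below D m = ci → below (D.map s.σ) (s.σ m) = cj →
      q m ∈ (cellSet P (s.keep C.cells D).n (s.keep C.cells D).σ (fun a => q (nth D a)) ci cj).pts := by
    intro m hm hmD e1 e3
    refine ⟨h.config.mem m hm, ?_⟩
    have hne : ∀ a ∈ D, a ≠ m := fun a ha e => hmD (e ▸ ha)
    have hc := inCell_keep (σ := s.σ) (q := q) (p := q m) (m := m) (v := s.σ m) hD
      (fun a ha => by
          have h2 := h.config.fst_lt a (hDn a ha) m hm
          have h3 := h.config.fst_lt m hm a (hDn a ha)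
          have := hne a ha
          omega) (fun a ha => by
          have h2 := h.config.snd_lt a (hDn a ha) m hm
          have h3 := h.config.snd_lt m hm a (hDn a ha)
          have h4 := hne a ha
          have h5 : (q a).2 ≠ (q m).2 := fun e => by
            have e := P.snd_inj _ (h.config.mem a (hDn a ha)) _ (h.config.mem m hm) e
            have h6 := h.config.fst_lt a (hDn a ha) m hm
            have h7 := h.config.fst_lt m hm a (hDn a ha)
            rw [e] at h6 h7
            omega
          omega)
    rwa [e1, e3] at hc
  -- From here on the dropped pair is forgotten; only `q₂` enters the new configuration.
  obtain ⟨q₂, hq₂, hclear⟩ := hS (cellSet P (s.keep C.cells D).n (s.keep C.cells D).σ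
    (fun a => q (nth D a)) ci cj) (fun a => if a = 0 then q m else q m') (by
    have i1 := hin m hm hmD e1 e3
    have i2 := hin m' hm' hmD' e2 e4
    have f1 := h.config.fst_lt m hm m' hm'
    have f2 := h.config.fst_lt m' hm' m hm
    have g1 := h.config.snd_lt m hm m' hm'
    have g2 := h.config.snd_lt m' hm' m hm
    refine ⟨fun a ha => ?_, fun a ha => ?_, fun a ha b hb => ?_, fun a ha b hb => ?_⟩
    · split_ifs
      · exact i1
      · exact i2
    · rw [hρ]; split_ifs <;> omega
    · interval_cases a <;> interval_cases b <;> simp <;> omega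
    · rw [hρ, hρ]
      interval_cases a <;> interval_cases b <;> simp <;> split_ifs at hσ ⊢ <;> omega)
  set s₁ := s.keep C.cells D with hs₁
  have hi : ci ≤ s₁.n := hi
  have hj : cj ≤ s₁.n := hj
  have m0 := hq₂.mem 0 (by norm_num)
  have m1 := hq₂.mem 1 (by norm_num)
  have hx := (hq₂.fst_lt 0 (by norm_num) 1 (by norm_num)).2 (by norm_num)
  have hy : if ρ = 0 then (q₂ 0).2 < (q₂ 1).2 else (q₂ 1).2 < (q₂ 0).2 := by
    have h1 := hq₂.snd_lt 0 (by norm_num) 1 (by norm_num)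
    have h2 := hq₂.snd_lt 1 (by norm_num) 0 (by norm_num)
    rw [hρ, hρ] at h1 h2
    split_ifs at h1 h2 ⊢
    · exact h1.2 (by norm_num)
    · exact h2.2 (by norm_num)
  have ec : (cond (Nat.beq ρ 0) (cj + 1) cj) = if ρ = 0 then cj + 1 else cj := cond_beq _ _ _ _
  have r1 := realizes_insert (c := (ci, cj)) (d := 4) (U := []) hk hi hj m0.1 m0.2 (by simp)
  have c2 : InCell (s₁.n + 1) (insRank s₁.σ ci cj) (insFun (fun a => q (nth D a)) ci (q₂ 0))
      (ci + 1) (cond (Nat.beq ρ 0) (cj + 1) cj) (q₂ 1) := by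
    refine m1.2.insert hi ⟨hx, rfl⟩ ?_
    rw [ec]
    split_ifs at hy ⊢ with h0
    · exact Or.inl ⟨hy, rfl⟩
    · exact Or.inr ⟨hy, rfl⟩
  have r2 := realizes_insert (c := (ci + 1, cond (Nat.beq ρ 0) (cj + 1) cj)) (d := 4) (U := []) r1
    (show ci + 1 ≤ s₁.n + 1 by omega)
    (show cond (Nat.beq ρ 0) (cj + 1) cj ≤ s₁.n + 1 by rw [ec]; split_ifs <;> omega) m1.1 c2
    (by simp)
  refine ⟨_, r2.config, fun i hi' j hj' hb p hp hcell => ?_, r2.orig⟩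
  change (cond _ (ones C.cells) (((s₁.insert C.cells (ci, cj) 4 []).insert C.cells
    (ci + 1, cond (Nat.beq ρ 0) (cj + 1) cj) 4 []).E i j)).testBit r = true at hb
  rw [Bool.cond_eq_ite] at hb
  split_ifs at hb with hc
  · rw [Bool.and_eq_true, Bool.and_eq_true, Bool.and_eq_true, Bool.and_eq_true, Nat.ble_eq,
      Nat.ble_eq, Nat.ble_eq, Nat.ble_eq] at hc
    obtain ⟨⟨a1, a2⟩, ⟨a3, a4⟩, a5⟩ := hc
    have hcell' : InCell (s₁.n + 1 + 1) (insRank (insRank s₁.σ ci cj) (ci + 1)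
        (cond (Nat.beq ρ 0) (cj + 1) cj)) (insFun (insFun (fun a => q (nth D a)) ci (q₂ 0))
          (ci + 1) (q₂ 1)) i j p := hcell
    have k1 := hcell'.insert_compare (by omega)
    have k2 := hcell'.of_insert
    have k3 := k2.insert_compare hi
    have k4 := k2.of_insert
    rw [ec] at k1 k2 k3 k4
    -- Removing both new grid lines collapses the 3 by 3 block to the original cell. A point in the
    -- block therefore belongs to the cell's point set, where `hclear` excludes it.
    have u1 : unbump ci (unbump (ci + 1) i) = ci := by
      simp only [unbump_eq]; split_ifs <;> omega
    have u2 : unbump cj (unbump (if ρ = 0 then cj + 1 else cj) j) = cj := by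
      simp only [unbump_eq]; split_ifs <;> omega
    rw [u1, u2] at k4
    refine hclear (i - ci) (by omega) (j - cj) (by omega) a5 p ⟨hp, k4⟩ ?_
    simp only [unbump_eq] at k3
    intro a ha
    rw [hρ]
    interval_cases a
    · split_ifs at k3 ⊢ <;> omega
    · split_ifs at k1 ⊢ <;> omega
  · exact r2.empty i hi' j hj' hb p hp hcell

/-- The available pairs are justified. -/
def Goal.PairsHold (C : Goal) : Prop :=
  ∀ x ∈ C.pairs, ∀ (Q : PointSet) (q : ℕ → ℕ × ℕ), Config Q 2 (pairRank x.1) q →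
    Contains Q 2 (pairRank x.1) x.2

/-- The two halves describe the evaluator at rest and in the middle of a case distinction. With
cells `cs` still pending, what must be shown is that the goal holds whichever of them contains the
extreme point of `U`, and also when all of `U` is empty. The hypothesis `ih` is the induction over
the weight and is consumed by `descend` alone. -/
theorem Tree.run_sound {C : Goal} (hC : C.WellFormed) (hpairs : C.PairsHold) {P : PointSet} {r : ℕ}
    (hr : r < 2 ^ C.cells) {q₀ : ℕ → ℕ × ℕ}
    (ih : ∀ q, Config P C.k (nth C.τ) q → Clear P C.k (nth C.τ) r q →
      C.weight P.bound q < C.weight P.bound q₀ → C.Reached P r) (t : Tree) :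
    ∀ (s : State) (U : List (ℕ × ℕ)) (d : ℕ),
      ((t.run C s [] U d).testBit r = true → ∀ q, s.Realizes C P r q₀ q → C.Reached P r) ∧
      ∀ cs, cs ≠ [] → (t.run C s cs U d).testBit r = true →
        (∀ c ∈ cs, ∀ q, s.Realizes C P r q₀ q → ∀ p ∈ P.pts, InCell s.n s.σ q c.1 c.2 p →
          (∀ u ∈ U, ∀ p' ∈ P.pts, InCell s.n s.σ q u.1 u.2 p' →
            dirKey P.bound d p ≤ dirKey P.bound d p') → C.Reached P r) ∧
        (∀ q, (s.clear C.cells U).Realizes C P r q₀ q → C.Reached P r) := by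
  have hnil : ∀ {cs : List (ℕ × ℕ)}, cs ≠ [] → cs.isEmpty = false := by
    intro cs h; cases cs
    · exact absurd rfl h
    · rfl
  induction t with
  | hit g D =>
    intro s U d
    constructor
    · intro h q hq
      change (cond (mem C.targets D) (hitMask C s g D) 0).testBit r = true at h
      rw [Bool.cond_eq_ite] at h
      split_ifs at h with hm
      · obtain ⟨h1, h2, -⟩ := hitMask_sound hC hr hq.config hq.empty h
        exact ⟨D, mem_iff.1 hm, _, h1, h2⟩
      · simp at h
    · intro cs hcs h
      change (cond (and cs.isEmpty _) _ 0).testBit r = true at h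
      rw [hnil hcs] at h
      simp at h
  | descend g =>
    intro s U d
    constructor
    · intro h q hq
      change (cond (precedes C s.σ g s.f) (hitMask C s g 0) 0).testBit r = true at h
      rw [Bool.cond_eq_ite] at h
      split_ifs at h with hm
      · obtain ⟨h1, h2, h3⟩ := hitMask_sound hC hr hq.config hq.empty h
        rw [Nat.xor_zero] at h2
        exact ih _ h1 h2 (descend_weight hC hq.config h3 hq.orig hm)
      · simp at h
    · intro cs hcs h
      change (cond (and cs.isEmpty _) _ 0).testBit r = true at h
      rw [hnil hcs] at h
      simp at h
  | either t₁ t₂ ih₁ ih₂ =>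
    intro s U d
    constructor
    · intro h q hq
      change (Nat.lor (t₁.run C s [] [] 0) (t₂.run C s [] [] 0)).testBit r = true at h
      rw [testBit_lor, Bool.or_eq_true] at h
      rcases h with h | h
      · exact (ih₁ s [] 0).1 h q hq
      · exact (ih₂ s [] 0).1 h q hq
    · intro cs hcs h
      change (cond cs.isEmpty _ 0).testBit r = true at h
      rw [hnil hcs] at h
      simp at h
  | split V d' t iht =>
    intro s U d
    constructor
    · intro h q hq
      change (t.run C s V V d').testBit r = true at h
      -- Without cells there is nothing to distinguish, and the subtree is run in the unchanged
      -- state.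
      by_cases hV : V = []
      · subst hV
        exact (iht s [] d').1 h q hq
      · obtain ⟨h1, h2⟩ := (iht s V d').2 V hV h
        -- If the union is nonempty, the point minimising `dirKey` over all of its cells is extreme;
        -- the cell containing it selects the case.
        by_cases hne : ∃ p ∈ P.pts, ∃ u ∈ V, InCell s.n s.σ q u.1 u.2 p
        · obtain ⟨p, ⟨hp, u, hu, hc⟩, hmin⟩ := exists_min_key
            {p | p ∈ P.pts ∧ ∃ u ∈ V, InCell s.n s.σ q u.1 u.2 p}
            (by obtain ⟨p, hp, u, hu, hc⟩ := hne; exact ⟨p, hp, u, hu, hc⟩) (dirKey P.bound d')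
          exact h1 u hu q hq p hp hc fun u' hu' p' hp' hc' => hmin p' ⟨hp', u', hu', hc'⟩
        · refine h2 q (realizes_clear hq fun u hu p hp hc => hne ⟨p, hp, u, hu, hc⟩)
    · intro cs hcs h
      change (cond cs.isEmpty _ 0).testBit r = true at h
      rw [hnil hcs] at h
      simp at h
  | kid t₁ t₂ ih₁ ih₂ =>
    intro s U d
    constructor
    · intro h
      change (0 : ℕ).testBit r = true at h
      simp at h
    · intro cs hcs h
      obtain ⟨c, cs, rfl⟩ := List.exists_cons_of_ne_nil hcs
      change (cond (and (Nat.ble c.1 s.n) (Nat.ble c.2 s.n))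
        (Nat.land (Nat.lor (s.E c.1 c.2) (t₁.run C (s.insert C.cells c d U) [] [] 0))
          (t₂.run C (cond cs.isEmpty (s.clear C.cells U) s) cs U d)) 0).testBit r = true at h
      rw [Bool.cond_eq_ite] at h
      split_ifs at h with hm
      swap
      · simp at h
      rw [Bool.and_eq_true, Nat.ble_eq, Nat.ble_eq] at hm
      rw [testBit_land, testBit_lor, Bool.and_eq_true, Bool.or_eq_true] at h
      have hfirst : ∀ q, s.Realizes C P r q₀ q → ∀ p ∈ P.pts, InCell s.n s.σ q c.1 c.2 p →
          (∀ u ∈ U, ∀ p' ∈ P.pts, InCell s.n s.σ q u.1 u.2 p' →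
            dirKey P.bound d p ≤ dirKey P.bound d p') → C.Reached P r := by
        intro q hq p hp hc hext
        rcases h.1 with h1 | h1
        · exact absurd hc (hq.empty _ hm.1 _ hm.2 h1 p hp)
        · exact (ih₁ _ [] 0).1 h1 _ (realizes_insert hq hm.1 hm.2 hp hc hext)
      -- Once the last cell has been treated, the remaining tree runs in the state with all of `U`
      -- empty; before that the state stays as it was.
      by_cases hcs' : cs = []
      · subst hcs'
        have h2 : (t₂.run C (s.clear C.cells U) [] U d).testBit r = true := h.2
        refine ⟨fun c' hc' => ?_, (ih₂ _ U d).1 h2⟩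
        rw [List.mem_singleton] at hc'
        subst hc'
        exact hfirst
      · have h2 := h.2
        rw [hnil hcs'] at h2
        obtain ⟨h3, h4⟩ := (ih₂ s U d).2 cs hcs' h2
        refine ⟨fun c' hc' => ?_, h4⟩
        rcases List.mem_cons.1 hc' with rfl | hc'
        · exact hfirst
        · exact h3 c' hc'
  | drop D i j ρ S t iht =>
    intro s U d
    constructor
    · intro h q hq
      change (cond (and (and (isIncr s.n D) (hasPair s D i j ρ))
        (and (and (Nat.ble i D.length) (Nat.ble j D.length)) (memCell C.pairs ρ S)))
        (t.run C ((s.keep C.cells D).insertPair C.cells i j ρ S) [] [] 0) 0).testBit r = true at h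
      rw [Bool.cond_eq_ite] at h
      split_ifs at h with hm
      · rw [Bool.and_eq_true, Bool.and_eq_true, Bool.and_eq_true, Bool.and_eq_true, Nat.ble_eq,
          Nat.ble_eq, memCell_iff] at hm
        obtain ⟨⟨h1, h2⟩, ⟨h3, h4⟩, h5⟩ := hm
        obtain ⟨q', hq'⟩ := realizes_pair hq (isIncr_iff h1) h3 h4 h2 (hpairs _ h5)
        exact (iht _ [] 0).1 h q' hq'
      · simp at h
    · intro cs hcs h
      change (cond (and (and cs.isEmpty _) _) _ 0).testBit r = true at h
      rw [hnil hcs] at h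
      simp at h

/-- Strong induction on the weight of the occurrence. In the initial state the only points are those
of the occurrence, and a cell is known to be empty exactly for the shadings that contain it. -/
theorem Goal.mask_sound {C : Goal} (hC : C.WellFormed) (hpairs : C.PairsHold) {r : ℕ}
    (hr : r < 2 ^ C.cells) {t : Tree} (h : (C.mask t).testBit r = true) {P : PointSet}
    (hP : Contains P C.k (nth C.τ) r) : C.Reached P r := by
  obtain ⟨q, hq, hcl⟩ := hP
  induction hw : C.weight P.bound q using Nat.strong_induction_on generalizing q with
  | _ w ih =>
    subst hw
    refine (Tree.run_sound hC hpairs hr (q₀ := q) (fun q' h1 h2 h3 => ih _ h3 q' h1 h2 rfl) t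
      C.start [] 0).1 h q ⟨hq, fun i hi j hj hb => ?_, fun _ a ha => ?_⟩
    · change i ≤ C.k at hi
      change j ≤ C.k at hj
      have hlt : i * (C.k + 1) + j < C.cells := cell_lt hi hj
      refine hcl i hi j hj ?_
      change (nth ((List.range C.cells).map (var C.cells)) (i * (C.k + 1) + j)).testBit r = true at hb
      rwa [nth_eq, List.getD_eq_getElem _ _ (by simpa using hlt), List.getElem_map,
        List.getElem_range, testBit_var hlt hr] at hb
    · change nth (List.range C.k) a < C.k ∧ q (nth (List.range C.k) a) = q a
      have : nth (List.range C.k) a = a := by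
        rw [nth_eq, List.getD_eq_getElem _ _ (by simpa using ha), List.getElem_range]
      rw [this]
      exact ⟨ha, rfl⟩

end PointSet

namespace PointSet

/-! ### Permutations as point sets -/

/-- The graph of a permutation. -/
def ofPerm {n : ℕ} (π : Equiv.Perm (Fin n)) : PointSet where
  pts := {p | ∃ m : Fin n, p = (m.val, (π m).val)}
  bound := n
  lt_bound := by
    rintro _ ⟨m, rfl⟩
    exact ⟨m.isLt.le, (π m).isLt.le⟩
  fst_inj := by
    rintro _ ⟨m, rfl⟩ _ ⟨m', rfl⟩ h
    have : m = m' := Fin.ext h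
    rw [this]
  snd_inj := by
    rintro _ ⟨m, rfl⟩ _ ⟨m', rfl⟩ h
    have : m = m' := π.injective (Fin.ext h)
    rw [this]

/-- The shading encoded by a number. -/
def shading (k r : ℕ) : Finset (Fin (k + 1) × Fin (k + 1)) :=
  Finset.univ.filter fun s => r.testBit (s.1.val * (k + 1) + s.2.val) = true

/-- The bridge between point sets and the definitions of the theorem. Positions and values of the
permutation become coordinates, and no further point set has to come from a permutation. -/
theorem contains_ofPerm_iff {k n : ℕ} (τ : Equiv.Perm (Fin k)) (π : Equiv.Perm (Fin n)) {t : ℕ → ℕ}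
    (ht : ∀ a : Fin k, t a = τ a) (r : ℕ) :
    Contains (ofPerm π) k t r ↔ (MeshPattern.mk k τ (shading k r)).ContainedIn ⟨n, π⟩ := by
  constructor
  · rintro ⟨q, hq, hcl⟩
    choose f hf using fun a : Fin k => hq.mem a a.isLt
    have hmono : StrictMono f := by
      intro a b hab
      have := (hq.fst_lt a a.isLt b b.isLt).2 hab
      rw [hf a, hf b] at this
      exact this
    refine ⟨OrderEmbedding.ofStrictMono f hmono, fun a b => ?_, fun s hs m hm => ?_⟩
    · have h1 := hq.snd_lt a a.isLt b b.isLt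
      rw [hf a, hf b, ht, ht] at h1
      exact h1
    · have hs' : r.testBit (s.1.val * (k + 1) + s.2.val) = true := (Finset.mem_filter.1 hs).2
      refine hcl s.1 (Nat.le_of_lt_succ s.1.isLt) s.2 (Nat.le_of_lt_succ s.2.isLt) hs'
        (m, π m) ⟨m, rfl⟩ fun a ha => ?_
      obtain ⟨h1, h2, h3, h4⟩ := hm
      have e := hf ⟨a, ha⟩
      simp only at e
      rw [e, ht ⟨a, ha⟩]
      exact ⟨h1 ⟨a, ha⟩, h2 ⟨a, ha⟩, h3 ⟨a, ha⟩, h4 ⟨a, ha⟩⟩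
  · rintro ⟨f, hiso, hcl⟩
    -- The value `(0, 0)` outside the range is arbitrary, since only indices below `k` are ever
    -- consulted.
    obtain ⟨q, key⟩ : ∃ q : ℕ → ℕ × ℕ, ∀ a (ha : a < k),
        q a = (((f ⟨a, ha⟩ : Fin n) : ℕ), ((π (f ⟨a, ha⟩) : Fin n) : ℕ)) :=
      ⟨fun a => if h : a < k then
        (((f ⟨a, h⟩ : Fin n) : ℕ), ((π (f ⟨a, h⟩) : Fin n) : ℕ)) else (0, 0),
        fun a ha => by simp [ha]⟩
    refine ⟨q, ⟨fun a ha => ?_, fun a ha => ?_, fun a ha b hb => ?_, fun a ha b hb => ?_⟩,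
      fun i hi j hj hb p hp hc => ?_⟩
    · rw [key a ha]; exact ⟨_, rfl⟩
    · rw [ht ⟨a, ha⟩]; exact (τ ⟨a, ha⟩).isLt
    · rw [key a ha, key b hb]
      exact (f.lt_iff_lt (a := ⟨a, ha⟩) (b := ⟨b, hb⟩))
    · rw [key a ha, key b hb, ht ⟨a, ha⟩, ht ⟨b, hb⟩]
      exact hiso ⟨a, ha⟩ ⟨b, hb⟩
    · obtain ⟨m, rfl⟩ := hp
      refine hcl (⟨i, Nat.lt_succ_of_le hi⟩, ⟨j, Nat.lt_succ_of_le hj⟩) (Finset.mem_filter.2 ⟨Finset.mem_univ _, hb⟩) m ?_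
      refine ⟨fun a => ?_, fun a => ?_, fun a => ?_, fun a => ?_⟩ <;>
      · have h1 := hc a a.isLt
        rw [key a a.isLt, ht a] at h1
        first
          | exact h1.1
          | exact h1.2.1
          | exact h1.2.2.1
          | exact h1.2.2.2

/-! ### Enumeration of the occurrences in a given permutation -/

/-- The increasing lists of length `k` of numbers below `n`. -/
def tuples : ℕ → ℕ → List (List ℕ)
  | 0, 0 => [[]]
  | 0, _ + 1 => []
  | _ + 1, 0 => [[]]
  | n + 1, k + 1 => tuples n (k + 1) ++ (tuples n k).map (· ++ [n])

theorem mem_tuples (n k : ℕ) (f : ℕ → ℕ) (hlt : ∀ a < k, f a < n)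
    (hf : ∀ a < k, ∀ b < k, a < b → f a < f b) : (List.range k).map f ∈ tuples n k := by
  induction n generalizing k with
  | zero => cases k with
    | zero => simp [tuples]
    | succ k => exact absurd (hlt 0 (by omega)) (by omega)
  | succ n ih => cases k with
    | zero => simp [tuples]
    | succ k =>
      rw [tuples, List.mem_append]
      by_cases h : f k = n
      · right
        refine List.mem_map.2 ⟨_, ih k (fun a ha => ?_) (fun a ha b hb => hf a (by omega) b (by omega)),
          ?_⟩
        · have := hf a (by omega) k (by omega) ha; omega
        · rw [List.range_succ, List.map_append]; simp [h]
      · left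
        refine ih (k + 1) (fun a ha => ?_) hf
        have h1 := hlt k (by omega)
        rcases Nat.lt_succ_iff_lt_or_eq.1 ha with h2 | h2
        · have := hf a ha k (by omega) h2; omega
        · subst h2; omega

/-- The family of shadings of `τ` avoided by the points outside the occurrence `g` in `w`. -/
def occMask (k : ℕ) (τ w g : List ℕ) : ℕ :=
  cond (isOcc k τ w.length (nth w) g)
    (allLT (Nat.mul (Nat.succ k) (Nat.succ k)) (fun m => cond (mem g m)
      (ones (Nat.mul (Nat.succ k) (Nat.succ k)))
      (unshaded (Nat.mul (Nat.succ k) (Nat.succ k)) 0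
        (Nat.add (Nat.mul (below g m) (Nat.succ k)) (below (g.map (nth w)) (nth w m))))) w.length) 0

/-- The family of shadings of `τ` for which the mesh pattern is contained in the permutation `w`. -/
def contMask (k : ℕ) (τ w : List ℕ) : ℕ :=
  List.rec 0 (fun g _ x => Nat.lor (occMask k τ w g) x) (tuples w.length k)

/-- Whether a list is a permutation of `0, …, n - 1`. -/
def isPerm (w : List ℕ) : Bool :=
  allB (fun a => and (Nat.blt (nth w a) w.length)
    (allB (fun b => cond (Nat.beq (nth w a) (nth w b)) (Nat.beq a b) true) w.length)) w.length

theorem isPerm_iff {w : List ℕ} (h : isPerm w = true) :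
    ∀ a < w.length, nth w a < w.length ∧ ∀ b < w.length, nth w a = nth w b → a = b := by
  rw [isPerm, allB_iff] at h
  intro a ha
  have h1 := h a ha
  rw [Bool.and_eq_true, Nat.blt_eq, allB_iff] at h1
  refine ⟨h1.1, fun b hb hab => ?_⟩
  have h2 := h1.2 b hb
  rw [cond_beq, if_pos hab] at h2
  exact Nat.eq_of_beq_eq_true h2

/-- The permutation with a given list of values. -/
noncomputable def toPerm (w : List ℕ) (h : isPerm w = true) : Equiv.Perm (Fin w.length) :=
  Equiv.ofBijective (fun a => ⟨nth w a, (isPerm_iff h a a.isLt).1⟩)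
    (Finite.injective_iff_bijective.1 fun a b hab =>
      Fin.ext ((isPerm_iff h a a.isLt).2 b b.isLt (Fin.ext_iff.1 hab)))

theorem testBit_allLT_iff {e n r : ℕ} (hr : r < 2 ^ e) {f : ℕ → ℕ} :
    (allLT e f n).testBit r = true ↔ ∀ i < n, (f i).testBit r = true := by
  refine ⟨testBit_allLT, fun h => ?_⟩
  induction n with
  | zero => exact testBit_ones hr
  | succ n ih =>
    change (Nat.land (allLT e f n) (f n)).testBit r = true
    rw [testBit_land, ih fun i hi => h i (by omega), h n (by omega)]
    rfl

theorem below_le_length (l : List ℕ) (v : ℕ) : below l v ≤ l.length := by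
  induction l with
  | nil => simp [below]
  | cons y l ih => rw [below_cons]; split_ifs <;> simp <;> omega

theorem below_lt_iff {l : List ℕ} {n a v : ℕ} (hln : l.length = n)
    (hl : ∀ x < n, ∀ y < n, nth l x < nth l y ↔ x < y) (ha : a < n) :
    nth l a < v ↔ a < below l v := by
  have e : below l (nth l a) = a := below_eq _ _ _ (by omega) fun b hb => hl b (by omega) a ha
  have h := below_lt_below (y := v) (nth_mem (g := l) (a := a) (by omega))
  rw [e] at h
  exact h.symm

/-- For an explicit permutation all points are known, so the mask is exact and not just sufficient
as in `hitMask_sound`. Both directions are used when containment by permutations is compared with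
`Agree`. -/
theorem testBit_contMask {k : ℕ} {τ w : List ℕ} (hτ : isPerm τ = true) (hk : τ.length = k)
    (hb : ∀ j ≤ k, below τ j = j) (hw : isPerm w = true) {r : ℕ}
    (hr : r < 2 ^ ((k + 1) * (k + 1))) :
    (contMask k τ w).testBit r = true ↔ Contains (ofPerm (toPerm w hw)) k (nth τ) r := by
  have hor : (contMask k τ w).testBit r = true ↔
      ∃ g ∈ tuples w.length k, (occMask k τ w g).testBit r = true := by
    unfold contMask
    induction tuples w.length k with
    | nil => simp
    | cons g l ih =>
      change (Nat.lor (occMask k τ w g) _).testBit r = true ↔ _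
      rw [testBit_lor, Bool.or_eq_true, ih]
      simp
  -- All points of the permutation together form a configuration whose ranks are its values.
  have hconf : Config (ofPerm (toPerm w hw)) w.length (nth w) (fun m => (m, nth w m)) :=
    ⟨fun a ha => ⟨⟨a, ha⟩, rfl⟩, fun a ha => (isPerm_iff hw a ha).1, fun _ _ _ _ => Iff.rfl,
      fun _ _ _ _ => Iff.rfl⟩
  have hpts : ∀ p ∈ (ofPerm (toPerm w hw)).pts, ∃ m < w.length, p = (m, nth w m) := by
    rintro _ ⟨m, rfl⟩; exact ⟨m, m.isLt, rfl⟩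
  rw [hor]
  constructor
  · rintro ⟨g, -, hg⟩
    rw [occMask, Bool.cond_eq_ite] at hg
    split_ifs at hg with hocc
    swap
    · simp at hg
    obtain ⟨hlen, hg'⟩ := isOcc_iff hocc
    refine ⟨fun a => ((nth g a), nth w (nth g a)), ⟨fun a ha => hconf.mem _ (hg' a ha).1,
      fun a ha => hk ▸ (isPerm_iff hτ a (by omega)).1, fun a ha b hb => ((hg' a ha).2 b hb).1,
      fun a ha b hb => ((hg' a ha).2 b hb).2⟩, fun i hi j hj hbit p hp hcell => ?_⟩
    obtain ⟨m, hm, rfl⟩ := hpts p hp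
    have h1 := testBit_allLT hg m hm
    rw [Bool.cond_eq_ite] at h1
    split_ifs at h1 with hmem
    · obtain ⟨a, ha, rfl⟩ := exists_nth_of_mem hmem
      have := hcell a (by omega)
      simp only at this
      omega
    · have e1 : below g m = i := below_eq g m i (by omega) fun a ha => by
        have h2 := hcell a (by omega)
        simp only at h2
        omega
      have e2 : below (g.map (nth w)) (nth w m) = j := by
        rw [← hb j hj]
        refine below_congr _ _ _ _ (by simp [hlen, hk]) fun a ha => ?_
        have ha : a < k := by simpa [hlen] using ha
        rw [nth_map _ _ _ (by omega)]
        have h2 := hcell a (by omega)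
        simp only at h2
        omega
      rw [e1, e2] at h1
      have h5 := testBit_unshaded (D := 0) (cell_lt hi hj) hr
      rw [Nat.xor_zero, hbit] at h5
      change (unshaded ((k + 1) * (k + 1)) 0 (i * (k + 1) + j)).testBit r = true at h1
      rw [h1] at h5
      exact absurd h5 (by simp)
  · rintro ⟨q, hq, hcl⟩
    have hq' : ∀ a < k, (q a).1 < w.length ∧ q a = ((q a).1, nth w (q a).1) := fun a ha => by
      obtain ⟨m, hm, h⟩ := hpts _ (hq.mem a ha)
      rw [h]; exact ⟨hm, rfl⟩
    set g := (List.range k).map fun a => (q a).1 with hg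
    have hlen : g.length = k := by simp [hg]
    have hnth : ∀ a < k, nth g a = (q a).1 := fun a ha => by
      rw [hg, nth_map _ _ _ (by simpa using ha), nth_eq,
        List.getD_eq_getElem _ _ (by simpa using ha), List.getElem_range]
    have hnth2 : ∀ a < k, nth w (nth g a) = (q a).2 := fun a ha => by
      rw [hnth a ha]; conv_rhs => rw [(hq' a ha).2]
    refine ⟨g, mem_tuples _ _ _ (fun a ha => (hq' a ha).1)
      (fun a ha b hb hab => (hq.fst_lt a ha b hb).2 hab), ?_⟩
    have hocc : isOcc k τ w.length (nth w) g = true := by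
      rw [isOcc, Bool.and_eq_true, allB_iff]
      refine ⟨by simp [hlen], fun a ha => ?_⟩
      rw [Bool.and_eq_true, allB_iff, Nat.blt_eq, hnth a ha]
      refine ⟨(hq' a ha).1, fun b hb => ?_⟩
      rw [← hnth a ha, hnth2 a ha, hnth2 b hb, hnth a ha, hnth b hb, Bool.and_eq_true, cond_blt,
        cond_blt]
      have h1 := hq.fst_lt a ha b hb
      have h2 := hq.snd_lt a ha b hb
      constructor <;> split_ifs <;> simp only [Nat.blt_eq, Nat.ble_eq] <;> omega
    rw [occMask, hocc, cond_true, testBit_allLT_iff (by exact hr)]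
    intro m hm
    rw [Bool.cond_eq_ite]
    split_ifs with hmem
    · exact testBit_ones hr
    have hmg : ∀ a < k, (q a).1 ≠ m := fun a ha e => hmem
      (mem_iff.2 (by rw [← e, ← hnth a ha]; exact nth_mem (by omega)))
    have hi : below g m ≤ k := hlen ▸ below_le_length g m
    have hj : below (g.map (nth w)) (nth w m) ≤ k := by
      have := below_le_length (g.map (nth w)) (nth w m)
      rwa [List.length_map, hlen] at this
    have h5 := testBit_unshaded (D := 0) (cell_lt hi hj) hr
    rw [Nat.xor_zero] at h5
    change (unshaded ((k + 1) * (k + 1)) 0 (below g m * (k + 1) +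
      below (g.map (nth w)) (nth w m))).testBit r = true
    rw [h5, Bool.not_eq_true', ← Bool.not_eq_true]
    intro hbit
    refine hcl _ hi _ hj hbit (m, nth w m) ⟨⟨m, hm⟩, rfl⟩ fun a ha => ?_
    have h6 := below_lt_iff (v := m) hlen (fun x hx y hy => by
      rw [hnth x hx, hnth y hy]; exact hq.fst_lt x hx y hy) ha
    rw [hnth a ha] at h6
    have hne := hmg a ha
    -- the heights
    have h7 : nth w (nth g a) < nth w m ↔ nth τ a < below (g.map (nth w)) (nth w m) := by
      have hin : nth w (nth g a) ∈ g.map (nth w) := List.mem_map.2 ⟨_, nth_mem (by omega), rfl⟩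
      -- The number of chosen points lower than the one with index `a` is its rank in the pattern,
      -- by order isomorphism and because `τ` is a permutation.
      have e : below (g.map (nth w)) (nth w (nth g a)) = nth τ a := by
        rw [← hb (nth τ a) (hq.rank_lt a ha).le]
        refine below_congr _ _ _ _ (by simp [hlen, hk]) fun b hb => ?_
        have hb : b < k := by simpa [hlen] using hb
        rw [nth_map _ _ _ (by omega), hnth2 b hb, hnth2 a ha]
        exact hq.snd_lt b hb a ha
      have h := below_lt_below (y := nth w m) hin
      rw [e] at h
      exact h.symm
    rw [hnth2 a ha] at h7
    have hne2 : (q a).2 ≠ nth w m := fun e => hne ((isPerm_iff hw _ (hq' a ha).1).2 m hm (by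
      rw [← e]; conv_rhs => rw [(hq' a ha).2]))
    simp only
    omega

end PointSet

namespace PointSet

/-! ### Evaluation helpers -/

/-- Apply a function after evaluating its argument. -/
def force {α : Type} (x : ℕ) (f : ℕ → α) : α := Nat.rec (f 0) (fun n _ => f (Nat.succ n)) x

/-- Logically `force` is plain application. The recursion on `x` makes the kernel reduce `x` to a
numeral before the body is unfolded, so that a large number used several times is computed once. -/
theorem force_eq {α : Type} (x : ℕ) (f : ℕ → α) : force x f = f x := by cases x <;> rfl

/-- Apply a function after evaluating a list of numbers. -/
def forceList {α : Type} (l : List ℕ) : (List ℕ → α) → α :=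
  List.rec (fun f => f []) (fun x _ rest f => force x fun y => rest fun ys => f (y :: ys)) l

theorem forceList_eq {α : Type} (l : List ℕ) (f : List ℕ → α) : forceList l f = f l := by
  induction l generalizing f with
  | nil => rfl
  | cons x l ih =>
    change force x (fun y => forceList l fun ys => f (y :: ys)) = _
    rw [force_eq, ih]

/-! ### Families of counters -/

/-- The value at `r` of a family of counters, given by their binary digits. -/
def value (c : List ℕ) (r : ℕ) : ℕ :=
  List.rec 0 (fun x _ v => (x.testBit r).toNat + 2 * v) c

theorem value_nil (r : ℕ) : value [] r = 0 := rfl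

theorem value_cons (x : ℕ) (c : List ℕ) (r : ℕ) :
    value (x :: c) r = (x.testBit r).toNat + 2 * value c r := rfl

/-- Addition of families of counters. -/
def addCounters (c : List ℕ) : List ℕ → ℕ → List ℕ :=
  List.rec (fun _ z => cond (Nat.beq z 0) [] [z])
    (fun x _ rest d z => force (d.headD 0) fun y => force (Nat.xor x y) fun s =>
      Nat.xor s z :: rest d.tail (Nat.lor (Nat.land x y) (Nat.land s z))) c

/-- A ripple-carry adder, run for all `r` in parallel: `z` holds the carries, sum and carry of a
digit are the usual Boolean expressions, and missing digits of `d` count as zero. The final carry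
becomes a new digit unless it vanishes everywhere. -/
theorem value_addCounters (c d : List ℕ) (z r : ℕ) (h : d.length ≤ c.length) :
    value (addCounters c d z) r = value c r + value d r + (z.testBit r).toNat := by
  induction c generalizing d z with
  | nil =>
    have : d = [] := by simpa using h
    subst this
    change value (cond (Nat.beq z 0) [] [z]) r = _
    rw [cond_beq]
    split_ifs with hz
    · subst hz; simp [value_nil]
    · simp [value_cons, value_nil]
  | cons x c ih =>
    change value (force (d.headD 0) fun y => force (Nat.xor x y) fun s =>
      Nat.xor s z :: addCounters c d.tail (Nat.lor (Nat.land x y) (Nat.land s z))) r = _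
    rw [force_eq, force_eq, value_cons, ih _ _ (by simp at h ⊢; omega), value_cons]
    simp only [testBit_xor', testBit_lor, testBit_land]
    cases d with
    | nil =>
      simp only [List.headD_nil, List.tail_nil, value_nil, Nat.zero_testBit]
      cases x.testBit r <;> cases z.testBit r <;> simp <;> omega
    | cons y d =>
      simp only [List.headD_cons, List.tail_cons, value_cons]
      cases x.testBit r <;> cases y.testBit r <;> cases z.testBit r <;> simp <;> omega

/-- One operation on every digit acts on whole counters. Masking keeps or erases them (`b`), and
shifting moves them from `r'` to `r`. -/
theorem value_map_eq (c : List ℕ) (f : ℕ → ℕ) (r r' : ℕ) (b : Bool)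
    (hf : ∀ x, (f x).testBit r = (b && x.testBit r')) :
    value (c.map f) r = if b then value c r' else 0 := by
  induction c with
  | nil => simp [value_nil]
  | cons x c ih =>
    rw [List.map_cons, value_cons, value_cons, ih, hf]
    cases b <;> simp

/-- The sum of a family of counters over all `r < 2 ^ e`. -/
def total (e : ℕ) : List ℕ → ℕ :=
  Nat.rec (fun c => List.rec 0 (fun x _ v => Nat.add (Nat.land x 1) (Nat.mul 2 v)) c)
    (fun i rest c => forceList (addCounters (c.map fun x => Nat.land x (ones i))
      (c.map fun x => Nat.shiftRight x (Nat.pow 2 i)) 0) rest) e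

theorem testBit_ones_ge {e r : ℕ} (hr : 2 ^ e ≤ r) : (ones e).testBit r = false := by
  change (2 ^ 2 ^ e - 1).testBit r = false
  rw [Nat.testBit_two_pow_sub_one]; simpa using hr

/-- The upper half of the index range is added to the lower half, as counters, until a single index
is left. The number of additions is therefore `e` and not `2 ^ e`. -/
theorem total_eq (e : ℕ) (c : List ℕ) :
    total e c = ∑ r ∈ Finset.range (2 ^ e), value c r := by
  induction e generalizing c with
  | zero =>
    simp only [pow_zero, Finset.range_one, Finset.sum_singleton]
    induction c with
    | nil => rfl
    | cons x c ih =>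
      change Nat.land x 1 + 2 * total 0 c = _
      rw [ih, value_cons]
      congr 1
      change x &&& 1 = _
      rw [Nat.and_one_is_mod, Nat.testBit_zero]
      rcases Nat.mod_two_eq_zero_or_one x with h | h <;> simp [h]
  | succ e ih =>
    change forceList (addCounters (c.map fun x => Nat.land x (ones e))
      (c.map fun x => Nat.shiftRight x (Nat.pow 2 e)) 0) (total e) = _
    rw [forceList_eq, ih, pow_succ, mul_two, Finset.sum_range_add, ← Finset.sum_add_distrib]
    refine Finset.sum_congr rfl fun r hr => ?_
    have hr : r < 2 ^ e := by simpa using hr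
    rw [value_addCounters _ _ _ _ (by simp), value_map_eq c _ r r true fun x => by
      rw [testBit_land, testBit_ones hr]; simp, value_map_eq c _ r (2 ^ e + r) true fun x => by
      change (x >>> 2 ^ e).testBit r = _
      rw [Nat.testBit_shiftRight]; simp]
    simp

/-- The number of elements of a family. -/
def count (e x : ℕ) : ℕ := total e [x]

theorem count_eq (e x : ℕ) :
    count e x = ((Finset.range (2 ^ e)).filter fun r => x.testBit r = true).card := by
  rw [count, total_eq, Finset.card_filter]
  refine Finset.sum_congr rfl fun r _ => ?_
  rw [value_cons, value_nil]
  cases x.testBit r <;> rfl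

/-- The places where a counter is nonzero. -/
def support (c : List ℕ) : ℕ := List.rec 0 (fun x _ y => Nat.lor x y) c

theorem testBit_support (c : List ℕ) (r : ℕ) : (support c).testBit r = true ↔ value c r ≠ 0 := by
  induction c with
  | nil => simp [support, value_nil]
  | cons x c ih =>
    change (Nat.lor x (support c)).testBit r = true ↔ _
    rw [testBit_lor, Bool.or_eq_true, ih, value_cons]
    cases x.testBit r <;> simp

/-- The places where a counter has a given value. -/
def valueEq (e : ℕ) (c : List ℕ) : ℕ → ℕ :=
  List.rec (fun j => cond (Nat.beq j 0) (ones e) 0)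
    (fun x _ rest j => Nat.land (cond (Nat.beq (Nat.mod j 2) 0) (compl e x) x)
      (rest (Nat.div j 2))) c

/-- Equality with `j` is tested digit by digit: the parity of `j` decides whether the lowest digit
or its complement is taken. -/
theorem testBit_valueEq {e r : ℕ} (hr : r < 2 ^ e) (c : List ℕ) (j : ℕ) :
    (valueEq e c j).testBit r = true ↔ value c r = j := by
  induction c generalizing j with
  | nil =>
    change (cond (Nat.beq j 0) (ones e) 0).testBit r = true ↔ _
    rw [cond_beq, value_nil]
    split_ifs with h
    · simp [h, testBit_ones hr]
    · simpa using Ne.symm h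
  | cons x c ih =>
    change (Nat.land (cond (Nat.beq (j % 2) 0) (compl e x) x) (valueEq e c (j / 2))).testBit r =
      true ↔ _
    rw [testBit_land, Bool.and_eq_true, ih, value_cons, cond_beq]
    split_ifs with h
    · rw [testBit_compl _ hr]
      cases x.testBit r <;> simp <;> omega
    · cases x.testBit r <;> simp <;> omega

/-! ### Merging shadings -/

/-- Two shadings give coincident mesh patterns. -/
def Equiv (k : ℕ) (τ : ℕ → ℕ) (r r' : ℕ) : Prop :=
  ∀ P : PointSet, Contains P k τ r ↔ Contains P k τ r'

/-- The families `edges` consist of shadings to which a cell can be added. -/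
def EdgesSound (k : ℕ) (τ : ℕ → ℕ) (edges : List ℕ) : Prop :=
  ∀ b < (k + 1) * (k + 1), ∀ r, (nth edges b).testBit r = true →
    r < 2 ^ ((k + 1) * (k + 1)) ∧ r.testBit b = false ∧ Equiv k τ r (r + 2 ^ b)

/-- The counters `c` give the number of shadings assigned to every place by some function that
assigns to every shading an equivalent one. -/
def Located (k : ℕ) (τ : ℕ → ℕ) (c : List ℕ) (loc : ℕ → ℕ) : Prop :=
  ∀ r < 2 ^ ((k + 1) * (k + 1)), loc r < 2 ^ ((k + 1) * (k + 1)) ∧ Equiv k τ r (loc r) ∧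
    value c r = ((Finset.range (2 ^ ((k + 1) * (k + 1)))).filter fun r' => loc r' = r).card

/-- Fewer shaded cells impose fewer conditions on the same occurrence. Hence removing a cell needs
no proof, and only adding a cell does. -/
theorem Contains.mono {P : PointSet} {k : ℕ} {τ : ℕ → ℕ} {r r' : ℕ}
    (h : ∀ b, r'.testBit b = true → r.testBit b = true) (hP : Contains P k τ r) :
    Contains P k τ r' := by
  obtain ⟨q, hq, hcl⟩ := hP
  exact ⟨q, hq, fun i hi j hj hb => hcl i hi j hj (h _ hb)⟩

/-- Move the places in the family `src` down by `d`. -/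
def moveDown (d src : ℕ) (c : List ℕ) : List ℕ :=
  addCounters (c.map fun x => Nat.xor x (Nat.land x src))
    (c.map fun x => Nat.shiftRight (Nat.land x src) d) 0

/-- Move the places in the family `src` up by `d`. -/
def moveUp (d src : ℕ) (c : List ℕ) : List ℕ :=
  addCounters (c.map fun x => Nat.xor x (Nat.land x src))
    (c.map fun x => Nat.shiftLeft (Nat.land x src) d) 0

theorem value_stay (c : List ℕ) (src r : ℕ) :
    value (c.map fun x => Nat.xor x (Nat.land x src)) r =
      if src.testBit r then 0 else value c r := by
  rw [value_map_eq c _ r r (!src.testBit r) fun x => by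
    rw [testBit_xor', testBit_land]; cases x.testBit r <;> cases src.testBit r <;> rfl]
  cases src.testBit r <;> simp

/-- After the move the shadings at `r` are those that were there and stayed, together with those
that came from the only possible source `r'`. The last hypothesis covers the case that nothing
arrives at `r`. -/
theorem card_moved (M : ℕ) (loc φ : ℕ → ℕ) (s : ℕ → Bool) (r r' : ℕ)
    (h : ∀ x, s x = true → (φ x = r ↔ x = r')) (hr' : s r' = true ∨ ∀ x, s x = true → φ x ≠ r) :
    ((Finset.range M).filter fun x => (if s (loc x) then φ (loc x) else loc x) = r).card =
      (if s r then 0 else ((Finset.range M).filter fun x => loc x = r).card) +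
      (if s r' then ((Finset.range M).filter fun x => loc x = r').card else 0) := by
  have e1 : (if s r then 0 else ((Finset.range M).filter fun x => loc x = r).card) =
      ((Finset.range M).filter fun x => loc x = r ∧ s (loc x) = false).card := by
    split_ifs with hs
    · symm
      rw [Finset.card_eq_zero, Finset.filter_eq_empty_iff]
      rintro x - ⟨hx, h2⟩
      rw [hx, hs] at h2
      exact absurd h2 (by simp)
    · congr 1
      refine Finset.filter_congr fun x _ => ⟨fun hx => ⟨hx, by rw [hx]; simpa using hs⟩, And.left⟩
  have e2 : (if s r' then ((Finset.range M).filter fun x => loc x = r').card else 0) =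
      ((Finset.range M).filter fun x => s (loc x) = true ∧ φ (loc x) = r).card := by
    split_ifs with hs
    · congr 1
      refine Finset.filter_congr fun x _ => ⟨fun hx => ?_, fun hx => (h _ hx.1).1 hx.2⟩
      rw [hx]; exact ⟨hs, (h _ hs).2 rfl⟩
    · symm
      rw [Finset.card_eq_zero, Finset.filter_eq_empty_iff]
      rintro x - ⟨hx, h2⟩
      exact (hr'.resolve_left hs) _ hx h2
  rw [e1, e2, ← Finset.card_union_of_disjoint]
  · congr 1
    ext x
    simp only [Finset.mem_filter, Finset.mem_union]
    cases s (loc x) <;> simp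
  · rw [Finset.disjoint_filter]
    rintro x - ⟨-, h1⟩ ⟨h2, -⟩
    rw [h1] at h2
    exact absurd h2 (by simp)

/-- All places in `src` move by the same distance, so one shift and one addition update the counters
of all shadings. The relocation is legitimate because source and destination are equivalent; nothing
is required of the destinations, which may be occupied. -/
theorem Located.moveDown {k : ℕ} {τ : ℕ → ℕ} {c : List ℕ} {loc : ℕ → ℕ}
    (h : Located k τ c loc) {d src : ℕ}
    (hsrc : ∀ x, src.testBit x = true → d ≤ x ∧ x < 2 ^ ((k + 1) * (k + 1)) ∧
      Equiv k τ (x - d) x) :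
    Located k τ (moveDown d src c)
      (fun r => if src.testBit (loc r) then loc r - d else loc r) := by
  intro r hr
  obtain ⟨h1, h2, h3⟩ := h r hr
  refine ⟨?_, ?_, ?_⟩
  · dsimp only
    split_ifs
    · exact lt_of_le_of_lt (Nat.sub_le _ _) h1
    · exact h1
  · dsimp only
    split_ifs with hs
    · exact fun P => (h2 P).trans ((hsrc _ hs).2.2 P).symm
    · exact h2
  · rw [PointSet.moveDown, value_addCounters _ _ _ _ (by simp), value_stay,
      value_map_eq c _ r (d + r) (src.testBit (d + r)) fun x => by
        change ((Nat.land x src) >>> d).testBit r = _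
        rw [Nat.testBit_shiftRight, testBit_land, Bool.and_comm],
      card_moved _ loc (fun x => x - d) (fun x => src.testBit x) r (d + r)
        (fun x hx => by have := (hsrc x hx).1; omega) ?_]
    · rw [← h3]
      by_cases hs : src.testBit (d + r) = true
      · rw [if_pos hs, if_pos hs, ← (h _ (hsrc _ hs).2.1).2.2]; simp
      · rw [if_neg hs, if_neg hs]; simp
    · by_cases hs : src.testBit (d + r) = true
      · exact Or.inl hs
      · refine Or.inr fun x hx e => hs ?_
        have := (hsrc x hx).1
        rw [← e, Nat.add_sub_cancel' this]
        exact hx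

theorem Located.moveUp {k : ℕ} {τ : ℕ → ℕ} {c : List ℕ} {loc : ℕ → ℕ}
    (h : Located k τ c loc) {d src : ℕ}
    (hsrc : ∀ x, src.testBit x = true → x + d < 2 ^ ((k + 1) * (k + 1)) ∧
      Equiv k τ x (x + d)) :
    Located k τ (moveUp d src c)
      (fun r => if src.testBit (loc r) then loc r + d else loc r) := by
  intro r hr
  obtain ⟨h1, h2, h3⟩ := h r hr
  refine ⟨?_, ?_, ?_⟩
  · dsimp only
    split_ifs with hs
    · exact (hsrc _ hs).1
    · exact h1
  · dsimp only
    split_ifs with hs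
    · exact fun P => (h2 P).trans ((hsrc _ hs).2 P)
    · exact h2
  · rw [PointSet.moveUp, value_addCounters _ _ _ _ (by simp), value_stay]
    by_cases hb : d ≤ r
    · rw [value_map_eq c _ r (r - d) (src.testBit (r - d)) fun x => by
        change ((Nat.land x src) <<< d).testBit r = _
        rw [Nat.testBit_shiftLeft, testBit_land, Bool.and_comm (src.testBit _)]; simp [hb],
        card_moved _ loc (fun x => x + d) (fun x => src.testBit x) r (r - d)
          (fun x hx => by omega) ?_]
      · rw [← h3]
        by_cases hs : src.testBit (r - d) = true
        · rw [if_pos hs, if_pos hs, ← (h (r - d) (lt_of_le_of_lt (Nat.sub_le _ _) hr)).2.2]; simp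
        · rw [if_neg hs, if_neg hs]; simp
      · by_cases hs : src.testBit (r - d) = true
        · exact Or.inl hs
        · refine Or.inr fun x hx e => hs ?_
          rw [← e, Nat.add_sub_cancel]
          exact hx
    -- A place below `d` receives nothing. The number `2 ^ ((k + 1) * (k + 1))`, which cannot belong
    -- to `src`, serves as a dummy source in `card_moved`.
    · have hM : src.testBit (2 ^ ((k + 1) * (k + 1))) = false := by
        by_contra hs
        have := (hsrc _ (by simpa using hs)).1
        exact absurd (Nat.le_add_right _ _) (not_le.2 this)
      have h4 := card_moved (2 ^ ((k + 1) * (k + 1))) loc (fun x => x + d)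
        (fun x => src.testBit x) r (2 ^ ((k + 1) * (k + 1)))
        (fun x hx => ⟨fun e => absurd (e ▸ Nat.le_add_left _ _) hb,
          fun e => by rw [e, hM] at hx; exact absurd hx (by simp)⟩)
        (Or.inr fun x _ e => hb (e ▸ Nat.le_add_left _ _))
      rw [value_map_eq c _ r r false fun x => by
        change ((Nat.land x src) <<< d).testBit r = _
        rw [Nat.testBit_shiftLeft]; simp [hb], h4, h3, hM]
      simp

end PointSet

namespace PointSet

/-! ### Upper bounds for the number of classes -/

/-- Adding a missing cell to a shading is an addition without carries. The rules speak of symmetric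
differences, the moves of shifts by `2 ^ b`; this identifies them. -/
theorem xor_two_pow {r b : ℕ} (h : r.testBit b = false) : r ^^^ 2 ^ b = r + 2 ^ b := by
  refine Nat.eq_of_testBit_eq fun j => ?_
  rw [Nat.testBit_xor, Nat.testBit_two_pow]
  rcases lt_trichotomy j b with hj | rfl | hj
  · rw [add_comm, Nat.testBit_two_pow_add_gt hj]
    simp [hj.ne']
  · rw [add_comm, Nat.testBit_two_pow_add_eq]; simp
  · obtain ⟨i, rfl⟩ : ∃ i, j = i + (b + 1) := ⟨j - (b + 1), by omega⟩
    -- As digit `b` of `r` is zero, adding `2 ^ b` stays below `2 ^ (b + 1)` in the lower part and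
    -- leaves the higher digits alone.
    have h1 : r % 2 ^ (b + 1) < 2 ^ b := by
      rw [Nat.mod_pow_succ]
      rw [Nat.testBit_eq_decide_div_mod_eq] at h
      have h2 : r / 2 ^ b % 2 = 0 := by simpa using h
      rw [h2, mul_zero, add_zero]
      exact Nat.mod_lt _ (by positivity)
    have h2 : (r + 2 ^ b) / 2 ^ (b + 1) = r / 2 ^ (b + 1) := by
      rw [Nat.add_div_eq_of_add_mod_lt, Nat.div_eq_of_lt (Nat.pow_lt_pow_right (by norm_num)
        (Nat.lt_succ_self b)), add_zero]
      rw [Nat.mod_eq_of_lt (Nat.pow_lt_pow_right (by norm_num) (Nat.lt_succ_self b)), pow_succ 2 b]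
      rw [pow_succ 2 b] at h1
      omega
    rw [← Nat.testBit_div_two_pow, ← Nat.testBit_div_two_pow, h2]
    have : decide (b = i + (b + 1)) = false := by simp; omega
    rw [this, Bool.xor_false]

/-- A certificate for a family of containments between mesh patterns. -/
structure Rule where
  targets : List ℕ
  measure : (Bool × ℕ × Bool) × (Bool × ℕ × Bool)
  tree : Tree

/-- The goal of a rule. -/
def Rule.goal (k : ℕ) (τ : List ℕ) (pairs : List (ℕ × ℕ)) (R : Rule) : Goal :=
  ⟨k, τ, R.targets, R.measure, pairs⟩

/-- The shadings for which a rule is proved. -/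
noncomputable def Rule.mask (k : ℕ) (τ : List ℕ) (pairs : List (ℕ × ℕ)) (R : Rule) : ℕ :=
  cond (and (Nat.blt R.measure.1.2.1 k) (Nat.blt R.measure.2.2.1 k))
    ((R.goal k τ pairs).mask R.tree) 0

/-- Whether a list describes a permutation of length `k`. -/
def isPattern (k : ℕ) (τ : List ℕ) : Bool :=
  and (Nat.beq τ.length k) (allB (fun j => Nat.beq (below τ j) j) (Nat.succ k))

/-- The pairs that may be used by `drop`. -/
def PairsSound (pairs : List (ℕ × ℕ)) : Prop :=
  ∀ x ∈ pairs, ∀ (Q : PointSet) (q : ℕ → ℕ × ℕ), Config Q 2 (pairRank x.1) q →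
    Contains Q 2 (pairRank x.1) x.2

theorem Rule.mask_sound {k : ℕ} {τ : List ℕ} {pairs : List (ℕ × ℕ)} (hτ : isPattern k τ = true)
    (hp : PairsSound pairs) {R : Rule} {r : ℕ} (hr : r < 2 ^ ((k + 1) * (k + 1)))
    (h : (R.mask k τ pairs).testBit r = true) {P : PointSet} (hP : Contains P k (nth τ) r) :
    ∃ D ∈ R.targets, Contains P k (nth τ) (r ^^^ D) := by
  rw [isPattern, Bool.and_eq_true, allB_iff] at hτ
  rw [Rule.mask, Bool.cond_eq_ite] at h
  split_ifs at h with hm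
  · rw [Bool.and_eq_true, Nat.blt_eq, Nat.blt_eq] at hm
    have hC : (R.goal k τ pairs).WellFormed := ⟨Nat.eq_of_beq_eq_true hτ.1,
      fun j hj => Nat.eq_of_beq_eq_true (hτ.2 j (Nat.lt_succ_of_le hj)), hm.1, hm.2⟩
    exact Goal.mask_sound hC hp hr h hP
  · simp at h

/-- Every point set containing the first mesh pattern contains the second. -/
def Leads (k : ℕ) (τ : ℕ → ℕ) (x y : ℕ) : Prop :=
  ∀ P : PointSet, Contains P k τ x → Contains P k τ y

/-- The occurrences among `k + 1` points after the insertion of a point in the cell `b`. -/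
def autoTree (k b d : ℕ) : Tree :=
  .split [(b / (k + 1), b % (k + 1))] d (.kid
    -- If the cell contains points, its extreme point is added and each choice of `k` of the `k + 1`
    -- points is tried with the new cell shaded. The start value `.hit [] 0` proves nothing, since
    -- `0` is not the target of the rule.
    (List.rec (.hit [] 0) (fun g _ t => .either (.hit g (Nat.pow 2 b)) t) (tuples (k + 1) k))
    -- If the cell is empty, the occurrence itself survives the additional shading.
    (.hit (List.range k) (Nat.pow 2 b)))

/-- The shadings to which the cell `b` can be added according to the rules. -/
noncomputable def edgeMask (k : ℕ) (τ : List ℕ) (pairs : List (ℕ × ℕ))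
    (rules : List (ℕ × (Bool × ℕ × Bool) × Tree)) (b : ℕ) : ℕ :=
  Nat.land (compl ((k + 1) * (k + 1)) (var ((k + 1) * (k + 1)) b))
    (List.rec 0 (fun R _ x => force x fun y => cond (Nat.beq R.1 b)
      (Nat.lor y (Rule.mask k τ pairs ⟨[Nat.pow 2 b], (R.2.1, (false, 0, false)), R.2.2⟩)) y)
      (((List.range 4).map fun d => (b, (false, 0, false), autoTree k b d)) ++ rules))

/-- Containment with the additional cell is the stronger condition, so one direction is
`Contains.mono`; a rule with the single target `2 ^ b` supplies the other. The complement of `var`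
keeps only shadings in which the cell is still missing. The four automatic trees, one for each
direction, come before the special ones. -/
theorem testBit_edgeMask {k : ℕ} {τ : List ℕ} {pairs : List (ℕ × ℕ)} (hτ : isPattern k τ = true)
    (hp : PairsSound pairs) {rules : List (ℕ × (Bool × ℕ × Bool) × Tree)} {b r : ℕ}
    (hb : b < (k + 1) * (k + 1)) (hr : r < 2 ^ ((k + 1) * (k + 1)))
    (h : (edgeMask k τ pairs rules b).testBit r = true) :
    r.testBit b = false ∧ Equiv k (nth τ) r (r + 2 ^ b) := by
  rw [edgeMask, testBit_land, Bool.and_eq_true, testBit_compl _ hr, testBit_var hb hr] at h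
  have hb' : r.testBit b = false := by simpa using h.1
  refine ⟨hb', fun P => ⟨fun hP => ?_, Contains.mono fun j hj => ?_⟩⟩
  · have h2 := h.2
    generalize ((List.range 4).map fun d => (b, (false, 0, false), autoTree k b d)) ++ rules = l at h2
    induction l with
    | nil => simp at h2
    | cons R l ih =>
      change (force _ fun y => cond (Nat.beq R.1 b) (Nat.lor y _) y).testBit r = true at h2
      rw [force_eq, cond_beq] at h2
      split_ifs at h2 with hR
      · rw [testBit_lor, Bool.or_eq_true] at h2
        rcases h2 with h2 | h2
        · exact ih h2
        · obtain ⟨D, hD, h3⟩ := Rule.mask_sound hτ hp hr h2 hP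
          rw [List.mem_singleton] at hD
          rw [hD] at h3
          exact (xor_two_pow hb') ▸ h3
      · exact ih h2
  · rw [← xor_two_pow hb', Nat.testBit_xor, hj, Nat.testBit_two_pow]
    by_cases e : b = j
    · rw [e] at hb'; rw [hb'] at hj; exact absurd hj (by simp)
    · simp [e]

/-- The families of shadings to which the cells can be added. -/
noncomputable def edges (k : ℕ) (τ : List ℕ) (pairs : List (ℕ × ℕ))
    (rules : List (ℕ × (Bool × ℕ × Bool) × Tree)) : List ℕ :=
  (List.range ((k + 1) * (k + 1))).map fun b =>
    Nat.land (ones ((k + 1) * (k + 1))) (edgeMask k τ pairs rules b)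

theorem edgesSound_edges {k : ℕ} {τ : List ℕ} {pairs : List (ℕ × ℕ)} (hτ : isPattern k τ = true)
    (hp : PairsSound pairs) (rules : List (ℕ × (Bool × ℕ × Bool) × Tree)) :
    EdgesSound k (nth τ) (edges k τ pairs rules) := by
  intro b hb r h
  have e : nth (edges k τ pairs rules) b = Nat.land (ones ((k + 1) * (k + 1)))
      (edgeMask k τ pairs rules b) := by
    rw [nth_eq, edges, List.getD_eq_getElem _ _ (by simpa using hb)]; simp
  rw [e, testBit_land, Bool.and_eq_true] at h
  have hr : r < 2 ^ ((k + 1) * (k + 1)) := by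
    by_contra hr
    rw [testBit_ones_ge (not_lt.1 hr)] at h
    exact absurd h.1 (by simp)
  exact ⟨hr, testBit_edgeMask hτ hp hb hr h.2⟩

/-- Follow a path: a step below `e` adds or removes a cell, and `e + y` uses the known containment
of `y`. -/
def walk (e : ℕ) (E : List ℕ) (known : List (ℕ × ℕ)) (path : List ℕ) : ℕ → ℕ → Bool :=
  List.rec (fun x y => Nat.beq x y)
    (fun s _ rest x y => cond (Nat.blt s e)
      (cond (Nat.testBit x s) (rest (Nat.xor x (Nat.pow 2 s)) y)
        (and (Nat.testBit (nth E s) x) (rest (Nat.add x (Nat.pow 2 s)) y)))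
      (and (memCell known x (Nat.sub s e)) (rest (Nat.sub s e) y))) path

/-- Removing a cell is always allowed, adding one needs membership in the corresponding family `E`,
and all other steps quote a containment established before. -/
theorem leads_of_walk {k : ℕ} {τ : ℕ → ℕ} {E : List ℕ} (hE : EdgesSound k τ E)
    {known : List (ℕ × ℕ)} (hk : ∀ f ∈ known, Leads k τ f.1 f.2) {path : List ℕ} {x y : ℕ}
    (h : walk ((k + 1) * (k + 1)) E known path x y = true) : Leads k τ x y := by
  induction path generalizing x with
  | nil => rw [Nat.eq_of_beq_eq_true h]; exact fun _ h => h
  | cons s path ih =>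
    change cond (Nat.blt s _) (cond (Nat.testBit x s) (walk _ E known path (x ^^^ 2 ^ s) y)
      (and (Nat.testBit (nth E s) x) (walk _ E known path (x + 2 ^ s) y)))
      (and (memCell known x (s - (k + 1) * (k + 1))) (walk _ E known path _ y)) = true at h
    rw [cond_blt] at h
    split_ifs at h with hs
    · cases hx : x.testBit s
      · rw [hx, cond_false, Bool.and_eq_true] at h
        exact fun P hP => ih h.2 P (((hE s hs x h.1).2.2 P).1 hP)
      · rw [hx, cond_true] at h
        refine fun P hP => ih h P (Contains.mono (fun j hj => ?_) hP)
        rw [Nat.testBit_xor, Nat.testBit_two_pow] at hj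
        by_cases e : s = j
        · rw [← e]; exact hx
        · simpa [e] using hj
    · rw [Bool.and_eq_true, memCell_iff] at h
      exact fun P hP => ih h.2 P (hk _ h.1 P hP)

/-- A containment of `y` in `x`: a path from `x` to `r`, a rule that applies to `r`, and paths from
its targets to `y`. -/
structure Link where
  x : ℕ
  y : ℕ
  r : ℕ
  path : List ℕ
  rule : ℕ
  paths : List (List ℕ)

/-- Whether all entries of a list have a property. -/
def allMem {α : Type} (p : α → Bool) (l : List α) : Bool :=
  List.rec true (fun a _ c => and (p a) c) l

theorem allMem_iff {α : Type} {p : α → Bool} {l : List α} :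
    allMem p l = true ↔ ∀ a ∈ l, p a = true := by
  induction l with
  | nil => simp [allMem]
  | cons a l ih =>
    have : allMem p (a :: l) = and (p a) (allMem p l) := rfl
    rw [this, Bool.and_eq_true, ih]; simp

/-- Whether a link is correct. -/
def Link.check (e : ℕ) (E : List ℕ) (rules : List Rule) (masks : List ℕ) (known : List (ℕ × ℕ))
    (L : Link) : Bool :=
  and (and (walk e E known L.path L.x L.r) (Nat.blt L.r (Nat.pow 2 e)))
    (and (Nat.testBit (nth masks L.rule) L.r)
      (allMem (fun D => not (allMem (fun p => not (walk e E known p (Nat.xor L.r D) L.y)) L.paths))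
        (rules.getD L.rule ⟨[], ((false, 0, false), (false, 0, false)), .hit [] 0⟩).targets))

/-- The known containments after the verification of a list of links. -/
def checkLinks (e : ℕ) (E : List ℕ) (rules : List Rule) (masks : List ℕ) (links : List Link) :
    List (ℕ × ℕ) → (List (ℕ × ℕ) → Bool) → Bool :=
  List.rec (fun known f => f known)
    (fun L _ rest known f => and (L.check e E rules masks known) (rest ((L.x, L.y) :: known) f)) links

/-- A rule may have several targets, and only their disjunction is guaranteed. A link is correct if
every target is connected with `y` by one of the listed paths. Links are verified in order, each
being allowed to use the previous ones. -/
theorem checkLinks_sound {k : ℕ} {τ : List ℕ} {pairs : List (ℕ × ℕ)} (hτ : isPattern k τ = true)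
    (hp : PairsSound pairs) {E : List ℕ} (hE : EdgesSound k (nth τ) E) {rules : List Rule}
    {links : List Link} {known : List (ℕ × ℕ)} {f : List (ℕ × ℕ) → Bool}
    (hk : ∀ f ∈ known, Leads k (nth τ) f.1 f.2)
    (h : checkLinks ((k + 1) * (k + 1)) E rules (rules.map (Rule.mask k τ pairs)) links known f =
      true) :
    ∃ known', (∀ f ∈ known', Leads k (nth τ) f.1 f.2) ∧ f known' = true := by
  induction links generalizing known with
  | nil => exact ⟨known, hk, h⟩
  | cons L links ih =>
    change and (L.check _ E rules _ known) (checkLinks _ E rules _ links ((L.x, L.y) :: known) f) =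
      true at h
    rw [Bool.and_eq_true] at h
    refine ih (fun g hg => ?_) h.2
    rcases List.mem_cons.1 hg with rfl | hg
    · have h1 := h.1
      rw [Link.check, Bool.and_eq_true, Bool.and_eq_true, Bool.and_eq_true, allMem_iff,
        Nat.blt_eq] at h1
      obtain ⟨⟨h1, hr⟩, h2, h3⟩ := h1
      intro P hP
      have hlt : L.rule < rules.length := by
        by_contra hl
        rw [nth_eq, List.getD_eq_default _ _ (by simpa using hl)] at h2
        simp at h2
      rw [nth_eq, List.getD_eq_getElem _ _ (by simpa using hlt), List.getElem_map] at h2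
      rw [List.getD_eq_getElem _ _ hlt] at h3
      obtain ⟨D, hD, h4⟩ := Rule.mask_sound hτ hp hr h2 (leads_of_walk hE hk h1 P hP)
      have h5 := h3 D hD
      rw [Bool.not_eq_true', ← Bool.not_eq_true, allMem_iff] at h5
      push Not at h5
      obtain ⟨p, -, h6⟩ := h5
      exact leads_of_walk hE hk (by simpa using h6) P h4
    · exact hk g hg

/-- Follow a list of moves along single cells: `b` removes and `e + b` adds the cell `b`. -/
def moves (e : ℕ) (E : List ℕ) (free : ℕ) (ops : List ℕ) : List ℕ → (List ℕ → Bool) → Bool :=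
  List.rec (fun c f => f c)
    (fun s _ rest c f => forceList (cond (Nat.blt s e)
      (force (Nat.land (Nat.shiftLeft (nth E s) (Nat.pow 2 s)) free) fun m =>
        moveDown (Nat.pow 2 s) m c)
      (cond (Nat.blt (Nat.sub s e) e) (force (Nat.land (nth E (Nat.sub s e)) free) fun m =>
        moveUp (Nat.pow 2 (Nat.sub s e)) m c) c)) fun c' => rest c' f) ops

theorem moves_sound {k : ℕ} {τ : ℕ → ℕ} {E : List ℕ} (hE : EdgesSound k τ E) {free : ℕ}
    {ops : List ℕ} {c : List ℕ} {f : List ℕ → Bool} (hc : ∃ loc, Located k τ c loc)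
    (h : moves ((k + 1) * (k + 1)) E free ops c f = true) :
    ∃ c', (∃ loc, Located k τ c' loc) ∧ f c' = true := by
  induction ops generalizing c with
  | nil => exact ⟨c, hc, h⟩
  | cons s ops ih =>
    change forceList _ (fun c' => moves _ E free ops c' f) = true at h
    rw [forceList_eq, cond_blt, cond_blt, force_eq, force_eq] at h
    refine ih ?_ h
    obtain ⟨loc, hc⟩ := hc
    split_ifs with h1 h2
    · refine ⟨_, hc.moveDown fun x hx => ?_⟩
      rw [testBit_land, Bool.and_eq_true] at hx
      have h3 : ((nth E s) <<< 2 ^ s).testBit x = true := hx.1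
      rw [Nat.testBit_shiftLeft, Bool.and_eq_true] at h3
      have h4 : 2 ^ s ≤ x := by simpa using h3.1
      obtain ⟨h5, h6, h7⟩ := hE s h1 _ h3.2
      have h8 : Nat.pow 2 s = 2 ^ s := rfl
      rw [Nat.sub_add_cancel h4] at h7
      refine ⟨h4, ?_, h7⟩
      rw [← Nat.sub_add_cancel h4, ← xor_two_pow h6]
      exact Nat.xor_lt_two_pow h5 (Nat.pow_lt_pow_right (by norm_num) h1)
    · refine ⟨_, hc.moveUp fun x hx => ?_⟩
      rw [testBit_land, Bool.and_eq_true] at hx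
      obtain ⟨h5, h6, h7⟩ := hE _ h2 _ hx.1
      refine ⟨?_, h7⟩
      change x + 2 ^ (Nat.sub s ((k + 1) * (k + 1))) < _
      rw [← xor_two_pow h6]
      exact Nat.xor_lt_two_pow h5 (Nat.pow_lt_pow_right (by norm_num) h2)
    · exact ⟨loc, hc⟩

/-- Follow a list of moves `(x, y, p, q)` from `x` to `y`, with paths in both directions. -/
def jumps (e : ℕ) (E : List ℕ) (known : List (ℕ × ℕ)) (l : List (ℕ × ℕ × List ℕ × List ℕ)) :
    List ℕ → (List ℕ → Bool) → Bool :=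
  List.rec (fun c f => f c)
    (fun J _ rest c f => and (and (and (Nat.blt J.1 (Nat.pow 2 e)) (Nat.blt J.2.1 (Nat.pow 2 e)))
        (and (walk e E known J.2.2.1 J.1 J.2.1) (walk e E known J.2.2.2 J.2.1 J.1)))
      (forceList (cond (Nat.ble J.1 J.2.1) (moveUp (Nat.sub J.2.1 J.1) (Nat.pow 2 J.1) c)
        (moveDown (Nat.sub J.1 J.2.1) (Nat.pow 2 J.1) c)) fun c' => rest c' f)) l

/-- Treats the remaining shadings individually. Unlike an edge, a jump has to be justified by paths
in both directions, because links are only one-sided containments. -/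
theorem jumps_sound {k : ℕ} {τ : ℕ → ℕ} {E : List ℕ} (hE : EdgesSound k τ E)
    {known : List (ℕ × ℕ)} (hk : ∀ f ∈ known, Leads k τ f.1 f.2)
    {l : List (ℕ × ℕ × List ℕ × List ℕ)} {c : List ℕ} {f : List ℕ → Bool}
    (hc : ∃ loc, Located k τ c loc) (h : jumps ((k + 1) * (k + 1)) E known l c f = true) :
    ∃ c', (∃ loc, Located k τ c' loc) ∧ f c' = true := by
  induction l generalizing c with
  | nil => exact ⟨c, hc, h⟩
  | cons J l ih =>
    change and _ (forceList _ (fun c' => jumps _ E known l c' f)) = true at h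
    rw [Bool.and_eq_true, Bool.and_eq_true, Bool.and_eq_true, Bool.and_eq_true, Nat.blt_eq,
      Nat.blt_eq, forceList_eq, cond_ble] at h
    obtain ⟨⟨⟨hx, hy⟩, h1, h2⟩, h⟩ := h
    refine ih ?_ h
    obtain ⟨loc, hc⟩ := hc
    have he : Equiv k τ J.1 J.2.1 :=
      fun P => ⟨leads_of_walk hE hk h1 P, leads_of_walk hE hk h2 P⟩
    have hs : ∀ x, (Nat.pow 2 J.1).testBit x = true → x = J.1 := fun x hx => by
      have : (2 ^ J.1).testBit x = true := hx
      rw [Nat.testBit_two_pow] at this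
      exact (by simpa using this : J.1 = x).symm
    split_ifs with hle
    · refine ⟨_, hc.moveUp fun x hx => ?_⟩
      rw [hs x hx]
      change J.1 + (J.2.1 - J.1) < _ ∧ Equiv k τ J.1 (J.1 + (J.2.1 - J.1))
      rw [Nat.add_sub_cancel' hle]
      exact ⟨hy, he⟩
    · refine ⟨_, hc.moveDown fun x hx' => ?_⟩
      rw [hs x hx']
      change J.1 - J.2.1 ≤ J.1 ∧ J.1 < _ ∧ Equiv k τ (J.1 - (J.1 - J.2.1)) J.1
      rw [Nat.sub_sub_self (not_le.1 hle).le]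
      exact ⟨Nat.sub_le _ _, hx, fun P => (he P).symm⟩

/-- A certificate for an upper bound of the number of classes of shadings. -/
structure Certificate where
  rules : List (ℕ × (Bool × ℕ × Bool) × Tree)
  special : List Rule
  links : List Link
  ops : List ℕ
  jumps : List (ℕ × ℕ × List ℕ × List ℕ)

/-- Verification of a certificate: all shadings are equivalent to shadings in the family `rep`, and
the numbers `sizes` count those in `rep` with a given number of shadings assigned to them. -/
noncomputable def Certificate.check (k : ℕ) (τ : List ℕ) (pairs : List (ℕ × ℕ)) (rep : ℕ)
    (size : ℕ) (sizes : List ℕ) (C : Certificate) : Bool :=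
  let e := Nat.mul (Nat.succ k) (Nat.succ k)
  and (isPattern k τ) (forceList (edges k τ pairs C.rules) fun E =>
    forceList (C.special.map (Rule.mask k τ pairs)) fun masks =>
      checkLinks e E C.special masks C.links [] fun known =>
        force (compl e rep) fun free => moves e E free C.ops [ones e] fun c =>
          PointSet.jumps e E known C.jumps c fun c =>
            and (and (Nat.beq (support c) rep) (Nat.beq (count e rep) size))
              (allB (fun j => Nat.beq (count e (valueEq e c (Nat.succ j))) (nth sizes j))
                sizes.length))

/-- The shadings are distributed among representatives in the family `rep`, with given numbers of
representatives of given numbers of shadings. -/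
def Distributed (k : ℕ) (τ : ℕ → ℕ) (rep size : ℕ) (sizes : List ℕ) : Prop :=
  ∃ loc : ℕ → ℕ, (∀ r < 2 ^ ((k + 1) * (k + 1)), loc r < 2 ^ ((k + 1) * (k + 1)) ∧
      Equiv k τ r (loc r) ∧ rep.testBit (loc r) = true) ∧
    ((Finset.range (2 ^ ((k + 1) * (k + 1)))).filter fun r => rep.testBit r = true).card = size ∧
    ∀ j < sizes.length, ((Finset.range (2 ^ ((k + 1) * (k + 1)))).filter fun r =>
      ((Finset.range (2 ^ ((k + 1) * (k + 1)))).filter fun r' => loc r' = r).card = j + 1).card =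
        sizes.getD j 0

/-- The final counters vanish outside `rep`, so every shading has been moved to a representative,
and the values of the counters are the sizes of the fibres. That different representatives are
inequivalent is not claimed here; the number of classes is only bounded from above. -/
theorem Certificate.check_sound {k : ℕ} {τ : List ℕ} {pairs : List (ℕ × ℕ)} {rep size : ℕ}
    {sizes : List ℕ} (hp : PairsSound pairs) (C : Certificate)
    (h : C.check k τ pairs rep size sizes = true) : Distributed k (nth τ) rep size sizes := by
  rw [Certificate.check, Bool.and_eq_true, forceList_eq, forceList_eq] at h
  obtain ⟨hτ, h⟩ := h
  have hE := edgesSound_edges hτ hp C.rules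
  obtain ⟨known, hk, h⟩ := checkLinks_sound hτ hp hE (by simp) h
  rw [force_eq] at h
  -- At the beginning every shading is at its own place, so every counter is 1 and one binary digit
  -- suffices.
  obtain ⟨c, hc, h⟩ := moves_sound hE ⟨id, fun r hr => ⟨hr, fun _ => Iff.rfl, by
    rw [value_cons, value_nil]
    change ((ones ((k + 1) * (k + 1))).testBit r).toNat + 2 * 0 = _
    simp only [id]
    rw [testBit_ones hr, Finset.filter_eq', if_pos (by simpa using hr)]
    simp⟩⟩ h
  obtain ⟨c, ⟨loc, hc⟩, h⟩ := jumps_sound hE hk hc h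
  rw [Bool.and_eq_true, Bool.and_eq_true, allB_iff] at h
  obtain ⟨⟨h1, h2⟩, h3⟩ := h
  have h1 := Nat.eq_of_beq_eq_true h1
  refine ⟨loc, fun r hr => ?_, ?_, fun j hj => ?_⟩
  · obtain ⟨h4, h5, -⟩ := hc r hr
    refine ⟨h4, h5, ?_⟩
    -- The counter at `loc r` is positive because it counts `r` itself.
    rw [← h1, testBit_support, (hc _ h4).2.2]
    exact (Finset.card_pos.2 ⟨r, by simpa using hr⟩).ne'
  · rw [← Nat.eq_of_beq_eq_true h2]
    exact (count_eq _ _).symm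
  · rw [← nth_eq, ← Nat.eq_of_beq_eq_true (h3 j hj)]
    refine Eq.trans ?_ (count_eq _ _).symm
    congr 1
    refine Finset.filter_congr fun r hr => ?_
    have hr : r < 2 ^ ((k + 1) * (k + 1)) := by simpa using hr
    rw [← (hc r hr).2.2]
    exact (testBit_valueEq hr c _).symm

end PointSet

namespace PointSet

/-! ### Pairs of points -/

theorem Contains.congr {P : PointSet} {k : ℕ} {σ τ : ℕ → ℕ} (h : ∀ a < k, σ a = τ a) {r : ℕ}
    (hP : Contains P k σ r) : Contains P k τ r := by
  obtain ⟨q, hq, hcl⟩ := hP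
  refine ⟨q, ⟨hq.mem, fun a ha => h a ha ▸ hq.rank_lt a ha, hq.fst_lt,
    fun a ha b hb => by rw [← h a ha, ← h b hb]; exact hq.snd_lt a ha b hb⟩,
    fun i hi j hj hb p hp hin => hcl i hi j hj hb p hp fun a ha => ?_⟩
  rw [h a ha]
  exact hin a ha

/-- Verification of a list of pairs. -/
noncomputable def checkPairs (l : List (ℕ × ℕ × (Bool × ℕ × Bool) × Tree)) : Bool :=
  allMem (fun x => and (isPattern 2 [pairRank x.1 0, pairRank x.1 1])
    (Nat.testBit (Rule.mask 2 [pairRank x.1 0, pairRank x.1 1] []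
      ⟨[x.2.1], (x.2.2.1, (false, 0, false)), x.2.2.2⟩) 0)) l

/-- A pair of points in the order `ρ` is an occurrence of the unshaded pattern of size 2. It
therefore suffices that the rule with target `S` holds for the shading 0. These rules are run
without pairs of their own, which excludes circularity. -/
theorem pairsSound_of_check {l : List (ℕ × ℕ × (Bool × ℕ × Bool) × Tree)}
    (h : checkPairs l = true) : PairsSound (l.map fun x => (x.1, x.2.1)) := by
  intro y hy Q q hq
  obtain ⟨x, hx, rfl⟩ := List.mem_map.1 hy
  have h1 := allMem_iff.1 h x hx
  rw [Bool.and_eq_true] at h1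
  have hr : ∀ a < 2, pairRank x.1 a = nth [pairRank x.1 0, pairRank x.1 1] a := by
    intro a ha
    interval_cases a <;> rfl
  obtain ⟨D, hD, h2⟩ := Rule.mask_sound h1.1 (by simp [PairsSound]) (by norm_num) h1.2
    (P := Q) (Contains.congr hr ⟨q, hq, fun i _ j _ hb => by simp at hb⟩)
  rw [List.mem_singleton] at hD
  rw [hD, Nat.zero_xor] at h2
  exact h2.congr fun a ha => (hr a ha).symm

end PointSet

namespace PointSet

/-! ### The certificates -/

/-- Distinguish whether the cell `(i, j)` is empty. -/
def Tree.branch (i j d : ℕ) (s t : Tree) : Tree := .split [(i, j)] d (.kid s t)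

/-- Mesh patterns contained in every point set with two points in the given order. -/
def pairRules : List (ℕ × ℕ × (Bool × ℕ × Bool) × Tree) := [
  (0, 51, (false, 0, false), .branch 0 0 0 (.descend [0,1]) (.branch 0 1 0 (.descend [0,2]) (.branch
    0 2 0 (.split [(2,1),(2,2),(2,3)] 0 (.kid (.hit [1,2] 51) (.kid (.branch 1 2 0 (.descend [1,3])
    (.hit [1,2] 51)) (.kid (.descend [0,2]) (.hit [1,2] 51))))) (.branch 1 1 0 (.branch 1 3 0 (.hit
    [0,1] 51) (.hit [0,1] 51)) (.branch 1 2 0 (.hit [0,1] 51) (.branch 2 0 0 (.hit [0,1] 51)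
    (.branch 2 1 0 (.hit [0,1] 51) (.branch 2 2 0 (.hit [0,1] 51) (.hit [0,1] 51))))))))),
  (0, 153, (false, 0, true), .branch 0 0 1 (.branch 0 0 2 (.split [(1,1),(3,1),(4,1)] 2 (.kid (.hit
    [0,1] 153) (.kid (.descend [3,4]) (.kid (.split [(3,0),(4,0)] 0 (.kid (.descend [3,4]) (.kid
    (.descend [4,5]) (.hit [0,4] 153)))) (.hit [0,1] 153))))) (.branch 2 1 0 (.descend [2,3])
    (.branch 3 1 2 (.split [(2,0),(3,0)] 0 (.kid (.descend [2,3]) (.kid (.descend [3,4]) (.hit [0,3]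
    153)))) (.hit [0,1] 153)))) (.branch 0 2 0 (.split [(2,0),(2,1),(3,1)] 0 (.kid (.descend [2,3])
    (.kid (.descend [2,3]) (.kid (.branch 3 0 0 (.descend [3,4]) (.branch 4 1 2 (.branch 4 0 0
    (.descend [4,5]) (.hit [1,4] 153)) (.hit [1,3] 153))) (.hit [1,2] 153))))) (.branch 1 0 0
    (.descend [1,2]) (.branch 1 1 0 (.descend [1,2]) (.branch 1 2 0 (.branch 3 1 2 (.branch 3 0 0
    (.descend [3,4]) (.hit [0,3] 153)) (.hit [0,2] 153)) (.branch 2 0 0 (.split [(2,2),(3,2)] 1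
    (.kid (.branch 2 2 0 (.descend [2,3]) (.hit [0,2] 153)) (.kid (.descend [2,3]) (.hit [0,1]
    153)))) (.branch 2 1 0 (.branch 3 1 0 (.branch 4 1 0 (.branch 5 1 0 (.branch 6 1 0 (.branch 7 1
    2 (.hit [0,7] 153) (.hit [0,6] 153)) (.hit [0,5] 153)) (.hit [0,4] 153)) (.hit [0,3] 153)) (.hit
    [0,2] 153)) (.branch 2 2 0 (.hit [0,1] 153) (.hit [0,1] 153))))))))),
  (0, 291, (false, 0, false), .branch 0 0 0 (.descend [0,1]) (.branch 0 1 0 (.descend [0,2])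
    (.branch 1 0 0 (.split [(1,3),(2,3),(3,3)] 3 (.kid (.branch 0 3 0 (.descend [0,2]) (.hit [0,1]
    291)) (.kid (.branch 0 3 0 (.descend [0,3]) (.hit [0,2] 291)) (.kid (.branch 0 3 0 (.descend
    [0,4]) (.hit [0,3] 291)) (.hit [0,2] 291))))) (.branch 1 1 0 (.split [(1,3),(2,3),(3,3)] 3 (.kid
    (.branch 0 3 0 (.descend [0,2]) (.hit [0,1] 291)) (.kid (.branch 0 3 0 (.descend [0,3]) (.hit
    [0,2] 291)) (.kid (.branch 0 3 0 (.descend [0,4]) (.hit [0,3] 291)) (.hit [0,2] 291)))))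
    (.branch 1 2 0 (.branch 0 2 0 (.descend [0,2]) (.branch 2 3 3 (.branch 0 3 0 (.descend [0,3])
    (.branch 4 4 3 (.branch 0 4 0 (.descend [0,5]) (.hit [0,4] 291)) (.hit [0,2] 291))) (.branch 3 3
    3 (.branch 0 3 0 (.descend [0,4]) (.hit [0,3] 291)) (.hit [0,1] 291)))) (.branch 2 0 0 (.split
    [(2,3),(3,3)] 3 (.kid (.branch 0 3 0 (.descend [0,3]) (.hit [0,2] 291)) (.kid (.branch 0 3 0
    (.descend [0,4]) (.hit [0,3] 291)) (.hit [0,1] 291)))) (.branch 2 1 0 (.split [(2,3),(3,3)] 3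
    (.kid (.branch 0 3 0 (.descend [0,3]) (.hit [0,2] 291)) (.kid (.branch 0 3 0 (.descend [0,4])
    (.hit [0,3] 291)) (.hit [0,1] 291)))) (.branch 2 2 0 (.branch 0 2 0 (.descend [0,3]) (.branch 3
    3 3 (.branch 0 3 0 (.descend [0,4]) (.hit [0,3] 291)) (.hit [0,2] 291))) (.hit [0,1]
    291))))))))),
  (0, 297, (false, 0, false), .branch 1 0 2 (.branch 3 3 3 (.branch 2 4 3 (.branch 0 0 2 (.split
    [(1,6),(2,6)] 3 (.kid (.hit [0,1] 297) (.kid (.hit [0,2] 297) (.hit [0,3] 297)))) (.hit [1,2]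
    297)) (.branch 3 0 2 (.branch 0 0 2 (.split [(1,6),(2,6)] 3 (.kid (.hit [0,1] 297) (.kid (.hit
    [0,2] 297) (.hit [0,5] 297)))) (.hit [3,4] 297)) (.branch 0 0 2 (.split [(1,5),(2,5)] 3 (.kid
    (.hit [0,1] 297) (.kid (.hit [0,2] 297) (.hit [0,4] 297)))) (.hit [1,3] 297)))) (.branch 2 3 3
    (.branch 0 0 2 (.split [(1,5),(2,5)] 3 (.kid (.hit [0,1] 297) (.kid (.hit [0,2] 297) (.hit [0,3]
    297)))) (.hit [1,2] 297)) (.branch 0 0 2 (.split [(1,4),(2,4)] 3 (.kid (.hit [0,1] 297) (.kid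
    (.hit [0,2] 297) (.hit [0,3] 297)))) (.hit [1,2] 297)))) (.branch 1 2 0 (.branch 0 0 2 (.split
    [(1,4),(3,4),(4,4)] 3 (.kid (.hit [0,1] 297) (.kid (.hit [0,3] 297) (.kid (.branch 4 0 0
    (.branch 5 0 0 (.branch 6 0 2 (.hit [6,7] 297) (.hit [5,6] 297)) (.hit [4,5] 297)) (.hit [0,4]
    297)) (.hit [0,2] 297))))) (.branch 2 3 3 (.branch 4 4 3 (.branch 4 0 0 (.branch 5 0 0 (.branch
    6 0 2 (.hit [6,7] 297) (.hit [5,6] 297)) (.hit [4,5] 297)) (.hit [0,4] 297)) (.hit [0,2] 297))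
    (.branch 3 3 3 (.branch 3 0 0 (.branch 4 0 0 (.branch 5 0 0 (.branch 6 0 2 (.hit [6,7] 297)
    (.hit [5,6] 297)) (.hit [4,5] 297)) (.hit [3,4] 297)) (.hit [0,3] 297)) (.hit [0,1] 297))))
    (.branch 2 1 0 (.branch 0 0 2 (.split [(1,4),(3,4),(4,4)] 3 (.kid (.hit [0,1] 297) (.kid
    (.branch 3 0 0 (.branch 4 0 0 (.branch 5 0 2 (.hit [5,6] 297) (.hit [4,5] 297)) (.hit [3,4]
    297)) (.hit [0,3] 297)) (.kid (.split [(3,0),(4,0)] 2 (.kid (.hit [3,5] 297) (.kid (.hit [4,5]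
    297) (.hit [0,4] 297)))) (.hit [0,2] 297))))) (.branch 2 3 3 (.branch 2 0 2 (.branch 5 5 3
    (.split [(4,0),(5,0)] 2 (.kid (.hit [4,6] 297) (.kid (.hit [5,6] 297) (.hit [2,5] 297)))) (.hit
    [2,3] 297)) (.branch 4 4 3 (.split [(3,0),(4,0)] 2 (.kid (.hit [3,5] 297) (.kid (.hit [4,5] 297)
    (.hit [0,4] 297)))) (.hit [0,2] 297))) (.branch 3 3 3 (.split [(2,0),(3,0)] 2 (.kid (.hit [2,4]
    297) (.kid (.hit [3,4] 297) (.hit [0,3] 297)))) (.hit [0,1] 297)))) (.branch 2 2 0 (.branch 0 0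
    2 (.branch 3 0 2 (.branch 5 5 3 (.branch 5 0 0 (.branch 6 0 2 (.hit [6,7] 297) (.hit [5,6] 297))
    (.hit [3,5] 297)) (.hit [3,4] 297)) (.branch 1 4 3 (.branch 5 5 3 (.branch 5 0 0 (.branch 6 0 2
    (.hit [6,7] 297) (.hit [5,6] 297)) (.hit [0,5] 297)) (.hit [0,1] 297)) (.branch 4 4 3 (.branch 4
    0 0 (.branch 5 0 0 (.branch 6 0 2 (.hit [6,7] 297) (.hit [5,6] 297)) (.hit [4,5] 297)) (.hit
    [0,4] 297)) (.hit [0,3] 297)))) (.branch 2 0 2 (.branch 4 4 3 (.branch 4 0 0 (.branch 5 0 0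
    (.branch 6 0 2 (.hit [6,7] 297) (.hit [5,6] 297)) (.hit [4,5] 297)) (.hit [2,4] 297)) (.hit
    [2,3] 297)) (.branch 3 3 3 (.branch 3 0 0 (.branch 4 0 0 (.branch 5 0 0 (.branch 6 0 2 (.hit
    [6,7] 297) (.hit [5,6] 297)) (.hit [4,5] 297)) (.hit [3,4] 297)) (.hit [0,3] 297)) (.hit [0,2]
    297)))) (.branch 0 0 2 (.branch 1 3 0 (.branch 2 4 0 (.branch 3 5 0 (.branch 4 6 0 (.branch 5 7
    3 (.hit [0,5] 297) (.hit [0,4] 297)) (.hit [0,3] 297)) (.hit [0,2] 297)) (.hit [0,1] 297)) (.hit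
    [0,2] 297)) (.hit [0,1] 297)))))),
  (0, 387, (false, 0, false), .branch 0 1 0 (.branch 3 3 1 (.branch 4 2 1 (.branch 0 0 0 (.split
    [(6,1),(6,2)] 1 (.kid (.hit [0,6] 387) (.kid (.hit [0,6] 387) (.hit [0,5] 387)))) (.hit [0,4]
    387)) (.branch 0 3 0 (.branch 0 0 0 (.split [(6,1),(6,2)] 1 (.kid (.hit [0,6] 387) (.kid (.hit
    [0,6] 387) (.hit [0,5] 387)))) (.hit [0,4] 387)) (.branch 0 0 0 (.split [(5,1),(5,2)] 1 (.kid
    (.hit [0,5] 387) (.kid (.hit [0,5] 387) (.hit [0,4] 387)))) (.hit [0,3] 387)))) (.branch 3 2 1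
    (.branch 0 0 0 (.split [(5,1),(5,2)] 1 (.kid (.hit [0,5] 387) (.kid (.hit [0,5] 387) (.hit [0,4]
    387)))) (.hit [0,3] 387)) (.branch 0 0 0 (.split [(4,1),(4,2)] 1 (.kid (.hit [0,4] 387) (.kid
    (.hit [0,4] 387) (.hit [0,3] 387)))) (.hit [0,2] 387)))) (.branch 2 1 1 (.branch 0 0 0 (.split
    [(4,1),(4,4)] 1 (.kid (.hit [0,4] 387) (.kid (.branch 0 4 0 (.hit [0,5] 387) (.hit [0,4] 387))
    (.hit [0,3] 387)))) (.branch 3 3 1 (.branch 0 3 0 (.hit [0,4] 387) (.hit [0,3] 387)) (.hit [0,2]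
    387))) (.branch 2 2 1 (.split [(0,0),(0,2)] 0 (.kid (.branch 4 1 1 (.hit [0,4] 387) (.hit [0,3]
    387)) (.kid (.hit [0,3] 387) (.hit [0,2] 387)))) (.branch 0 0 0 (.branch 3 1 1 (.hit [0,3] 387)
    (.hit [0,2] 387)) (.hit [0,1] 387))))),
  (0, 393, (false, 0, true), .branch 1 0 0 (.descend [1,2]) (.branch 1 1 0 (.descend [1,2]) (.branch
    2 1 1 (.branch 0 0 2 (.branch 3 0 0 (.descend [3,4]) (.branch 4 1 1 (.split [(4,0),(5,5)] 0
    (.kid (.descend [4,5]) (.kid (.descend [2,5]) (.hit [0,4] 393)))) (.branch 4 4 0 (.descend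
    [2,4]) (.hit [0,3] 393)))) (.branch 2 0 0 (.descend [2,3]) (.branch 3 3 0 (.descend [1,3]) (.hit
    [0,2] 393)))) (.branch 2 2 0 (.descend [1,2]) (.branch 0 0 2 (.branch 3 1 1 (.branch 3 0 0
    (.descend [3,4]) (.hit [0,3] 393)) (.hit [0,2] 393)) (.hit [0,1] 393)))))),
  (1, 30, (false, 0, false), .branch 0 1 0 (.descend [0,2]) (.branch 0 2 0 (.descend [0,1]) (.branch
    1 0 0 (.split [(0,1),(1,2)] 0 (.kid (.descend [0,2]) (.kid (.hit [0,1] 30) (.hit [0,1] 30))))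
    (.branch 1 1 0 (.hit [0,1] 30) (.branch 1 2 0 (.hit [0,2] 30) (.branch 2 0 0 (.hit [0,1] 30)
    (.branch 2 1 0 (.hit [0,1] 30) (.branch 2 2 0 (.hit [0,1] 30) (.hit [0,1] 30))))))))),
  (1, 60, (false, 0, false), .branch 0 2 3 (.split [(1,0),(1,1),(1,2)] 0 (.kid (.hit [0,1] 60) (.kid
    (.hit [0,1] 60) (.kid (.hit [0,1] 60) (.hit [0,1] 60))))) (.branch 1 0 0 (.branch 1 2 0 (.branch
    1 4 3 (.branch 2 4 0 (.hit [1,2] 60) (.hit [1,2] 60)) (.hit [0,1] 60)) (.branch 1 3 3 (.branch 2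
    3 0 (.hit [1,2] 60) (.hit [1,2] 60)) (.hit [0,1] 60))) (.branch 1 1 0 (.branch 1 3 3 (.branch 2
    3 0 (.hit [1,2] 60) (.hit [1,2] 60)) (.hit [0,1] 60)) (.branch 1 2 0 (.branch 2 2 0 (.branch 2 4
    3 (.branch 3 4 0 (.hit [2,3] 60) (.hit [2,3] 60)) (.hit [1,2] 60)) (.branch 2 3 3 (.branch 3 3 0
    (.hit [2,3] 60) (.hit [2,3] 60)) (.hit [1,2] 60))) (.branch 2 0 0 (.hit [0,1] 60) (.branch 2 1 0
    (.hit [0,1] 60) (.branch 2 2 0 (.hit [0,1] 60) (.hit [0,1] 60)))))))),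
  (1, 78, (false, 0, false), .branch 0 1 0 (.descend [0,2]) (.branch 0 2 0 (.descend [0,1]) (.branch
    1 0 0 (.branch 0 1 0 (.descend [0,2]) (.branch 2 0 2 (.branch 0 1 0 (.descend [0,3]) (.branch 4
    0 2 (.branch 0 1 0 (.descend [0,5]) (.hit [0,4] 78)) (.hit [0,2] 78))) (.branch 3 0 2 (.branch 0
    1 0 (.descend [0,4]) (.hit [0,3] 78)) (.hit [0,1] 78)))) (.branch 1 1 0 (.branch 3 0 2 (.branch
    0 1 0 (.descend [0,4]) (.hit [0,3] 78)) (.hit [0,2] 78)) (.branch 1 2 0 (.branch 3 0 2 (.branch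
    0 1 0 (.descend [0,4]) (.hit [0,3] 78)) (.hit [0,2] 78)) (.branch 2 0 0 (.branch 0 1 0 (.descend
    [0,3]) (.branch 3 0 2 (.branch 0 1 0 (.descend [0,4]) (.hit [0,3] 78)) (.hit [0,2] 78)))
    (.branch 2 1 0 (.hit [0,1] 78) (.branch 2 2 0 (.hit [0,1] 78) (.hit [0,1] 78))))))))),
  (1, 90, (false, 0, false), .branch 0 1 0 (.descend [0,2]) (.branch 0 2 0 (.descend [0,1]) (.split
    [(1,0),(1,1),(2,0)] 2 (.kid (.branch 0 1 0 (.descend [0,2]) (.branch 1 1 0 (.branch 2 1 0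
    (.branch 3 1 0 (.branch 4 1 0 (.branch 5 1 2 (.hit [5,6] 90) (.hit [4,5] 90)) (.hit [3,4] 90))
    (.hit [2,3] 90)) (.hit [1,2] 90)) (.branch 1 2 0 (.branch 2 2 0 (.branch 3 2 0 (.branch 4 2 0
    (.branch 5 2 2 (.hit [5,6] 90) (.hit [4,5] 90)) (.hit [3,4] 90)) (.hit [2,3] 90)) (.hit [1,2]
    90)) (.hit [0,1] 90)))) (.kid (.hit [1,2] 90) (.kid (.branch 0 1 0 (.descend [0,3]) (.branch 1 1
    2 (.branch 3 1 0 (.branch 4 1 0 (.branch 5 1 0 (.branch 6 1 2 (.hit [6,7] 90) (.hit [5,6] 90))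
    (.hit [4,5] 90)) (.hit [3,4] 90)) (.hit [1,3] 90)) (.branch 2 1 0 (.branch 3 1 0 (.branch 4 1 0
    (.branch 5 1 0 (.branch 6 1 2 (.hit [6,7] 90) (.hit [5,6] 90)) (.hit [4,5] 90)) (.hit [3,4] 90))
    (.hit [2,3] 90)) (.hit [1,2] 90)))) (.hit [0,1] 90))))))),
  (1, 210, (false, 0, false), .branch 2 0 1 (.split [(0,1),(1,1),(2,1)] 2 (.kid (.hit [0,3] 210)
    (.kid (.hit [1,3] 210) (.kid (.hit [2,3] 210) (.hit [1,2] 210))))) (.branch 2 1 1 (.split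
    [(0,2),(1,2),(2,2)] 2 (.kid (.hit [0,3] 210) (.kid (.hit [1,3] 210) (.kid (.hit [2,3] 210) (.hit
    [0,2] 210))))) (.branch 2 2 0 (.split [(0,1),(1,1)] 2 (.kid (.hit [0,2] 210) (.kid (.hit [1,2]
    210) (.hit [0,1] 210)))) (.split [(0,1),(1,1)] 2 (.kid (.hit [0,2] 210) (.kid (.hit [1,2] 210)
    (.hit [0,1] 210)))))))]

theorem pairsSound_pairRules : PairsSound (pairRules.map fun x => (x.1, x.2.1)) :=
  pairsSound_of_check (by decide +kernel)

/-- The chosen representatives of the classes for the pattern `12`. -/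
def representatives12 : ℕ :=
  0xeeaacc1ffeba0000eeaaff3ffebafc00eeff0c0cfefa0c00eeaa0c00eeaacc00eeaacc1f20201000eeaaff3f3000fc0000ec0c4c30f8dc5100000c002000cc11

/-- The certificate for the pattern `12`. -/
def certificate12 : Certificate where
  -- An entry consists of the cell to be added, the coordinate that decreases in a descent, and a
  -- tree. The coordinate states whether heights are used, which point is meant, and whether it is
  -- to be maximised.
  rules := [
    (0, (false, 0, false), .branch 0 0 0 (.split [(0,2),(1,1)] 0 (.kid (.split [(1,3),(2,3)] 0 (.kid
      (.hit [0,1] 1) (.kid (.hit [0,2] 1) (.hit [0,3] 1)))) (.kid (.hit [0,1] 1) (.hit [0,1] 1))))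
      (.hit [0,1] 1)),
    (0, (false, 0, false), .branch 0 0 2 (.split [(2,0),(1,1)] 2 (.kid (.split [(3,1),(3,2)] 2 (.kid
      (.hit [2,3] 1) (.kid (.hit [2,3] 1) (.hit [2,3] 1)))) (.kid (.hit [0,1] 1) (.hit [0,1] 1))))
      (.hit [0,1] 1)),
    (1, (false, 1, true), .branch 0 1 3 (.branch 3 1 1 (.split [(4,3),(3,1)] 1 (.kid (.branch 4 3 1
      (.descend [4,5]) (.descend [3,4])) (.kid (.descend [3,4]) (.descend [1,3])))) (.hit [0,2] 2))
      (.hit [0,1] 2)),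
    (1, (true, 1, true), .branch 0 1 0 (.branch 1 3 3 (.descend [0,1]) (.hit [0,2] 2)) (.hit [0,1]
      2)),
    (3, (false, 1, true), .branch 1 0 2 (.branch 3 1 1 (.descend [1,3]) (.hit [1,2] 8)) (.hit [0,1]
      8)),
    (3, (true, 1, true), .branch 1 0 1 (.branch 1 3 3 (.split [(3,4),(1,3)] 3 (.kid (.branch 3 4 3
      (.descend [3,4]) (.descend [1,3])) (.kid (.descend [1,2]) (.descend [0,1])))) (.hit [1,2] 8))
      (.hit [0,1] 8)),
    (5, (true, 0, false), .branch 1 2 0 (.branch 2 0 2 (.split [(1,0),(3,1)] 2 (.kid (.branch 2 1 2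
      (.descend [1,2]) (.descend [1,3])) (.kid (.descend [2,3]) (.descend [2,3])))) (.hit [0,1] 32))
      (.hit [0,1] 32)),
    (7, (false, 0, false), .branch 2 1 2 (.branch 0 2 0 (.split [(0,1),(1,3)] 0 (.kid (.branch 1 2 0
      (.descend [0,1]) (.descend [0,1])) (.kid (.descend [0,1]) (.descend [0,2])))) (.hit [0,2]
      128)) (.hit [0,1] 128)),
    (8, (false, 0, false), .branch 2 2 1 (.split [(3,1),(2,2)] 1 (.kid (.split [(3,1),(2,1)] 1 (.kid
      (.hit [3,4] 256) (.kid (.hit [2,4] 256) (.hit [0,3] 256)))) (.kid (.hit [2,3] 256) (.hit [1,2]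
      256)))) (.hit [0,1] 256)),
    (8, (false, 0, false), .branch 2 2 3 (.split [(1,3),(2,2)] 3 (.kid (.split [(1,3),(1,2)] 3 (.kid
      (.hit [1,2] 256) (.kid (.hit [1,2] 256) (.hit [0,1] 256)))) (.kid (.hit [2,3] 256) (.hit [1,2]
      256)))) (.hit [0,1] 256))]
  -- Both rules exchange several cells at once: 170 is the set of the cells 1, 3, 5 and 7, and it
  -- turns the shading 220 into 118 and conversely.
  special := [
    ⟨[170], ((false, 0, false), (false, 0, false)), .branch 1 2 0 (.branch 0 1 3 (.hit [0,2] 170)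
      (.hit [0,1] 170)) (.branch 0 1 3 (.hit [0,2] 170) (.hit [0,1] 170))⟩,
    ⟨[170], ((false, 0, false), (false, 0, false)), .branch 2 1 2 (.branch 1 0 1 (.hit [1,3] 170)
      (.hit [0,2] 170)) (.branch 1 0 1 (.hit [1,2] 170) (.hit [0,1] 170))⟩]
  links := [
    ⟨220, 118, 220, [], 0, [[]]⟩, ⟨118, 220, 118, [], 1, [[]]⟩]
  -- Entries below 9 remove that cell from all shadings where this is allowed; entries from 9 on add
  -- the cell with number smaller by 9.
  ops := [
    4, 1, 8, 5, 0, 3, 7, 0, 8, 1, 8, 10, 14, 7, 1, 4, 5, 12, 16, 5, 3, 4, 7]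
  -- The steps 127 = 9 + 118 and 229 = 9 + 220 quote the two links.
  jumps := [
    (220, 118, [127], [229])]

/-- The list holds the numbers of fibres with 1, 2, …, 7 elements. Since no other count is needed,
the larger fibres are only accounted for by the total. -/
theorem distributed_12 : Distributed 2 (nth [0, 1]) representatives12 220
    [161, 37, 2, 11, 0, 0, 0] :=
  Certificate.check_sound pairsSound_pairRules certificate12 (by decide +kernel)

/-- The chosen representatives of the classes for the pattern `123`. -/
def representatives123 : ℕ :=
  0xeeeeaaaacccc1ffffefebafa00000000ffeebfaadfcc1f1ffffebbba00000000eeeeaaaaffff3ffffefebafafcfc0000ffeebfaaffff3f3ffffebbbafffc0000eeeeffff0c0c0c0cfefefafa0c0c000cffeeffff0c0c0c0cfffefffa0c0c0000eeeeaaaa0c0c000ceeeeaaaacccc000cffeebfaadfcc0c0cfffebbbadddc0000eeeeaaaacccc1fff2030203010300030ffeebfaadfcc1f1f3030202010100000eeeeaaaaffff3fff30300030fcfc0030ffeebfaaffff3f3ffffc2020fffc00000000ecec0c0c4ccc3030f8f8dcfc51ffffeeffffdfcc5f5ffffefbfadddc5151000000000c0c000c20200020cccc11ffffeebfaadfcc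1f1ffffebbbadddc1111eeeeaaaacccc1ffffefebafadcfc11ffffeebfaadfcc1f1ffffebbba00000000eeeeaaaaffff3ffffefebafaffff33ffffeebfaaffff3f3ffffebbbafffc0000eeeeffff0c0c4cccfefeffffdcfc55ffffeeffff0c0c0c0cfffefffa0c0c0000eeeeaaaa0c0c000ceeeeaaaacccc11ffffeebbaa0c0c0000ffeebbaaddcc00000000000000000000003000f000f000f00f000f000f000f00000000000000000000000000000000000030003000f000f00f000f000f000f0000000000000000000000000000000000000000f0000000f000000f000c000f00000000000000000000000000000000000000000000000000000000000c0000000000000000000000eeeeaaaaffff3ffffefebafa00000000ffeebfaaffff3f3ffffebbba00000000eeeeaaaaffff3ffffefebafaffff0000ffeebfaaffff3f3ffffebbbaffff0000ffffffff0c0c0c0cfefefafa0c0c000cffffffff0c0c0c0cfffefffa0c0c0000eeeeaaaa0c0c000ceeeeaaaaffff000cffeebfaaffff0c0cfffebbbaffff0000eeeeaaaaffff3fff3030203030300030ffeebfaaffff3f3f3030202030300000eeeeaaaaffff3fff30300030ffff0030ffeebfaaffff3f3ffffe2020ffff00000000ffff0c0cffff3030fafafffff3fffffffffffffffffffffefb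fafffff3f3000000000c0c000c20200020ffff33ffffeebfaaffff3f3ffffebbbaffff3333eeeeaaaaffff3ffffefebafaffff33ffffeebfaaffff3f3ffffebbba00000000eeeeaaaaffff3ffffefebafaffff33ffffeebfaaffff3f3ffffebbbaffff0000ffffffff0c0cffffffffffffffffffffffffffff0c0c0c0cfffefffa0c0c0000eeeeaaaa0c0c000ceeeeaaaaffff33ffffeebbaa0c0c0000ffeebbaaffff0000eeeeaaaaffff3fff3030bafaffff33ffffeebfaaffff3f3f303020203030000000000000000000000030003000f000f00f000f000f000f0000000000000000000000ffff0c0cffff3030ffffffffffff0000ffff0c0cffff3030fbfafffff3f300000000000000000000000000000000000000000c0000000000000000000000eeeeffffcccc5ffffefeffff0c0c040cffeeffffdfcc5f5ffffeffff0c0c0404ffffffffffffffffffffffffffff0c0cffffffffffffffffffffffffffff0c0ceeeeffff0c0c0c0cfefeffff0c0c040cffeeffff0c0c0c0cfffeffff0c0c0404eeeeffff0c0c0c0cfefeffffcccc040cffeeffffdfcc0c0cfffeffffdddc0404eeeeffffcccc5ffffefeffffdcfc55ffffeeffffdfcc5f5ffffeffffdddc5555ffffffffffffffffffffffffffffffff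ffffffffffffffffffffffffffffffff0c0ceeee0c0c4cccfefeffffdcfc55ffffeeffffdfcc5f5ffffeffffdddc55550c0c0c0c0c0c0c0ceeeeffffcccc55ffffeeffffdfcc5f5ffffeffffdddc5555eeeeffffcccc5ffffefeffffdcfc55ffffeeffffdfcc5f5ffffeffff0c000400fffffffffffffffffffffffffffffffffffffffffffffffffffefffffffc0c00eeeeffff0c0c4cccfefeffffdcfc55ffffeeffff0c0c0c0cfffeffff0c0c0404eeeeffff0c0c0c0cfefeffffcccc55ffffeeffff0c0c0c04fffeffffddcc0404eeeeffffcccc5ffffefeffffdcfc55ffffeeffffdfcc5f5f3f303f301d101510fffffffffffffffffffffffffffffffffffffffffffffffffffc3f30fffc3f300000000000000000000000f0000000f00c000f000c000f000000000000000000000000000000000000000000000000000c000c000c000c000000000000000000eeeeaaaacccc1ffffefebafa0c0c000cffeebfaadfcc1f1ffffebbba0c0c0000eeeeaaaaffff3ffffefebafaffff000cffeebfaaffff3f3ffffebbbaffff0000eeeeffff0c0c0c0cfefeffff0c0c040cffeeffff0c0c0c0cfffeffff0c0c0404eeeeaaaa0c0c000ceeeeaaaacccc000cffeebfaadfcc0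c0cfffebbbadddc0000eeeeaaaacccc1ffffefebafadcfc11ffffeebfaadfcc1f1ffffebbbadddc1111eeeeaaaaffff3ffffefebafaffff33ffffeebfaaffff3f3ffffebbbaffff33330c0ceeee0c0c4cccfefeffffdcfc55ffffeeffffdfcc5f5ffffeffffdddc55550c0c00080c0c000ceeeeaaaacccc11ffffeebfaadfcc1f1ffffebbbadddc1111eeeeaaaacccc1ffffefebafadcfc11ffffeebfaadfcc1f1ffffebbba0c0c0000eeeeaaaaffff3ffffefebafaffff33ffffeebfaaffff3f3ffffebbbafffc0000eeeeffff0c0c4cccfefeffffdcfc55ffffeeffff0c0c0c0cfffeffff0c0c0404eeeeaaaa0c0c000ceeeeaaaacccc11ffffeebbaa0c0c0000ffeebbaaddcc0000eeeeaaaacccc1ffffefebafadcfc11ffffeebfaadfcc1f1ffffebbbadddc1111eeeeaaaaffff3ffffefebafaffff33ffffeebfaaffff3f3ffffc0000fffc00000c0ceeee0c0c4cccfefeffffdcfc55ff0c0cffee0c0c5f4cfffeffffdddc5555000000000000000000000000000000000c0000000c0000000000000000000000eeeeaaaacccc1ffffefebafa10300030ffeebfaadfcc1f1ffffebbba1010000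0eeeeaaaaffff3ffffefebafafcfc0030ffeebfaaffff3f3ffffebbbafffc0000eeeeffffcccc5ffffefefafadcfc51ffffeeffffdfcc5f5ffffefffadddc5151eeeeaaaacccc1ffffefebafadcfc11ffffeebfaadfcc1f1ffffebbbadddc111100e000a000c000f00030003000300030ffeebfaadfcc1f1f003000200010000000e000a000f000f00030003000f00030ffeebfaaffff3f3f00f0002000f00000002000f000c000f0003000f000f000f0ffeeffffdfcc5f5f00f000f000d000500020002000c000f00030003000f000f0ffeebfaadfcc1f1f00f000b000d00010eeeeaaaacccc1ffffefebafadcfc11ffffeebfaadfcc1f1ffffebbba00000000eeeeaaaaffff3ffffefebafaffff33ffffeebfaaffff3f3ffffebbbafffc0000eeeeffffcccc5ffffefeffffdcfc55ffffeeffff0f0c0f0cfffefffa0d0c0100eeeeaaaacccc1ffffefebafadcfc11ffffeebfaadfcc0f00ffeebbaaddcc010000e000a000c000f0003000f000f000f0ffeebfaadfcc1f1f002000200010000000e000a000f000f00030003000f000f0ffeebfaaffff3f3f0030000000f00000002000f000c000f0003000f000f000f00000ffec0f0c5f4c003000f000d000500020002000c000f00030003000f000f0000000000f0c0f000020000000c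00010eeeeaaaaffff3ffffefebafa30300030ffeebfaaffff3f3ffffebbba30300000eeeeaaaaffff3ffffefebafaffff0030ffeebfaaffff3f3ffffebbbaffff0000fffffffffffffffffefefafafffff3fffffffffffffffffffffefffafffff3f3eeeeaaaaffff3ffffefebafaffff33ffffeebfaaffff3f3ffffebbbaffff333300e000a000f000f00030003000300030ffeebfaaffff3f3f003000200030000000e000a000f000f00030003000f00030ffeebfaaffff3f3f00f0002000f000003030ffffffffffff303030f030f030f0ffffffffffffffff30f030f030f030f00020002000f000f00030003000f000f0ffeebfaaffff3f3f00f000b000f00030eeeeaaaaffff3ffffefebafaffff33ffffeebfaaffff3f3ffffebbba30300000eeeeaaaaffff3ffffefebafaffff33ffffeebfaaffff3f3ffffebbbaffff0000fffffffffffffffffffffffffffffffffffffffffffffffffffefffafffff3f3eeeeaaaaffff3ffffefebafaffff33ffffeebfaaffff0f00fffebbaaffff0300eeeeaaaaffff3fff3030bafaffff33ffffeebfaaffff3f3f303020203030000000e000a000f000f00030003000f000f0ffeebfaaffff3f3f0030000000f000003030ffffffffffff3030ffffffffffff3030ffffffffffff3030fbfafffff3f30020002000f000f00030003000f000f0000000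000f0c0a000020000000f00030eeeeffffcccc5ffffefeffff00000000ffeeffffdfcc5f5ffffeffff00000000fffffffffffffffffefefffffcfc0000fffffffffffffffffffefffffffc0000eeeeffff0c0c0c0cfefeffff0c0c040cffeeffff0c0c0c0cfffeffff0c0c0404eeeeffff0c0c0c0cfefeffffcccc040cffeeffffdfcc0c0cfffeffffdddc040400e000f000c000f00030003000300030ffeeffffdfcc5f5f0030003000100010ffffffffffffffff30303030fcfc3030fffffffffffffffffffc3030fffc3030000000e0000000c0003000f000f000f00cecfffc0ccc5f5c00f000f000d0005000000000000000000020003000c000f0ffecfffcdfcc5f5c00f000f000d00050eeeeffffcccc5ffffefeffff0cfc04fcffeeffffdfcc5f5ffffeffff00000000fffffffffffffffffffffffffffffffffffffffffffffffffffefffffffc0000eeeeffff0c0c0cccfefeffff0cfc04fcffeeffff0c0c0c0cfffeffff0c0c0404eeeeffff0c0c0c0cfefeffffcccc55ffffeeffff0c0c0c04fffeffffddcc0404eeeeffffcccc5fff303030f010f010f0ffeeffffdfcc5f5f3030303010101010ffffffffffffffff30303030fffefffeffffffffffffffff30303030fffc3030000000e0000000c0003000f000f000f00000ffec0c0c5f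4c003000f000d0005000000000000000000020003000c000f0000000000c0c0c040020003000c00050eeeeaaaacccc1ffffefebafa00000000ffeebfaadfcc1f1ffffebbba00000000eeeeaaaaffff3ffffefebafafcfc0000ffeebfaaffff3f3ffffebbbafdfc0000eeeeffff0c0c0c0cfefefafa0c0c000cffeeffff0c0c0c0cfffefffa0c0c0000eeeeaaaa0c0c000ceeeeaaaacccc000cffeebbaa0ccc0000fffebbbadddc000000e000a000c000f00030003000300030ffeebfaadfcc1f1f003000200010000000e000a000f000f00030003000f00030ffeebfaaffff3f3f00f0002000f00000000000e0000000c0003000f000f000f00cecfffc0ccc5f5c00f000f000d0005000000000000000000020002000c000f00cec00a00ccc001000f000b000d00010eeeeaaaacccc1ffffefebafa0cfc00fcffeebfaadfcc1f1ffffebbba00000000eeeeaaaaffff3ffffefebafafcfc00fcffeebfaaffff3f3ffffebbbafdfc0000eeeeffff0c0c0cccfefefafe0cfc00fcffeeffff0c0c0c0cfffefffa0c0c0000eeeeaaaa0c0c000ceeeeaaaacccc00fcffeebbaa0c0c0000ffeebbaaddcc0000eeeeaaaacccc1fff203020f010f000f0ffeebfaadfcc1f1f3020202010100000eeeeaaa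affff3fff30300030fcfc00f0ffeebfaaffff3f3f30300000fdfc00000000ecec0c0c4ccc3030f8f8dcfc51ff0000ffec0c0c5f4c3030fbf8dddc515100000000000000000020002000c000f0000000000c0c00000020000000c00010eeeeaaaacccc1ffffefebafa00000000ffeebfaadfcc1f1ffffebbba00000000eeeeaaaaffff3ffffefebafafcfc0000ffeebfaaffff3f3ffffebbbafffc0000eeeeffff0c0c0c0cfefefafa0c0c000cffeeffff0c0c0c0cfffefffa0c0c0000eeeeaaaa0c0c000ceeeeaaaacccc000cffeebfaadfcc0c0cfffebbbadddc0000eeeeaaaacccc1fff2030203010300030ffeebfaadfcc1f1f3030202010100000eeeeaaaaffff3fff30300030fcfc0030ffeebfaaffff3f3ffffc2020fffc00000000ecec0c0c4ccc3030f8f8dcfc51ffffeeffffdfcc5f5ffffefbfadddc5151000000000c0c000c20200020cccc11ffffeebfaadfcc1f1ffffebbbadddc11110e000a000c000f00fefebafa1cfc11fc0f000f000f000f000f000b00000000000e000a000f000f00fefebafaffff33ff0f000f000f000f000f000b000f0000000e000f000c000c00fefeffff0c0c55fc0f000f000c000c000f000f000c0000000e000a000c000000eeeeaaaa0c0c010c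0f000b000c0000000f000b000d0000000e000a000c000f003030b8f8dcfc11ff0f000f000f000f0000000000000000000e000a000f000f0030300030ffff33ff0f000f000f000f00000000000f00000000000c000c000c000000fcfc0c0c55fc00000f000c000f0000000b000d000100000000000c000000000000000c0c010c000000000c000000000000000d000100eeeeaaaaffff3ffffefebafa00000000ffeebfaaffff3f3ffffebbba00000000eeeeaaaaffff3ffffefebafaffff0000ffeebfaaffff3f3ffffebbbaffff0000ffffffff0c0c0c0cfefefafa0c0c000cffffffff0c0c0c0cfffefffa0c0c0000eeeeaaaa0c0c000ceeeeaaaaffff000cffeebfaaffff0c0cfffebbbaffff0000eeeeaaaaffff3fff3030203030300030ffeebfaaffff3f3f3030202030300000eeeeaaaaffff3fff30300030ffff0030ffeebfaaffff3f3ffffe2020ffff00000000ffff0c0cffff3030fafafffff3fffffffffffffffffffffefbfafffff3f3000000000c0c000c20200020ffff33ffffeebfaaffff3f3ffffebbbaffff33330e000a000f000f00fefebafaffff33ff0f000f000f000f000f000b00000000000e000a000f000f00fefebafaffff03fc0f000f000f000f000f000b000f000000ffffffff0c0cffffffffffffffffffffffffffff0c0c0c0c3f303f300c0000000e000a000c0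00000eeeeaaaa0f0c030c0f000b000c0000000f000b000f000000eeeeaaaaffff3fff3030bafaffff33ffffeebfaaffff3f3f30302020303000000e000a000f000f0030300030ffff33ff0f000f000f000f00000000000f0000000000ffff0c0cffff3030ffffffffffff0000ffff0c0cffff3030fbfafffff3f3000000000c000000000000000f0c030c000000000c000000000000000f000300eeeeffffcccc5ffffefeffff0c0c040cffeeffffdfcc5f5ffffeffff0c0c0404ffffffffffffffffffffffffffff0c0cffffffffffffffffffffffffffff0c0ceeeeffff0c0c0c0cfefeffff0c0c040cffeeffff0c0c0c0cfffeffff0c0c0404eeeeffff0c0c0c0cfefeffffcccc040cffeeffffdfcc0c0cfffeffffdddc0404eeeeffffcccc5ffffefeffffdcfc55ffffeeffffdfcc5f5ffffeffffdddc5555ffffffffffffffffffffffffffffffffffffffffffffffffffffffffffffffff0c0ceeee0c0c4cccfefeffffdcfc55ffffeeffffdfcc5f5ffffeffffdddc55550c0c0c0c0c0c0c0ceeeeffffcccc55ffffeeffffdfcc5f5ffffeffffdddc55550e000f000c000f00fefeffffdcfc55ff0f000f000f000f000f000f000c000400fffffffffffffffffffffffffffffffffffffffffffffffffffc3f30ff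fc0c000e000f000c000c000e0cfffc0c0c55fc0f000f000c000c000f000f000c0004000e000f000c000c00fefeffff0c0c050c0f000f000c000c000f000f000d000400eeeeffffcccc5ffffefeffffdcfc55ffffeeffffdfcc5f5f3f303f301d101510fffffffffffffffffffffffffffffffffffffffffffffffffffc3f30fffc3f100c000e000c000c000e0cfffc0c0c55fc0c000f000c000f000f000f000d0005000c000c000c000c000e0c0f0c0c0c050c0c000c000c000c000f000f000d000500eeeeaaaacccc1ffffefebafa0c0c000cffeebfaadfcc1f1ffffebbba0c0c0000eeeeaaaaffff3ffffefebafaffff000cffeebfaaffff3f3ffffebbbaffff0000eeeeffff0c0c0c0cfefeffff0c0c040cffeeffff0c0c0c0cfffeffff0c0c0404eeeeaaaa0c0c000ceeeeaaaacccc000cffeebfaadfcc0c0cfffebbbadddc0000eeeeaaaacccc1ffffefebafadcfc11ffffeebfaadfcc1f1ffffebbbadddc1111eeeeaaaaffff3ffffefebafaffff33ffffeebfaaffff3f3ffffebbbaffff33330c0ceeee0c0c4cccfefeffffdcfc55ffffeeffffdfcc5f5ffffeffffdddc55550c0c00080c0c000ceeeeaaaacccc11ffffeebfaadfcc1f1f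fffebbbadddc11110e000a000c000f00fefebafadcfc11ff0f000f000f000f000f000b000c0000000e000a000f000f00fefebafaffff33ff0f000f000f000f000f000b000f0000000e000f000c000c000e0cfffe0c0c55fc0f000f000c000c000f000f000c0004000e000a000c0000000e0c0a080c0c010c0f000b000c0000000f000b000d000000eeeeaaaacccc1ffffefebafadcfc11ffffeebfaadfcc1f1ffffebbbadddc1111eeeeaaaaffff3ffffefebafaffff33ffffeebfaaffff3f3ffffc0b00fffc03000c0ceeee0c0c4cccfefeffffdcfc55ff0c0cffee0c0c5f4cfffeffffdddc55550c0000000c0000000e0c0a080c0c010c0c0000000c0000000f000b000d000100000000000000000000f000f0003000300f000f000f000f000000000000000000eeeeaaaaffff3ffffefebafafcfc0030ffeebfaaffff3f3ffffebbbafffc0000eeeeffffcccc5ffffefefafa10f010f0ffeeffffdfcc5f5f3f303f3010101010eeeeaaaacccc1ffffefebafadcfc11ffffeebfaadfcc1f1ffffebbbadddc111100e000a000c000f00030003000300030ffeebfaadfcc1f1f0030002000100000eeeeaaaaffff3fff30300030fcfc0030ffeebfaaffff3f3ffffc2020fffc00002020fcfccccc5fff303030f010f010f0ffeeffffdfcc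5f5f30f030f010d0105020200020cccc1fff30300030dcfc11ffffeebfaadfcc1f1ffffebbbadddc11110e000a000c000f00fefebafadcfc11ff0f000f000f000f000f000b0000000000eeeeaaaaffff3ffffefebafaffff33ffffeebfaaffff3f3ffffebbbafffc0000eeeeffffcccc5ffffefeffffdcfc55ffffeeffff0f0c0f0c3f303f300d000100eeeeaaaacccc1ffffefebafadcfc11ffffeebfaa0f0c0f00ffeebbaaddcc0100eeeeaaaacccc1fff3030b8f8dcfc11ffffeebfaadfcc1f1f3020202010100000eeeeaaaaffff3fff30300030ffff33ffffeebfaaffff3f3f30300000fffc00002020fcfccccc5fff3030fcfcdcfc55ff0000ffec0f0c5f4c3030fbf8dddc515120200020cccc1fff30300030dcfc11ff000000000f0c0f0030200000ddcc1111000000000000000000f000f0003000300f000f000f000f000000000000000000000000000000000000f000f000f000300f000f000f000f000000000000000000fffffffffffffffffefefafa30f030f0ffffffffffffffff3f303f3030303030eeeeaaaaffff3ffffefebafaffff00f0ffeebfaaffff3f3ffffe0b20ffff000000e000a000f000f00030003000300030ffeebfaaffff3f3f003000200030000000e000a000f000f00030003000f00030ffeebfaaffff3f3f00f0002000f0000030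30ffffffffffff303030f030f030f0ffffffffffffffff30f030f030f030f020200020ffff3fff30300030ffff00f0ffeebfaaffff3f3ffffe00b0ffff00300e000a000f000f00fefebafaffff33ff0f000f000f000f000f000b00000000000e000a000f000f00fefebafaffff33ff0f000f000f000f000f000b000f000000ffffffffffffffffffffffffffffffffffffffffffffffff3f303f303f303330eeeeaaaaffff3ffffefebafaffff33ffffeebfaa0f0c0f00ffee0b00ffff0300eeeeaaaaffff3fff3030bafaffff33ffffeebfaaffff3f3f3030202030300000eeeeaaaaffff3fff30300030ffff33ffffeebfaaffff3f3f30300000ffff00003030ffffffffffff3030ffffffffffff3030ffffffffffff3030fbfafffff3f320200020ffff3fff30300030ffff33ff000000000f0c0f0030200000ffff3333000000000000000000f000f0000000000f000f000f000f000000000000000000fffffffffffffffffefefffffcfc0000fffffffffffffffffffefffffffc00000000000000000000000000f0000000000c000f000c000c000000000000000000eeeeffff0c0c0c0cfefeffffcccc040cffeeffffdfcc0c0cfffeffffdddc040400e000f000c000f00030003000300030ffeeffffdfcc5f5f0030003000100010ffffffffffffffff30303030fcfc3030fffffffffffffffffffc3030fffc3030000000e0000000c0003000f000f000f00cecfffc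0ccc5f5c00f000f000d00050000000000c0c0c0c20203030cccc55ffffeeffffdfcc5f5ffffeffffdddc55550e000f000c000f00fefeffff00f000f00f000f000f000f000f000f0000000000fffffffffffffffffffffffffffffffffffffffffffffffffffefffffffc00000e000f000c000c000e0cfffc0c0c04fc0f000f000c000c000f000f000c000400eeeeffff0c0c0c0cfefeffffcccc55ffffeeffff0c0c0c04fffeffffddcc0404eeeeffffcccc5fff303030f010f010f0ffeeffffdfcc5f5f3030303010101010ffffffffffffffff30303030ffffffffffffffffffffffff30303030fffc30100000ecec0c0c4ccc3030fcfcdcfc55ff0000ffec0c0c5f4c3030fffcdddc5555000000000c0c0c0c20203030cccc55ff000000000c0c0c0430203030ddcc5555000000000000000000f000f0000000000f000f000f000f000000000000000000000000000000000000f000f000f000000f000f000f000f0000000000000000000000000000000000000000f0000000000c000f000c000c000000000000000000000000000000000000000000000000000c0000000c000000000000000000000000e000a000c000f00030003000300030ffeebfaadfcc1f1f003000200010000000e000a000f000f00030003000f00030ffeebfaaffff3f3f00f0002000f00000000000e0000000c0003000f000f000f00cecfffc0ccc5d5c00f000f000d0005000000000000000000020002000c000f00cec00a00ccc001000f000b0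00d000100e000a000c000f00fefebafa00f000f00f000f000f000f000f000b00000000000e000a000f000f00fefebafafcfc00f00f000f000f000f000f000b000d0000000e000f000c000c000e0cfaf80c0c00fc0f000f000c000c000f000f000c0000000e000a000c0000000e0c0a080c0c000c0f000b000c0000000f000b000d000000eeeeaaaacccc1fff203020f010f000f0ffeebfaadfcc1f1f3020202010100000eeeeaaaaffff3fff30300030fcfc00f0ffeebfaaffff3f3f30300000fdfc00000000ecec0c0c4ccc3030f8f8dcfc51ff0000ffec0c0c5d4c3030fbf8dddc5151000000000c0c000c20200020cccc11ff000000000c0c000030200000ddcc1111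

/-- The certificate for the pattern `123`. -/
def certificate123 : Certificate where
  rules := [
    (0, (false, 0, false), .branch 0 0 0 (.branch 3 1 1 (.split [(0,3),(5,3)] 0 (.kid (.branch 6 3 1
      (.branch 1 3 2 (.branch 7 3 1 (.hit [2,5,7] 1) (.hit [1,4,6] 1)) (.hit [1,4,6] 1)) (.hit
      [0,3,5] 1)) (.kid (.branch 6 3 0 (.branch 7 3 0 (.branch 8 3 1 (.hit [0,3,8] 1) (.hit [0,3,7]
      1)) (.hit [0,3,6] 1)) (.hit [0,3,5] 1)) (.hit [0,3,4] 1)))) (.hit [0,2,3] 1)) (.hit [0,1,2]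
      1)),
    (0, (false, 0, false), .split [(3,1),(3,2)] 1 (.kid (.branch 0 0 0 (.branch 4 2 3 (.branch 2 3 3
      (.branch 1 6 0 (.branch 5 4 3 (.hit [0,5,8] 1) (.hit [0,3,7] 1)) (.hit [0,3,4] 1)) (.branch 3
      3 0 (.branch 1 6 0 (.branch 5 4 3 (.hit [0,5,8] 1) (.hit [0,4,7] 1)) (.hit [0,2,4] 1)) (.hit
      [0,4,5] 1))) (.branch 3 2 3 (.branch 1 5 0 (.branch 3 3 0 (.branch 4 4 3 (.hit [0,4,8] 1)
      (.hit [0,3,7] 1)) (.hit [0,4,6] 1)) (.hit [0,2,4] 1)) (.branch 2 2 1 (.branch 1 5 0 (.branch 3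
      3 0 (.branch 4 4 3 (.hit [0,4,8] 1) (.hit [0,3,7] 1)) (.hit [0,3,6] 1)) (.hit [0,3,4] 1))
      (.hit [0,1,4] 1)))) (.hit [0,1,2] 1)) (.kid (.drop [3] 0 0 0 291 (.hit [0,1,2] 1)) (.drop [2]
      0 0 0 291 (.hit [0,1,2] 1))))),
    (0, (false, 0, false), .branch 0 0 2 (.branch 1 3 3 (.split [(3,0),(3,5)] 2 (.kid (.branch 3 6 3
      (.branch 3 1 0 (.branch 3 7 3 (.hit [0,1,3] 1) (.hit [3,6,7] 1)) (.hit [0,1,3] 1)) (.hit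
      [3,4,5] 1)) (.kid (.branch 3 6 2 (.branch 3 7 2 (.branch 3 8 3 (.hit [0,1,3] 1) (.hit [0,1,3]
      1)) (.hit [0,1,3] 1)) (.hit [0,1,3] 1)) (.hit [0,1,4] 1)))) (.hit [0,2,3] 1)) (.hit [0,1,2]
      1)),
    (0, (false, 0, false), .split [(1,3),(2,3)] 3 (.kid (.branch 0 0 2 (.branch 2 4 1 (.branch 3 2 1
      (.branch 6 1 2 (.branch 4 5 1 (.hit [0,4,5] 1) (.hit [0,3,4] 1)) (.hit [0,5,6] 1)) (.branch 3
      3 2 (.branch 6 1 2 (.branch 4 5 1 (.hit [0,4,5] 1) (.hit [0,3,4] 1)) (.hit [0,5,6] 1)) (.hit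
      [0,2,3] 1))) (.branch 2 3 1 (.branch 5 1 2 (.branch 3 3 2 (.branch 4 4 1 (.hit [0,4,5] 1)
      (.hit [0,3,4] 1)) (.hit [0,2,3] 1)) (.hit [0,4,5] 1)) (.branch 2 2 3 (.branch 5 1 2 (.branch 3
      3 2 (.branch 4 4 1 (.hit [0,4,5] 1) (.hit [0,3,4] 1)) (.hit [0,2,3] 1)) (.hit [0,4,5] 1))
      (.hit [0,1,2] 1)))) (.hit [0,2,3] 1)) (.kid (.drop [2] 0 0 0 393 (.hit [0,1,2] 1)) (.drop [2]
      0 0 0 393 (.hit [0,1,2] 1))))),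
    (1, (false, 0, false), .branch 0 1 0 (.branch 1 2 2 (.branch 3 5 3 (.branch 5 2 2 (.hit [0,5,6]
      2) (.hit [0,1,3] 2)) (.hit [0,1,4] 2)) (.hit [0,2,3] 2)) (.hit [0,1,2] 2)),
    (1, (false, 0, false), .branch 0 1 0 (.branch 1 2 2 (.hit [0,1,4] 2) (.hit [0,2,3] 2)) (.hit
      [0,1,2] 2)),
    (1, (true, 0, true), .branch 0 1 3 (.branch 1 3 3 (.branch 1 3 2 (.branch 2 4 2 (.branch 3 5 2
      (.branch 4 6 3 (.descend [4,5,8]) (.descend [3,4,7])) (.descend [2,3,6])) (.descend [1,2,5]))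
      (.descend [0,1,4])) (.hit [0,2,3] 2)) (.hit [0,1,2] 2)),
    (1, (true, 0, true), .branch 0 1 3 (.branch 1 3 3 (.split [(1,3),(3,5)] 3 (.kid (.descend
      [1,2,5]) (.kid (.split [(1,3),(3,5)] 3 (.kid (.descend [1,2,4]) (.kid (.branch 3 5 2 (.branch
      4 6 3 (.descend [4,5,6]) (.descend [3,4,5])) (.descend [1,3,4])) (.descend [0,1,3]))))
      (.descend [0,1,4])))) (.hit [0,2,3] 2)) (.hit [0,1,2] 2)),
    (1, (false, 0, false), .branch 0 1 0 (.branch 1 2 2 (.split [(4,2),(2,3)] 2 (.kid (.split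
      [(5,3),(5,4)] 2 (.kid (.hit [0,4,5] 2) (.kid (.hit [0,4,5] 2) (.hit [0,4,5] 2)))) (.kid (.hit
      [0,1,2] 2) (.hit [0,1,3] 2)))) (.hit [0,2,3] 2)) (.hit [0,1,2] 2)),
    (1, (false, 1, false), .branch 0 1 0 (.branch 1 3 1 (.branch 1 4 1 (.branch 1 5 1 (.branch 1 6 1
      (.branch 1 7 3 (.descend [0,1,8]) (.descend [0,1,7])) (.descend [0,1,6])) (.descend [0,1,5]))
      (.descend [0,1,4])) (.hit [0,2,3] 2)) (.hit [0,1,2] 2)),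
    (1, (false, 1, false), .branch 0 1 0 (.branch 1 3 3 (.branch 3 5 0 (.branch 4 6 0 (.branch 5 7 3
      (.branch 5 7 3 (.descend [2,5,6]) (.descend [2,4,5])) (.descend [2,3,4])) (.descend [0,1,3]))
      (.descend [0,1,4])) (.hit [0,2,3] 2)) (.hit [0,1,2] 2)),
    (1, (false, 0, false), .branch 0 1 0 (.branch 1 2 0 (.branch 3 5 3 (.hit [0,1,3] 2) (.hit
      [0,1,4] 2)) (.hit [0,2,3] 2)) (.hit [0,1,2] 2)),
    (4, (false, 0, false), .branch 1 0 2 (.branch 2 1 0 (.branch 5 3 1 (.branch 2 5 0 (.hit [1,2,5]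
      16) (.hit [1,2,5] 16)) (.hit [1,2,4] 16)) (.hit [1,2,3] 16)) (.hit [0,1,2] 16)),
    (4, (false, 0, false), .branch 1 0 2 (.branch 2 1 0 (.hit [1,2,4] 16) (.hit [1,2,3] 16)) (.hit
      [0,1,2] 16)),
    (4, (false, 0, true), .branch 1 0 1 (.branch 3 1 1 (.branch 3 1 0 (.branch 4 2 0 (.branch 5 3 0
      (.branch 6 4 1 (.descend [6,7,8]) (.descend [5,6,7])) (.descend [4,5,6])) (.descend [3,4,5]))
      (.descend [1,3,4])) (.hit [1,2,3] 16)) (.hit [0,1,2] 16)),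
    (4, (false, 0, true), .branch 1 0 1 (.branch 3 1 1 (.split [(3,1),(5,3)] 1 (.kid (.descend
      [3,4,5]) (.kid (.split [(3,1),(5,3)] 1 (.kid (.descend [3,4,6]) (.kid (.branch 5 3 0 (.branch
      6 4 1 (.descend [6,7,8]) (.descend [5,6,7])) (.descend [3,5,6])) (.descend [1,3,5]))))
      (.descend [1,3,4])))) (.hit [1,2,3] 16)) (.hit [0,1,2] 16)),
    (4, (false, 0, false), .branch 1 0 2 (.branch 2 1 0 (.split [(2,4),(3,2)] 0 (.kid (.split
      [(3,5),(4,5)] 0 (.kid (.hit [1,2,3] 16) (.kid (.hit [1,2,4] 16) (.hit [1,2,5] 16)))) (.kid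
      (.hit [1,2,3] 16) (.hit [1,2,3] 16)))) (.hit [1,2,3] 16)) (.hit [0,1,2] 16)),
    (4, (false, 0, false), .branch 1 0 2 (.branch 2 1 2 (.branch 5 3 1 (.hit [1,2,5] 16) (.hit
      [1,2,4] 16)) (.hit [1,2,3] 16)) (.hit [0,1,2] 16)),
    (4, (true, 1, false), .branch 1 0 2 (.branch 3 1 3 (.branch 4 1 3 (.branch 5 1 3 (.branch 6 1 3
      (.branch 7 1 1 (.descend [1,7,8]) (.descend [1,6,7])) (.descend [1,5,6])) (.descend [1,4,5]))
      (.descend [1,3,4])) (.hit [1,2,3] 16)) (.hit [0,1,2] 16)),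
    (4, (true, 1, false), .branch 1 0 2 (.branch 3 1 1 (.branch 5 3 2 (.branch 6 4 2 (.branch 7 5 1
      (.branch 7 5 1 (.descend [0,7,8]) (.descend [0,6,7])) (.descend [0,5,6])) (.descend [1,3,5]))
      (.descend [1,3,4])) (.hit [1,2,3] 16)) (.hit [0,1,2] 16)),
    (5, (false, 1, true), .branch 2 3 3 (.split [(2,3),(1,1)] 3 (.kid (.branch 0 2 0 (.branch 4 1 1
      (.branch 5 5 1 (.descend [0,5,6]) (.descend [1,4,5])) (.descend [0,3,4])) (.descend [0,2,3]))
      (.kid (.branch 3 1 1 (.branch 4 3 1 (.descend [1,4,5]) (.descend [0,3,4])) (.hit [1,2,3] 32))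
      (.hit [0,1,2] 32)))) (.branch 1 1 3 (.branch 3 1 1 (.branch 4 3 1 (.descend [1,4,5]) (.descend
      [0,3,4])) (.hit [1,2,3] 32)) (.hit [0,1,2] 32))),
    (5, (true, 1, true), .branch 3 2 1 (.split [(3,2),(1,1)] 1 (.kid (.branch 2 0 2 (.branch 1 4 3
      (.branch 5 5 3 (.descend [3,5,7]) (.descend [0,1,6])) (.descend [2,4,5])) (.descend [0,3,4]))
      (.kid (.branch 1 3 3 (.branch 3 4 3 (.descend [2,3,6]) (.descend [0,1,5])) (.hit [1,2,4] 32))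
      (.hit [0,1,3] 32)))) (.branch 1 1 1 (.branch 1 3 3 (.branch 3 4 3 (.descend [2,3,5]) (.descend
      [0,1,4])) (.hit [1,2,3] 32)) (.hit [0,1,2] 32))),
    (6, (false, 0, false), .branch 1 2 0 (.branch 2 3 0 (.hit [0,1,2] 64) (.hit [0,1,3] 64)) (.hit
      [0,1,2] 64)),
    (6, (false, 0, false), .branch 1 2 0 (.branch 2 3 0 (.branch 3 3 0 (.branch 4 3 0 (.branch 5 3 0
      (.branch 6 3 2 (.hit [0,1,6] 64) (.hit [0,1,5] 64)) (.hit [0,1,4] 64)) (.hit [0,1,3] 64))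
      (.hit [0,1,2] 64)) (.hit [0,1,3] 64)) (.hit [0,1,2] 64)),
    (6, (false, 1, false), .branch 1 2 1 (.branch 2 4 0 (.branch 3 5 0 (.branch 4 6 0 (.branch 5 7 3
      (.branch 5 7 1 (.descend [0,5,6]) (.descend [0,4,5])) (.descend [0,3,4])) (.descend [0,2,3]))
      (.descend [0,1,2])) (.descend [0,1,3])) (.hit [0,1,2] 64)),
    (6, (true, 0, true), .branch 3 2 1 (.split [(1,2),(3,2)] 3 (.kid (.branch 0 2 2 (.branch 0 3 2
      (.branch 0 4 2 (.branch 0 5 0 (.descend [0,5,8]) (.descend [0,4,7])) (.descend [0,3,6]))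
      (.descend [0,2,5])) (.hit [0,1,4] 64)) (.kid (.branch 0 2 2 (.branch 0 3 2 (.branch 0 4 2
      (.branch 0 5 0 (.descend [0,7,8]) (.descend [0,6,7])) (.descend [0,5,6])) (.descend [0,4,5]))
      (.hit [0,3,4] 64)) (.hit [0,1,3] 64)))) (.branch 1 2 3 (.branch 0 2 2 (.branch 0 3 2 (.branch
      0 4 2 (.branch 0 5 2 (.branch 0 6 0 (.descend [0,6,8]) (.descend [0,5,7])) (.descend [0,4,6]))
      (.descend [0,3,5])) (.descend [0,2,4])) (.hit [0,1,3] 64)) (.hit [0,1,2] 64))),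
    (6, (false, 2, false), .branch 1 0 2 (.split [(2,3),(2,1)] 0 (.kid (.branch 3 5 1 (.branch 3 6 1
      (.branch 3 7 1 (.branch 3 8 3 (.descend [1,2,3]) (.descend [1,2,3])) (.descend [1,2,3]))
      (.descend [1,2,3])) (.hit [1,2,4] 64)) (.kid (.branch 3 5 1 (.branch 3 6 1 (.branch 3 7 1
      (.branch 3 8 3 (.descend [1,2,3]) (.descend [1,2,3])) (.descend [1,2,3])) (.descend [1,2,3]))
      (.hit [1,2,4] 64)) (.hit [1,2,3] 64)))) (.branch 1 2 0 (.branch 2 4 1 (.branch 2 5 1 (.branch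
      2 6 1 (.branch 2 7 1 (.branch 2 8 3 (.descend [0,1,2]) (.descend [0,1,2])) (.descend [0,1,2]))
      (.descend [0,1,2])) (.descend [0,1,2])) (.hit [0,1,3] 64)) (.hit [0,1,2] 64))),
    (6, (false, 0, false), .branch 1 2 3 (.branch 1 2 3 (.hit [1,2,4] 64) (.hit [0,1,3] 64)) (.hit
      [0,1,2] 64)),
    (6, (false, 0, false), .branch 1 2 3 (.branch 1 2 3 (.branch 2 2 3 (.branch 3 2 3 (.branch 4 2 3
      (.branch 5 2 1 (.hit [5,6,8] 64) (.hit [4,5,7] 64)) (.hit [3,4,6] 64)) (.hit [2,3,5] 64))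
      (.hit [1,2,4] 64)) (.hit [0,1,3] 64)) (.hit [0,1,2] 64)),
    (6, (true, 1, true), .branch 1 2 2 (.branch 0 2 3 (.branch 0 2 3 (.branch 0 2 3 (.branch 0 2 0
      (.branch 1 3 2 (.descend [0,1,8]) (.descend [0,1,7])) (.descend [0,1,6])) (.descend [0,1,5]))
      (.descend [0,2,4])) (.descend [0,1,3])) (.hit [0,1,2] 64)),
    (6, (true, 1, true), .branch 1 2 3 (.split [(2,4),(0,2)] 3 (.kid (.branch 0 2 3 (.branch 0 2 3
      (.branch 0 2 3 (.branch 0 2 0 (.descend [0,5,6]) (.descend [0,4,5])) (.descend [0,3,4]))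
      (.descend [0,2,3])) (.descend [0,1,2])) (.kid (.branch 0 2 3 (.branch 0 2 3 (.branch 0 2 3
      (.branch 0 2 0 (.descend [0,6,8]) (.descend [0,5,7])) (.descend [0,4,6])) (.descend [0,3,5]))
      (.descend [0,2,4])) (.hit [0,1,3] 64)))) (.hit [0,1,2] 64)),
    (9, (false, 0, true), .branch 2 3 3 (.split [(2,1),(2,3)] 1 (.kid (.branch 2 0 0 (.branch 3 0 0
      (.branch 4 0 0 (.branch 5 0 2 (.descend [5,6,7]) (.descend [4,5,6])) (.descend [3,4,5]))
      (.descend [2,3,4])) (.hit [0,2,3] 512)) (.kid (.branch 2 0 0 (.branch 3 0 0 (.branch 4 0 0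
      (.branch 5 0 2 (.descend [5,6,7]) (.descend [4,5,6])) (.descend [3,4,5])) (.descend [2,3,4]))
      (.hit [0,2,3] 512)) (.hit [0,1,2] 512)))) (.branch 2 1 1 (.branch 2 0 0 (.branch 3 0 0
      (.branch 4 0 0 (.branch 5 0 0 (.branch 6 0 2 (.descend [6,7,8]) (.descend [5,6,7])) (.descend
      [4,5,6])) (.descend [3,4,5])) (.descend [2,3,4])) (.hit [0,2,3] 512)) (.hit [0,1,2] 512))),
    (9, (false, 0, false), .branch 2 1 2 (.branch 3 2 2 (.hit [0,2,3] 512) (.hit [0,2,3] 512)) (.hit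
      [0,1,2] 512)),
    (9, (false, 0, false), .branch 2 1 2 (.branch 3 2 2 (.branch 3 3 2 (.branch 3 4 2 (.branch 3 5 2
      (.branch 3 6 0 (.hit [0,2,3] 512) (.hit [0,2,3] 512)) (.hit [0,2,3] 512)) (.hit [0,2,3] 512))
      (.hit [0,2,3] 512)) (.hit [0,2,3] 512)) (.hit [0,1,2] 512)),
    (9, (true, 1, false), .branch 2 1 3 (.branch 4 2 2 (.branch 5 3 2 (.branch 6 4 2 (.branch 7 5 1
      (.branch 7 5 3 (.descend [0,7,8]) (.descend [0,6,7])) (.descend [0,5,6])) (.descend [0,4,5]))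
      (.descend [0,2,4])) (.descend [0,2,3])) (.hit [0,1,2] 512)),
    (9, (false, 0, false), .branch 2 1 1 (.branch 2 1 1 (.hit [2,3,4] 512) (.hit [0,2,3] 512)) (.hit
      [0,1,2] 512)),
    (9, (false, 0, false), .branch 2 1 1 (.branch 2 1 1 (.branch 2 2 1 (.branch 2 3 1 (.branch 2 4 1
      (.branch 2 5 3 (.hit [2,7,8] 512) (.hit [2,6,7] 512)) (.hit [2,5,6] 512)) (.hit [2,4,5] 512))
      (.hit [2,3,4] 512)) (.hit [0,2,3] 512)) (.hit [0,1,2] 512)),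
    (9, (false, 1, true), .branch 2 1 0 (.branch 2 0 1 (.branch 2 0 1 (.branch 2 0 1 (.branch 2 0 2
      (.branch 3 1 0 (.descend [2,3,8]) (.descend [2,3,7])) (.descend [2,3,6])) (.descend [2,3,5]))
      (.descend [2,3,4])) (.descend [0,2,3])) (.hit [0,1,2] 512)),
    (9, (false, 1, true), .branch 2 1 1 (.split [(4,2),(2,0)] 1 (.kid (.branch 2 0 1 (.branch 2 0 1
      (.branch 2 0 1 (.branch 2 0 2 (.descend [2,6,8]) (.descend [2,5,7])) (.descend [2,4,6]))
      (.descend [2,3,5])) (.descend [0,2,4])) (.kid (.branch 2 0 1 (.branch 2 0 1 (.branch 2 0 1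
      (.branch 2 0 2 (.descend [2,7,8]) (.descend [2,6,7])) (.descend [2,5,6])) (.descend [2,4,5]))
      (.descend [2,3,4])) (.hit [0,2,3] 512)))) (.hit [0,1,2] 512)),
    (9, (true, 2, false), .branch 0 1 0 (.split [(3,2),(1,2)] 2 (.kid (.branch 5 3 3 (.branch 6 3 3
      (.branch 7 3 3 (.branch 8 3 1 (.descend [0,3,8]) (.descend [0,3,7])) (.descend [0,3,6]))
      (.descend [0,3,5])) (.hit [0,3,4] 512)) (.kid (.branch 5 3 3 (.branch 6 3 3 (.branch 7 3 3
      (.branch 8 3 1 (.descend [0,1,8]) (.descend [0,1,7])) (.descend [0,1,6])) (.descend [0,1,5]))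
      (.hit [0,1,4] 512)) (.hit [0,2,3] 512)))) (.branch 2 1 2 (.branch 4 2 3 (.branch 5 2 3
      (.branch 6 2 3 (.branch 7 2 3 (.branch 8 2 1 (.descend [0,2,8]) (.descend [0,2,7])) (.descend
      [0,2,6])) (.descend [0,2,5])) (.descend [0,2,4])) (.hit [0,2,3] 512)) (.hit [0,1,2] 512))),
    (10, (false, 1, false), .branch 1 0 2 (.split [(2,1),(3,3)] 2 (.kid (.branch 5 3 1 (.branch 2 5
      0 (.branch 2 2 0 (.descend [1,2,7]) (.descend [1,2,5])) (.descend [1,2,5])) (.descend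
      [1,2,4])) (.kid (.branch 2 4 0 (.branch 2 3 0 (.descend [1,2,5]) (.descend [1,2,5])) (.hit
      [1,2,3] 1024)) (.hit [1,2,3] 1024)))) (.branch 2 2 2 (.branch 1 3 0 (.branch 1 2 0 (.descend
      [0,1,4]) (.descend [0,1,4])) (.hit [0,1,2] 1024)) (.hit [0,1,2] 1024))),
    (10, (true, 1, false), .branch 0 1 0 (.split [(1,2),(3,3)] 0 (.kid (.branch 3 5 3 (.branch 5 2 2
      (.branch 2 2 2 (.descend [0,2,4]) (.descend [0,5,6])) (.descend [0,1,3])) (.descend [0,1,4]))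
      (.kid (.branch 4 2 2 (.branch 3 2 2 (.descend [0,3,4]) (.descend [0,4,5])) (.hit [0,2,3]
      1024)) (.hit [0,2,3] 1024)))) (.branch 2 2 0 (.branch 3 1 2 (.branch 2 1 2 (.descend [0,2,3])
      (.descend [0,3,4])) (.hit [0,1,2] 1024)) (.hit [0,1,2] 1024))),
    (11, (false, 0, false), .branch 2 3 3 (.branch 2 3 3 (.branch 0 2 0 (.hit [0,3,4] 2048) (.hit
      [0,2,3] 2048)) (.hit [0,1,2] 2048)) (.hit [0,1,2] 2048)),
    (11, (true, 1, true), .branch 2 3 3 (.branch 1 3 2 (.branch 1 4 2 (.branch 1 5 2 (.branch 1 6 2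
      (.branch 1 7 0 (.descend [0,1,7]) (.descend [0,1,6])) (.descend [0,1,5])) (.descend [0,1,4]))
      (.descend [0,1,3])) (.hit [0,1,2] 2048)) (.hit [0,1,2] 2048)),
    (11, (true, 1, true), .branch 2 3 3 (.branch 1 3 0 (.branch 0 2 3 (.branch 0 2 3 (.branch 0 2 0
      (.branch 1 3 0 (.descend [0,1,8]) (.descend [0,1,7])) (.descend [0,1,6])) (.descend [0,2,4]))
      (.descend [0,1,3])) (.hit [0,1,2] 2048)) (.hit [0,1,2] 2048)),
    (11, (false, 0, false), .branch 2 3 3 (.branch 2 3 1 (.branch 0 2 0 (.branch 4 1 1 (.hit [1,4,5]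
      2048) (.hit [0,3,4] 2048)) (.hit [0,2,3] 2048)) (.hit [0,1,2] 2048)) (.hit [0,1,2] 2048)),
    (11, (false, 0, false), .branch 2 3 3 (.branch 2 3 1 (.hit [0,2,3] 2048) (.hit [0,1,2] 2048))
      (.hit [0,1,2] 2048)),
    (11, (false, 2, false), .branch 2 3 0 (.branch 1 3 0 (.branch 2 4 1 (.branch 2 4 1 (.branch 2 4
      1 (.branch 2 4 0 (.descend [0,1,2]) (.descend [0,1,2])) (.descend [0,1,2])) (.descend
      [0,1,2])) (.descend [0,1,3])) (.hit [0,1,2] 2048)) (.hit [0,1,2] 2048)),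
    (11, (false, 2, false), .branch 2 3 0 (.branch 1 3 0 (.split [(2,4),(0,2)] 0 (.kid (.descend
      [0,1,2]) (.kid (.split [(3,5),(1,3)] 0 (.kid (.descend [0,2,3]) (.kid (.branch 2 4 1 (.branch
      2 4 0 (.descend [0,1,2]) (.descend [0,1,2])) (.descend [0,1,3])) (.descend [0,2,4]))))
      (.descend [0,1,3])))) (.hit [0,1,2] 2048)) (.hit [0,1,2] 2048)),
    (11, (false, 0, false), .branch 2 3 3 (.branch 2 3 1 (.split [(3,1),(2,3)] 1 (.kid (.split
      [(3,1),(2,1)] 1 (.kid (.hit [3,4,5] 2048) (.kid (.hit [2,4,5] 2048) (.hit [0,3,4] 2048))))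
      (.kid (.hit [2,3,4] 2048) (.hit [1,2,3] 2048)))) (.hit [0,1,2] 2048)) (.hit [0,1,2] 2048)),
    (14, (false, 1, true), .branch 3 2 1 (.branch 3 1 0 (.branch 4 1 0 (.branch 5 1 0 (.branch 6 1 0
      (.branch 7 1 2 (.descend [0,7,8]) (.descend [0,6,7])) (.descend [0,5,6])) (.descend [0,4,5]))
      (.descend [0,3,4])) (.hit [0,1,3] 16384)) (.hit [0,1,2] 16384)),
    (14, (false, 1, true), .branch 3 2 1 (.branch 3 1 2 (.branch 2 0 1 (.branch 2 0 1 (.branch 2 0 2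
      (.branch 3 1 2 (.descend [2,3,6]) (.descend [2,3,5])) (.descend [2,3,4])) (.descend [2,4,5]))
      (.descend [0,3,4])) (.hit [0,1,3] 16384)) (.hit [0,1,2] 16384)),
    (14, (false, 0, false), .branch 3 2 1 (.branch 3 2 1 (.branch 2 0 2 (.hit [2,4,5] 16384) (.hit
      [0,3,4] 16384)) (.hit [0,1,3] 16384)) (.hit [0,1,2] 16384)),
    (14, (false, 0, false), .branch 3 2 1 (.branch 3 2 3 (.branch 2 0 2 (.branch 1 4 3 (.hit [0,1,6]
      16384) (.hit [2,4,5] 16384)) (.hit [0,3,4] 16384)) (.hit [0,1,3] 16384)) (.hit [0,1,2]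
      16384)),
    (14, (false, 0, false), .branch 3 2 1 (.branch 3 2 3 (.hit [0,3,4] 16384) (.hit [0,1,3] 16384))
      (.hit [0,1,2] 16384)),
    (14, (true, 2, false), .branch 3 2 2 (.branch 3 1 2 (.branch 4 2 3 (.branch 4 2 3 (.branch 4 2 3
      (.branch 4 2 2 (.descend [0,3,4]) (.descend [0,3,4])) (.descend [0,3,4])) (.descend [0,3,4]))
      (.descend [0,3,4])) (.hit [0,1,3] 16384)) (.hit [0,1,2] 16384)),
    (14, (true, 2, false), .branch 3 2 2 (.branch 3 1 2 (.split [(4,2),(2,0)] 2 (.kid (.descend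
      [0,3,4]) (.kid (.split [(5,3),(3,1)] 2 (.kid (.descend [2,4,5]) (.kid (.branch 4 2 3 (.branch
      4 2 2 (.descend [2,3,4]) (.descend [2,3,4])) (.descend [2,3,5])) (.descend [2,4,5]))))
      (.descend [0,3,4])))) (.hit [0,1,3] 16384)) (.hit [0,1,2] 16384)),
    (14, (false, 0, false), .branch 3 2 1 (.branch 3 2 3 (.split [(1,3),(3,2)] 3 (.kid (.split
      [(1,3),(1,2)] 3 (.kid (.hit [1,2,6] 16384) (.kid (.hit [1,2,6] 16384) (.hit [0,1,5] 16384))))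
      (.kid (.hit [3,4,5] 16384) (.hit [1,3,4] 16384)))) (.hit [0,1,3] 16384)) (.hit [0,1,2]
      16384)),
    (15, (false, 0, false), .split [(0,1),(0,2)] 0 (.kid (.drop [0] 1 1 0 393 (.hit [0,1,2] 32768))
      (.kid (.branch 4 4 1 (.split [(1,3),(2,3),(3,3)] 2 (.kid (.descend [0,1,4]) (.kid (.descend
      [0,2,4]) (.kid (.descend [0,3,4]) (.hit [0,3,4] 32768))))) (.hit [1,2,3] 32768)) (.drop [0] 1
      1 0 393 (.hit [0,1,2] 32768))))),
    (15, (false, 0, false), .split [(1,0),(2,0)] 2 (.kid (.drop [1] 1 1 0 291 (.hit [0,1,2] 32768))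
      (.kid (.branch 4 4 3 (.split [(3,1),(3,2),(3,3)] 0 (.kid (.hit [2,3,5] 32768) (.kid (.hit
      [2,3,5] 32768) (.kid (.hit [2,3,5] 32768) (.hit [2,3,4] 32768))))) (.hit [0,1,3] 32768))
      (.drop [0] 1 1 0 291 (.hit [0,1,2] 32768))))),
    (15, (false, 0, false), .branch 3 3 1 (.branch 1 3 0 (.split [(5,2),(0,2)] 1 (.kid (.branch 0 3
      0 (.branch 6 4 3 (.branch 1 5 0 (.hit [1,3,6] 32768) (.hit [1,3,6] 32768)) (.hit [0,2,5]
      32768)) (.hit [0,2,5] 32768)) (.kid (.branch 0 3 1 (.branch 0 4 1 (.branch 0 5 0 (.hit [0,5,8]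
      32768) (.hit [0,4,7] 32768)) (.hit [0,3,6] 32768)) (.hit [0,2,5] 32768)) (.hit [0,1,4]
      32768)))) (.hit [0,1,3] 32768)) (.hit [0,1,2] 32768)),
    (15, (false, 0, false), .branch 3 3 3 (.branch 3 1 2 (.split [(2,5),(2,0)] 3 (.kid (.branch 3 0
      2 (.branch 4 6 1 (.branch 5 1 2 (.hit [5,7,8] 32768) (.hit [0,1,4] 32768)) (.hit [3,5,6]
      32768)) (.hit [0,1,2] 32768)) (.kid (.branch 3 0 3 (.branch 4 0 3 (.branch 5 0 2 (.hit [5,7,8]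
      32768) (.hit [4,6,7] 32768)) (.hit [3,5,6] 32768)) (.hit [2,4,5] 32768)) (.hit [0,3,4]
      32768)))) (.hit [0,1,3] 32768)) (.hit [0,1,2] 32768))]
  special := [
    ⟨[594], ((false, 0, false), (false, 0, false)), .branch 1 2 0 (.branch 0 1 3 (.hit [0,2,4] 594)
      (.hit [0,1,3] 594)) (.branch 0 1 3 (.hit [0,2,3] 594) (.hit [0,1,2] 594))⟩,
    ⟨[594], ((false, 0, false), (false, 0, false)), .branch 2 1 2 (.branch 1 0 1 (.hit [1,3,4] 594)
      (.hit [0,2,3] 594)) (.branch 1 0 1 (.hit [1,2,3] 594) (.hit [0,1,2] 594))⟩,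
    ⟨[2147], ((false, 0, false), (false, 1, false)), .branch 0 0 0 (.descend [0,1,2]) (.branch 0 1 0
      (.descend [0,2,3]) (.branch 1 1 0 (.descend [0,1,2]) (.branch 1 2 0 (.descend [0,1,3])
      (.branch 2 2 0 (.branch 2 4 0 (.branch 1 4 0 (.descend [0,1,3]) (.hit [0,1,2] 2147)) (.hit
      [0,1,2] 2147)) (.branch 2 3 0 (.branch 1 3 0 (.descend [0,1,3]) (.hit [0,1,2] 2147)) (.branch
      3 0 0 (.hit [0,1,2] 2147) (.branch 3 1 0 (.hit [0,1,2] 2147) (.branch 3 2 0 (.hit [0,1,2]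
      2147) (.branch 3 3 0 (.hit [0,1,2] 2147) (.hit [0,1,2] 2147))))))))))⟩,
    ⟨[16945], ((true, 0, false), (true, 1, false)), .branch 0 0 2 (.descend [0,1,2]) (.branch 1 0 2
      (.descend [1,2,3]) (.branch 1 1 2 (.descend [0,1,2]) (.branch 2 1 2 (.descend [0,2,3])
      (.branch 2 2 2 (.branch 4 2 2 (.branch 4 1 2 (.descend [0,4,5]) (.hit [0,1,4] 16945)) (.hit
      [0,1,2] 16945)) (.branch 3 2 2 (.branch 3 1 2 (.descend [0,3,4]) (.hit [0,1,3] 16945))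
      (.branch 0 3 2 (.hit [1,2,3] 16945) (.branch 1 3 2 (.hit [0,2,3] 16945) (.branch 2 3 2 (.hit
      [0,1,3] 16945) (.branch 3 3 2 (.hit [0,1,2] 16945) (.hit [0,1,2] 16945))))))))))⟩,
    ⟨[19008], ((false, 0, false), (false, 0, false)), .branch 1 2 3 (.branch 3 4 0 (.hit [0,1,3]
      19008) (.hit [0,1,3] 19008)) (.branch 2 3 0 (.hit [0,1,2] 19008) (.hit [0,1,2] 19008))⟩,
    ⟨[19008], ((false, 0, false), (false, 0, false)), .branch 2 1 1 (.branch 4 3 2 (.hit [0,2,4]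
      19008) (.hit [0,2,3] 19008)) (.branch 3 2 2 (.hit [0,1,3] 19008) (.hit [0,1,2] 19008))⟩,
    ⟨[34915], ((false, 0, false), (false, 1, false)), .branch 0 0 0 (.descend [0,1,2]) (.branch 0 1
      0 (.descend [0,2,3]) (.branch 1 1 0 (.descend [0,1,2]) (.branch 1 2 0 (.descend [0,1,3])
      (.branch 2 3 3 (.branch 1 3 0 (.descend [0,1,3]) (.branch 4 4 3 (.branch 1 4 0 (.descend
      [0,1,5]) (.hit [0,1,4] 34915)) (.hit [0,1,2] 34915))) (.branch 3 0 0 (.split [(3,4),(4,4)] 3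
      (.kid (.branch 1 4 0 (.descend [0,1,4]) (.hit [0,1,3] 34915)) (.kid (.branch 1 4 0 (.descend
      [0,1,5]) (.hit [0,1,4] 34915)) (.hit [0,1,2] 34915)))) (.branch 3 1 0 (.split [(3,4),(4,4)] 3
      (.kid (.branch 1 4 0 (.descend [0,1,4]) (.hit [0,1,3] 34915)) (.kid (.branch 1 4 0 (.descend
      [0,1,5]) (.hit [0,1,4] 34915)) (.hit [0,1,2] 34915)))) (.branch 3 2 0 (.split [(3,4),(4,4)] 3
      (.kid (.branch 1 4 0 (.descend [0,1,4]) (.hit [0,1,3] 34915)) (.kid (.branch 1 4 0 (.descend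
      [0,1,5]) (.hit [0,1,4] 34915)) (.hit [0,1,2] 34915)))) (.branch 3 3 3 (.branch 1 3 0 (.descend
      [0,1,4]) (.hit [0,1,3] 34915)) (.hit [0,1,2] 34915)))))))))⟩,
    ⟨[35906], ((true, 2, true), (true, 1, true)), .branch 3 3 3 (.descend [1,2,3]) (.branch 2 3 3
      (.descend [0,1,2]) (.branch 2 2 3 (.descend [1,2,3]) (.branch 1 2 3 (.descend [0,1,3])
      (.branch 1 1 3 (.branch 0 2 3 (.branch 1 4 3 (.descend [0,1,5]) (.hit [0,3,4] 35906)) (.hit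
      [1,2,3] 35906)) (.branch 0 1 3 (.branch 1 3 3 (.descend [0,1,4]) (.hit [0,2,3] 35906))
      (.branch 3 0 3 (.hit [0,1,2] 35906) (.branch 2 0 3 (.hit [0,1,3] 35906) (.branch 1 0 3 (.hit
      [0,2,3] 35906) (.branch 0 0 3 (.hit [1,2,3] 35906) (.hit [0,1,2] 35906))))))))))⟩,
    ⟨[35907], ((true, 2, true), (true, 1, true)), .branch 3 3 3 (.descend [1,2,3]) (.branch 2 3 3
      (.descend [0,1,2]) (.branch 2 2 3 (.descend [1,2,3]) (.branch 1 2 3 (.descend [0,1,3])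
      (.branch 0 1 0 (.branch 1 3 3 (.descend [0,1,4]) (.branch 0 0 0 (.branch 1 4 3 (.descend
      [0,1,5]) (.hit [0,3,4] 35907)) (.hit [0,2,3] 35907))) (.branch 3 0 3 (.split [(0,1),(0,0)] 0
      (.kid (.branch 1 4 3 (.descend [0,1,4]) (.hit [0,2,3] 35907)) (.kid (.branch 1 4 3 (.descend
      [0,1,4]) (.hit [0,2,3] 35907)) (.hit [0,1,2] 35907)))) (.branch 2 0 3 (.split [(0,1),(0,0)] 0
      (.kid (.branch 1 4 3 (.descend [0,1,5]) (.hit [0,2,4] 35907)) (.kid (.branch 1 4 3 (.descend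
      [0,1,5]) (.hit [0,2,4] 35907)) (.hit [0,1,3] 35907)))) (.branch 1 0 3 (.split [(0,1),(0,0)] 0
      (.kid (.branch 1 4 3 (.descend [0,1,5]) (.hit [0,3,4] 35907)) (.kid (.branch 1 4 3 (.descend
      [0,1,5]) (.hit [0,3,4] 35907)) (.hit [0,2,3] 35907)))) (.branch 0 0 0 (.branch 1 3 3 (.descend
      [0,1,4]) (.hit [0,2,3] 35907)) (.hit [0,1,2] 35907)))))))))⟩,
    ⟨[49713], ((true, 0, false), (true, 1, false)), .branch 0 0 2 (.descend [0,1,2]) (.branch 1 0 2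
      (.descend [1,2,3]) (.branch 1 1 2 (.descend [0,1,2]) (.branch 2 1 2 (.descend [0,2,3])
      (.branch 3 2 1 (.branch 3 1 2 (.descend [0,3,4]) (.branch 4 4 1 (.branch 4 1 2 (.descend
      [0,4,5]) (.hit [0,1,4] 49713)) (.hit [0,1,3] 49713))) (.branch 0 3 2 (.split [(4,3),(4,4)] 1
      (.kid (.branch 4 1 2 (.descend [1,4,5]) (.hit [1,2,4] 49713)) (.kid (.branch 4 1 2 (.descend
      [1,4,5]) (.hit [1,2,4] 49713)) (.hit [1,2,3] 49713)))) (.branch 1 3 2 (.split [(4,3),(4,4)] 1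
      (.kid (.branch 4 1 2 (.descend [0,4,5]) (.hit [0,2,4] 49713)) (.kid (.branch 4 1 2 (.descend
      [0,4,5]) (.hit [0,2,4] 49713)) (.hit [0,2,3] 49713)))) (.branch 2 3 2 (.split [(4,3),(4,4)] 1
      (.kid (.branch 4 1 2 (.descend [0,4,5]) (.hit [0,1,4] 49713)) (.kid (.branch 4 1 2 (.descend
      [0,4,5]) (.hit [0,1,4] 49713)) (.hit [0,1,3] 49713)))) (.branch 3 3 1 (.branch 3 1 2 (.descend
      [0,3,4]) (.hit [0,1,3] 49713)) (.hit [0,1,2] 49713)))))))))⟩,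
    ⟨[50704], ((false, 2, true), (false, 1, true)), .branch 3 3 1 (.descend [1,2,3]) (.branch 3 2 1
      (.descend [0,1,3]) (.branch 2 2 1 (.descend [1,2,3]) (.branch 2 1 1 (.descend [0,2,3])
      (.branch 1 1 1 (.branch 2 0 1 (.branch 4 1 1 (.descend [2,4,5]) (.hit [2,3,4] 50704)) (.hit
      [1,2,3] 50704)) (.branch 1 0 1 (.branch 3 1 1 (.descend [1,3,4]) (.hit [1,2,3] 50704))
      (.branch 0 3 1 (.hit [1,2,3] 50704) (.branch 0 2 1 (.hit [1,2,3] 50704) (.branch 0 1 1 (.hit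
      [1,2,3] 50704) (.branch 0 0 1 (.hit [1,2,3] 50704) (.hit [0,1,2] 50704))))))))))⟩,
    ⟨[50705], ((false, 2, true), (false, 1, true)), .branch 3 3 1 (.descend [1,2,3]) (.branch 3 2 1
      (.descend [0,1,3]) (.branch 2 2 1 (.descend [1,2,3]) (.branch 2 1 1 (.descend [0,2,3])
      (.branch 1 0 2 (.branch 3 1 1 (.descend [1,3,4]) (.branch 0 0 2 (.branch 4 1 1 (.descend
      [0,4,5]) (.hit [0,3,4] 50705)) (.hit [1,2,3] 50705))) (.branch 0 3 1 (.split [(1,0),(0,0)] 2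
      (.kid (.branch 4 1 1 (.descend [1,4,5]) (.hit [1,3,4] 50705)) (.kid (.branch 4 1 1 (.descend
      [0,4,5]) (.hit [0,3,4] 50705)) (.hit [1,2,3] 50705)))) (.branch 0 2 1 (.split [(1,0),(0,0)] 2
      (.kid (.branch 4 1 1 (.descend [1,4,5]) (.hit [1,3,4] 50705)) (.kid (.branch 4 1 1 (.descend
      [0,4,5]) (.hit [0,3,4] 50705)) (.hit [1,2,3] 50705)))) (.branch 0 1 1 (.split [(1,0),(0,0)] 2
      (.kid (.branch 4 1 1 (.descend [1,4,5]) (.hit [1,3,4] 50705)) (.kid (.branch 4 1 1 (.descend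
      [0,4,5]) (.hit [0,3,4] 50705)) (.hit [1,2,3] 50705)))) (.branch 0 0 2 (.branch 3 1 1 (.descend
      [0,3,4]) (.hit [0,2,3] 50705)) (.hit [0,1,2] 50705)))))))))⟩]
  -- The links that start at 0 show that the unshaded pattern 123 leads to several shadings at once,
  -- for instance 2147 with its five cells 0, 1, 5, 6 and 11.
  links := [
    ⟨820, 358, 820, [], 0, [[]]⟩, ⟨358, 820, 358, [], 1, [[]]⟩, ⟨956, 494, 956, [], 0, [[]]⟩,
    ⟨494, 956, 2542, [11], 1, [[11]]⟩, ⟨0, 2147, 0, [], 2, [[]]⟩, ⟨13108, 12646, 29492, [14], 0,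
    [[14]]⟩, ⟨12646, 13108, 12646, [], 1, [[]]⟩, ⟨0, 16945, 0, [], 3, [[]]⟩, ⟨26240, 11456,
    26240, [], 4, [[]]⟩, ⟨11456, 26240, 11456, [], 5, [[]]⟩, ⟨26241, 11457, 26241, [], 4, [[]]⟩,
    ⟨11457, 26241, 11457, [], 5, [[]]⟩, ⟨26252, 11468, 26252, [], 4, [[]]⟩, ⟨11468, 26252, 11470,
    [1], 5, [[1]]⟩, ⟨26253, 11469, 26253, [], 4, [[]]⟩, ⟨11469, 26253, 11471, [1], 5, [[1]]⟩,
    ⟨30592, 15808, 30608, [4], 4, [[4]]⟩, ⟨15808, 30592, 15808, [], 5, [[]]⟩, ⟨30593, 15809,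
    30609, [4], 4, [[4]]⟩, ⟨15809, 30593, 15809, [], 5, [[]]⟩, ⟨30622, 15838, 30622, [], 4,
    [[]]⟩, ⟨15838, 30622, 15838, [], 5, [[]]⟩, ⟨30623, 15839, 30623, [], 4, [[]]⟩, ⟨15839, 30623,
    15839, [], 5, [[]]⟩, ⟨31676, 31214, 31676, [], 0, [[]]⟩, ⟨31214, 31676, 31214, [], 1, [[]]⟩,
    ⟨33588, 33126, 33588, [], 0, [[]]⟩, ⟨33126, 33588, 33126, [], 1, [[]]⟩, ⟨33724, 33262, 33724,
    [], 0, [[]]⟩, ⟨33262, 33724, 35310, [11], 1, [[11]]⟩, ⟨0, 34915, 0, [], 6, [[]]⟩, ⟨0, 35906,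
    0, [], 7, [[]]⟩, ⟨0, 35907, 0, [], 8, [[]]⟩, ⟨45876, 45414, 62260, [14], 0, [[14]]⟩, ⟨45414,
    45876, 45414, [], 1, [[]]⟩, ⟨0, 49713, 0, [], 9, [[]]⟩, ⟨0, 50704, 0, [], 10, [[]]⟩, ⟨0,
    50705, 0, [], 11, [[]]⟩, ⟨64444, 63982, 64444, [], 0, [[]]⟩, ⟨63982, 64444, 63982, [], 1,
    [[]]⟩]
  ops := [
    5, 10, 6, 15, 0, 9, 1, 14, 11, 4, 5, 10, 0, 15, 6, 9, 1, 11, 5, 0, 15, 14, 4, 22, 14, 6, 5,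
    4, 0, 1, 10, 5, 25, 11, 9, 5, 1, 0, 4, 10, 5, 17, 9, 1, 0, 14, 20, 6, 4, 0, 11, 22, 4, 6, 10,
    15, 5, 10, 11, 14, 25, 1, 9, 10, 15, 5, 10, 11, 14, 27, 9, 11, 15, 4, 30, 6, 14, 15, 1, 17,
    5, 1, 0, 20, 5, 4, 0, 27, 10, 11, 15, 30, 10, 14, 15, 22, 5, 6, 10, 11, 15, 25, 5, 9, 10, 14,
    15, 22, 10, 6, 5, 0, 1, 25, 10, 9, 5, 0, 4, 17, 10, 1, 30, 5, 14, 20, 10, 4, 27, 5, 11, 17,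
    9, 1, 20, 6, 4, 17, 27, 9, 1, 11, 0, 15, 20, 30, 6, 4, 14, 0, 15, 17, 25, 5, 1, 11, 9, 0, 17,
    9, 1, 20, 22, 5, 4, 14, 6, 0, 20, 6, 4, 17, 20, 5, 1, 4, 27, 30, 10, 11, 14, 15]
  -- To return from a shading to 0 it suffices to remove its cells one after another; in the other
  -- direction a step such as 2163 = 16 + 2147 quotes a link.
  jumps := [
    (394, 392, [1], [11,9,1,9,11]), (820, 358, [374], [836]), (956, 494, [510], [972]), (1418,
    392, [1,10], [11,9,10,1,9,11]), (2147, 0, [0,1,5,6,11], [2163]), (12308, 12292, [4],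
    [14,6,4,6,14]), (13108, 12646, [12662], [13124]), (13332, 12292, [4,10], [14,6,10,4,6,14]),
    (16945, 0, [0,4,5,9,14], [16961]), (26240, 11456, [11472], [26256]), (26241, 11457, [11473],
    [26257]), (26252, 11468, [11484], [26268]), (26253, 11469, [11485], [26269]), (30592, 15808,
    [15824], [30608]), (30593, 15809, [15825], [30609]), (30622, 15838, [15854], [30638]),
    (30623, 15839, [15855], [30639]), (31676, 31214, [31230], [31692]), (33162, 33160, [1],
    [11,9,1,9,11]), (33588, 33126, [33142], [33604]), (33724, 33262, [33278], [33740]), (34186,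
    33160, [1,10], [11,9,10,1,9,11]), (34915, 0, [0,1,5,6,11,15], [34931]), (35906, 0,
    [1,6,10,11,15], [35922]), (35907, 0, [0,1,6,10,11,15], [35923]), (45076, 45060, [4],
    [14,6,4,6,14]), (45876, 45414, [45430], [45892]), (46100, 45060, [4,10], [14,6,10,4,6,14]),
    (49713, 0, [0,4,5,9,14,15], [49729]), (50704, 0, [4,9,10,14,15], [50720]), (50705, 0,
    [0,4,9,10,14,15], [50721]), (64444, 63982, [63998], [64460])]

theorem distributed_123 : Distributed 3 (nth [0, 1, 2]) representatives123 33516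
    [23908, 6116, 132, 1961, 16, 172, 0] :=
  Certificate.check_sound pairsSound_pairRules certificate123 (by decide +kernel)

/-- The chosen representatives of the classes for the pattern `132`. -/
def representatives132 : ℕ :=
  0xeeeeaaaacccc1ffffefebafadcfc11ffffeebfaadfcc1f1f0000000000000000eeeeaaaaffff3ffffefebafaffff33ffffeebfaaffff3f3ffffe0000ffff0000eeeeffffcccc5ffffefeffffdcfc55ffffeeffffdfcc5f5ffffeffff00000000eeeeaaaacccc1ffffefebafadcfc11ffffeebfaadfcc1f1ffffebbbadddc0000eeeeaaaacccc1fff00f000f000f000f0ffeebfaadfcc1f1f00f000b000d00010eeeeaaaaffff3fff00f000f0fefe00f0ffeebfaaffff3f3ffffe00b0ffff0030000000000c0c0c0c0030303000000000000000000c0c0c0c3030303000000000000000000c0c08080030003000000000000000000c0c0c083030202000000000eeeeaaaacccc1ffffefebafadcfc11ff0f000f000f000f000f000b000d000100eeeeaaaaffff3ffffefebafaffff33ff0f000f00ffee0f00fffe0b00ffff0300eeeeffffcccc5ffffefeffffdcfc55ff0f00ffee0f000f00fffeffff0d000500eeeeaaaacccc1ffffefebafadcfc11ff0f000f000f000f0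0ffeebbaadd8c01000000aaaacccc0eee00f0bafadcfc10fe0f00bfaadfcc1f0efffebbbadddc111100000000eeee2aaa00f000f0fefe32fa0f000f00ffee3f2afffebbbaffff33330000000000000c0c0000303000000000000000000c000c0c000030300000000000000000000000000000000000000000000000000c0008000000000000000000eeeeaaaaffff3ffffefebafaffff33ffffeebfaaffff3f3f0000000000000000eeeeaaaaffff3ffffefebafaffff33ffffeebfaaffff3f3ffffe0000ffff0000ffffffffffffffffffffffffffffffffffffffffffffffffffffffff00000000eeeeaaaaffff3ffffefebafaffff33ffffeebfaaffff3f3ffffebbbafffc0000eeeeaaaaffff3fff00f000f000f000f0ffeebfaaffff3f3f00f000b000f00030eeeeaaaaffff3fff00f000f0fefe00f0ffeebfaaffff3f3ffffe00b0ffff0030ffffffffffffffff00f0ffff00f000f0ffffffffffffffffffffffff00f000f0000000000c0c08080030003000000000000000000c0c0c083030202000000000eeeeaaaaffff3ffffefebafaffff33ff0f000f000f000f000f000b000f000300eeeeaaaaffff3ffffefebafaffff33ff0f000f00ffee0f00fffe0b00ffff0300ffffffffffffffffffffffffffffffff0f00ffff0f000f00ffffffff0f000f00eeeeaaaaffff3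ffffefebafaffff33ff0f000f000f000f00ffeebbaafffc03000000aaaaeeee3fff00f0bafafefe33ff0f00bfaaffee3f3ffffebbbaffff333300000000eeee2aaa00f000f0fefe32fa0f000f00ffee3f2afffebbbaffff33330000ffff0000ffff00f0ffff00f0ffff0f00ffff0f00ffffffffffffffffffff00000000000000000000000000000000000000000c0008000000000000000000eeeeffffcccc5ffffefeffffdcfc55ffffeeffffdfcc5f5f0000000000000000ffffffffffffffffffffffffffffffffffffffffffffffffffff0000ffff00000c0c0c0c0c0c0c0cfefeffff0c0c040c0c0c0c0c0c0c0c0c3ffcfffe000000000c0c0c0c0c0c0c0cfefeffff0c0c040c0c0c0c0c0c0c0c0cfffefffa0c0c0000eeeeffffcccc5fff00f000f000f000f0ffeeffffdfcc5f5f00f000f000d00050ffffffffffffffff00f000f0ffff00f0ffffffffffffffffffff00f0ffff00f00c0c0c0c0c0c0c0c00f0fefe000000000c0c0c0c0c0c0c0cfffeffff000000000c0c0c0c0c0c0c0c00f000f0000000000c0c0c0c0c0c0c0cfefefafa0c0c0000eeeeffffcccc5ffffefeffffdcfc55ff0f000f000f000f000f000f000d000500ffffffffffffffffffffffffffffffff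0f000f00ffff0f00ffff0f00ffff0f000c0c0c0c0c0c0c0cfefeffff0c0c040c0c000c0c0c000c000f0cfffe0c0004000c0c0c0c0c0c0c0cfefeffff0c0c040c0c000c000c000c000f0c0f080c0c04000000eeeecccc5fff00f0fefedcfc55ff0f00ffeedfcc5f5ffffeffffdddc555500000000ffffffff00f000f0ffffffff0f000f00ffffffffffffffffffffffff00000c0c00000c0c0000fefe0000040c0c000c0c0c000c0c0f0cfffe0c0c0404000000000000000000000000000000000c000c000c000c000e0c0a080c0c0000eeeeaaaacccc1ffffefebafadcfc11ffffeebfaadfcc1f1f0000000000000000eeeeaaaaffff3ffffefebafaffff33ffffeebfaaffff3f3ffffe0000ffff00000c0c0c0c0c0c0c0cfefeffff0c0c040c0c0c0c0c0c0c0c0cfffeffff000000000c0c08080c0c0c0cfefebafa0c0c00000c0c0c080c0c0c0cfefe2ab80c0c0000eeeeaaaacccc1fff00f000f000f000f0ffeebfaadfcc1f1f00f000b000d00010eeeeaaaaffff3fff00f000f0fefe00f0ffeebfaaffff3f3ffffe00b0ffff0030eeeeffffcccc5fff00f0fefe00f000f0ffeeffffdfcc5f5ffffeffff00d000500c0c0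8080c0c0c0c00f000f0000000000c0c0c080c0c0c0cfefebaba0c0c0000eeeeaaaacccc1ffffefebafadcfc11ff0f000f000f000f000f000b000d000100eeeeaaaaffff3ffffefebafaffff33ff0f000f00ffee0f00fffe0b00ffff0300eeeeffffcccc5ffffefeffff0cfc04fc0f00ffee0f000f00fffeffff0c0004000c0c08080c0c0c0cfefebafa0c0c00000c000c000c000c000e0c0a080c0c00000000aaaacccc0eee00f0bafadcfc10fe0f00bfaadfcc1f0efffebbbadddc111100000000eeee2aaa00f000f0fefe32fa0f000f00ffee3f2afffebbbaffff33330000eeee00004ccc00f0fefe00f054fc0f00ffee0f005f4cfffeffffdddc5555000000000000000000000000000000000c0008000c000c000e0c0a080c0c0000eeeeaaaacccc1ffffefebafadcfc11ffffeebfaadfcc1f1f00f000b000d00010eeeeaaaaffff3ffffefebafaffff33ffffeebfaaffff3f3ffffe00b0ffff0030eeeeffffcccc5ffffefeffffdcfc55ffffeeffffdfcc5f5ffffeffff00000000eeeeaaaacccc1ffffefebafadcfc11ffffeebfaadfcc1f1ffffebbbadddc000020202020cccc0aba003000300030003030202020dfcc1f0a003000200010000020202020fefe2aba0030003030300030302020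20fffe3f2a303000203030000020203030cccc5fff003030300030003030203030dfcc5f5f303030300010001020202020cccc0aba003000300030003030202020dfcc1f0a3030202010100000eeeeaaaacccc1ffffefebafadcfc11ffffeebfaadfcc1f1ffffebbbadddc1111eeeeaaaaffff3ffffefebafaffff33ffffeebfaaffff3f3ffffebbbaffff3333eeeeffffcccc5ffffefeffffdcfc55ffffeeffff0f0c0f0cfffeffff0d0c0504eeeeaaaacccc1ffffefebafadcfc11ffffeebfaadfcc0f00ffeebbaaddcc010000202020cccc0aba003020301030003020202020dfcc1f0a303020201010000000200020eefe2aba003000303030003030202020fffe3f2a30302020303000000020203000004ccc0030303000301030302030300f0c5f4c303030301010101000200020000000000020002000000030202020200c0c0a002020202000000000eeeeaaaaffff3ffffefebafaffff33ffffeebfaaffff3f3f00f000b000f00030eeeeaaaaffff3ffffefebafaffff33ffffeebfaaffff3f3ffffe00b0ffff0030ffffffffffffffffffffffffffffffffffffffffffffffffffffffff00f000f0eeeeaaaaffff3ffffefebafaffff33ffffeebfaaffff3f3ffffebbbafffc000020202020fefe2aba003000300030003030202020fffe3f2a003000200030000020202020fefe2aba003000303030003030202020fffe3f2a3030002030300000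ffffffffffffffff00f030f000f000f0ffffffffffffffff30f030f000f000f020202020fefe2aba003000300030003030202020fffe3f2a3030202030300000eeeeaaaaffff3ffffefebafaffff33ffffeebfaaffff3f3ffffebbbaffff3333eeeeaaaaffff3ffffefebafaffff33ffffeebfaaffff3f3ffffebbbaffff3333ffffffffffffffffffffffffffffffffffffffffffffffffffffffffffffffffeeeeaaaaffff3ffffefebafaffff33ffffeebfaafffc0f00fffebbaafffc030000e0aaaaeefe3fff00f0bafa30f000f0ffeebfaaffff3f3ffefebbba30f0003000200020eefe2aba003000303030003030202020fffe3f2a303020203030000000f0ffff00f0ffff00f0fafa00f0f3fffffffffffffffffffefefffafffff3f300200020000000000020002000300030202020200e0c0a002020202030300000000000000c0c0c0c3030303000000000000000000c0c0c0c0030003000000000ffffffffffffffffffffffffffffffffffffffffffffffffffff00f0ffff00f00c0c0c0c0c0c0c0cfefeffff0c0c040c0c0c0c0c0c0c0c0c30f030f000000000eeeeffffcccc5ffffefeffffdcfc55ffffeeffffdfcc5f5ffffefffadddc000020203030cccc5fff003000300030003030203030dfcc5f5f0030003000100010ffffffffffffffff00f000f0fefe00f0fffffffffffffffffffe00f0f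fff00f0eeeeffffcccc5fff00f030f000f000f0ffeeffffdfcc5f5f30f030f000d00050eeeeffffcccc5fff00f000f000f000f0ffeeffffdfcc5f5ffefefafadcdc0050eeeeffffcccc5ffffefeffff0cfc04fcffeeffffdfcc5f5ffffeffff00d00050ffffffffffffffffffffffffffffffffffffffffffffffffffffffffffffffffeeeeffffcccc5ffffefeffff0cfc04fcffeeffff0f0c0f0cfffeffff0c0c0404eeeeffffcccc5ffffefeffffdcfc55ffffeeffba0f0c0f00fffeffbaddcc050000e0eefecccc5fff00f0fafa10f010f0ffeeffffdfcc5f5ffefefbfa10d0105000f000f0ffffffff00f000f0fefef2fafffffffffffffffffffefbfafffff3f300e0eefe00004ccc00f0fafa00f050fcffeeffff0f0c5f4cfefefffadddc515100e000b00000000000f000b000c000f0eeeebfba0c0c0f00fefebabacccc5151000000000c0c08083030203000000000000000000c0c0c080030002000000000000000000c0c08083030203000000000000000000c0c0c0830300020000000000c0c0c0c0c0c0c0cfefefafa080c000c0c0c0c0c0c0c0c0c30f030f0000000000c0c08080c0c0c0cfefebafa0c0c00000c0c0c080c0c0c0cfefe20b00c0c000020202020cccc0aba003000300030003030202020dfc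c1f0a003000200010000020202020fefe2aba003000303030003030202020fffe3f2a3030002030300000eeeeffffcccc5fff00f030f000f000f0ffeeffffdfcc5f5f30f030f000d00050eeeeaaaacccc1fff00f000f000f000f0ffeebfaadfcc1f1ffefe20b0dcdc0010eeeeaaaacccc1ffffefebafa0cfc00fcffeebfaadfcc1f1ffefebbba00d00010eeeeaaaaffff3ffffefebafafcfc00f0ffeebfaafffe3f3afefebabafcfc0030eeeeffffcccc5ffffefefafe0cfc00fcffeeffffdfcc5f5ffefefffa0cdc0050eeeeaaaacccc1ffffefebafadcfc00f0ffeebfaa0f0c0f00feeebaaadccc000000e0aaaacccc0efe00f0bafa10f000f0ffeebfaadfcc1f1ffefebbba10d0001000e000a0eefe2afa00f000f0fcfc00f0ffeebfaafffe3f3afefebabafcfc003000e0eefe00c04cfc00f0fafa00f050fcffeeffffdfcc5f5ffefefffadddc515100e000a00000000000e000a000c000f0eeeeaaaa0c0c0f00eeeeaaaacccc1111eeeeaaaacccc1ffffefebafadcfc11ffffeebfaadfcc1f1f0f000b000d000100eeeeaaaaffff3ffffefebafaffff33ffffeebfaaffff3f3ffffe0b00ffff0300eeeeffffcccc5ffff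efeffffdcfc55ffffeeffffdfcc5f5ffffeffff0c000400eeeeaaaacccc1ffffefebafadcfc11ffffeebfaadfcc1f1ffffebbbadddc0000eeeeaaaacccc1ffffefebafadcfc11ffffeebfaadfcc1f1ffffebbbadddc1111eeeeaaaaffff3ffffefebafaffff33ffffeebfaaffff3f3ffffebbbaffff3333eeeeffffcccc5ffffefeffff0cfc04fcffeeffffdfcc5f5ffffeffff0cdc0454eeeeaaaacccc1ffffefebafadcfc00f0ffeebfaadfcc1f1ffefebabadcdc0010eeeeaaaacccc1ffffefebafadcfc11ff0f000f000f000f000f000b000d000100eeeeaaaaffff3ffffefebafaffff33ff0f000f00ffee0f00fffe0b00ffff0300eeeeffffcccc5ffffefeffffdcfc55ff0f00ffaa0f000f00ffaaffba0d000500eeeeaaaacccc1ffffefebafadcfc11ff0f000f000f000f00ffaebbaadd8c01000e00aaaacccc0feefefebafadcfc11ff0f00bfaadfcc1f0efffebbbadddc11110e000a00efee2faafefebafaffff33ff0f000f00ffee3f2afffebbbaffff3333000000000c000c0c0000303000000000000000000c000c0c0000303000000000000000000c0000000000000000000000000000000c0008000000000000000000eeeeaaaaffff3ffffefebafaffff3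3ffffeebfaaffff3f3f0f000b000f000300eeeeaaaaffff3ffffefebafaffff33ffffeebfaaffff3f3ffffe0b00ffff0300ffffffffffffffffffffffffffffffffffffffffffffffffffffffff0f000f00eeeeaaaaffff3ffffefebafaffff33ffffeebfaaffff3f3ffffebbbafffc0000eeeeaaaaffff3ffffefebafaffff33ffffeebfaaffff3f3ffffebbbaffff3333eeeeaaaaffff3ffffefebafaffff33ffffeebfaaffff3f3ffffebbbaffff3333ffffffffffffffffffffffffffffffffffffffffffffffffffffffffffffffffeeeeaaaaffff3ffffefebafafcfc00f0ffeebfaaffff3f3ffefebabafcfc0030eeeeaaaaffff3ffffefebafaffff33ff0f000f000f000f000f000b000f000300eeeeaaaaffff3ffffefebafaffff33ff0f000f00ffee0f00fffe0b00ffff0300ffffffffffffffffffffffffffffffff0f00ffba0f000f00ffbafffa0f000f00eeeeaaaaffff3ffffefebafaffff33ff0f000f000f000f00ffeebbaafffc03000e00aaaaefee3ffffefebafaffff33ff0f00bfaaffee3f3ffffebbbaffff33330e000a00efee2faafefebafaffff33ff0f000f00ffee3f2afffebbbaffff33330f00ffff0f00ffffbfbaffffffffffff0f00ffff0f00ffff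ffbaffffffffffff000000000c0000000000000000000000000000000c0008000000000000000000eeeeffffcccc5ffffefeffffdcfc55ffffeeffffdfcc5f5f0f000f000d000500ffffffffffffffffffffffffffffffffffffffffffffffffffff0f00ffff0f000c0c0c0c0c0c0c0cfefeffff0c0c040c0c0c0c0c0c0c0c0cfffeffff0c000400eeeeffffcccc5ffffefeffffdcfc04fcffeeffffdfcc5f5ffffefffadcdc0000eeeeffffcccc5ffffefeffffdcfc55ffffeeffffdfcc5f5ffffeffffdddc5555ffffffffffffffffffffffffffffffffffffffffffffffffffffffffffffffffeeeeffffcccc5ffffefeffff0cfc04fcffeeffffdfcc5f5ffffeffff0cdc0454eeeeffffcccc5ffffefefafadcfc00f0ffeeffffdfcc5f5ffefefafadcdc0050eeeeffffcccc5ffffefeffffdcfc55ff0f000f000f000f000f000f000d000500ffffffffffffffffffffffffffffffff0f000f00ffff0f00ffff0f00ffff0f000c080c0c0c0c0c0c0e0cfffe0c0c040c0c000c080c000c000f08fffa0c0004000c0c0c0c0c0c0c0cfefefffe0c0c040c0c000c000c000c000f0c0f080c0c04000e00efeecccc5ffffefeffffdcfc55ff0f00ffeedfcc5f5ffffeffff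dddc55550f000f00ffffffffffffffffffffffff0f000f00ffffffffffffffffffffffff0c000c0c0c000c0c0e08fffe0c0c040c0c000c0c0c000c0c0f08fffe0c0c04040c0008000c000c000e0c0a080c0c00000c000c000c000c000e0c0a080c0c0000eeeeaaaacccc1ffffefebafadcfc11ffffeebfaadfcc1f1f0f000b000d000100eeeeaaaaffff3ffffefebafaffff33ffffeebfaaffff3f3ffffe0b00ffff03000c0c0c0c0c0c0c0cfefeffff0c0c040c0c0c0c0c0c0c0c0cfffeffff0c0004000c0c08080c0c0c0cfefebafa0c0c00000c0c0c080c0c0c0cfefebaba0c0c0000eeeeaaaacccc1ffffefebafadcfc11ffffeebfaadfcc1f1ffffebbbadddc1111eeeeaaaaffff3ffffefebafaffff33ffffeebfaaffff3f3ffffebbbaffff3333eeeeffffcccc5ffffefeffffdcfc55ffffeeffffdfcc5f5ffffeffffdddc5555eeeeaaaacccc1ffffefebafadcfc00f0ffeebfaadfcc1f1ffefebabadcdc0010eeeeaaaacccc1ffffefebafadcfc11ff0f000f000f000f000f000b000d000100eeeeaaaaffff3ffffefebafaffff33ff0f000f00ffee0f00fffe0b00ffff03000c0c0c0c0c0c0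c0c0e0cfffe0c0c040c0c000c0c0c000c000f0cfffe0c0004000c0808080c0c00000e0c0a080c0c00000c0008000c000c000e080a080c0c00000e00aaaacccc0feefefebafadcfc11ff0f00bfaadfcc1f0efffebbbadddc11110e000a00efee2faafefebafaffff33ff0f000f00ffee3f2afffebbbaffff33330e00efee0c004fccfefeffffdcfc55ff0f00ffee0f005f4cfffeffffdddc55550c0008000c0000000e080a080c0c00000c0008000c000c000e080a080c0c0000eeeeaaaacccc1ffffefebafadcfc11ffffeebfaadfcc1f1f0000000000000000eeeeaaaaffff3ffffefebafaffff33ffffeebfaaffff3f3ffffe0000fffc0000eeeeffffcccc5ffffefeffffdcfc55ffffeeffffdfcc5f5f3f303f3000000000eeeeaaaacccc1ffffefebafadcfc11ffffeebfaadfcc1f1ffffebbbadddc000020202020cccc0aba003000300030003030202020dfcc1f0a0030002000100000eeeeaaaaffff3fff00f000f0fcfc00f0ffeebfaaffff3f3ffefe00b0fffc0030eeeeffffcccc5fff00b030f000f000f0ffeeffffdfcc5f5f30f030f000d00050eeeeaaaacccc1fff00f000f000f000f0ffeebfaadfcc1f1ffefebabadcdc0010eeeeaaaacccc1ffffefeb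afadcfc11ff0f000f000f000f000f000b000d000100eeeeaaaaffff3ffffefebafaffff33ff0f000f00ffec0f00fffe0b00fffc0300eeeeffffcccc5ffffefeffffdcfc55ff0f003f200f000f003f303f300d000500eeeeaaaacccc1ffffefebafadcfc11ff0f000f000f000f00ffeebbaaddcc0100000020200c000aa80030203010300030000020201f001f08202020201010000000000000eeec2aa8003000303030003000000000ffec3f2830302020303000000000202000004ccc0030303000301030000030200f005f4c303030301010101000000000000000000020002000000030000000000c000a002020202000000000eeeeaaaaffff3ffffefebafaffff33ffffeebfaaffff3f3f0000000000000000eeeeaaaaffff3ffffefebafaffff33ffffeebfaaffff3f3fbffa0000fffc0000ffffffffffffffffffffffffffffffffffffffffffffffff3f303f3000000000eeeeaaaaffff3ffffefebafaffff33ffffeebfaaffff3f3ffffe2a20fffc000020202020fefe2aba003000300030003030202020fffe3f2a003000200030000020202020fefe2aba003000303030003030202020fffe3f2a3030002030300000ffffffffffffffff00b030f000f000f0ffffffffffffffff30f030f000f000f0eeeeaaaaffff3fff00b000b000f000f0ffeebfaaffff3f3fbefa20b0fcfc0030eeeeaaaaffff3ffffefebafaffff33ff0f000f000f000f000f000b0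00f000300eeeeaaaaffff3ffffefebafaffff33ff0f000a003f200f00bfba0a00fffc0300ffffffffffffffffffffffffffffffff0f003f300f000f003f303f300f000f00eeeeaaaaffff3ffffefebafaffff33ff0f000a000f000f00ffee2a20fffc0300000020202e202aba0030203030300030000020203f203f2a3030202030300000000000002e2000200030003030300030000000003e200a0030302020303000000000ffff0000ffff00b0fafa00f0f3ff0f00ffff0f00ffffbebafbfafffff3f300000000000000000020002000300030000000000e000a002020202030300000000000000c0c0c0c3030303000000000000000000c0c0c0c0000000000000000fffffffffffffffffffffffffffffffffffffffffffffffffffe0000ffff00000c0c0c0c0c0c0c0cfefeffff0c0c040c0c0c0c0c0c0c0c0c3030303000000000eeeeffffcccc5ffffefeffffdcfc55ffffeeffffdfcc5f5ffffefffadddc000020203030cccc5fff003000300030003030203030dfcc5f5f0030003000100010ffffffffffffffff00f000f0fefe00f0fffffffffffffffffffe00f0ffff00f0eeeeffffcccc5fff00f030f000f000f0ffeeffffdfcc5f5f30f030f000d00050eeeeffffcccc5fff00f000f000f000f0ffeeffffdfcc5f5ffefefafadcdc0050000000000c000c0c0000303000000000000000000c000c000000000000000000fffefffefffffffffffefffe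ffffffff0f000f00fffe0f00fffe0f00ffff0f000c080c0c0c0c0c0c0e0cfffe0c0c040c0c000c000c000c000f003f300c000400eeeefffecccc5ffffefefffedcfc55ff0f000f000f000f00ffeeffbaddcc0500000020200c005ffc0030303010301030000030201f005f5c303030301010101000000000fffefffa00f000f0fefef2fa0f000f00fffefffafffefbfafffff3f30000eeee00004ccc00b0fafa00f050fc0f00ffee0f005f4cbebafbfadddc5151000000000000000000e000b000c000f00e000f000c000f00eeeebabacccc5151000000000c0c08082020203000000000000000000c0c0c080000000000000000000000000c0c08082020202000000000000000000c0c0c0820300000000000000c0c0c0c0c0c0c0caabebafa080c000c0c0c0c0c0c0c0c0c30303030000000000c0c08080c0c0c0caeaeaaaa0c0c00000c0c0c080c0c0c0caefa20200c0c000020202020cccc0aba003000300030003030202020dfcc1f0a003000200010000020202020fefe2aba003000303030003030202020fffe3f2a3030002030300000eeeeffffcccc5fff00b030f000f000f0ffeeffffdfcc5f5f30f030f000d00050eeeeaaaacccc1fff00b000b000f000f0ffeebfaadfcc1f1fbefa20b0dcdc0010000000000c0008080000203000000000000000000c000c000000000000000000000000000c0000000000000000000000000000000c00080000000000000000000c0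80c0c0c0c0c0c0e0cfafa0c0c000c0c000c000c000c000e003b300c0000000c0808080c0c00000e0c0a080c0c00000c0008000c000c000e080a000c0c0000000020200c000aa80030203010300030000020201f001f082020202010100000000000002e2000200030003030300030000000003e200a0030302020303000000000eeee00004ccc00b0fafa00f050fc0f00ffee0f005f4cbebafbfadddc5151000000000000000000a000a000c000f00e000a000c000f00aeaaaaaacccc1111

/-- The certificate for the pattern `132`. -/
def certificate132 : Certificate where
  rules := [
    (5, (false, 0, true), .branch 1 1 2 (.split [(1,2),(1,3)] 3 (.kid (.hit [0,1,2] 32) (.kid (.hit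
      [0,1,2] 32) (.descend [1,2,3])))) (.hit [0,1,2] 32)),
    (5, (false, 0, true), .branch 1 1 0 (.split [(2,1),(3,1)] 0 (.kid (.hit [0,1,2] 32) (.kid (.hit
      [0,1,3] 32) (.descend [1,2,3])))) (.hit [0,1,2] 32)),
    (5, (false, 2, false), .branch 2 1 0 (.descend [0,1,2]) (.branch 1 1 3 (.split [(1,3),(2,1)] 3
      (.kid (.branch 2 3 0 (.descend [0,1,2]) (.descend [0,1,2])) (.kid (.branch 2 4 1 (.branch 2 5
      1 (.branch 2 6 3 (.branch 3 6 0 (.descend [0,2,3]) (.descend [0,2,3])) (.descend [0,2,3]))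
      (.descend [0,2,3])) (.descend [0,1,2])) (.hit [1,2,3] 32)))) (.hit [0,1,2] 32))),
    (5, (false, 1, true), .branch 1 1 3 (.branch 4 1 0 (.split [(4,3),(4,4),(4,5)] 1 (.kid (.descend
      [0,4,5]) (.kid (.descend [0,4,5]) (.kid (.descend [0,4,5]) (.descend [0,3,4]))))) (.hit
      [1,2,3] 32)) (.hit [0,1,2] 32)),
    (5, (false, 0, true), .branch 1 1 2 (.split [(1,2),(1,3),(1,4)] 1 (.kid (.hit [0,1,2] 32) (.kid
      (.hit [0,1,2] 32) (.kid (.hit [0,1,2] 32) (.descend [1,2,3]))))) (.hit [0,1,2] 32)),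
    (5, (false, 0, false), .branch 0 2 3 (.branch 2 1 1 (.branch 2 5 2 (.split [(4,5),(6,4)] 2 (.kid
      (.hit [0,4,5] 32) (.kid (.branch 6 5 0 (.branch 7 5 2 (.hit [0,7,8] 32) (.hit [0,6,7] 32))
      (.hit [0,4,6] 32)) (.hit [0,2,4] 32)))) (.branch 2 2 3 (.hit [2,4,5] 32) (.hit [2,3,4] 32)))
      (.hit [1,2,3] 32)) (.branch 1 0 0 (.drop [0] 1 1 1 30 (.branch 1 1 3 (.branch 4 2 0 (.branch 5
      2 0 (.branch 6 2 0 (.branch 7 2 2 (.branch 7 3 2 (.hit [1,7,8] 32) (.hit [1,6,7] 32)) (.hit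
      [1,5,6] 32)) (.hit [1,4,5] 32)) (.hit [1,3,4] 32)) (.hit [1,2,3] 32)) (.branch 3 1 0 (.branch
      4 1 0 (.branch 5 1 0 (.branch 6 1 0 (.branch 7 1 2 (.branch 7 2 2 (.hit [0,7,8] 32) (.hit
      [0,6,7] 32)) (.hit [0,5,6] 32)) (.hit [0,4,5] 32)) (.hit [0,3,4] 32)) (.hit [0,2,3] 32)) (.hit
      [0,1,2] 32)))) (.branch 1 1 0 (.drop [0] 1 1 1 30 (.branch 1 1 3 (.branch 4 2 0 (.branch 5 2 0
      (.branch 6 2 0 (.branch 7 2 2 (.branch 7 3 2 (.hit [1,7,8] 32) (.hit [1,6,7] 32)) (.hit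
      [1,5,6] 32)) (.hit [1,4,5] 32)) (.hit [1,3,4] 32)) (.hit [1,2,3] 32)) (.branch 3 1 0 (.branch
      4 1 0 (.branch 5 1 0 (.branch 6 1 0 (.branch 7 1 2 (.branch 7 2 2 (.hit [0,7,8] 32) (.hit
      [0,6,7] 32)) (.hit [0,5,6] 32)) (.hit [0,4,5] 32)) (.hit [0,3,4] 32)) (.hit [0,2,3] 32)) (.hit
      [0,1,2] 32)))) (.branch 1 3 0 (.hit [0,2,3] 32) (.branch 2 0 0 (.hit [0,1,3] 32) (.branch 2 3
      0 (.hit [0,1,3] 32) (.branch 3 0 0 (.hit [0,1,2] 32) (.branch 3 2 0 (.hit [0,1,2] 32) (.branch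
      3 3 0 (.hit [0,1,2] 32) (.hit [0,1,2] 32)))))))))),
    (5, (false, 0, false), .branch 0 2 3 (.branch 2 1 1 (.branch 2 5 2 (.branch 6 4 0 (.branch 7 4 2
      (.branch 7 5 2 (.hit [0,7,8] 32) (.hit [0,6,7] 32)) (.hit [0,4,6] 32)) (.branch 4 5 1 (.branch
      4 5 0 (.branch 5 5 2 (.hit [0,5,7] 32) (.hit [0,4,6] 32)) (.hit [0,4,5] 32)) (.hit [0,2,4]
      32))) (.hit [2,3,4] 32)) (.hit [1,2,3] 32)) (.branch 0 1 0 (.drop [0] 1 1 1 30 (.branch 1 1 3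
      (.branch 4 2 0 (.branch 5 2 0 (.branch 6 2 0 (.branch 7 2 2 (.branch 7 3 2 (.hit [1,7,8] 32)
      (.hit [1,6,7] 32)) (.hit [1,5,6] 32)) (.hit [1,4,5] 32)) (.hit [1,3,4] 32)) (.hit [1,2,3] 32))
      (.branch 3 1 0 (.branch 4 1 0 (.branch 5 1 0 (.branch 6 1 0 (.branch 7 1 2 (.branch 7 2 2
      (.hit [0,7,8] 32) (.hit [0,6,7] 32)) (.hit [0,5,6] 32)) (.hit [0,4,5] 32)) (.hit [0,3,4] 32))
      (.hit [0,2,3] 32)) (.hit [0,1,2] 32)))) (.branch 1 0 0 (.drop [0] 1 1 1 30 (.branch 1 1 3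
      (.branch 4 2 0 (.branch 5 2 0 (.branch 6 2 0 (.branch 7 2 2 (.branch 7 3 2 (.hit [1,7,8] 32)
      (.hit [1,6,7] 32)) (.hit [1,5,6] 32)) (.hit [1,4,5] 32)) (.hit [1,3,4] 32)) (.hit [1,2,3] 32))
      (.branch 3 1 0 (.branch 4 1 0 (.branch 5 1 0 (.branch 6 1 0 (.branch 7 1 2 (.branch 7 2 2
      (.hit [0,7,8] 32) (.hit [0,6,7] 32)) (.hit [0,5,6] 32)) (.hit [0,4,5] 32)) (.hit [0,3,4] 32))
      (.hit [0,2,3] 32)) (.hit [0,1,2] 32)))) (.branch 1 1 0 (.drop [0] 1 1 1 30 (.branch 1 1 3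
      (.branch 4 2 0 (.branch 5 2 0 (.branch 6 2 0 (.branch 7 2 2 (.branch 7 3 2 (.hit [1,7,8] 32)
      (.hit [1,6,7] 32)) (.hit [1,5,6] 32)) (.hit [1,4,5] 32)) (.hit [1,3,4] 32)) (.hit [1,2,3] 32))
      (.branch 3 1 0 (.branch 4 1 0 (.branch 5 1 0 (.branch 6 1 0 (.branch 7 1 2 (.branch 7 2 2
      (.hit [0,7,8] 32) (.hit [0,6,7] 32)) (.hit [0,5,6] 32)) (.hit [0,4,5] 32)) (.hit [0,3,4] 32))
      (.hit [0,2,3] 32)) (.hit [0,1,2] 32)))) (.branch 1 3 0 (.hit [0,2,3] 32) (.branch 2 0 0 (.hit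
      [0,1,3] 32) (.branch 2 1 0 (.hit [0,1,3] 32) (.branch 2 3 0 (.hit [0,1,3] 32) (.branch 3 0 0
      (.hit [0,1,2] 32) (.branch 3 2 0 (.hit [0,1,2] 32) (.branch 3 3 0 (.hit [0,1,2] 32) (.hit
      [0,1,2] 32)))))))))))),
    (5, (false, 0, false), .branch 0 1 0 (.descend [0,2,3]) (.branch 0 2 0 (.branch 2 1 1 (.branch 2
      5 1 (.split [(4,5),(6,4)] 1 (.kid (.descend [0,4,5]) (.kid (.branch 6 5 0 (.branch 7 5 1
      (.descend [0,7,8]) (.descend [0,6,7])) (.descend [0,4,6])) (.descend [0,2,4])))) (.hit [2,3,4]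
      32)) (.hit [1,2,3] 32)) (.branch 1 0 0 (.drop [0] 1 1 1 30 (.branch 1 1 3 (.branch 4 2 0
      (.branch 5 2 0 (.branch 6 2 0 (.branch 7 2 2 (.branch 7 3 1 (.hit [1,7,8] 32) (.hit [1,6,7]
      32)) (.hit [1,5,6] 32)) (.hit [1,4,5] 32)) (.hit [1,3,4] 32)) (.hit [1,2,3] 32)) (.branch 3 1
      0 (.branch 4 1 0 (.branch 5 1 0 (.branch 6 1 0 (.branch 7 1 2 (.branch 7 2 1 (.hit [0,7,8] 32)
      (.hit [0,6,7] 32)) (.hit [0,5,6] 32)) (.hit [0,4,5] 32)) (.hit [0,3,4] 32)) (.hit [0,2,3] 32))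
      (.hit [0,1,2] 32)))) (.branch 1 1 0 (.drop [0] 1 1 1 30 (.branch 1 1 3 (.branch 4 2 0 (.branch
      5 2 0 (.branch 6 2 0 (.branch 7 2 2 (.branch 7 3 1 (.hit [1,7,8] 32) (.hit [1,6,7] 32)) (.hit
      [1,5,6] 32)) (.hit [1,4,5] 32)) (.hit [1,3,4] 32)) (.hit [1,2,3] 32)) (.branch 3 1 0 (.branch
      4 1 0 (.branch 5 1 0 (.branch 6 1 0 (.branch 7 1 2 (.branch 7 2 1 (.hit [0,7,8] 32) (.hit
      [0,6,7] 32)) (.hit [0,5,6] 32)) (.hit [0,4,5] 32)) (.hit [0,3,4] 32)) (.hit [0,2,3] 32)) (.hit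
      [0,1,2] 32)))) (.branch 1 2 0 (.hit [0,2,3] 32) (.branch 1 3 0 (.hit [0,2,3] 32) (.branch 2 0
      0 (.hit [0,1,3] 32) (.branch 2 1 0 (.hit [0,1,3] 32) (.branch 2 3 0 (.hit [0,1,3] 32) (.branch
      3 0 0 (.hit [0,1,2] 32) (.branch 3 2 0 (.hit [0,1,2] 32) (.branch 3 3 0 (.hit [0,1,2] 32)
      (.hit [0,1,2] 32))))))))))))),
    (5, (false, 0, true), .branch 1 0 0 (.descend [1,2,3]) (.branch 2 0 2 (.branch 1 2 0 (.branch 5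
      2 0 (.branch 4 3 0 (.split [(4,5),(4,7),(5,3)] 0 (.kid (.branch 5 5 0 (.descend [3,4,5])
      (.descend [3,4,5])) (.kid (.split [(5,5),(5,7)] 0 (.kid (.descend [3,4,5]) (.kid (.descend
      [3,4,5]) (.descend [3,4,5])))) (.kid (.descend [3,4,5]) (.descend [3,4,6]))))) (.branch 3 3 0
      (.split [(5,5),(5,7),(6,5)] 0 (.kid (.split [(6,5),(7,5)] 0 (.kid (.descend [4,5,6]) (.kid
      (.descend [4,5,7]) (.descend [4,5,7])))) (.kid (.branch 6 7 0 (.descend [4,5,6]) (.descend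
      [4,5,6])) (.kid (.descend [4,5,6]) (.descend [4,5,6]))))) (.branch 2 3 0 (.split
      [(5,5),(5,7),(6,5)] 0 (.kid (.split [(6,5),(7,5)] 0 (.kid (.descend [4,5,6]) (.kid (.descend
      [4,5,7]) (.descend [4,5,7])))) (.kid (.branch 6 7 0 (.descend [4,5,6]) (.descend [4,5,6]))
      (.kid (.descend [4,5,6]) (.descend [4,5,6]))))) (.hit [0,1,5] 32)))) (.descend [1,2,4])) (.hit
      [0,1,3] 32)) (.branch 2 1 0 (.split [(1,1),(1,2)] 0 (.kid (.branch 5 1 0 (.split [(2,2),(4,2)]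
      0 (.kid (.hit [0,1,2] 32) (.kid (.hit [0,1,4] 32) (.hit [0,1,5] 32)))) (.descend [1,2,4]))
      (.kid (.branch 2 2 0 (.hit [0,1,2] 32) (.hit [0,1,3] 32)) (.hit [0,1,2] 32)))) (.branch 2 3 0
      (.branch 1 1 0 (.branch 5 1 0 (.branch 2 2 0 (.hit [0,1,2] 32) (.hit [0,1,5] 32)) (.descend
      [1,2,4])) (.hit [0,1,3] 32)) (.branch 3 1 0 (.split [(1,1),(1,2)] 0 (.kid (.branch 5 1 0
      (.branch 2 2 0 (.hit [0,1,2] 32) (.hit [0,1,5] 32)) (.descend [1,2,3])) (.kid (.branch 2 2 0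
      (.hit [0,1,2] 32) (.hit [0,1,4] 32)) (.hit [0,1,2] 32)))) (.branch 3 2 0 (.branch 1 1 0
      (.descend [1,2,3]) (.hit [0,1,2] 32)) (.branch 3 3 0 (.branch 1 1 0 (.descend [1,2,3]) (.hit
      [0,1,2] 32)) (.branch 1 1 0 (.descend [1,2,3]) (.hit [0,1,2] 32))))))))),
    (5, (true, 0, true), .branch 1 1 0 (.split [(2,1),(3,1)] 1 (.kid (.hit [0,1,2] 32) (.kid (.hit
      [0,1,3] 32) (.descend [1,2,3])))) (.hit [0,1,2] 32)),
    (5, (true, 0, true), .branch 1 1 2 (.split [(1,2),(1,3)] 2 (.kid (.hit [0,1,2] 32) (.kid (.hit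
      [0,1,2] 32) (.descend [1,2,3])))) (.hit [0,1,2] 32)),
    (5, (true, 1, false), .branch 1 2 2 (.descend [0,1,3]) (.branch 1 1 1 (.split [(3,1),(1,2)] 1
      (.kid (.branch 3 2 2 (.descend [0,3,4]) (.descend [0,1,3])) (.kid (.branch 4 2 3 (.branch 5 2
      3 (.branch 6 2 1 (.branch 6 3 2 (.descend [0,6,7]) (.descend [0,5,6])) (.descend [0,4,5]))
      (.descend [0,1,4])) (.descend [0,1,2])) (.hit [1,2,3] 32)))) (.hit [0,1,2] 32))),
    (5, (true, 2, true), .branch 1 1 1 (.branch 1 4 2 (.split [(3,4),(4,4),(5,4)] 3 (.kid (.descend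
      [0,1,3]) (.kid (.descend [0,1,4]) (.kid (.descend [0,1,5]) (.descend [0,1,3]))))) (.hit
      [1,2,3] 32)) (.hit [0,1,2] 32)),
    (5, (true, 0, true), .branch 1 1 0 (.split [(2,1),(3,1),(4,1)] 3 (.kid (.hit [0,1,2] 32) (.kid
      (.hit [0,1,3] 32) (.kid (.hit [0,1,4] 32) (.descend [1,2,3]))))) (.hit [0,1,2] 32)),
    (5, (false, 0, false), .branch 2 0 1 (.branch 1 2 3 (.branch 5 2 0 (.split [(5,4),(4,6)] 0 (.kid
      (.hit [3,4,5] 32) (.kid (.branch 5 6 2 (.branch 5 7 0 (.hit [3,4,5] 32) (.hit [3,4,5] 32))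
      (.hit [3,4,5] 32)) (.hit [3,4,5] 32)))) (.branch 2 2 1 (.hit [2,3,5] 32) (.hit [1,2,4] 32)))
      (.hit [0,1,3] 32)) (.branch 0 1 2 (.drop [1] 1 1 1 90 (.branch 1 1 1 (.branch 2 4 2 (.branch 2
      5 2 (.branch 2 6 2 (.branch 2 7 0 (.branch 3 7 0 (.hit [1,2,3] 32) (.hit [1,2,3] 32)) (.hit
      [1,2,3] 32)) (.hit [1,2,3] 32)) (.hit [1,2,3] 32)) (.hit [1,2,3] 32)) (.branch 1 3 2 (.branch
      1 4 2 (.branch 1 5 2 (.branch 1 6 2 (.branch 1 7 0 (.branch 2 7 0 (.hit [0,1,2] 32) (.hit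
      [0,1,2] 32)) (.hit [0,1,2] 32)) (.hit [0,1,2] 32)) (.hit [0,1,2] 32)) (.hit [0,1,2] 32)) (.hit
      [0,1,2] 32)))) (.branch 1 1 2 (.drop [0] 1 1 1 90 (.branch 1 1 1 (.branch 2 4 2 (.branch 2 5 2
      (.branch 2 6 2 (.branch 2 7 0 (.branch 3 7 0 (.hit [1,2,3] 32) (.hit [1,2,3] 32)) (.hit
      [1,2,3] 32)) (.hit [1,2,3] 32)) (.hit [1,2,3] 32)) (.hit [1,2,3] 32)) (.branch 1 3 2 (.branch
      1 4 2 (.branch 1 5 2 (.branch 1 6 2 (.branch 1 7 0 (.branch 2 7 0 (.hit [0,1,2] 32) (.hit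
      [0,1,2] 32)) (.hit [0,1,2] 32)) (.hit [0,1,2] 32)) (.hit [0,1,2] 32)) (.hit [0,1,2] 32)) (.hit
      [0,1,2] 32)))) (.branch 3 1 2 (.hit [0,1,2] 32) (.branch 0 2 2 (.hit [1,2,3] 32) (.branch 3 2
      2 (.hit [0,1,2] 32) (.branch 0 3 2 (.hit [1,2,3] 32) (.branch 2 3 2 (.hit [0,1,3] 32) (.branch
      3 3 2 (.hit [0,1,2] 32) (.hit [0,1,2] 32)))))))))),
    (5, (false, 0, false), .branch 2 0 1 (.branch 1 2 3 (.branch 5 2 0 (.branch 4 6 2 (.branch 4 7 0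
      (.branch 5 7 0 (.hit [3,4,5] 32) (.hit [3,4,5] 32)) (.hit [3,4,5] 32)) (.branch 5 4 3 (.branch
      5 4 2 (.branch 5 5 0 (.hit [3,4,5] 32) (.hit [3,4,5] 32)) (.hit [3,4,5] 32)) (.hit [3,4,5]
      32))) (.hit [1,2,4] 32)) (.hit [0,1,3] 32)) (.branch 1 0 2 (.drop [1] 1 1 1 90 (.branch 1 1 1
      (.branch 2 4 2 (.branch 2 5 2 (.branch 2 6 2 (.branch 2 7 0 (.branch 3 7 0 (.hit [1,2,3] 32)
      (.hit [1,2,3] 32)) (.hit [1,2,3] 32)) (.hit [1,2,3] 32)) (.hit [1,2,3] 32)) (.hit [1,2,3] 32))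
      (.branch 1 3 2 (.branch 1 4 2 (.branch 1 5 2 (.branch 1 6 2 (.branch 1 7 0 (.branch 2 7 0
      (.hit [0,1,2] 32) (.hit [0,1,2] 32)) (.hit [0,1,2] 32)) (.hit [0,1,2] 32)) (.hit [0,1,2] 32))
      (.hit [0,1,2] 32)) (.hit [0,1,2] 32)))) (.branch 0 1 2 (.drop [1] 1 1 1 90 (.branch 1 1 1
      (.branch 2 4 2 (.branch 2 5 2 (.branch 2 6 2 (.branch 2 7 0 (.branch 3 7 0 (.hit [1,2,3] 32)
      (.hit [1,2,3] 32)) (.hit [1,2,3] 32)) (.hit [1,2,3] 32)) (.hit [1,2,3] 32)) (.hit [1,2,3] 32))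
      (.branch 1 3 2 (.branch 1 4 2 (.branch 1 5 2 (.branch 1 6 2 (.branch 1 7 0 (.branch 2 7 0
      (.hit [0,1,2] 32) (.hit [0,1,2] 32)) (.hit [0,1,2] 32)) (.hit [0,1,2] 32)) (.hit [0,1,2] 32))
      (.hit [0,1,2] 32)) (.hit [0,1,2] 32)))) (.branch 1 1 2 (.drop [0] 1 1 1 90 (.branch 1 1 1
      (.branch 2 4 2 (.branch 2 5 2 (.branch 2 6 2 (.branch 2 7 0 (.branch 3 7 0 (.hit [1,2,3] 32)
      (.hit [1,2,3] 32)) (.hit [1,2,3] 32)) (.hit [1,2,3] 32)) (.hit [1,2,3] 32)) (.hit [1,2,3] 32))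
      (.branch 1 3 2 (.branch 1 4 2 (.branch 1 5 2 (.branch 1 6 2 (.branch 1 7 0 (.branch 2 7 0
      (.hit [0,1,2] 32) (.hit [0,1,2] 32)) (.hit [0,1,2] 32)) (.hit [0,1,2] 32)) (.hit [0,1,2] 32))
      (.hit [0,1,2] 32)) (.hit [0,1,2] 32)))) (.branch 3 1 2 (.hit [0,1,2] 32) (.branch 0 2 2 (.hit
      [1,2,3] 32) (.branch 1 2 2 (.hit [0,2,3] 32) (.branch 3 2 2 (.hit [0,1,2] 32) (.branch 0 3 2
      (.hit [1,2,3] 32) (.branch 2 3 2 (.hit [0,1,3] 32) (.branch 3 3 2 (.hit [0,1,2] 32) (.hit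
      [0,1,2] 32)))))))))))),
    (5, (true, 0, false), .branch 1 0 2 (.descend [1,2,3]) (.branch 2 0 2 (.branch 1 2 3 (.branch 5
      2 3 (.split [(5,4),(4,6)] 3 (.kid (.descend [3,4,5]) (.kid (.branch 5 6 2 (.branch 5 7 3
      (.descend [3,4,5]) (.descend [3,4,5])) (.descend [3,4,5])) (.descend [3,4,5])))) (.hit [1,2,4]
      32)) (.hit [0,1,3] 32)) (.branch 0 1 2 (.drop [1] 1 1 1 90 (.branch 1 1 1 (.branch 2 4 2
      (.branch 2 5 2 (.branch 2 6 2 (.branch 2 7 0 (.branch 3 7 3 (.hit [1,2,3] 32) (.hit [1,2,3]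
      32)) (.hit [1,2,3] 32)) (.hit [1,2,3] 32)) (.hit [1,2,3] 32)) (.hit [1,2,3] 32)) (.branch 1 3
      2 (.branch 1 4 2 (.branch 1 5 2 (.branch 1 6 2 (.branch 1 7 0 (.branch 2 7 3 (.hit [0,1,2] 32)
      (.hit [0,1,2] 32)) (.hit [0,1,2] 32)) (.hit [0,1,2] 32)) (.hit [0,1,2] 32)) (.hit [0,1,2] 32))
      (.hit [0,1,2] 32)))) (.branch 1 1 2 (.drop [0] 1 1 1 90 (.branch 1 1 1 (.branch 2 4 2 (.branch
      2 5 2 (.branch 2 6 2 (.branch 2 7 0 (.branch 3 7 3 (.hit [1,2,3] 32) (.hit [1,2,3] 32)) (.hit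
      [1,2,3] 32)) (.hit [1,2,3] 32)) (.hit [1,2,3] 32)) (.hit [1,2,3] 32)) (.branch 1 3 2 (.branch
      1 4 2 (.branch 1 5 2 (.branch 1 6 2 (.branch 1 7 0 (.branch 2 7 3 (.hit [0,1,2] 32) (.hit
      [0,1,2] 32)) (.hit [0,1,2] 32)) (.hit [0,1,2] 32)) (.hit [0,1,2] 32)) (.hit [0,1,2] 32)) (.hit
      [0,1,2] 32)))) (.branch 2 1 2 (.hit [0,1,3] 32) (.branch 3 1 2 (.hit [0,1,2] 32) (.branch 0 2
      2 (.hit [1,2,3] 32) (.branch 1 2 2 (.hit [0,2,3] 32) (.branch 3 2 2 (.hit [0,1,2] 32) (.branch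
      0 3 2 (.hit [1,2,3] 32) (.branch 2 3 2 (.hit [0,1,3] 32) (.branch 3 3 2 (.hit [0,1,2] 32)
      (.hit [0,1,2] 32))))))))))))),
    (5, (true, 0, true), .branch 0 1 2 (.descend [0,2,3]) (.branch 0 2 0 (.branch 2 1 2 (.branch 2 5
      2 (.branch 3 4 2 (.split [(5,4),(7,4),(3,5)] 2 (.kid (.branch 5 5 2 (.descend [0,5,6])
      (.descend [0,3,5])) (.kid (.split [(5,5),(7,5)] 2 (.kid (.descend [0,5,8]) (.kid (.descend
      [0,7,8]) (.descend [0,3,7])))) (.kid (.descend [0,3,4]) (.descend [0,2,3]))))) (.branch 3 3 2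
      (.split [(5,5),(7,5),(5,6)] 2 (.kid (.split [(5,6),(5,7)] 2 (.kid (.descend [0,5,6]) (.kid
      (.descend [0,5,6]) (.descend [0,2,5])))) (.kid (.branch 7 6 2 (.descend [0,7,8]) (.descend
      [0,5,7])) (.kid (.descend [0,5,6]) (.descend [0,2,5]))))) (.branch 3 2 2 (.split
      [(5,5),(7,5),(5,6)] 2 (.kid (.split [(5,6),(5,7)] 2 (.kid (.descend [0,5,6]) (.kid (.descend
      [0,5,6]) (.descend [0,2,5])))) (.kid (.branch 7 6 2 (.descend [0,7,8]) (.descend [0,5,7]))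
      (.kid (.descend [0,5,6]) (.descend [0,2,5]))))) (.hit [1,2,3] 32)))) (.descend [2,3,4])) (.hit
      [1,2,3] 32)) (.branch 1 2 2 (.split [(1,1),(2,1)] 2 (.kid (.branch 1 5 2 (.split [(2,2),(2,4)]
      2 (.kid (.hit [0,2,3] 32) (.kid (.hit [0,2,3] 32) (.hit [0,1,2] 32)))) (.descend [1,3,4]))
      (.kid (.branch 2 2 2 (.hit [0,2,3] 32) (.hit [0,1,2] 32)) (.hit [0,1,3] 32)))) (.branch 3 2 2
      (.branch 1 1 2 (.branch 1 5 2 (.branch 2 2 2 (.hit [0,2,3] 32) (.hit [0,1,2] 32)) (.descend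
      [1,2,3])) (.hit [0,1,2] 32)) (.branch 1 3 2 (.split [(1,1),(2,1)] 2 (.kid (.branch 1 5 2
      (.branch 2 2 2 (.hit [0,2,3] 32) (.hit [0,1,2] 32)) (.descend [1,3,4])) (.kid (.branch 2 2 2
      (.hit [0,2,3] 32) (.hit [0,1,2] 32)) (.hit [0,2,3] 32)))) (.branch 2 3 2 (.branch 1 1 2
      (.descend [1,2,4]) (.hit [0,1,3] 32)) (.branch 3 3 2 (.branch 1 1 2 (.descend [1,2,3]) (.hit
      [0,1,2] 32)) (.branch 1 1 2 (.descend [1,2,3]) (.hit [0,1,2] 32))))))))),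
    (6, (false, 1, false), .branch 1 2 1 (.branch 2 1 0 (.branch 3 1 0 (.branch 4 1 0 (.branch 5 1 2
      (.branch 5 2 1 (.descend [0,5,6]) (.descend [0,4,5])) (.descend [0,3,4])) (.descend [0,2,3]))
      (.descend [0,1,2])) (.descend [0,1,3])) (.hit [0,1,2] 64)),
    (6, (false, 0, false), .branch 1 2 0 (.branch 2 2 3 (.hit [0,1,2] 64) (.hit [0,1,3] 64)) (.hit
      [0,1,2] 64)),
    (6, (false, 0, false), .branch 1 2 2 (.branch 1 3 2 (.branch 1 4 2 (.branch 1 5 2 (.branch 1 6 0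
      (.branch 2 6 0 (.hit [0,1,2] 64) (.hit [0,1,2] 64)) (.hit [0,1,2] 64)) (.hit [0,1,2] 64))
      (.hit [0,1,2] 64)) (.hit [0,1,3] 64)) (.hit [0,1,2] 64)),
    (6, (true, 2, false), .branch 1 2 0 (.branch 2 1 2 (.descend [0,1,2]) (.hit [0,1,3] 64)) (.hit
      [0,1,2] 64)),
    (6, (true, 0, true), .branch 1 2 2 (.split [(2,1),(4,3)] 2 (.kid (.descend [2,3,4]) (.kid
      (.branch 4 4 2 (.branch 4 5 2 (.branch 4 6 2 (.branch 4 7 0 (.descend [1,2,4]) (.descend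
      [1,2,4])) (.descend [1,2,4])) (.descend [1,2,4])) (.descend [1,2,4])) (.hit [0,1,3] 64))))
      (.hit [0,1,2] 64)),
    (6, (true, 0, true), .split [(1,1),(3,1)] 2 (.kid (.branch 1 2 0 (.branch 5 2 2 (.branch 2 2 2
      (.branch 2 3 2 (.branch 2 4 3 (.descend [2,6,8]) (.descend [2,5,7])) (.descend [2,4,6]))
      (.descend [2,3,5])) (.descend [1,3,4])) (.descend [1,2,3])) (.kid (.branch 1 3 0 (.branch 1 2
      2 (.branch 1 3 2 (.branch 1 4 2 (.branch 1 5 0 (.hit [0,1,8] 64) (.hit [0,1,7] 64)) (.hit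
      [0,1,6] 64)) (.hit [0,1,5] 64)) (.hit [0,1,4] 64)) (.hit [0,1,2] 64)) (.branch 1 2 2 (.branch
      1 3 2 (.branch 1 4 2 (.branch 1 5 2 (.branch 1 6 2 (.branch 1 7 0 (.hit [0,1,8] 64) (.hit
      [0,1,7] 64)) (.hit [0,1,6] 64)) (.hit [0,1,5] 64)) (.hit [0,1,4] 64)) (.hit [0,1,3] 64)) (.hit
      [0,1,2] 64))))),
    (6, (true, 0, true), .branch 1 2 0 (.branch 4 3 2 (.branch 0 3 0 (.branch 4 4 2 (.branch 5 7 3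
      (.branch 6 5 2 (.descend [0,5,6]) (.descend [0,5,7])) (.descend [0,3,4])) (.descend [0,3,5]))
      (.branch 3 3 2 (.branch 4 6 3 (.branch 5 4 2 (.descend [1,4,5]) (.descend [1,4,6])) (.descend
      [1,2,3])) (.descend [1,2,4]))) (.branch 2 1 3 (.branch 1 2 2 (.branch 1 3 2 (.branch 1 4 2
      (.branch 1 5 3 (.hit [1,5,8] 64) (.hit [1,4,7] 64)) (.hit [1,3,6] 64)) (.hit [1,2,5] 64))
      (.descend [2,3,4])) (.hit [0,1,3] 64))) (.hit [0,1,2] 64)),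
    (7, (false, 0, false), .branch 1 3 0 (.branch 4 3 1 (.branch 0 2 0 (.hit [0,2,5] 128) (.hit
      [0,1,4] 128)) (.hit [0,1,3] 128)) (.hit [0,1,2] 128)),
    (7, (false, 0, false), .branch 1 3 0 (.branch 4 3 1 (.branch 0 2 3 (.branch 6 1 0 (.branch 7 2 0
      (.branch 8 3 1 (.hit [1,2,8] 128) (.hit [1,2,7] 128)) (.hit [1,2,6] 128)) (.hit [0,2,5] 128))
      (.hit [0,1,4] 128)) (.hit [0,1,3] 128)) (.hit [0,1,2] 128)),
    (7, (false, 0, false), .branch 0 2 0 (.branch 2 4 0 (.split [(3,4),(4,4),(5,4)] 3 (.kid (.hit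
      [0,2,3] 128) (.kid (.hit [0,2,4] 128) (.kid (.hit [0,2,5] 128) (.hit [0,2,3] 128))))) (.hit
      [1,2,3] 128)) (.branch 1 3 0 (.split [(2,3),(3,3),(4,3)] 3 (.kid (.hit [0,1,2] 128) (.kid
      (.hit [0,1,3] 128) (.kid (.hit [0,1,4] 128) (.hit [0,1,2] 128))))) (.hit [0,1,2] 128))),
    (7, (false, 0, false), .branch 0 2 3 (.branch 2 4 0 (.split [(3,4),(4,4),(5,4)] 3 (.kid (.hit
      [0,2,3] 128) (.kid (.hit [0,2,4] 128) (.kid (.hit [0,2,5] 128) (.hit [0,2,3] 128))))) (.hit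
      [1,2,3] 128)) (.branch 1 3 0 (.split [(2,3),(3,3),(4,3)] 3 (.kid (.hit [0,1,2] 128) (.kid
      (.hit [0,1,3] 128) (.kid (.hit [0,1,4] 128) (.hit [0,1,2] 128))))) (.hit [0,1,2] 128))),
    (7, (false, 0, false), .split [(0,1),(0,2)] 0 (.kid (.drop [0] 1 1 1 78 (.hit [0,1,2] 128))
      (.kid (.branch 2 4 0 (.drop [0] 1 1 1 78 (.hit [0,1,2] 128)) (.hit [1,2,3] 128)) (.drop [0] 1
      1 1 78 (.hit [0,1,2] 128))))),
    (7, (true, 1, true), .branch 1 3 2 (.branch 0 2 0 (.split [(4,4),(5,4)] 3 (.kid (.branch 0 4 2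
      (.branch 0 5 2 (.branch 0 6 0 (.descend [0,5,7]) (.descend [0,4,6])) (.descend [0,3,5]))
      (.descend [0,2,4])) (.kid (.branch 0 4 2 (.branch 0 5 2 (.branch 0 6 0 (.descend [0,5,8])
      (.descend [0,4,7])) (.descend [0,3,6])) (.descend [0,2,5])) (.descend [0,2,3])))) (.branch 3 3
      2 (.branch 5 3 3 (.branch 0 3 2 (.branch 0 4 2 (.branch 0 5 0 (.descend [0,6,8]) (.descend
      [0,5,7])) (.descend [0,4,6])) (.descend [0,3,5])) (.descend [0,3,4])) (.branch 4 3 3 (.branch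
      0 3 2 (.branch 0 4 2 (.branch 0 5 2 (.branch 0 6 0 (.descend [0,5,8]) (.descend [0,4,7]))
      (.descend [0,3,6])) (.descend [0,2,5])) (.descend [0,1,4])) (.descend [0,1,2])))) (.hit
      [0,1,2] 128)),
    (7, (false, 0, false), .branch 0 2 0 (.branch 2 4 2 (.branch 2 5 2 (.drop [0,1,4,5] 2 4 1 78
      (.branch 3 5 2 (.branch 3 6 2 (.branch 3 7 0 (.hit [0,2,3] 128) (.hit [0,2,3] 128)) (.hit
      [0,2,3] 128)) (.hit [0,2,3] 128))) (.hit [0,2,3] 128)) (.hit [1,2,3] 128)) (.drop [0] 1 1 1 78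
      (.branch 2 2 2 (.branch 2 3 2 (.branch 2 4 2 (.branch 2 5 2 (.branch 2 6 2 (.branch 2 7 0
      (.hit [0,1,2] 128) (.hit [0,1,2] 128)) (.hit [0,1,2] 128)) (.hit [0,1,2] 128)) (.hit [0,1,2]
      128)) (.hit [0,1,2] 128)) (.hit [0,1,2] 128)))),
    (9, (false, 0, false), .branch 2 1 2 (.branch 2 2 1 (.hit [0,2,3] 512) (.hit [0,1,2] 512)) (.hit
      [0,1,2] 512)),
    (9, (false, 0, false), .branch 2 1 0 (.branch 3 1 0 (.branch 4 1 0 (.branch 5 1 0 (.branch 6 1 2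
      (.branch 6 2 2 (.hit [0,6,7] 512) (.hit [0,5,6] 512)) (.hit [0,4,5] 512)) (.hit [0,3,4] 512))
      (.hit [0,2,3] 512)) (.hit [0,1,2] 512)) (.hit [0,1,2] 512)),
    (9, (false, 0, true), .branch 2 1 0 (.split [(1,2),(3,4)] 0 (.kid (.descend [1,2,4]) (.kid
      (.branch 4 4 0 (.branch 5 4 0 (.branch 6 4 0 (.branch 7 4 2 (.descend [2,7,8]) (.descend
      [2,6,7])) (.descend [2,5,6])) (.descend [2,4,5])) (.descend [2,3,4])) (.hit [0,1,2] 512))))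
      (.hit [0,1,2] 512)),
    (9, (false, 0, true), .split [(1,1),(1,3)] 0 (.kid (.branch 2 1 2 (.branch 2 5 0 (.branch 2 2 0
      (.branch 3 2 0 (.branch 4 2 1 (.descend [4,5,8]) (.descend [3,4,7])) (.descend [2,3,6]))
      (.descend [1,2,5])) (.descend [2,3,4])) (.descend [1,2,3])) (.kid (.branch 3 1 2 (.branch 2 1
      0 (.branch 3 1 0 (.branch 4 1 0 (.branch 5 1 2 (.hit [0,1,5] 512) (.hit [0,1,4] 512)) (.hit
      [0,1,3] 512)) (.hit [0,1,2] 512)) (.hit [0,1,3] 512)) (.hit [0,2,3] 512)) (.branch 2 1 0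
      (.branch 3 1 0 (.branch 4 1 0 (.branch 5 1 0 (.branch 6 1 0 (.branch 7 1 2 (.hit [0,1,7] 512)
      (.hit [0,1,6] 512)) (.hit [0,1,5] 512)) (.hit [0,1,4] 512)) (.hit [0,1,3] 512)) (.hit [0,1,2]
      512)) (.hit [0,1,2] 512))))),
    (9, (false, 0, true), .branch 2 1 2 (.branch 3 4 0 (.branch 3 0 2 (.branch 4 4 0 (.branch 7 5 1
      (.branch 5 6 0 (.descend [3,5,8]) (.descend [3,5,7])) (.descend [3,4,6])) (.descend [3,4,5]))
      (.branch 3 3 0 (.branch 6 4 1 (.branch 4 5 0 (.descend [2,4,7]) (.descend [2,4,6])) (.descend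
      [2,3,5])) (.descend [2,3,4]))) (.branch 1 2 1 (.branch 2 1 0 (.branch 3 1 0 (.branch 4 1 0
      (.branch 5 1 1 (.hit [5,6,7] 512) (.hit [4,5,6] 512)) (.hit [3,4,5] 512)) (.hit [2,3,4] 512))
      (.descend [1,2,4])) (.hit [0,1,2] 512))) (.hit [0,1,2] 512)),
    (9, (true, 2, false), .branch 2 1 3 (.branch 1 2 2 (.branch 1 3 2 (.branch 1 4 2 (.branch 1 5 0
      (.branch 2 5 3 (.descend [0,1,2]) (.descend [0,1,2])) (.descend [0,1,2])) (.descend [0,1,2]))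
      (.descend [0,1,3])) (.descend [0,1,2])) (.hit [0,1,2] 512)),
    (10, (false, 1, true), .branch 2 2 0 (.split [(0,2),(3,4)] 3 (.kid (.branch 3 1 0 (.branch 4 6 0
      (.branch 3 7 0 (.descend [1,3,7]) (.descend [1,4,6])) (.hit [1,2,3] 1024)) (.hit [0,2,3]
      1024)) (.kid (.branch 2 5 0 (.descend [0,2,5]) (.descend [0,3,4])) (.hit [0,1,2] 1024))))
      (.hit [0,1,2] 1024)),
    (10, (false, 0, false), .branch 2 2 0 (.branch 0 2 0 (.split [(1,4),(1,5)] 0 (.kid (.descend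
      [0,1,4]) (.kid (.descend [0,1,4]) (.hit [0,2,3] 1024)))) (.hit [0,1,2] 1024)) (.hit [0,1,2]
      1024)),
    (10, (false, 2, true), .branch 2 2 1 (.branch 4 3 1 (.branch 5 2 0 (.branch 6 2 0 (.branch 7 2 0
      (.branch 8 2 1 (.descend [0,1,8]) (.descend [0,1,7])) (.descend [0,1,6])) (.descend [0,1,5]))
      (.descend [0,1,4])) (.branch 2 0 2 (.branch 5 1 0 (.branch 6 1 0 (.branch 7 1 0 (.branch 8 1 1
      (.descend [2,3,8]) (.descend [2,3,7])) (.descend [2,3,6])) (.descend [2,3,5])) (.hit [2,3,4]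
      1024)) (.hit [0,2,3] 1024))) (.hit [0,1,2] 1024)),
    (10, (false, 0, false), .branch 2 2 3 (.branch 0 2 0 (.branch 1 5 0 (.branch 2 6 0 (.branch 3 7
      0 (.branch 4 8 3 (.descend [0,4,7]) (.descend [0,3,6])) (.descend [0,2,5])) (.descend
      [0,1,4])) (.hit [0,2,3] 1024)) (.hit [0,1,2] 1024)) (.hit [0,1,2] 1024)),
    (10, (true, 1, true), .split [(1,3),(2,3)] 3 (.kid (.descend [0,1,3]) (.kid (.branch 2 1 1
      (.branch 4 1 0 (.branch 2 1 1 (.descend [2,4,5]) (.descend [0,3,4])) (.descend [2,3,4]))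
      (.descend [0,2,3])) (.branch 2 2 0 (.branch 1 2 1 (.branch 3 1 0 (.hit [0,2,3] 1024) (.hit
      [1,2,3] 1024)) (.hit [0,1,2] 1024)) (.hit [0,1,2] 1024))))),
    (10, (false, 2, true), .split [(3,1),(3,2)] 1 (.kid (.descend [0,1,3]) (.kid (.split
      [(0,2),(1,2)] 3 (.kid (.descend [0,2,4]) (.kid (.descend [1,2,4]) (.descend [0,1,3]))))
      (.branch 2 2 1 (.branch 2 1 0 (.branch 3 2 0 (.branch 4 3 0 (.branch 5 4 0 (.branch 6 5 3
      (.hit [6,7,8] 1024) (.hit [5,6,7] 1024)) (.hit [4,5,6] 1024)) (.hit [3,4,5] 1024)) (.hit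
      [2,3,4] 1024)) (.hit [0,2,3] 1024)) (.hit [0,1,2] 1024))))),
    (10, (false, 2, true), .split [(3,1),(3,2)] 1 (.kid (.descend [0,1,3]) (.kid (.branch 0 2 3
      (.branch 1 4 0 (.descend [0,1,5]) (.descend [0,2,4])) (.descend [0,1,3])) (.branch 2 2 2
      (.branch 2 1 0 (.branch 3 2 0 (.branch 4 3 0 (.branch 5 4 0 (.branch 6 5 3 (.hit [6,7,8] 1024)
      (.hit [5,6,7] 1024)) (.hit [4,5,6] 1024)) (.hit [3,4,5] 1024)) (.hit [2,3,4] 1024)) (.hit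
      [0,2,3] 1024)) (.hit [0,1,2] 1024))))),
    (10, (true, 1, true), .branch 2 2 0 (.split [(0,2),(3,4)] 0 (.kid (.branch 4 5 0 (.branch 3 6 0
      (.descend [1,3,6]) (.descend [1,4,5])) (.branch 1 5 3 (.split [(2,3),(3,3)] 0 (.kid (.branch 5
      7 0 (.descend [0,5,6]) (.descend [0,1,2])) (.kid (.branch 5 7 0 (.descend [0,5,6]) (.descend
      [0,1,3])) (.descend [0,1,4])))) (.hit [0,2,3] 1024))) (.kid (.branch 2 5 0 (.descend [0,2,5])
      (.descend [0,3,4])) (.hit [0,1,2] 1024)))) (.hit [0,1,2] 1024)),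
    (10, (false, 2, true), .branch 3 1 1 (.branch 1 2 0 (.branch 5 4 1 (.branch 0 4 0 (.branch 1 6 0
      (.descend [0,1,7]) (.descend [0,3,6])) (.descend [0,2,5])) (.descend [0,1,4])) (.descend
      [0,1,3])) (.branch 3 2 1 (.branch 0 2 0 (.branch 1 4 0 (.descend [0,1,5]) (.descend [0,2,4]))
      (.descend [0,1,3])) (.branch 2 2 0 (.branch 3 2 0 (.drop [0,1,4] 2 2 1 78 (.branch 2 2 0
      (.branch 3 2 0 (.branch 4 2 0 (.branch 5 2 2 (.hit [0,5,8] 1024) (.hit [0,4,7] 1024)) (.hit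
      [0,3,6] 1024)) (.hit [0,2,5] 1024)) (.hit [0,3,4] 1024))) (.hit [0,2,3] 1024)) (.hit [0,1,2]
      1024)))),
    (10, (false, 2, true), .branch 3 2 1 (.branch 1 2 1 (.branch 1 4 0 (.split [(1,2),(1,3)] 1 (.kid
      (.descend [1,2,6]) (.kid (.descend [1,2,6]) (.descend [0,1,5])))) (.descend [1,2,4]))
      (.descend [0,1,3])) (.branch 2 2 2 (.split [(2,0),(2,1)] 1 (.kid (.branch 1 3 0 (.branch 2 3 0
      (.drop [0,3,4,5,6] 1 3 1 30 (.branch 3 3 0 (.branch 4 3 1 (.hit [0,4,8] 1024) (.hit [0,3,7]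
      1024)) (.hit [0,2,6] 1024))) (.hit [0,1,5] 1024)) (.hit [2,3,4] 1024)) (.kid (.branch 1 3 0
      (.branch 2 3 0 (.drop [0,3,4,5,6] 1 3 1 30 (.branch 3 3 0 (.branch 4 3 1 (.hit [0,4,8] 1024)
      (.hit [0,3,7] 1024)) (.hit [0,2,6] 1024))) (.hit [0,1,5] 1024)) (.hit [2,3,4] 1024)) (.hit
      [0,2,3] 1024)))) (.hit [0,1,2] 1024))),
    (10, (false, 1, true), .branch 2 2 1 (.branch 2 1 1 (.split [(3,3),(4,1)] 2 (.kid (.hit [2,3,5]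
      1024) (.kid (.branch 2 1 1 (.branch 3 3 0 (.branch 7 3 1 (.descend [2,3,7]) (.descend
      [2,3,6])) (.branch 6 3 1 (.descend [2,3,6]) (.descend [2,3,5]))) (.branch 2 2 0 (.branch 6 2 1
      (.descend [0,2,6]) (.descend [0,2,5])) (.branch 5 2 1 (.descend [0,2,5]) (.descend [0,2,4]))))
      (.hit [2,3,4] 1024)))) (.branch 2 2 0 (.descend [0,2,4]) (.hit [0,2,3] 1024))) (.branch 2 3 0
      (.hit [0,1,3] 1024) (.branch 3 0 0 (.hit [0,1,2] 1024) (.branch 3 3 0 (.hit [0,1,2] 1024)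
      (.hit [0,1,2] 1024))))),
    (10, (true, 2, true), .branch 2 2 2 (.split [(2,0),(4,3)] 1 (.kid (.branch 1 3 2 (.branch 6 4 2
      (.branch 7 3 2 (.descend [0,2,7]) (.descend [0,2,6])) (.hit [0,1,5] 1024)) (.hit [2,3,4]
      1024)) (.kid (.branch 5 2 2 (.descend [0,1,5]) (.descend [0,1,4])) (.hit [0,2,3] 1024))))
      (.hit [0,1,2] 1024)),
    (10, (true, 0, false), .branch 2 2 2 (.branch 2 0 2 (.split [(4,1),(5,1)] 2 (.kid (.descend
      [2,3,4]) (.kid (.descend [2,3,5]) (.hit [2,3,4] 1024)))) (.hit [0,2,3] 1024)) (.hit [0,1,2]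
      1024)),
    (10, (true, 1, true), .branch 2 2 3 (.branch 3 4 3 (.branch 2 5 2 (.branch 2 6 2 (.branch 2 7 2
      (.branch 2 8 3 (.descend [0,2,8]) (.descend [0,2,7])) (.descend [0,2,6])) (.descend [0,2,5]))
      (.descend [0,3,4])) (.branch 0 2 0 (.branch 1 5 2 (.branch 1 6 2 (.branch 1 7 2 (.branch 1 8 3
      (.descend [0,1,7]) (.descend [0,1,6])) (.descend [0,1,5])) (.descend [0,1,4])) (.hit [0,2,3]
      1024)) (.hit [0,1,2] 1024))) (.hit [0,1,2] 1024)),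
    (10, (true, 0, false), .branch 2 2 1 (.branch 2 0 2 (.branch 5 1 2 (.branch 6 2 2 (.branch 7 3 2
      (.branch 8 4 1 (.descend [2,3,8]) (.descend [2,3,7])) (.descend [2,3,6])) (.descend [2,3,5]))
      (.hit [2,3,4] 1024)) (.hit [0,2,3] 1024)) (.hit [0,1,2] 1024)),
    (10, (false, 2, true), .split [(3,1),(3,2)] 1 (.kid (.descend [0,1,3]) (.kid (.branch 1 2 3
      (.branch 1 4 2 (.branch 1 2 3 (.descend [1,2,6]) (.descend [0,1,5])) (.descend [1,2,4]))
      (.descend [0,1,3])) (.branch 2 2 2 (.branch 2 1 3 (.branch 1 3 2 (.hit [0,1,5] 1024) (.hit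
      [2,3,4] 1024)) (.hit [0,2,3] 1024)) (.hit [0,1,2] 1024))))),
    (10, (true, 1, true), .split [(1,3),(2,3)] 3 (.kid (.descend [0,1,3]) (.kid (.split
      [(2,0),(2,1)] 1 (.kid (.descend [2,3,4]) (.kid (.descend [2,3,4]) (.descend [0,2,3]))))
      (.branch 2 2 3 (.branch 1 2 2 (.branch 2 3 2 (.branch 3 4 2 (.branch 4 5 2 (.branch 5 6 1
      (.hit [5,6,7] 1024) (.hit [4,5,6] 1024)) (.hit [3,4,5] 1024)) (.hit [2,3,4] 1024)) (.hit
      [1,2,3] 1024)) (.hit [0,1,2] 1024)) (.hit [0,1,2] 1024))))),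
    (10, (true, 1, true), .split [(1,3),(2,3)] 3 (.kid (.descend [0,1,3]) (.kid (.branch 2 0 1
      (.branch 4 1 2 (.descend [2,3,4]) (.descend [2,3,4])) (.descend [0,2,3])) (.branch 2 2 0
      (.branch 1 2 2 (.branch 2 3 2 (.branch 3 4 2 (.branch 4 5 2 (.branch 5 6 1 (.hit [5,6,7] 1024)
      (.hit [4,5,6] 1024)) (.hit [3,4,5] 1024)) (.hit [2,3,4] 1024)) (.hit [1,2,3] 1024)) (.hit
      [0,1,2] 1024)) (.hit [0,1,2] 1024))))),
    (10, (false, 2, true), .branch 2 2 2 (.split [(2,0),(4,3)] 2 (.kid (.branch 5 4 2 (.branch 6 3 2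
      (.descend [0,1,6]) (.descend [0,1,5])) (.branch 5 1 1 (.split [(3,2),(3,3)] 2 (.kid (.branch 7
      5 2 (.descend [2,4,7]) (.descend [2,3,6])) (.kid (.branch 7 5 2 (.descend [2,4,7]) (.descend
      [2,3,6])) (.descend [2,3,5])))) (.hit [2,3,4] 1024))) (.kid (.branch 5 2 2 (.descend [0,1,5])
      (.descend [0,1,4])) (.hit [0,2,3] 1024)))) (.hit [0,1,2] 1024)),
    (10, (true, 1, true), .branch 1 3 3 (.branch 2 1 2 (.branch 4 5 3 (.branch 4 0 2 (.branch 6 1 2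
      (.descend [4,5,6]) (.descend [4,5,6])) (.descend [0,4,5])) (.descend [0,1,2])) (.descend
      [0,1,3])) (.branch 2 3 3 (.branch 2 0 2 (.branch 4 1 2 (.descend [2,3,4]) (.descend [2,3,4]))
      (.descend [0,2,3])) (.branch 2 2 2 (.branch 2 3 2 (.drop [0,1,4] 2 2 1 78 (.branch 2 2 2
      (.branch 2 3 2 (.branch 2 4 2 (.branch 2 5 0 (.hit [0,1,2] 1024) (.hit [0,1,2] 1024)) (.hit
      [0,1,2] 1024)) (.hit [0,1,2] 1024)) (.hit [0,1,2] 1024))) (.hit [0,1,2] 1024)) (.hit [0,1,2]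
      1024)))),
    (10, (true, 1, true), .branch 2 3 3 (.branch 2 1 3 (.branch 4 1 2 (.split [(2,1),(3,1)] 3 (.kid
      (.descend [2,4,5]) (.kid (.descend [3,4,5]) (.descend [0,3,4])))) (.descend [2,3,4]))
      (.descend [0,2,3])) (.branch 2 2 0 (.split [(0,2),(1,2)] 3 (.kid (.branch 3 1 2 (.branch 3 2 2
      (.drop [0,1,2,5,6] 3 1 1 90 (.branch 3 3 2 (.branch 3 4 3 (.hit [1,2,3] 1024) (.hit [1,2,3]
      1024)) (.hit [1,2,3] 1024))) (.hit [1,2,3] 1024)) (.hit [0,2,3] 1024)) (.kid (.branch 3 1 2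
      (.branch 3 2 2 (.drop [0,1,2,5,6] 3 1 1 90 (.branch 3 3 2 (.branch 3 4 3 (.hit [0,2,3] 1024)
      (.hit [0,2,3] 1024)) (.hit [0,2,3] 1024))) (.hit [0,2,3] 1024)) (.hit [1,2,3] 1024)) (.hit
      [0,1,2] 1024)))) (.hit [0,1,2] 1024))),
    (10, (true, 2, true), .branch 2 2 3 (.branch 1 2 3 (.split [(3,3),(1,4)] 0 (.kid (.hit [1,2,3]
      1024) (.kid (.branch 1 2 3 (.branch 3 3 2 (.branch 3 7 3 (.descend [1,3,4]) (.descend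
      [1,2,3])) (.branch 3 6 3 (.descend [1,3,4]) (.descend [1,2,3]))) (.branch 2 2 2 (.branch 2 6 3
      (.descend [0,2,3]) (.descend [0,1,2])) (.branch 2 5 3 (.descend [0,2,3]) (.descend [0,1,2]))))
      (.hit [1,2,3] 1024)))) (.branch 2 2 2 (.descend [0,1,2]) (.hit [0,1,2] 1024))) (.branch 3 2 2
      (.hit [0,1,2] 1024) (.branch 0 3 2 (.hit [1,2,3] 1024) (.branch 3 3 2 (.hit [0,1,2] 1024)
      (.hit [0,1,2] 1024))))),
    (11, (false, 0, false), .branch 2 3 3 (.branch 3 3 0 (.hit [0,2,3] 2048) (.hit [0,2,3] 2048))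
      (.hit [0,1,2] 2048)),
    (11, (false, 0, false), .branch 2 3 3 (.branch 3 3 0 (.hit [1,2,3] 2048) (.hit [0,2,3] 2048))
      (.hit [0,1,2] 2048)),
    (11, (false, 0, false), .branch 2 3 3 (.branch 2 1 1 (.branch 4 1 1 (.branch 2 1 1 (.branch 5 1
      2 (.branch 2 1 1 (.hit [2,5,6] 2048) (.hit [0,4,5] 2048)) (.hit [2,4,5] 2048)) (.hit [0,3,4]
      2048)) (.hit [2,3,4] 2048)) (.hit [0,2,3] 2048)) (.hit [0,1,2] 2048)),
    (11, (false, 1, true), .branch 2 3 1 (.branch 4 3 1 (.branch 4 4 0 (.branch 5 4 0 (.branch 6 4 0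
      (.branch 7 4 1 (.descend [0,7,8]) (.descend [0,6,7])) (.descend [0,5,6])) (.descend [0,4,5]))
      (.descend [0,2,4])) (.hit [0,2,3] 2048)) (.hit [0,1,2] 2048)),
    (11, (false, 1, true), .branch 2 2 0 (.branch 2 1 3 (.branch 5 1 1 (.branch 2 1 0 (.branch 3 2 0
      (.branch 4 3 3 (.descend [4,5,8]) (.descend [3,4,7])) (.descend [2,3,6])) (.descend [0,2,5]))
      (.descend [2,3,4])) (.descend [0,2,3])) (.branch 3 1 0 (.split [(2,1),(4,2)] 3 (.kid (.branch
      5 1 1 (.branch 2 1 0 (.branch 3 2 0 (.branch 4 3 3 (.descend [4,5,8]) (.descend [3,4,7]))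
      (.descend [2,3,6])) (.descend [0,2,5])) (.descend [2,3,4])) (.kid (.drop [0,1,2] 3 1 0 387
      (.split [(2,1),(2,2)] 3 (.kid (.branch 6 1 1 (.branch 2 1 0 (.branch 3 2 3 (.descend [3,4,8])
      (.descend [2,3,7])) (.descend [0,2,6])) (.descend [2,3,5])) (.kid (.branch 6 1 1 (.branch 2 1
      0 (.branch 3 2 3 (.descend [3,4,8]) (.descend [2,3,7])) (.descend [0,2,6])) (.descend
      [2,3,5])) (.descend [0,2,4]))))) (.descend [0,2,3])))) (.branch 2 3 0 (.branch 4 3 1 (.split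
      [(0,3),(1,3)] 3 (.kid (.descend [0,3,5]) (.kid (.descend [1,3,5]) (.descend [1,2,4]))))
      (.branch 2 1 3 (.descend [2,3,4]) (.descend [0,2,3]))) (.hit [0,1,2] 2048)))),
    (11, (false, 1, true), .branch 2 3 1 (.branch 4 3 1 (.split [(0,2),(4,4)] 3 (.kid (.branch 6 1 0
      (.branch 7 2 0 (.branch 8 3 3 (.descend [1,5,8]) (.descend [1,5,7])) (.descend [1,5,6]))
      (.descend [0,3,5])) (.kid (.drop [0,1,2,3] 4 3 1 210 (.branch 0 2 0 (.branch 7 1 0 (.branch 8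
      2 3 (.descend [1,6,8]) (.descend [1,6,7])) (.descend [0,5,6])) (.descend [0,4,5]))) (.descend
      [0,2,4])))) (.hit [0,2,3] 2048)) (.hit [0,1,2] 2048)),
    (11, (false, 0, false), .branch 2 3 3 (.branch 3 3 3 (.hit [0,2,3] 2048) (.hit [0,2,3] 2048))
      (.hit [0,1,2] 2048)),
    (11, (false, 0, false), .branch 2 3 3 (.branch 2 0 2 (.split [(4,1),(1,5)] 3 (.kid (.branch 4 1
      2 (.hit [2,3,4] 2048) (.hit [2,3,4] 2048)) (.kid (.branch 2 2 2 (.hit [0,1,2] 2048) (.hit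
      [0,1,5] 2048)) (.hit [2,3,4] 2048)))) (.hit [0,2,3] 2048)) (.hit [0,1,2] 2048)),
    (11, (false, 0, false), .branch 2 3 3 (.branch 2 1 3 (.branch 4 1 2 (.split [(2,1),(3,1)] 3
      (.kid (.hit [2,4,5] 2048) (.kid (.hit [3,4,5] 2048) (.hit [0,3,4] 2048)))) (.hit [2,3,4]
      2048)) (.hit [0,2,3] 2048)) (.hit [0,1,2] 2048)),
    (11, (true, 2, true), .branch 2 3 3 (.branch 4 3 2 (.branch 5 4 2 (.branch 6 5 2 (.branch 7 6 2
      (.branch 8 7 1 (.descend [0,2,8]) (.descend [0,2,7])) (.descend [0,2,6])) (.descend [0,2,5]))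
      (.descend [0,2,4])) (.hit [0,2,3] 2048)) (.hit [0,1,2] 2048)),
    (11, (false, 2, true), .branch 2 3 3 (.branch 2 1 3 (.split [(5,1),(1,5)] 2 (.kid (.descend
      [0,1,5]) (.kid (.branch 2 6 2 (.branch 3 7 2 (.branch 4 8 3 (.hit [0,4,8] 2048) (.hit [0,3,7]
      2048)) (.hit [0,2,6] 2048)) (.hit [0,1,5] 2048)) (.hit [2,3,4] 2048)))) (.hit [0,2,3] 2048))
      (.hit [0,1,2] 2048)),
    (11, (true, 2, true), .branch 2 3 3 (.split [(2,0),(4,3)] 1 (.kid (.branch 1 5 3 (.branch 6 5 2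
      (.branch 7 6 2 (.branch 8 7 1 (.descend [0,1,8]) (.descend [0,1,7])) (.descend [0,1,6])) (.hit
      [0,1,5] 2048)) (.hit [2,3,4] 2048)) (.kid (.branch 2 0 2 (.branch 1 6 2 (.branch 7 6 2
      (.branch 8 7 1 (.descend [0,1,8]) (.descend [0,1,7])) (.descend [0,1,6])) (.descend [2,3,5]))
      (.descend [0,2,4])) (.hit [0,2,3] 2048)))) (.hit [0,1,2] 2048)),
    (11, (true, 0, false), .branch 2 3 3 (.branch 2 0 2 (.branch 5 1 2 (.descend [2,3,5]) (.hit
      [2,3,4] 2048)) (.hit [0,2,3] 2048)) (.hit [0,1,2] 2048)),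
    (11, (true, 1, true), .branch 2 3 2 (.branch 2 4 2 (.branch 2 5 2 (.branch 2 6 2 (.branch 2 7 0
      (.branch 3 7 0 (.descend [1,2,3]) (.descend [1,2,3])) (.descend [1,2,3])) (.descend [1,2,3]))
      (.descend [1,2,3])) (.descend [0,2,3])) (.hit [0,1,2] 2048)),
    (11, (true, 1, true), .branch 1 3 0 (.branch 4 3 3 (.split [(0,2),(1,2)] 3 (.kid (.branch 6 1 3
      (.branch 7 5 1 (.branch 8 1 3 (.descend [1,2,8]) (.descend [0,2,7])) (.descend [1,2,6]))
      (.descend [0,2,5])) (.kid (.branch 6 1 3 (.branch 7 5 1 (.branch 8 1 3 (.descend [0,2,8])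
      (.descend [1,2,7])) (.descend [0,2,6])) (.descend [1,2,5])) (.descend [0,1,4])))) (.descend
      [0,1,3])) (.branch 3 1 1 (.branch 2 4 2 (.split [(2,1),(5,4)] 3 (.kid (.branch 2 6 3 (.branch
      7 6 1 (.branch 2 6 3 (.descend [2,3,8]) (.descend [1,2,7])) (.branch 2 1 3 (.descend [2,3,7])
      (.descend [0,2,6]))) (.descend [2,3,5])) (.kid (.descend [1,2,5]) (.descend [0,2,4])))) (.hit
      [0,1,2] 2048)) (.branch 0 2 2 (.branch 3 4 2 (.split [(3,1),(5,4)] 3 (.kid (.branch 3 6 3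
      (.branch 7 6 1 (.branch 3 6 3 (.descend [3,4,8]) (.descend [2,3,7])) (.branch 3 1 3 (.descend
      [3,4,7]) (.descend [1,3,6]))) (.descend [3,4,5])) (.kid (.descend [2,3,5]) (.descend
      [1,3,4])))) (.hit [1,2,3] 2048)) (.branch 2 3 2 (.split [(2,1),(4,3)] 3 (.kid (.branch 2 5 2
      (.split [(2,1),(6,5)] 3 (.kid (.branch 2 7 0 (.split [(2,1),(8,7)] 3 (.kid (.descend [2,3,8])
      (.kid (.descend [1,2,8]) (.descend [0,2,7])))) (.descend [2,3,6])) (.kid (.descend [1,2,6])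
      (.descend [0,2,5])))) (.descend [2,3,4])) (.kid (.descend [1,2,4]) (.descend [0,2,3]))))
      (.branch 3 3 2 (.hit [0,1,2] 2048) (.hit [0,1,2] 2048)))))),
    (11, (false, 2, true), .branch 3 1 2 (.branch 4 2 2 (.drop [0,1,2] 3 1 0 153 (.branch 5 3 2
      (.branch 6 4 2 (.branch 7 5 2 (.branch 8 6 3 (.descend [0,1,8]) (.descend [0,1,7])) (.descend
      [0,1,6])) (.descend [0,1,5])) (.descend [0,1,4]))) (.descend [0,1,3])) (.branch 0 2 2 (.branch
      3 4 3 (.branch 5 4 1 (.branch 3 4 3 (.descend [3,4,6]) (.descend [2,3,5])) (.branch 3 1 3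
      (.hit [3,4,5] 2048) (.hit [1,3,4] 2048))) (.hit [1,2,3] 2048)) (.branch 1 2 2 (.branch 3 4 3
      (.branch 5 4 1 (.branch 3 4 3 (.descend [3,4,6]) (.descend [2,3,5])) (.branch 3 1 3 (.hit
      [3,4,5] 2048) (.hit [0,3,4] 2048))) (.hit [0,2,3] 2048)) (.branch 2 3 3 (.branch 4 3 1
      (.branch 2 3 3 (.descend [2,3,5]) (.descend [1,2,4])) (.branch 2 1 3 (.hit [2,3,4] 2048) (.hit
      [0,2,3] 2048))) (.branch 3 3 2 (.hit [0,1,2] 2048) (.hit [0,1,2] 2048)))))),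
    (11, (false, 2, true), .branch 1 3 3 (.branch 4 3 1 (.descend [0,1,4]) (.branch 3 4 3 (.branch 5
      4 1 (.branch 3 0 2 (.branch 7 1 2 (.branch 8 2 1 (.descend [3,4,8]) (.descend [3,4,7]))
      (.descend [3,4,6])) (.descend [0,3,5])) (.branch 3 0 2 (.branch 6 1 2 (.branch 7 2 2 (.branch
      8 3 1 (.descend [3,4,8]) (.descend [3,4,7])) (.descend [3,4,6])) (.hit [3,4,5] 2048)) (.hit
      [0,3,4] 2048))) (.hit [0,1,3] 2048))) (.branch 2 3 3 (.branch 4 3 1 (.branch 2 0 2 (.branch 6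
      1 2 (.branch 7 2 2 (.branch 8 3 1 (.descend [2,3,8]) (.descend [2,3,7])) (.descend [2,3,6]))
      (.descend [2,3,5])) (.descend [0,2,4])) (.branch 2 0 2 (.branch 5 1 2 (.branch 6 2 2 (.drop
      [0,1,2,3,4] 5 1 0 393 (.branch 7 1 2 (.branch 8 2 1 (.descend [2,3,8]) (.descend [2,3,7]))
      (.descend [2,3,6]))) (.descend [2,3,5])) (.hit [2,3,4] 2048)) (.hit [0,2,3] 2048))) (.branch 3
      3 2 (.hit [0,1,2] 2048) (.hit [0,1,2] 2048)))),
    (11, (false, 1, true), .branch 3 1 1 (.split [(2,1),(3,2)] 3 (.kid (.descend [2,3,4]) (.kid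
      (.drop [0,1,2] 3 1 1 210 (.split [(2,1),(3,1)] 3 (.kid (.descend [2,4,5]) (.kid (.descend
      [3,4,5]) (.descend [0,3,4]))))) (.descend [0,2,3])))) (.branch 0 2 2 (.branch 3 4 2 (.split
      [(3,1),(5,4)] 3 (.kid (.descend [3,4,5]) (.kid (.descend [2,3,5]) (.descend [1,3,4])))) (.hit
      [1,2,3] 2048)) (.branch 1 2 2 (.branch 3 4 2 (.split [(3,1),(5,4)] 3 (.kid (.descend [3,4,5])
      (.kid (.descend [2,3,5]) (.descend [0,3,4])))) (.hit [0,2,3] 2048)) (.branch 2 3 2 (.split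
      [(2,1),(4,3)] 3 (.kid (.descend [2,3,4]) (.kid (.descend [1,2,4]) (.descend [0,2,3]))))
      (.branch 3 3 2 (.hit [0,1,2] 2048) (.hit [0,1,2] 2048)))))),
    (13, (false, 2, true), .branch 3 1 0 (.branch 2 0 2 (.split [(4,4),(4,5)] 1 (.kid (.branch 4 0 0
      (.branch 5 0 0 (.branch 6 0 2 (.descend [6,7,8]) (.descend [5,6,7])) (.descend [4,5,6]))
      (.descend [2,4,5])) (.kid (.branch 4 0 0 (.branch 5 0 0 (.branch 6 0 2 (.descend [6,7,8])
      (.descend [5,6,7])) (.descend [4,5,6])) (.descend [2,4,5])) (.descend [2,3,4])))) (.branch 3 3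
      0 (.branch 3 5 1 (.branch 3 0 0 (.branch 4 0 0 (.branch 5 0 2 (.descend [5,6,7]) (.descend
      [4,5,6])) (.descend [3,4,5])) (.descend [0,3,4])) (.descend [0,1,3])) (.branch 3 4 1 (.branch
      3 0 0 (.branch 4 0 0 (.branch 5 0 0 (.branch 6 0 2 (.descend [6,7,8]) (.descend [5,6,7]))
      (.descend [4,5,6])) (.descend [3,4,5])) (.descend [0,3,4])) (.descend [0,2,3])))) (.hit
      [0,1,2] 8192)),
    (13, (false, 0, false), .branch 2 0 2 (.branch 4 2 0 (.branch 5 2 0 (.drop [0,1,2,3] 4 2 1 78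
      (.branch 5 3 0 (.branch 6 3 0 (.branch 7 3 2 (.hit [2,7,8] 8192) (.hit [2,6,7] 8192)) (.hit
      [2,5,6] 8192)) (.hit [2,4,5] 8192))) (.hit [2,3,4] 8192)) (.hit [0,1,3] 8192)) (.drop [0] 1 1
      1 78 (.branch 2 2 0 (.branch 3 2 0 (.branch 4 2 0 (.branch 5 2 0 (.branch 6 2 0 (.branch 7 2 2
      (.hit [0,7,8] 8192) (.hit [0,6,7] 8192)) (.hit [0,5,6] 8192)) (.hit [0,4,5] 8192)) (.hit
      [0,3,4] 8192)) (.hit [0,2,3] 8192)) (.hit [0,1,2] 8192)))),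
    (13, (false, 0, false), .branch 3 1 2 (.branch 3 4 3 (.branch 2 0 2 (.hit [2,4,5] 8192) (.hit
      [0,3,4] 8192)) (.hit [0,1,3] 8192)) (.hit [0,1,2] 8192)),
    (13, (false, 0, false), .branch 3 1 2 (.branch 3 4 3 (.branch 2 0 1 (.branch 1 6 2 (.branch 2 7
      2 (.branch 3 8 3 (.hit [0,3,8] 8192) (.hit [0,2,7] 8192)) (.hit [0,1,6] 8192)) (.hit [2,4,5]
      8192)) (.hit [0,3,4] 8192)) (.hit [0,1,3] 8192)) (.hit [0,1,2] 8192)),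
    (13, (false, 0, false), .branch 2 0 2 (.branch 4 2 2 (.split [(4,3),(4,4),(4,5)] 1 (.kid (.hit
      [2,4,5] 8192) (.kid (.hit [2,4,5] 8192) (.kid (.hit [2,4,5] 8192) (.hit [2,3,4] 8192)))))
      (.hit [0,1,3] 8192)) (.branch 3 1 2 (.split [(3,2),(3,3),(3,4)] 1 (.kid (.hit [0,3,4] 8192)
      (.kid (.hit [0,3,4] 8192) (.kid (.hit [0,3,4] 8192) (.hit [0,2,3] 8192))))) (.hit [0,1,2]
      8192))),
    (13, (false, 0, false), .branch 2 0 1 (.branch 4 2 2 (.split [(4,3),(4,4),(4,5)] 1 (.kid (.hit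
      [2,4,5] 8192) (.kid (.hit [2,4,5] 8192) (.kid (.hit [2,4,5] 8192) (.hit [2,3,4] 8192)))))
      (.hit [0,1,3] 8192)) (.branch 3 1 2 (.split [(3,2),(3,3),(3,4)] 1 (.kid (.hit [0,3,4] 8192)
      (.kid (.hit [0,3,4] 8192) (.kid (.hit [0,3,4] 8192) (.hit [0,2,3] 8192))))) (.hit [0,1,2]
      8192))),
    (13, (false, 0, false), .split [(1,0),(2,0)] 2 (.kid (.drop [1] 1 1 1 78 (.hit [0,1,2] 8192))
      (.kid (.branch 4 2 2 (.drop [2] 1 1 1 78 (.hit [0,1,2] 8192)) (.hit [0,1,3] 8192)) (.drop [0]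
      1 1 1 78 (.hit [0,1,2] 8192))))),
    (14, (false, 0, false), .branch 3 2 1 (.branch 3 3 1 (.hit [0,3,4] 16384) (.hit [0,1,3] 16384))
      (.hit [0,1,2] 16384)),
    (14, (false, 0, false), .branch 3 2 1 (.branch 0 2 0 (.split [(1,4),(5,1)] 1 (.kid (.branch 1 4
      0 (.hit [0,1,6] 16384) (.hit [0,1,5] 16384)) (.kid (.branch 2 2 0 (.hit [1,2,6] 16384) (.hit
      [1,2,5] 16384)) (.hit [0,2,4] 16384)))) (.hit [0,1,3] 16384)) (.hit [0,1,2] 16384)),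
    (14, (false, 0, false), .branch 3 2 1 (.branch 1 2 1 (.branch 1 4 0 (.split [(1,2),(1,3)] 1
      (.kid (.hit [1,2,6] 16384) (.kid (.hit [1,2,6] 16384) (.hit [0,1,5] 16384)))) (.hit [1,2,4]
      16384)) (.hit [0,1,3] 16384)) (.hit [0,1,2] 16384)),
    (14, (true, 1, true), .branch 3 2 1 (.branch 1 2 1 (.split [(1,5),(5,1)] 0 (.kid (.descend
      [0,1,4]) (.kid (.branch 6 2 0 (.branch 7 3 0 (.branch 8 4 1 (.hit [0,2,8] 16384) (.hit [0,2,7]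
      16384)) (.hit [0,2,6] 16384)) (.hit [0,2,5] 16384)) (.hit [1,2,4] 16384)))) (.hit [0,1,3]
      16384)) (.hit [0,1,2] 16384)),
    (14, (false, 1, true), .branch 3 2 1 (.split [(0,2),(3,4)] 3 (.kid (.branch 5 1 1 (.branch 5 6 0
      (.branch 6 7 0 (.branch 7 8 3 (.descend [1,7,8]) (.descend [1,6,7])) (.descend [1,5,6])) (.hit
      [1,2,5] 16384)) (.hit [0,2,4] 16384)) (.kid (.branch 0 2 0 (.branch 6 1 0 (.branch 6 7 0
      (.branch 7 8 3 (.descend [1,7,8]) (.descend [1,6,7])) (.descend [1,4,6])) (.descend [0,4,5]))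
      (.descend [0,3,4])) (.hit [0,1,3] 16384)))) (.hit [0,1,2] 16384)),
    (14, (false, 0, false), .branch 3 2 1 (.branch 0 2 0 (.branch 1 5 0 (.descend [0,1,5]) (.hit
      [0,2,4] 16384)) (.hit [0,1,3] 16384)) (.hit [0,1,2] 16384)),
    (14, (false, 2, true), .branch 3 2 0 (.branch 4 2 0 (.branch 5 2 0 (.branch 6 2 0 (.branch 7 2 2
      (.branch 7 3 2 (.descend [2,7,8]) (.descend [2,6,7])) (.descend [2,5,6])) (.descend [2,4,5]))
      (.descend [2,3,4])) (.descend [0,1,3])) (.hit [0,1,2] 16384)),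
    (14, (false, 2, true), .branch 3 1 2 (.branch 3 4 1 (.split [(2,0),(2,1)] 1 (.kid (.branch 1 6 1
      (.branch 5 7 3 (.branch 1 8 1 (.descend [0,1,8]) (.descend [3,5,7])) (.descend [0,1,6]))
      (.descend [2,4,5])) (.kid (.branch 1 6 1 (.branch 5 7 3 (.branch 1 8 1 (.descend [0,1,8])
      (.descend [3,5,7])) (.descend [0,1,6])) (.descend [2,4,5])) (.descend [0,3,4])))) (.descend
      [0,1,3])) (.branch 1 3 3 (.branch 4 2 0 (.split [(1,2),(4,5)] 1 (.kid (.branch 6 2 1 (.branch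
      6 7 3 (.branch 6 2 1 (.descend [6,7,8]) (.descend [4,6,7])) (.branch 1 2 1 (.descend [1,3,7])
      (.descend [0,2,6]))) (.descend [1,2,5])) (.kid (.descend [3,4,5]) (.descend [0,1,4])))) (.hit
      [0,2,3] 16384)) (.branch 2 0 0 (.branch 4 3 0 (.split [(1,3),(4,5)] 1 (.kid (.branch 6 3 1
      (.branch 6 7 3 (.branch 6 3 1 (.descend [6,7,8]) (.descend [4,6,7])) (.branch 1 3 1 (.descend
      [1,3,7]) (.descend [0,2,6]))) (.descend [1,2,5])) (.kid (.descend [3,4,5]) (.descend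
      [0,1,4])))) (.hit [0,1,3] 16384)) (.branch 3 2 0 (.split [(1,2),(3,4)] 1 (.kid (.branch 5 2 0
      (.split [(1,2),(5,6)] 1 (.kid (.branch 7 2 2 (.split [(1,2),(7,8)] 1 (.kid (.descend [1,4,8])
      (.kid (.descend [4,7,8]) (.descend [0,3,7])))) (.descend [1,3,6])) (.kid (.descend [3,5,6])
      (.descend [0,2,5])))) (.descend [1,2,4])) (.kid (.descend [2,3,4]) (.descend [0,1,3]))))
      (.branch 3 3 0 (.hit [0,1,2] 16384) (.hit [0,1,2] 16384)))))),
    (14, (true, 1, true), .branch 1 3 0 (.branch 2 4 0 (.drop [0,3,4] 1 3 0 51 (.branch 3 5 0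
      (.branch 4 6 0 (.branch 5 7 0 (.branch 6 8 1 (.descend [0,6,8]) (.descend [0,5,7])) (.descend
      [0,4,6])) (.descend [0,3,5])) (.descend [0,2,4]))) (.descend [0,1,3])) (.branch 2 0 0 (.branch
      4 3 1 (.branch 4 5 3 (.branch 4 3 1 (.descend [4,5,6]) (.descend [3,4,5])) (.branch 1 3 1
      (.hit [1,2,5] 16384) (.hit [0,1,4] 16384))) (.hit [0,1,3] 16384)) (.branch 2 1 0 (.branch 4 3
      1 (.branch 4 5 3 (.branch 4 3 1 (.descend [4,5,6]) (.descend [3,4,5])) (.branch 1 3 1 (.hit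
      [1,2,5] 16384) (.hit [0,1,4] 16384))) (.hit [0,1,3] 16384)) (.branch 3 2 1 (.branch 3 4 3
      (.branch 3 2 1 (.descend [3,4,5]) (.descend [2,3,4])) (.branch 1 2 1 (.hit [1,2,4] 16384)
      (.hit [0,1,3] 16384))) (.branch 3 3 0 (.hit [0,1,2] 16384) (.hit [0,1,2] 16384)))))),
    (14, (true, 1, true), .branch 3 1 1 (.branch 3 4 3 (.descend [0,3,4]) (.branch 4 3 1 (.branch 4
      5 3 (.branch 0 3 0 (.branch 1 7 0 (.branch 2 8 3 (.descend [0,2,8]) (.descend [0,1,7]))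
      (.descend [0,5,6])) (.descend [0,4,5])) (.branch 0 3 0 (.branch 1 6 0 (.branch 2 7 0 (.branch
      3 8 3 (.descend [0,3,8]) (.descend [0,2,7])) (.descend [0,1,6])) (.hit [0,2,5] 16384)) (.hit
      [0,1,4] 16384))) (.hit [0,1,3] 16384))) (.branch 3 2 1 (.branch 3 4 3 (.branch 0 2 0 (.branch
      1 6 0 (.branch 2 7 0 (.branch 3 8 3 (.descend [0,3,8]) (.descend [0,2,7])) (.descend [0,1,6]))
      (.descend [0,4,5])) (.descend [0,3,4])) (.branch 0 2 0 (.branch 1 5 0 (.branch 2 6 0 (.drop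
      [0,3,4,5,6] 1 5 0 291 (.branch 1 7 0 (.branch 2 8 3 (.descend [0,2,8]) (.descend [0,1,7]))
      (.descend [0,2,6]))) (.descend [0,1,5])) (.hit [0,2,4] 16384)) (.hit [0,1,3] 16384))) (.branch
      3 3 0 (.hit [0,1,2] 16384) (.hit [0,1,2] 16384)))),
    (14, (true, 2, true), .branch 1 3 3 (.split [(1,2),(2,3)] 1 (.kid (.descend [1,2,3]) (.kid
      (.drop [0,3,4] 1 3 1 60 (.split [(1,2),(1,3)] 1 (.kid (.descend [1,2,3]) (.kid (.descend
      [1,2,3]) (.descend [0,1,2]))))) (.descend [0,1,2])))) (.branch 2 0 0 (.branch 4 3 0 (.split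
      [(1,3),(4,5)] 1 (.kid (.descend [1,2,5]) (.kid (.descend [3,4,5]) (.descend [0,1,4])))) (.hit
      [0,1,3] 16384)) (.branch 2 1 0 (.branch 4 3 0 (.split [(1,3),(4,5)] 1 (.kid (.descend [1,2,5])
      (.kid (.descend [3,4,5]) (.descend [0,1,4])))) (.hit [0,1,3] 16384)) (.branch 3 2 0 (.split
      [(1,2),(3,4)] 1 (.kid (.descend [1,2,4]) (.kid (.descend [2,3,4]) (.descend [0,1,3]))))
      (.branch 3 3 0 (.hit [0,1,2] 16384) (.hit [0,1,2] 16384)))))),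
    (14, (false, 0, false), .branch 3 2 1 (.branch 3 3 2 (.hit [0,3,4] 16384) (.hit [0,1,3] 16384))
      (.hit [0,1,2] 16384)),
    (14, (false, 0, false), .branch 3 2 1 (.branch 3 3 2 (.hit [2,3,4] 16384) (.hit [0,1,3] 16384))
      (.hit [0,1,2] 16384)),
    (14, (false, 0, false), .branch 3 2 1 (.branch 1 2 3 (.branch 1 4 3 (.branch 1 2 3 (.branch 1 5
      0 (.branch 1 2 3 (.hit [1,2,8] 16384) (.hit [0,1,7] 16384)) (.hit [1,2,6] 16384)) (.hit
      [0,1,5] 16384)) (.hit [1,2,4] 16384)) (.hit [0,1,3] 16384)) (.hit [0,1,2] 16384)),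
    (14, (true, 2, true), .branch 3 2 3 (.branch 3 4 3 (.branch 4 4 2 (.branch 4 5 2 (.branch 4 6 2
      (.branch 4 7 3 (.descend [0,3,4]) (.descend [0,3,4])) (.descend [0,3,4])) (.descend [0,3,4]))
      (.descend [0,3,4])) (.hit [0,1,3] 16384)) (.hit [0,1,2] 16384)),
    (14, (true, 2, true), .branch 2 2 2 (.branch 1 2 1 (.branch 1 5 3 (.branch 1 2 2 (.branch 2 3 2
      (.branch 3 4 1 (.descend [3,4,5]) (.descend [2,3,4])) (.descend [1,2,3])) (.descend [0,1,2]))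
      (.descend [1,2,3])) (.descend [0,1,2])) (.branch 1 3 2 (.split [(1,2),(2,4)] 1 (.kid (.branch
      1 5 3 (.branch 1 2 2 (.branch 2 3 2 (.branch 3 4 1 (.descend [3,4,5]) (.descend [2,3,4]))
      (.descend [1,2,3])) (.descend [0,1,2])) (.descend [1,2,3])) (.kid (.drop [0,3,4] 1 3 0 297
      (.split [(1,2),(2,2)] 1 (.kid (.branch 1 6 3 (.branch 1 2 2 (.branch 2 3 1 (.descend [2,3,4])
      (.descend [1,2,3])) (.descend [0,1,2])) (.descend [1,3,4])) (.kid (.branch 1 6 3 (.branch 1 2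
      2 (.branch 2 3 1 (.descend [2,3,5]) (.descend [1,2,4])) (.descend [0,1,3])) (.descend
      [2,3,4])) (.descend [0,2,3]))))) (.descend [0,1,2])))) (.branch 3 2 2 (.branch 3 4 3 (.split
      [(3,0),(3,1)] 1 (.kid (.descend [3,4,5]) (.kid (.descend [3,4,5]) (.descend [2,3,4]))))
      (.branch 1 2 1 (.descend [1,2,4]) (.descend [0,1,3]))) (.hit [0,1,2] 16384)))),
    (14, (true, 2, true), .branch 3 2 3 (.branch 3 4 3 (.split [(2,0),(4,4)] 1 (.kid (.branch 1 6 2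
      (.branch 2 7 2 (.branch 3 8 1 (.descend [0,3,7]) (.descend [0,2,6])) (.descend [0,1,5]))
      (.descend [2,4,5])) (.kid (.drop [0,1,2,5] 3 4 1 60 (.branch 2 0 2 (.branch 1 7 2 (.branch 2 8
      1 (.descend [0,2,6]) (.descend [0,1,5])) (.descend [2,4,5])) (.descend [0,3,4]))) (.descend
      [0,3,4])))) (.hit [0,1,3] 16384)) (.hit [0,1,2] 16384))]
  -- Several of these rules lead to a disjunction: the first one ends in one of three changes of the
  -- shading. A link that uses it has to continue from all three.
  special := [
    ⟨[1024, 34, 96], ((true, 0, false), (true, 2, true)), .branch 0 1 2 (.branch 2 3 2 (.split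
      [(4,3),(4,4)] 2 (.kid (.descend [1,3,4]) (.kid (.split [(2,4),(2,5)] 3 (.kid (.descend
      [1,2,3]) (.kid (.descend [1,2,3]) (.hit [2,3,4] 34)))) (.hit [1,3,4] 1024)))) (.hit [1,2,3]
      96)) (.hit [0,1,2] 34)⟩,
    ⟨[128, 3106, 3824, 1232], ((false, 0, false), (false, 0, false)), .branch 0 0 1 (.split
      [(0,2),(1,2)] 0 (.kid (.split [(3,4),(3,5)] 0 (.kid (.branch 4 6 2 (.split [(4,4),(5,4)] 2
      (.kid (.hit [1,3,4] 3824) (.kid (.hit [1,3,5] 3824) (.hit [3,4,5] 3106)))) (.hit [2,4,5] 128))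
      (.kid (.branch 4 4 2 (.hit [1,3,4] 3824) (.hit [1,3,4] 3824)) (.hit [2,3,4] 1232)))) (.kid
      (.hit [0,1,2] 3824) (.hit [1,2,3] 3106)))) (.branch 3 0 2 (.split [(1,3),(1,4)] 0 (.kid
      (.branch 0 2 2 (.branch 3 6 2 (.split [(3,4),(4,4)] 2 (.kid (.hit [1,2,3] 3824) (.kid (.hit
      [1,2,4] 3824) (.hit [2,3,4] 3106)))) (.hit [1,3,4] 128)) (.hit [0,1,3] 3106)) (.kid (.branch 0
      2 2 (.branch 3 4 2 (.hit [1,2,3] 3824) (.hit [1,2,3] 3824)) (.hit [0,2,3] 3106)) (.hit [0,1,2]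
      1232)))) (.branch 0 1 2 (.split [(2,3),(2,4)] 0 (.kid (.branch 3 5 2 (.split [(3,3),(4,3)] 2
      (.kid (.hit [1,2,3] 3824) (.kid (.hit [1,2,4] 3824) (.hit [2,3,4] 3106)))) (.hit [1,3,4] 128))
      (.kid (.branch 3 3 2 (.hit [1,2,3] 3824) (.hit [1,2,3] 3824)) (.hit [1,2,3] 1232)))) (.branch
      2 1 2 (.hit [0,1,2] 3106) (.branch 3 1 2 (.hit [0,2,3] 3106) (.branch 1 2 2 (.hit [0,1,3]
      3106) (.branch 3 2 2 (.hit [0,1,2] 3106) (.branch 1 3 2 (.hit [0,2,3] 3106) (.branch 3 3 2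
      (.hit [0,1,2] 128) (.hit [0,1,2] 128)))))))))⟩,
    ⟨[34], ((true, 0, true), (false, 0, false)), .branch 0 2 0 (.branch 2 1 0 (.branch 2 5 1 (.split
      [(4,5),(4,6),(6,4)] 1 (.kid (.descend [0,4,5]) (.kid (.descend [0,4,5]) (.kid (.split
      [(6,5),(6,6),(6,7)] 1 (.kid (.descend [0,6,7]) (.kid (.descend [0,6,7]) (.kid (.descend
      [0,6,7]) (.descend [0,4,6]))))) (.descend [0,2,4]))))) (.descend [2,3,4])) (.hit [1,2,3] 34))
      (.branch 1 1 2 (.branch 1 4 1 (.branch 4 1 2 (.branch 4 2 1 (.branch 5 4 1 (.hit [0,5,6] 34)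
      (.hit [0,4,5] 34)) (.branch 4 3 1 (.hit [0,4,5] 34) (.hit [0,3,4] 34))) (.branch 2 3 1
      (.branch 3 2 1 (.hit [0,3,4] 34) (.hit [0,2,3] 34)) (.branch 2 2 1 (.hit [0,2,3] 34) (.hit
      [0,1,2] 34)))) (.branch 1 2 3 (.descend [1,3,4]) (.descend [1,2,3]))) (.branch 1 2 0 (.hit
      [0,2,3] 34) (.branch 1 3 0 (.hit [0,2,3] 34) (.branch 2 0 0 (.hit [0,1,3] 34) (.branch 2 1 0
      (.hit [0,1,3] 34) (.branch 3 0 0 (.hit [0,1,2] 34) (.branch 3 2 0 (.hit [0,1,2] 34) (.branch 3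
      3 0 (.hit [0,1,2] 34) (.hit [0,1,2] 34)))))))))⟩,
    ⟨[11793], ((false, 1, true), (false, 0, false)), .branch 2 2 0 (.descend [0,2,3]) (.branch 2 3 0
      (.descend [0,2,3]) (.branch 3 1 0 (.descend [0,2,3]) (.split [(0,0),(1,0),(2,1)] 2 (.kid
      (.branch 4 1 0 (.descend [0,3,4]) (.branch 3 2 0 (.split [(3,1),(4,1),(4,2)] 2 (.kid (.branch
      3 2 0 (.descend [0,3,4]) (.hit [0,2,3] 11793)) (.kid (.descend [0,3,4]) (.kid (.descend
      [0,3,4]) (.hit [0,2,3] 11793))))) (.branch 3 1 0 (.branch 4 1 0 (.descend [0,3,4]) (.hit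
      [0,2,3] 11793)) (.hit [0,2,3] 11793)))) (.kid (.branch 4 1 0 (.descend [1,3,4]) (.branch 3 2 0
      (.split [(3,1),(4,1),(4,2)] 2 (.kid (.branch 3 2 0 (.descend [1,3,4]) (.hit [1,2,3] 11793))
      (.kid (.descend [1,3,4]) (.kid (.descend [0,3,4]) (.hit [1,2,3] 11793))))) (.branch 3 1 0
      (.branch 4 1 0 (.descend [1,3,4]) (.hit [1,2,3] 11793)) (.hit [1,2,3] 11793)))) (.kid (.branch
      2 2 0 (.descend [0,2,3]) (.hit [0,1,2] 11793)) (.hit [0,1,2] 11793)))))))⟩,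
    ⟨[17603], ((true, 2, true), (false, 0, false)), .branch 2 2 2 (.descend [0,1,2]) (.branch 3 2 2
      (.descend [0,1,3]) (.branch 1 3 2 (.descend [0,1,2]) (.split [(0,0),(0,1),(1,2)] 0 (.kid
      (.branch 1 4 2 (.descend [0,1,3]) (.branch 2 3 2 (.split [(1,3),(1,4),(2,4)] 0 (.kid (.branch
      2 3 2 (.descend [0,1,2]) (.hit [0,1,5] 17603)) (.kid (.descend [0,1,3]) (.kid (.descend
      [0,2,3]) (.hit [0,2,4] 17603))))) (.branch 1 3 2 (.branch 1 4 2 (.descend [0,1,2]) (.hit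
      [0,1,4] 17603)) (.hit [0,2,3] 17603)))) (.kid (.branch 1 4 2 (.descend [0,1,3]) (.branch 2 3 2
      (.split [(1,3),(1,4),(2,4)] 0 (.kid (.branch 2 3 2 (.descend [0,1,2]) (.hit [0,1,5] 17603))
      (.kid (.descend [0,1,3]) (.kid (.descend [1,2,3]) (.hit [0,2,4] 17603))))) (.branch 1 3 2
      (.branch 1 4 2 (.descend [0,1,2]) (.hit [0,1,4] 17603)) (.hit [0,2,3] 17603)))) (.kid (.branch
      2 2 2 (.descend [0,1,2]) (.hit [0,1,3] 17603)) (.hit [0,1,2] 17603)))))))⟩,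
    ⟨[2130], ((true, 1, true), (false, 0, false)), .branch 2 3 3 (.branch 4 3 3 (.branch 2 0 2
      (.branch 4 5 3 (.branch 3 6 0 (.branch 4 6 3 (.descend [2,3,4]) (.descend [2,3,5])) (.descend
      [2,3,4])) (.branch 3 5 0 (.branch 4 5 0 (.branch 5 6 3 (.descend [2,3,5]) (.descend [2,3,4]))
      (.descend [2,3,6])) (.descend [2,3,5]))) (.branch 2 4 0 (.split [(3,4),(4,4)] 3 (.kid
      (.descend [0,2,3]) (.kid (.descend [0,2,4]) (.descend [0,2,5])))) (.branch 3 4 0 (.branch 4 5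
      0 (.branch 5 6 0 (.branch 6 7 3 (.descend [0,2,6]) (.descend [0,2,5])) (.descend [0,2,4]))
      (.descend [0,2,3])) (.descend [0,2,4])))) (.branch 3 3 3 (.branch 2 0 2 (.branch 3 5 0
      (.branch 4 5 0 (.branch 5 6 3 (.descend [2,3,5]) (.descend [2,3,4])) (.descend [2,3,5]))
      (.descend [2,3,4])) (.branch 2 4 0 (.branch 3 4 0 (.branch 4 5 0 (.branch 5 6 3 (.descend
      [0,2,5]) (.descend [0,2,4])) (.descend [0,2,3])) (.descend [0,2,4])) (.descend [0,2,3])))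
      (.branch 0 1 0 (.branch 1 5 0 (.branch 1 1 2 (.split [(3,6),(7,6)] 3 (.kid (.descend [1,2,3])
      (.kid (.descend [1,2,7]) (.descend [1,2,5])))) (.branch 2 5 3 (.branch 7 6 0 (.branch 8 7 3
      (.descend [0,1,8]) (.descend [0,1,7])) (.descend [0,1,2])) (.branch 6 5 0 (.branch 7 6 0
      (.branch 8 7 3 (.descend [0,1,8]) (.descend [0,1,7])) (.descend [0,1,6])) (.descend
      [0,1,4])))) (.hit [0,3,4] 2130)) (.hit [0,2,3] 2130)))) (.branch 0 1 0 (.branch 1 4 0 (.branch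
      1 1 2 (.split [(3,5),(6,5)] 3 (.kid (.descend [1,2,3]) (.kid (.descend [1,2,6]) (.descend
      [1,2,4])))) (.branch 2 4 3 (.branch 6 5 0 (.branch 7 6 0 (.branch 8 7 3 (.descend [0,1,8])
      (.descend [0,1,7])) (.descend [0,1,6])) (.descend [0,1,2])) (.branch 5 4 0 (.branch 6 5 0
      (.branch 7 6 0 (.branch 8 7 3 (.descend [0,1,8]) (.descend [0,1,7])) (.descend [0,1,6]))
      (.descend [0,1,5])) (.descend [0,1,3])))) (.hit [0,2,3] 2130)) (.hit [0,1,2] 2130))⟩,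
    ⟨[48], ((false, 0, true), (false, 0, false)), .branch 2 0 2 (.branch 1 2 2 (.branch 5 2 3
      (.split [(5,4),(6,4),(4,6)] 3 (.kid (.descend [3,4,5]) (.kid (.descend [3,4,6]) (.kid (.split
      [(5,6),(6,6),(7,6)] 3 (.kid (.descend [3,4,5]) (.kid (.descend [3,4,6]) (.kid (.descend
      [3,4,7]) (.descend [3,4,5]))))) (.descend [3,4,5]))))) (.descend [1,2,4])) (.hit [0,1,3] 48))
      (.branch 1 1 0 (.branch 4 1 3 (.branch 1 4 0 (.branch 2 4 3 (.branch 4 5 3 (.hit [0,1,4] 48)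
      (.hit [0,1,2] 48)) (.branch 3 4 3 (.hit [0,1,3] 48) (.hit [0,1,4] 48))) (.branch 3 2 3
      (.branch 2 3 3 (.hit [0,1,2] 48) (.hit [0,1,3] 48)) (.branch 2 2 3 (.hit [0,1,2] 48) (.hit
      [0,1,4] 48)))) (.branch 2 1 1 (.descend [2,3,4]) (.descend [1,2,3]))) (.branch 2 1 2 (.hit
      [0,1,3] 48) (.branch 3 1 2 (.hit [0,1,2] 48) (.branch 0 2 2 (.hit [1,2,3] 48) (.branch 1 2 2
      (.hit [0,2,3] 48) (.branch 0 3 2 (.hit [1,2,3] 48) (.branch 2 3 2 (.hit [0,1,3] 48) (.branch 3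
      3 2 (.hit [0,1,2] 48) (.hit [0,1,2] 48)))))))))⟩,
    ⟨[1024, 48, 544], ((false, 0, false), (false, 1, true)), .branch 1 0 0 (.branch 3 2 0 (.split
      [(3,4),(4,4)] 0 (.kid (.descend [0,3,5]) (.kid (.split [(4,2),(5,2)] 1 (.kid (.descend
      [0,3,4]) (.kid (.descend [0,3,5]) (.hit [3,4,5] 48)))) (.hit [0,2,4] 1024)))) (.hit [0,2,3]
      544)) (.hit [0,1,2] 48)⟩,
    ⟨[16914], ((false, 2, true), (false, 0, false)), .branch 3 2 1 (.branch 3 4 1 (.branch 0 2 0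
      (.branch 5 4 1 (.branch 6 3 2 (.branch 6 4 1 (.descend [0,6,7]) (.descend [0,5,6])) (.descend
      [0,5,6])) (.branch 5 3 2 (.branch 5 4 2 (.branch 6 5 1 (.descend [0,6,7]) (.descend [0,5,6]))
      (.descend [0,4,5])) (.descend [0,4,5]))) (.branch 4 2 2 (.split [(4,3),(4,4)] 1 (.kid
      (.descend [0,4,5]) (.kid (.descend [0,4,5]) (.descend [0,3,4])))) (.branch 4 3 2 (.branch 5 4
      2 (.branch 6 5 2 (.branch 7 6 1 (.descend [0,7,8]) (.descend [0,6,7])) (.descend [0,5,6]))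
      (.descend [0,4,5])) (.descend [0,3,4])))) (.branch 3 3 1 (.branch 0 2 0 (.branch 5 3 2
      (.branch 5 4 2 (.branch 6 5 1 (.descend [0,6,7]) (.descend [0,5,6])) (.descend [0,4,5]))
      (.descend [0,4,5])) (.branch 4 2 2 (.branch 4 3 2 (.branch 5 4 2 (.branch 6 5 1 (.descend
      [0,6,7]) (.descend [0,5,6])) (.descend [0,4,5])) (.descend [0,3,4])) (.descend [0,3,4])))
      (.branch 1 0 2 (.branch 5 1 2 (.branch 1 1 0 (.split [(6,3),(6,7)] 1 (.kid (.descend [1,6,7])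
      (.kid (.descend [1,6,7]) (.descend [1,5,6])))) (.branch 5 2 1 (.branch 6 7 2 (.branch 7 8 1
      (.descend [1,7,8]) (.descend [1,6,7])) (.descend [1,5,6])) (.branch 5 6 2 (.branch 6 7 2
      (.branch 7 8 1 (.descend [1,7,8]) (.descend [1,6,7])) (.descend [1,5,6])) (.descend
      [1,4,5])))) (.hit [1,2,4] 16914)) (.hit [0,1,3] 16914)))) (.branch 1 0 2 (.branch 4 1 2
      (.branch 1 1 0 (.split [(5,3),(5,6)] 1 (.kid (.descend [1,5,6]) (.kid (.descend [1,5,6])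
      (.descend [1,4,5])))) (.branch 4 2 1 (.branch 5 6 2 (.branch 6 7 2 (.branch 7 8 1 (.descend
      [1,7,8]) (.descend [1,6,7])) (.descend [1,5,6])) (.descend [1,4,5])) (.branch 4 5 2 (.branch 5
      6 2 (.branch 6 7 2 (.branch 7 8 1 (.descend [1,7,8]) (.descend [1,6,7])) (.descend [1,5,6]))
      (.descend [1,4,5])) (.descend [1,3,4])))) (.hit [1,2,3] 16914)) (.hit [0,1,2] 16914))⟩,
    ⟨[8192, 17456, 26210, 9730], ((false, 0, false), (false, 0, false)), .branch 0 0 3 (.split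
      [(2,0),(2,1)] 2 (.kid (.split [(4,3),(5,3)] 2 (.kid (.branch 6 4 0 (.split [(4,4),(4,5)] 0
      (.kid (.hit [0,4,5] 26210) (.kid (.hit [0,4,5] 26210) (.hit [4,5,6] 17456)))) (.hit [1,3,5]
      8192)) (.kid (.branch 4 4 0 (.hit [0,4,6] 26210) (.hit [0,4,5] 26210)) (.hit [1,3,4] 9730))))
      (.kid (.hit [0,1,2] 26210) (.hit [1,2,3] 17456)))) (.branch 0 3 0 (.split [(3,1),(4,1)] 2
      (.kid (.branch 2 0 0 (.branch 6 3 0 (.split [(4,3),(4,4)] 0 (.kid (.hit [1,4,5] 26210) (.kid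
      (.hit [1,4,5] 26210) (.hit [4,5,6] 17456)))) (.hit [1,3,5] 8192)) (.hit [1,2,3] 17456)) (.kid
      (.branch 2 0 0 (.branch 4 3 0 (.hit [1,4,6] 26210) (.hit [1,4,5] 26210)) (.hit [1,2,3] 17456))
      (.hit [1,2,3] 9730)))) (.branch 1 0 0 (.split [(3,2),(4,2)] 2 (.kid (.branch 5 3 0 (.split
      [(3,3),(3,4)] 0 (.kid (.hit [0,3,4] 26210) (.kid (.hit [0,3,4] 26210) (.hit [3,4,5] 17456))))
      (.hit [0,2,4] 8192)) (.kid (.branch 3 3 0 (.hit [0,3,5] 26210) (.hit [0,3,4] 26210)) (.hit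
      [0,2,3] 9730)))) (.branch 1 2 0 (.hit [0,1,3] 17456) (.branch 1 3 0 (.hit [0,1,2] 17456)
      (.branch 2 1 0 (.hit [0,1,2] 17456) (.branch 2 3 0 (.hit [0,1,3] 17456) (.branch 3 1 0 (.hit
      [0,1,2] 17456) (.branch 3 3 0 (.hit [0,1,2] 8192) (.hit [0,1,2] 8192)))))))))⟩,
    ⟨[19008], ((false, 0, false), (false, 0, false)), .branch 2 1 0 (.branch 1 3 0 (.branch 2 3 0
      (.branch 3 3 0 (.branch 4 3 0 (.branch 5 3 2 (.hit [0,5,7] 19008) (.hit [0,4,6] 19008)) (.hit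
      [0,3,5] 19008)) (.hit [0,2,4] 19008)) (.hit [0,1,3] 19008)) (.hit [0,1,2] 19008)) (.branch 1 2
      2 (.hit [0,1,3] 19008) (.hit [0,1,2] 19008))⟩,
    ⟨[19008], ((false, 0, false), (false, 0, false)), .branch 3 2 3 (.branch 2 4 1 (.hit [0,2,4]
      19008) (.hit [0,1,3] 19008)) (.branch 2 3 1 (.hit [0,2,3] 19008) (.hit [0,1,2] 19008))⟩]
  links := [
    ⟨2108, 3132, 2236, [7], 0, [[7], [7,10,5,1], [5,7,10,6]]⟩, ⟨2228, 3252, 2228, [], 0, [[],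
    [10,5,1], [5,10,6]]⟩, ⟨2108, 3260, 2236, [7], 0, [[], [10,5,1], [5,10,6]]⟩, ⟨3388, 3516,
    3388, [], 1, [[], [7,10,11,5,1], [4,5,10,6,11,9], [4,10,6]]⟩, ⟨2620, 3644, 2748, [7], 0,
    [[7], [7,10,5,1], [5,7,10,6]]⟩, ⟨2740, 3764, 2740, [], 0, [[], [9,10,5,9,1], [5,10,6]]⟩,
    ⟨2620, 3772, 2748, [7], 0, [[], [9,10,5,9,1], [5,10,6]]⟩, ⟨2996, 4020, 2996, [], 0, [[],
    [9,10,5,9,1], [5,10,6]]⟩, ⟨9224, 11304, 11274, [1,11], 2, [[]]⟩, ⟨0, 11792, 0, [], 3, [[0]]⟩,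
    ⟨0, 11793, 0, [], 3, [[]]⟩, ⟨0, 17602, 0, [], 4, [[0]]⟩, ⟨0, 17603, 0, [], 4, [[]]⟩, ⟨0,
    19586, 17617, [17619,1,4], 5, [[0]]⟩, ⟨0, 19587, 17617, [17619,1,4], 5, [[]]⟩, ⟨5248, 21664,
    21648, [4,14], 6, [[]]⟩, ⟨20770, 21794, 28962, [13], 7, [[13], [10,5,4,13], [5,10,9,13]]⟩,
    ⟨20834, 21858, 29026, [13], 7, [[13], [10,13,5,4], [5,10,9,13]]⟩, ⟨24866, 25890, 24866, [],
    7, [[], [10,5,4], [5,10,9]]⟩, ⟨24930, 25954, 24930, [], 7, [[], [6,10,5,6,4], [5,10,9]]⟩,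
    ⟨24934, 25958, 24934, [], 7, [[], [6,10,5,6,4], [5,10,9]]⟩, ⟨0, 27664, 11779, [11809,4,1], 8,
    [[0]]⟩, ⟨0, 27665, 11779, [11809,4,1], 8, [[]]⟩, ⟨20770, 29986, 28962, [13], 7, [[],
    [10,5,4], [5,10,9]]⟩, ⟨21798, 29990, 21798, [], 9, [[], [13,10,14,5,4], [1,5,10,9,14,6],
    [1,10,9]]⟩, ⟨20834, 30050, 29026, [13], 7, [[], [6,10,5,6,4], [5,10,9]]⟩, ⟨52257, 34401,
    52257, [], 10, [[]]⟩, ⟨34401, 52257, 34401, [], 11, [[]]⟩, ⟨52268, 34412, 52270, [1], 10,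
    [[1]]⟩, ⟨34412, 52268, 34412, [], 11, [[]]⟩, ⟨52271, 34415, 52271, [], 10, [[]]⟩, ⟨34415,
    52271, 34415, [], 11, [[]]⟩, ⟨56608, 38752, 56624, [4], 10, [[4]]⟩, ⟨38752, 56608, 38752, [],
    11, [[]]⟩, ⟨56625, 38769, 56625, [], 10, [[]]⟩, ⟨38769, 56625, 38769, [], 11, [[]]⟩, ⟨56638,
    38782, 56638, [], 10, [[]]⟩, ⟨38782, 56638, 38782, [], 11, [[]]⟩, ⟨56639, 38783, 56639, [],
    10, [[]]⟩, ⟨38783, 56639, 38783, [], 11, [[]]⟩]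
  ops := [
    10, 11, 14, 7, 13, 0, 5, 6, 9, 1, 4, 13, 0, 7, 10, 5, 11, 14, 13, 4, 7, 1, 0, 10, 6, 9, 11,
    5, 13, 1, 4, 7, 0, 5, 14, 5, 22, 14, 6, 7, 5, 4, 10, 7, 5, 25, 11, 9, 13, 5, 1, 10, 13, 5,
    27, 9, 11, 7, 0, 10, 1, 4, 7, 30, 6, 14, 13, 0, 10, 1, 4, 13, 22, 10, 6, 7, 17, 13, 1, 9, 0,
    20, 7, 4, 6, 0, 21, 6, 5, 7, 13, 21, 9, 5, 13, 7, 25, 10, 9, 13, 17, 9, 1, 0, 6, 20, 6, 4, 0,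
    9, 21, 7, 5, 13, 1, 6, 1, 9, 13, 9, 21, 13, 5, 4, 9, 4, 6, 23, 4, 7, 11, 5, 13, 29, 1, 13,
    14, 5, 7, 22, 5, 6, 4, 25, 5, 9, 22, 4, 6, 25, 1, 9, 20, 7, 4, 0, 23, 5, 7, 29, 5, 13, 23,
    14, 7, 17, 13, 1, 27, 10, 11, 7, 0, 29, 11, 13, 30, 10, 14, 13, 0, 17, 13, 1, 0, 20, 7, 4, 0,
    27, 9, 11, 4, 7, 30, 6, 14, 1, 13, 17, 21, 9, 1, 5, 13, 20, 21, 6, 4, 5, 7, 17, 21, 13, 1, 5,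
    7, 20, 21, 7, 4, 5, 17, 27, 9, 11, 1, 0, 7, 27, 25, 1, 9, 11, 20, 30, 6, 14, 4, 0, 13, 30,
    22, 4, 6, 14, 23, 21, 4, 7, 13, 5, 9, 23, 5, 7, 29, 21, 1, 13, 7, 5, 6, 29, 5, 13, 27, 25, 5,
    9, 11, 30, 22, 5, 6, 14, 22, 23, 4, 7, 6, 5, 25, 29, 1, 13, 9, 17, 25, 11, 1, 9, 5, 10, 17,
    9, 1, 17, 13, 1, 20, 22, 14, 4, 6, 5, 10, 20, 6, 4, 20, 7, 4, 17, 21, 9, 1, 5, 13, 22, 23, 5,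
    7, 6, 23, 29, 5, 13, 7, 4, 23, 11, 7, 13, 0, 23, 30, 6, 7, 14, 4, 7, 13, 22, 23, 5, 7, 6, 14,
    27, 9, 11, 7, 20, 7, 4, 29, 14, 13, 7, 0, 29, 1, 13, 22, 29, 5, 13, 6, 13, 23, 25, 5, 7, 9,
    7, 25, 29, 5, 13, 9]
  jumps := [
    (3132, 2108, [10], [3148]), (3252, 2228, [10], [3268]), (3260, 2108, [7,10], [3276]), (3516,
    3388, [7], [3532]), (3644, 2620, [10], [3660]), (3764, 2740, [10], [3780]), (3772, 2620,
    [7,10], [3788]), (4020, 2996, [10], [4036]), (4408, 4376, [5], [7,9,13,5,7,9,13]), (8773, 4,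
    [0,6,9,13], [0,1,9,13,6,1]), (8781, 12, [0,6,9,13], [0,1,9,13,6,1]), (11304, 9224, [5,11],
    [11320]), (11792, 0, [4,9,10,11,13], [11808]), (11793, 0, [0,4,9,10,11,13], [11809]), (12332,
    4110, [1,5,13], [7,13,1,6,5,6,7]), (17602, 0, [1,6,7,10,14], [17618]), (17603, 0,
    [0,1,6,7,10,14], [17619]), (19512, 8, [4,5,10,11,14], [5,7,11,4,14,10,7]), (19586, 0,
    [1,7,10,11,14], [19602]), (19587, 0, [0,1,7,10,11,14], [19603]), (21664, 5248, [5,14],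
    [21680]), (21794, 20770, [10], [21810]), (21858, 20834, [10], [21874]), (22690, 4096,
    [1,5,7,11,14], [11,13,1,7,14,5,13]), (23586, 4096, [1,5,10,11,14], [5,13,11,14,1,10,13]),
    (25890, 24866, [10], [25906]), (25954, 24930, [10], [25970]), (25958, 24934, [10], [25974]),
    (26680, 8, [4,5,11,13,14], [7,4,13,14,11,5,7]), (27664, 0, [4,10,11,13,14], [27680]), (27665,
    0, [0,4,10,11,13,14], [27681]), (29986, 20770, [10,13], [30002]), (29990, 21798, [13],
    [30006]), (30050, 20834, [10,13], [30066]), (32796, 32780, [4], [7,14,6,4,6,7,14]), (36892,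
    36876, [4], [7,14,6,4,6,7,14]), (37030, 36998, [5], [13,14,6,5,6,13,14]), (37122, 37120, [1],
    [11,9,11,13,1,9,13]), (37130, 37128, [1], [11,9,11,13,1,9,13]), (37152, 37120, [5],
    [11,9,11,13,5,9,13]), (37154, 37120, [1,5], [11,9,11,13,1,5,9,13]), (37176, 37144, [5],
    [7,11,9,11,13,5,7,9,13]), (37258, 37144, [1,4,7], [7,4,11,9,11,13,1,9,13]), (37282, 37250,
    [5], [11,9,11,13,5,9,13]), (37290, 37144, [1,4,5,7], [7,4,11,9,11,13,1,5,9,13]), (41272,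
    41240, [5], [7,11,9,5,7,9,11]), (45084, 36878, [4,1,13], [7,13,1,14,6,4,6,7,14]), (45100,
    36878, [1,5,13], [7,13,1,14,6,5,6,7,14]), (52257, 34401, [34417], [52273]), (52268, 34412,
    [34428], [52284]), (52271, 34415, [34431], [52287]), (56608, 38752, [38768], [56624]),
    (56625, 38769, [38785], [56641]), (56638, 38782, [38798], [56654]), (56639, 38783, [38799],
    [56655])]

theorem distributed_132 : Distributed 3 (nth [0, 2, 1]) representatives132 33350
    [23035, 6598, 286, 2182, 46, 164, 0] :=
  Certificate.check_sound pairsSound_pairRules certificate132 (by decide +kernel)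

end PointSet
namespace PointSet

/-! ### Lower bounds for the number of classes -/

/-- The family of shadings contained in the permutation `w`. -/
def witness (k : ℕ) (τ w : List ℕ) : ℕ :=
  cond (and (isPerm w) (Nat.ble w.length 10)) (contMask k τ w) 0

/-- Two shadings that are contained in the same permutations of size at most `10`. -/
def Agree (k : ℕ) (τ : List ℕ) (r r' : ℕ) : Prop :=
  ∀ w, isPerm w = true → w.length ≤ 10 →
    (contMask k τ w).testBit r = (contMask k τ w).testBit r'

/-- A family of shadings that contains both or none of `r` and `r'`. -/
def Stable (r r' x : ℕ) : Prop := x.testBit r = x.testBit r'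

/-- The family of a permutation is replaced by the empty one unless the list is a permutation of
size at most 10. The size bound is thus checked during evaluation and no data have to be trusted. -/
theorem Agree.stable_witness {k : ℕ} {τ : List ℕ} {r r' : ℕ} (h : Agree k τ r r') (w : List ℕ) :
    Stable r r' (witness k τ w) := by
  rw [witness, Bool.cond_eq_ite]
  split_ifs with hw
  · rw [Bool.and_eq_true, Nat.ble_eq] at hw
    exact h w hw.1 hw.2
  · simp [Stable]

section Stable

variable {e r r' : ℕ}

theorem Stable.zero : Stable r r' 0 := by simp [Stable]

theorem Stable.ones (hr : r < 2 ^ e) (hr' : r' < 2 ^ e) : Stable r r' (ones e) := by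
  rw [Stable, testBit_ones hr, testBit_ones hr']

theorem Stable.land {x y : ℕ} (hx : Stable r r' x) (hy : Stable r r' y) :
    Stable r r' (Nat.land x y) := by
  rw [Stable, testBit_land, testBit_land, hx, hy]

theorem Stable.lor {x y : ℕ} (hx : Stable r r' x) (hy : Stable r r' y) :
    Stable r r' (Nat.lor x y) := by
  rw [Stable, testBit_lor, testBit_lor, hx, hy]

theorem Stable.xor {x y : ℕ} (hx : Stable r r' x) (hy : Stable r r' y) :
    Stable r r' (Nat.xor x y) := by
  rw [Stable, testBit_xor', testBit_xor', hx, hy]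

theorem Stable.compl (hr : r < 2 ^ e) (hr' : r' < 2 ^ e) {x : ℕ} (hx : Stable r r' x) :
    Stable r r' (compl e x) :=
  (Stable.ones hr hr').xor hx

theorem Stable.cond {x y : ℕ} (b : Bool) (hx : Stable r r' x) (hy : Stable r r' y) :
    Stable r r' (cond b x y) := by
  cases b <;> assumption

theorem Stable.nth {l : List ℕ} (hl : ∀ x ∈ l, Stable r r' x) (i : ℕ) : Stable r r' (nth l i) := by
  rw [nth_eq, List.getD_eq_getElem?_getD]
  by_cases h : i < l.length
  · rw [List.getElem?_eq_getElem h]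
    exact hl _ (List.getElem_mem h)
  · rw [List.getElem?_eq_none (not_lt.1 h)]
    exact Stable.zero

end Stable

/-- Evaluate the permutations in a list of rules. -/
def evalRow (k : ℕ) (τ : List ℕ) (row : List (List ℕ × List ℕ)) :
    (List (ℕ × List ℕ) → Bool) → Bool :=
  List.rec (fun f => f []) (fun x _ rest f =>
    force (compl ((k + 1) * (k + 1)) (witness k τ x.1)) fun m => rest fun ys => f ((m, x.2) :: ys)) row

/-- Evaluate the permutations in all rules. -/
def evalRows (k : ℕ) (τ : List ℕ) (rows : List (List (List ℕ × List ℕ))) :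
    (List (List (ℕ × List ℕ)) → Bool) → Bool :=
  List.rec (fun f => f []) (fun row _ rest f => evalRow k τ row fun y => rest fun ys => f (y :: ys)) rows

/-- The disjunction of the rules in a row. -/
def rowMask (S : List ℕ) (row : List (ℕ × List ℕ)) : ℕ :=
  List.rec 0 (fun x _ y => Nat.lor (List.rec x.1 (fun a _ z => Nat.land z (nth S a)) x.2) y) row

/-- New approximations from the complements `S` of old ones. -/
def refine (S : List ℕ) (rows : List (List (ℕ × List ℕ))) : List Bool → List ℕ → List ℕ :=
  List.rec (fun _ _ => [])
    (fun row _ rest done T => cond (done.headD false) (T.headD 0) (rowMask S row) ::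
      rest done.tail T.tail) rows

/-- Repeated improvement of the lower and upper approximations `L` and `U`. -/
def alternate (e : ℕ) (rows : List (List (ℕ × List ℕ))) (done : List Bool) (n : ℕ) :
    List ℕ → List ℕ → (List ℕ → List ℕ → Bool) → Bool :=
  Nat.rec (fun L U f => f L U)
    (fun _ rest L U f => forceList (L.map (compl e)) fun L' => forceList (refine L' rows done U) fun U =>
      forceList (U.map (compl e)) fun U' => forceList (refine U' rows done L) fun L => rest L U f) n

/-- The family given by a decision list; a term consists of a value, a permutation and its sign, and
the index and the sign of an approximation. -/
def decisionMask (k : ℕ) (τ : List ℕ) (V : List ℕ) (last : Bool)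
    (l : List (Bool × List ℕ × Bool × ℕ × Bool)) : ℕ :=
  let e := (k + 1) * (k + 1)
  List.rec (cond last (ones e) 0) (fun t _ rest => force (witness k τ t.2.1) fun F =>
    force (nth V t.2.2.2.1) fun v =>
      force (Nat.land (cond t.2.2.1 F (compl e F)) (cond t.2.2.2.2 v (compl e v))) fun g =>
        cond t.1 (Nat.lor g rest) (Nat.land (compl e g) rest)) l

/-- Decide the cells in the list `steps`, improving the approximations after each of them. -/
def decideAll (k : ℕ) (τ : List ℕ) (rows : List (List (ℕ × List ℕ))) (n : ℕ)
    (steps : List (ℕ × Bool × List (Bool × List ℕ × Bool × ℕ × Bool))) :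
    List Bool → List ℕ → List ℕ → (List ℕ → Bool) → Bool :=
  let e := (k + 1) * (k + 1)
  List.rec (fun _ L _ f => f L)
    (fun s _ rest done L U f =>
      force (Nat.lor (nth L s.1) (Nat.land (nth U s.1) (decisionMask k τ (L ++ U) s.2.1 s.2.2))) fun x =>
        forceList ((List.range e).map fun b => cond (Nat.beq b s.1) x (nth L b)) fun L =>
        forceList ((List.range e).map fun b => cond (Nat.beq b s.1) x (nth U b)) fun U =>
          alternate e rows ((List.range e).map fun b => cond (Nat.beq b s.1) true (done.getD b false))
            n L U fun L U => rest ((List.range e).map fun b =>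
              cond (Nat.beq b s.1) true (done.getD b false)) L U f) steps

/-- Corrections `(c, D, s, w)`: change the cells `D` at the shadings that were assigned `c` and
contain, or do not contain, the permutation `w`. -/
def correct (k : ℕ) (τ : List ℕ) (l : List (ℕ × ℕ × Bool × List ℕ)) :
    List ℕ → (List ℕ → Bool) → Bool :=
  let e := (k + 1) * (k + 1)
  List.rec (fun C f => f C)
    (fun p _ rest C f => force (witness k τ p.2.2.2) fun F =>
      force (Nat.land (cond p.2.2.1 F (compl e F))
        (allLT e (fun b => cond (Nat.testBit p.1 b) (nth C b) (compl e (nth C b))) e)) fun g =>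
      forceList ((List.range e).map fun b =>
        cond (Nat.testBit p.2.1 b) (Nat.xor (nth C b) g) (nth C b)) fun C => rest C f) l

/-- A certificate that the shadings in a family are contained in different permutations. -/
structure Separation where
  rows : List (List (List ℕ × List ℕ))
  steps : List (ℕ × Bool × List (Bool × List ℕ × Bool × ℕ × Bool))
  corrections : List (ℕ × ℕ × Bool × List ℕ)

/-- Verification of a certificate. -/
def Separation.check (k : ℕ) (τ : List ℕ) (rep : ℕ) (S : Separation) : Bool :=
  let e := (k + 1) * (k + 1)
  evalRows k τ S.rows fun rows =>
    alternate e rows [] 4 ((List.range e).map fun _ => 0) ((List.range e).map fun _ => ones e)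
      fun L U => decideAll k τ rows 2 S.steps [] L U fun C => correct k τ S.corrections C fun C =>
        allB (fun b => Nat.beq (Nat.land rep (Nat.xor (nth C b) (var e b))) 0) e

/-! ### Soundness of the separation certificates -/

section

variable {k : ℕ} {τ : List ℕ} {r r' : ℕ}

theorem evalRow_sound (h : Agree k τ r r') (hr : r < 2 ^ ((k + 1) * (k + 1)))
    (hr' : r' < 2 ^ ((k + 1) * (k + 1))) {row : List (List ℕ × List ℕ)}
    {f : List (ℕ × List ℕ) → Bool} (hf : evalRow k τ row f = true) :
    ∃ row', (∀ x ∈ row', Stable r r' x.1) ∧ f row' = true := by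
  induction row generalizing f with
  | nil => exact ⟨[], by simp, hf⟩
  | cons x row ih =>
    change force _ (fun m => evalRow k τ row fun ys => f ((m, x.2) :: ys)) = true at hf
    rw [force_eq] at hf
    obtain ⟨row', h1, h2⟩ := ih hf
    refine ⟨_, fun y hy => ?_, h2⟩
    rcases List.mem_cons.1 hy with rfl | hy
    · exact (h.stable_witness _).compl hr hr'
    · exact h1 y hy

theorem evalRows_sound (h : Agree k τ r r') (hr : r < 2 ^ ((k + 1) * (k + 1)))
    (hr' : r' < 2 ^ ((k + 1) * (k + 1))) {rows : List (List (List ℕ × List ℕ))}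
    {f : List (List (ℕ × List ℕ)) → Bool} (hf : evalRows k τ rows f = true) :
    ∃ rows', (∀ row ∈ rows', ∀ x ∈ row, Stable r r' x.1) ∧ f rows' = true := by
  induction rows generalizing f with
  | nil => exact ⟨[], by simp, hf⟩
  | cons row rows ih =>
    obtain ⟨row', h1, h2⟩ := evalRow_sound h hr hr' (row := row)
      (f := fun y => evalRows k τ rows fun ys => f (y :: ys)) hf
    obtain ⟨rows', h3, h4⟩ := ih h2
    refine ⟨row' :: rows', fun y hy => ?_, h4⟩
    rcases List.mem_cons.1 hy with rfl | hy
    · exact h1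
    · exact h3 y hy

/-- An entry of a row is intended as an implication: if the permutation does not contain the pattern
and the listed cells are unshaded, then the cell of the row is shaded. The proof does not depend on
this meaning, only on the mask being a Boolean combination of stable families. -/
theorem stable_rowMask {S : List ℕ} (hS : ∀ x ∈ S, Stable r r' x) {row : List (ℕ × List ℕ)}
    (h : ∀ x ∈ row, Stable r r' x.1) : Stable r r' (rowMask S row) := by
  induction row with
  | nil => exact Stable.zero
  | cons x row ih =>
    refine Stable.lor ?_ (ih fun y hy => h y (List.mem_cons_of_mem _ hy))
    induction x.2 with
    | nil => exact h x List.mem_cons_self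
    | cons a A ihA => exact ihA.land (Stable.nth hS a)

theorem stable_refine {S : List ℕ} (hS : ∀ x ∈ S, Stable r r' x)
    {rows : List (List (ℕ × List ℕ))} (h : ∀ row ∈ rows, ∀ x ∈ row, Stable r r' x.1)
    (done : List Bool) {T : List ℕ} (hT : ∀ x ∈ T, Stable r r' x) :
    ∀ x ∈ refine S rows done T, Stable r r' x := by
  induction rows generalizing done T with
  | nil => intro x hx; exact absurd hx (by simp [refine])
  | cons row rows ih =>
    intro x hx
    rcases List.mem_cons.1 hx with rfl | hx
    · refine Stable.cond _ ?_ (stable_rowMask hS (h row List.mem_cons_self))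
      cases T with
      | nil => exact Stable.zero
      | cons t T => exact hT t List.mem_cons_self
    · exact ih (fun y hy => h y (List.mem_cons_of_mem _ hy)) done.tail
        (fun y hy => hT y (List.mem_of_mem_tail hy)) x hx

theorem stable_map_compl {e : ℕ} (hr : r < 2 ^ e) (hr' : r' < 2 ^ e) {S : List ℕ}
    (hS : ∀ x ∈ S, Stable r r' x) : ∀ x ∈ S.map (compl e), Stable r r' x := by
  intro x hx
  obtain ⟨y, hy, rfl⟩ := List.mem_map.1 hx
  exact (hS y hy).compl hr hr'

/-- Complements of lower approximations give upper ones and conversely, which is how the mutually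
dependent rows are resolved. Whether the approximations deserve the name is irrelevant for
soundness: every family computed from stable families by Boolean operations is stable, and the
result is compared with the truth only at the end. -/
theorem alternate_sound {e : ℕ} (hr : r < 2 ^ e) (hr' : r' < 2 ^ e)
    {rows : List (List (ℕ × List ℕ))} (h : ∀ row ∈ rows, ∀ x ∈ row, Stable r r' x.1)
    {done : List Bool} {n : ℕ} {L U : List ℕ} {f : List ℕ → List ℕ → Bool}
    (hL : ∀ x ∈ L, Stable r r' x) (hU : ∀ x ∈ U, Stable r r' x)
    (hf : alternate e rows done n L U f = true) :
    ∃ L' U', (∀ x ∈ L', Stable r r' x) ∧ (∀ x ∈ U', Stable r r' x) ∧ f L' U' = true := by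
  induction n generalizing L U with
  | zero => exact ⟨L, U, hL, hU, hf⟩
  | succ n ih =>
    change forceList _ (fun L' => forceList _ fun U => forceList _ fun U' => forceList _ fun L =>
      alternate e rows done n L U f) = true at hf
    rw [forceList_eq, forceList_eq, forceList_eq, forceList_eq] at hf
    have hU' := stable_refine (stable_map_compl hr hr' hL) h done hU
    exact ih (stable_refine (stable_map_compl hr hr' hU') h done hL) hU' hf

/-- In a decision list the first applicable term determines the value, as later terms sit deeper in
the recursion; `last` is the value when no term applies. -/
theorem stable_decisionMask (h : Agree k τ r r') (hr : r < 2 ^ ((k + 1) * (k + 1)))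
    (hr' : r' < 2 ^ ((k + 1) * (k + 1))) {V : List ℕ} (hV : ∀ x ∈ V, Stable r r' x) (last : Bool)
    (l : List (Bool × List ℕ × Bool × ℕ × Bool)) : Stable r r' (decisionMask k τ V last l) := by
  induction l with
  | nil => exact Stable.cond _ (Stable.ones hr hr') Stable.zero
  | cons t l ih =>
    change Stable r r' (force (witness k τ t.2.1) fun F => force (nth V t.2.2.2.1) fun v =>
      force (Nat.land (cond t.2.2.1 F (compl _ F)) (cond t.2.2.2.2 v (compl _ v))) fun g =>
        cond t.1 (Nat.lor g (decisionMask k τ V last l)) (Nat.land (compl _ g) (decisionMask k τ V last l)))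
    rw [force_eq, force_eq, force_eq]
    have hF := h.stable_witness t.2.1
    have hv := Stable.nth hV t.2.2.2.1
    have hg := (hF.cond t.2.2.1 (hF.compl hr hr')).land (hv.cond t.2.2.2.2 (hv.compl hr hr'))
    exact (hg.lor ih).cond _ ((hg.compl hr hr').land ih)

theorem stable_map_range {e : ℕ} {f : ℕ → ℕ} (h : ∀ b, Stable r r' (f b)) :
    ∀ x ∈ (List.range e).map f, Stable r r' x := by
  intro x hx
  obtain ⟨b, -, rfl⟩ := List.mem_map.1 hx
  exact h b

theorem decideAll_sound (h : Agree k τ r r') (hr : r < 2 ^ ((k + 1) * (k + 1)))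
    (hr' : r' < 2 ^ ((k + 1) * (k + 1))) {rows : List (List (ℕ × List ℕ))}
    (hrows : ∀ row ∈ rows, ∀ x ∈ row, Stable r r' x.1) {n : ℕ}
    {steps : List (ℕ × Bool × List (Bool × List ℕ × Bool × ℕ × Bool))} {done : List Bool}
    {L U : List ℕ} {f : List ℕ → Bool} (hL : ∀ x ∈ L, Stable r r' x)
    (hU : ∀ x ∈ U, Stable r r' x) (hf : decideAll k τ rows n steps done L U f = true) :
    ∃ C, (∀ x ∈ C, Stable r r' x) ∧ f C = true := by
  induction steps generalizing done L U with
  | nil => exact ⟨L, hL, hf⟩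
  | cons s steps ih =>
    change force (Nat.lor (nth L s.1) (Nat.land (nth U s.1)
      (decisionMask k τ (L ++ U) s.2.1 s.2.2))) (fun x =>
        forceList ((List.range ((k + 1) * (k + 1))).map fun b =>
          cond (Nat.beq b s.1) x (nth L b)) fun L =>
        forceList ((List.range ((k + 1) * (k + 1))).map fun b =>
          cond (Nat.beq b s.1) x (nth U b)) fun U =>
        alternate ((k + 1) * (k + 1)) rows ((List.range ((k + 1) * (k + 1))).map fun b =>
          cond (Nat.beq b s.1) true (done.getD b false)) n L U fun L U =>
        decideAll k τ rows n steps ((List.range ((k + 1) * (k + 1))).map fun b =>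
          cond (Nat.beq b s.1) true (done.getD b false)) L U f) = true at hf
    rw [force_eq, forceList_eq, forceList_eq] at hf
    have hx := (Stable.nth hL s.1).lor ((Stable.nth hU s.1).land
      (stable_decisionMask h hr hr' (V := L ++ U)
        (fun x hx => (List.mem_append.1 hx).elim (hL x) (hU x)) s.2.1 s.2.2))
    obtain ⟨L', U', h1, h2, h3⟩ := alternate_sound hr hr' hrows
      (stable_map_range fun b => hx.cond _ (Stable.nth hL b))
      (stable_map_range fun b => hx.cond _ (Stable.nth hU b)) hf
    exact ih h1 h2 h3

theorem stable_allLT {e : ℕ} (hr : r < 2 ^ e) (hr' : r' < 2 ^ e) {f : ℕ → ℕ}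
    (h : ∀ b, Stable r r' (f b)) (n : ℕ) : Stable r r' (allLT e f n) := by
  induction n with
  | zero => exact Stable.ones hr hr'
  | succ n ih => exact ih.land (h n)

theorem correct_sound (h : Agree k τ r r') (hr : r < 2 ^ ((k + 1) * (k + 1)))
    (hr' : r' < 2 ^ ((k + 1) * (k + 1))) {l : List (ℕ × ℕ × Bool × List ℕ)} {C : List ℕ}
    {f : List ℕ → Bool} (hC : ∀ x ∈ C, Stable r r' x) (hf : correct k τ l C f = true) :
    ∃ C', (∀ x ∈ C', Stable r r' x) ∧ f C' = true := by
  induction l generalizing C with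
  | nil => exact ⟨C, hC, hf⟩
  | cons p l ih =>
    change force (witness k τ p.2.2.2) (fun F =>
      force (Nat.land (cond p.2.2.1 F (compl ((k + 1) * (k + 1)) F))
        (allLT ((k + 1) * (k + 1)) (fun b => cond (Nat.testBit p.1 b) (nth C b)
          (compl ((k + 1) * (k + 1)) (nth C b))) ((k + 1) * (k + 1)))) fun g =>
      forceList ((List.range ((k + 1) * (k + 1))).map fun b =>
        cond (Nat.testBit p.2.1 b) (Nat.xor (nth C b) g) (nth C b)) fun C =>
      correct k τ l C f) = true at hf
    rw [force_eq, force_eq, forceList_eq] at hf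
    have hF := h.stable_witness p.2.2.2
    have hg := (hF.cond p.2.2.1 (hF.compl hr hr')).land (stable_allLT hr hr' (fun b =>
      (Stable.nth hC b).cond (Nat.testBit p.1 b) ((Stable.nth hC b).compl hr hr'))
      ((k + 1) * (k + 1)))
    exact ih (stable_map_range fun b => ((Stable.nth hC b).xor hg).cond _ (Stable.nth hC b)) hf

/-- On the representatives the computed families coincide with the families of the cells. Being
stable, they take the same value at `r` and `r'`, so the two shadings have the same cells. This
single verification replaces a comparison of all pairs of representatives. -/
theorem Separation.eq_of_agree {rep : ℕ} (S : Separation) (hS : S.check k τ rep = true)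
    (h : Agree k τ r r') (hr : r < 2 ^ ((k + 1) * (k + 1))) (hr' : r' < 2 ^ ((k + 1) * (k + 1)))
    (hrep : rep.testBit r = true) (hrep' : rep.testBit r' = true) : r = r' := by
  obtain ⟨rows, h1, h2⟩ := evalRows_sound h hr hr' hS
  obtain ⟨L, U, h3, h4, h5⟩ := alternate_sound hr hr' h1 (stable_map_range fun _ => Stable.zero)
    (stable_map_range fun _ => Stable.ones hr hr') h2
  obtain ⟨C, h6, h7⟩ := decideAll_sound h hr hr' h1 h3 h4 h5
  obtain ⟨C, h8, h9⟩ := correct_sound h hr hr' h6 h7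
  rw [allB_iff] at h9
  -- The check says that the computed family and the family of the cell `b` differ only outside
  -- `rep`.
  have key : ∀ b < (k + 1) * (k + 1), ∀ x < 2 ^ ((k + 1) * (k + 1)), rep.testBit x = true →
      x.testBit b = (nth C b).testBit x := by
    intro b hb x hx hxr
    have h10 := Nat.eq_of_beq_eq_true (h9 b hb)
    have h11 : (Nat.land rep (Nat.xor (nth C b) (var ((k + 1) * (k + 1)) b))).testBit x = false := by
      rw [h10, Nat.zero_testBit]
    rw [testBit_land, testBit_xor', hxr, testBit_var hb hx, Bool.true_and] at h11
    cases h12 : x.testBit b <;> simp_all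
  refine Nat.eq_of_testBit_eq fun b => ?_
  by_cases hb : b < (k + 1) * (k + 1)
  · rw [key b hb r hr hrep, key b hb r' hr' hrep']
    exact Stable.nth h8 b
  -- Digits beyond the number of cells vanish for both shadings.
  · have hle : 2 ^ ((k + 1) * (k + 1)) ≤ 2 ^ b := Nat.pow_le_pow_right (by norm_num) (not_lt.1 hb)
    rw [Nat.testBit_lt_two_pow (lt_of_lt_of_le hr hle), Nat.testBit_lt_two_pow (lt_of_lt_of_le hr' hle)]

end

end PointSet

/-! ### The separating permutations -/

namespace PointSet

/-- The permutations that separate the classes for the pattern `12`. -/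
def separation12 : Separation where
  -- There is one row for each cell. For example, 312 contains the pattern 12 unless the upper left
  -- cell, number 2, is shaded, so that its row needs only this permutation.
  rows := [[
      ([1,0,2,3], []), ([0,2,1,3,4], []), ([2,0,1,3,4], []), ([1,2,0,3,4], []), ([0,2,3,1], [6]),
      ([3,0,4,1,2], [2]), ([2,3,0,1,4], [1]), ([1,3,4,0,2], [6]), ([2,3,0,1,4], [3])],
    [
      ([2,1,3,0,4], []), ([1,3,2,0,4], []), ([1,3,0,2], [2]), ([2,0,3,1], [7])],
    [
      ([2,0,1], [])],
    [
      ([3,1,0,2,4], []), ([3,0,2,1,4], []), ([2,0,3,1], [6]), ([1,3,0,2], [5])],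
    [
      ([0,2,1,3], []), ([0,3,4,1,2], [5]), ([2,3,0,1,4], [1]), ([1,2,0,3], [3]), ([0,2,3,1],
      [7]), ([2,0,1,3], [1]), ([0,3,1,2], [5]), ([1,4,2,0,3], [3,5]), ([3,0,2,4,1], [1,7]),
      ([2,0,4,1,3], [1,5]), ([1,3,0,4,2], [3,7])],
    [
      ([0,2,4,3,1], []), ([0,3,2,4,1], []), ([2,0,3,1], [2]), ([1,3,0,2], [3])],
    [
      ([1,2,0], [])],
    [
      ([0,4,1,3,2], []), ([0,4,2,1,3], []), ([1,3,0,2], [6]), ([2,0,3,1], [1])],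
    [
      ([0,1,3,2], []), ([0,1,3,2,4], []), ([0,1,4,2,3], []), ([0,1,3,4,2], []), ([2,0,1,3], [2]),
      ([2,3,0,4,1], [6]), ([0,3,4,1,2], [5]), ([2,4,0,1,3], [2]), ([0,3,4,1,2], [7])]]
  -- The index 18 lies beyond the 9 lower and 9 upper approximations and reads as 0. With negative
  -- sign it stands for all shadings, so these terms depend on the permutation alone.
  steps := [(1, false, [
      (true, [1,2,4,0,3], true, 18, false), (false, [2,3,0,1,4], false, 18, false), (true,
      [2,0,4,1,3], false, 18, false)]), (3, true, [
      (true, [3,0,1,4,2], true, 18, false), (false, [2,3,0,1,4], false, 18, false), (true,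
      [0,3,1,2], false, 18, false), (false, [2,0,4,1,3], false, 18, false)])]
  corrections := [
]

theorem separation12_check : separation12.check 2 [0, 1] representatives12 = true := by
  decide +kernel

/-- The permutations that separate the classes for the pattern `123`. -/
def separation123 : Separation where
  rows := [[
      ([1,0,3,2,4,5,6], []), ([2,3,0,1,4,5,6], []), ([3,0,1,2,4,5,6], []), ([1,2,3,0,4,5,6], []),
      ([0,1,3,2,4,5,6], []), ([2,0,1,3,4,5], []), ([0,2,3,1,4,5,6], []), ([1,2,0,3,4,5], []),
      ([0,3,1,2,4,5,6], []), ([0,6,1,5,2,3,4], [3]), ([0,2,4,5,6,3,1], [12]), ([3,0,5,4,1,2,6],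
      [2]), ([1,4,5,0,3,2,6], [8]), ([3,0,1,2,4], [2]), ([0,1,3,4,2], [13]), ([1,2,3,0,4], [8]),
      ([0,1,4,2,3], [7]), ([1,2,4,5,6,0,3], [12]), ([5,0,1,6,2,3,4], [3]), ([0,5,1,6,2,3,4],
      [3]), ([0,2,4,5,6,1,3], [12]), ([1,2,6,0,3,4,5], [3]), ([3,0,1,4,5,6,2], [12]),
      ([3,0,4,1,6,2,5], [2,7]), ([1,3,5,0,2,6,4], [8,13]), ([1,3,4,6,0,2,5], [8,11]),
      ([4,0,5,1,2,6,3], [2,14]), ([1,2,5,0,3,4], [4,7]), ([4,0,1,3,5,2], [2,13]),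
      ([1,3,6,4,0,2,5], [7,8]), ([0,3,2,4,1,5], [1,8]), ([2,0,5,3,1,4,6], [2,4]),
      ([3,0,1,5,6,2,4], [1,13]), ([4,0,5,1,3,6,2], [2,13]), ([1,2,5,3,0,4], [7,8]),
      ([3,0,2,4,1,5], [1,8]), ([1,2,5,0,6,3,4], [4,7]), ([0,3,2,4,1,5], [4,8]), ([4,0,2,5,1,6,3],
      [1,8,13]), ([1,4,2,6,0,3,5], [2,4,7]), ([5,0,2,4,1,6,3], [2,8,13]), ([1,4,2,6,3,0,5],
      [2,7,8])],
    [
      ([2,1,4,3,0,5,6], []), ([1,2,4,3,0,5,6], []), ([1,4,2,3,0,5,6], []), ([1,3,4,2,0,5,6], []),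
      ([1,6,2,5,0,3,4], [3]), ([2,3,0,5,6,4,1], [13]), ([1,3,0,2,4], [2]), ([2,0,3,1,4], [9]),
      ([4,1,2,0,3,5], [2]), ([1,2,0,5,3,4], [7]), ([5,1,2,6,0,3,4], [3]), ([1,3,0,5,6,2,4],
      [13]), ([1,4,0,5,2,3,6], [9]), ([1,5,2,6,0,3,4], [3]), ([1,3,0,5,2,4], [2,7]),
      ([2,0,4,6,3,1,5], [9,11]), ([5,1,4,0,2,6,3], [2,14]), ([3,0,4,1,5,2], [9,13]),
      ([3,0,6,4,1,2,5], [7,9]), ([2,3,1,6,4,0,5], [7,8]), ([5,1,2,0,4,6,3], [2,13]),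
      ([1,3,0,6,4,2,5], [7,9]), ([3,1,5,2,6,0,4], [9,12,13])],
    [
      ([2,0,1,3], [])],
    [
      ([3,0,1,2], [])],
    [
      ([4,1,0,3,2,5,6], []), ([4,0,1,3,2,5,6], []), ([4,0,3,1,2,5,6], []), ([4,0,2,3,1,5,6], []),
      ([2,6,0,1,5,3,4], [7]), ([4,0,2,5,6,3,1], [12]), ([2,0,3,1,4], [8]), ([1,3,0,2,4], [6]),
      ([3,1,2,4,0,5], [8]), ([2,0,1,4,5,3], [13]), ([4,1,2,5,6,0,3], [12]), ([3,0,2,6,1,4,5],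
      [7]), ([2,0,4,5,1,3,6], [6]), ([4,0,2,5,6,1,3], [12]), ([2,0,4,1,5,3], [8,13]),
      ([1,5,0,4,2,6,3], [6,14]), ([3,1,4,6,2,0,5], [8,11]), ([1,3,5,0,2,4], [6,7]),
      ([1,4,5,0,3,6,2], [6,13]), ([5,2,0,1,4,6,3], [2,13]), ([3,1,2,6,4,0,5], [7,8]),
      ([2,0,5,1,4,6,3], [6,13]), ([5,1,3,0,6,2,4], [3,6,7])],
    [
      ([0,2,4,1,3,5,6], []), ([0,3,1,4,2,5,6], []), ([0,3,2,4,1,5,6], []), ([0,3,4,1,2,5,6], []),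
      ([0,2,1,4,3,5,6], []), ([0,4,2,1,3,5,6], []), ([0,6,2,1,5,3,4], [7]), ([0,3,2,5,6,1,4],
      [13]), ([0,4,1,3,5,2,6], [9]), ([3,0,2,4,1,5,6], [1]), ([2,3,1,4,0,5,6], [4]),
      ([0,4,1,3,2,5], [6]), ([4,0,2,1,3,5], [2]), ([0,6,2,5,1,3,4], [7]), ([0,2,5,6,3,4,1],
      [13]), ([1,3,2,4,0,5], [8]), ([0,2,4,3,1,5], [9]), ([0,6,2,3,1,4,5], [7]),
      ([0,4,2,3,5,6,1], [13]), ([0,3,5,1,4,2,6], [6]), ([0,4,2,5,1,3,6], [6]), ([3,0,2,4,1,5],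
      [1,9]), ([1,4,2,0,5,3,6], [4,9]), ([2,0,5,3,1,4,6], [1,6]), ([5,0,2,4,6,3,1], [2,13]),
      ([1,6,2,5,3,0,4], [7,8]), ([1,5,2,0,3,4], [4,7]), ([5,0,2,1,6,3,4], [3,7]), ([3,0,2,4,5,1],
      [1,13]), ([1,3,2,5,6,0,4], [12,13]), ([2,3,0,4,5,1], [4,12]), ([2,5,0,1,3,4], [1,3]),
      ([0,2,4,6,3,1,5], [9,11]), ([0,5,1,4,2,6,3], [6,14]), ([1,3,4,0,5,2], [8,13]),
      ([3,0,5,1,2,4], [2,7]), ([0,2,4,1,5,3], [9,13]), ([0,3,1,5,2,4], [6,7]), ([3,0,5,1,6,2,4],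
      [2,7]), ([1,3,5,0,6,2,4], [8,13]), ([1,5,2,4,0,3,6], [4,6]), ([0,4,1,3,5,2], [6,13]),
      ([0,2,5,3,1,4], [7,9]), ([1,4,3,5,0,2,6], [8,9]), ([4,0,5,2,1,3,6], [2,6]),
      ([1,3,2,6,4,0,5], [7,8]), ([5,0,2,1,4,6,3], [2,13]), ([1,3,0,4,5,2], [4,13]),
      ([2,0,5,1,3,4], [1,7]), ([4,0,2,3,1,5], [2,9]), ([1,4,2,3,0,5], [6,8]), ([2,6,0,4,1,3,5],
      [1,3,6]), ([2,4,0,5,3,6,1], [4,9,12]), ([1,3,5,2,6,0,4], [9,12,13]), ([5,0,3,1,6,2,4],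
      [3,6,7]), ([1,3,0,4,6,2,5], [4,9,11]), ([2,0,5,1,3,6,4], [1,6,14]), ([4,0,6,1,3,5,2],
      [2,7,13]), ([1,3,6,4,0,5,2], [7,8,13]), ([1,3,6,4,0,2,5], [7,8,9]), ([4,0,5,1,3,6,2],
      [2,6,13]), ([3,6,0,4,1,2,5], [2,3,6]), ([2,4,5,0,3,6,1], [8,9,12]), ([1,6,2,4,5,0,3],
      [7,12,13]), ([5,0,2,6,3,4,1], [3,7,13]), ([2,3,0,1,4,5], [4])],
    [
      ([0,3,2,5,4,1,6], []), ([0,2,4,6,5,1,3], [7]), ([3,2,4,0,5,1,6], [2]), ([0,4,1,5,2,3],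
      [14]), ([2,4,1,5,0,3,6], [4]), ([0,3,5,4,2,6,1], [13]), ([4,0,2,3,1,5], [2]),
      ([1,4,3,5,2,0,6], [8]), ([0,5,2,3,1,4], [7]), ([3,0,4,1,5,2], [2,14]), ([1,3,5,2,0,4],
      [7,8]), ([2,4,0,3,5,1], [4,12]), ([3,0,4,2,5,1], [2,13]), ([1,5,3,0,2,4], [4,7]),
      ([1,4,2,5,0,3], [12,14]), ([4,0,2,5,1,3], [3,7]), ([2,5,0,3,1,4], [2,3]), ([1,4,5,3,0,6,2],
      [8,13]), ([4,0,3,1,5,2], [2,14]), ([1,5,2,0,6,3,4], [8,14]), ([2,5,0,1,4,6,3], [4,13]),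
      ([4,0,6,2,3,1,5], [2,7])],
    [
      ([0,3,1,2], [])],
    [
      ([1,2,0,3], [])],
    [
      ([0,5,2,1,4,3,6], []), ([0,5,1,6,2,4,3], [13]), ([1,3,0,2,4], [8]), ([0,3,6,1,5,2,4],
      [11]), ([4,2,0,5,1,3,6], [1]), ([0,4,2,3,5,1], [13]), ([1,4,2,3,0,5], [8]),
      ([0,6,4,1,3,2,5], [7]), ([5,0,4,2,1,3,6], [2]), ([3,0,4,1,5,2], [1,13]), ([1,5,3,0,2,4],
      [7,8]), ([4,0,2,5,1,3], [3,11]), ([1,3,5,2,0,4], [8,11]), ([4,0,3,1,5,2], [2,13]),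
      ([2,5,0,3,1,4], [1,3]), ([2,4,0,3,5,1], [8,12]), ([1,4,2,5,0,3], [12,13]),
      ([4,0,6,3,1,2,5], [2,7]), ([3,0,4,2,5,1], [1,13]), ([3,0,2,5,6,1,4], [2,11]),
      ([2,3,0,6,4,1,5], [1,7]), ([1,5,3,4,0,6,2], [8,13])],
    [
      ([0,1,3,2,5,4,6], []), ([0,1,3,5,2,4,6], []), ([0,1,4,5,2,3,6], []), ([0,1,4,2,3,5], []),
      ([0,1,3,5,4,2,6], []), ([0,1,5,2,4,3,6], []), ([0,1,4,2,5,3,6], []), ([3,2,5,0,1,4,6],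
      [2]), ([2,3,0,5,4,1,6], [8]), ([0,1,3,6,4,2,5], [11]), ([0,2,5,3,1,4,6], [9]),
      ([0,4,2,1,3,5], [6]), ([0,1,3,5,6,4,2], [14]), ([0,5,1,3,2,4], [7]), ([3,4,1,2,5,0,6],
      [8]), ([5,2,0,1,4,3,6], [2]), ([0,2,4,3,5,1], [13]), ([5,0,1,3,4,2,6], [2]),
      ([0,3,2,4,1,5], [9]), ([1,2,5,3,4,0,6], [8]), ([3,0,1,4,2,5], [2]), ([0,4,3,5,1,2,6], [6]),
      ([0,4,5,1,3,2,6], [6]), ([0,3,2,5,1,4,6], [6]), ([0,4,2,5,1,3,6], [6]), ([0,3,1,5,4,2,6],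
      [6]), ([0,3,5,1,4,2,6], [6]), ([0,5,3,1,4,6,2], [6,14]), ([0,2,5,3,1,6,4], [9,14]),
      ([0,3,1,6,4,2,5], [6,11]), ([5,3,0,2,4,6,1], [2,13]), ([2,6,3,1,4,0,5], [7,8]),
      ([4,0,1,3,5,2], [2,14]), ([1,2,5,3,0,4], [8,11]), ([2,3,0,5,4,6,1], [8,12]),
      ([2,6,0,1,4,3,5], [2,3]), ([4,0,1,5,2,3], [3,11]), ([1,2,4,5,0,3], [12,14]),
      ([3,0,4,2,5,1,6], [1,9]), ([1,5,3,0,2,4,6], [4,6]), ([3,0,5,1,2,4], [2,7]), ([1,3,4,0,5,2],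
      [8,13]), ([1,3,0,4,2,5], [8,9]), ([2,0,4,1,3,5], [2,6]), ([0,2,5,3,1,4], [9,11]),
      ([2,4,0,5,1,6,3], [8,13]), ([2,4,0,6,1,3,5], [2,7]), ([3,0,2,4,1,5], [2,9]),
      ([1,4,2,0,3,5], [6,8]), ([0,3,5,4,1,6,2], [9,13]), ([0,4,6,1,3,2,5], [6,7]),
      ([0,4,1,3,5,2], [6,14]), ([3,0,2,5,4,6,1], [2,13]), ([1,6,2,0,4,3,5], [7,8]),
      ([3,0,1,5,2,4], [2,11]), ([1,2,4,0,5,3], [8,14]), ([0,5,2,3,1,4], [7,9]), ([0,4,2,3,5,1],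
      [6,13]), ([1,3,5,2,6,0,4], [9,12,14]), ([5,0,3,1,6,2,4], [3,6,11]), ([2,6,0,4,1,3,5],
      [2,3,6]), ([2,4,0,5,3,6,1], [8,9,12]), ([1,4,0,2,6,3,5], [4,6,11]), ([2,0,3,5,1,6,4],
      [1,9,14]), ([4,1,6,2,0,3,5], [2,7,8]), ([4,1,3,5,0,6,2], [2,8,13]), ([1,4,6,2,0,3,5],
      [6,7,8]), ([4,0,3,5,1,6,2], [2,9,13]), ([5,0,3,6,1,2,4], [3,6,7]), ([1,4,5,2,6,0,3],
      [9,12,13]), ([5,2,3,0,4,6,1], [2,8,12]), ([3,6,1,2,4,0,5], [2,3,8])],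
    [
      ([0,1,4,3,6,5,2], []), ([0,1,4,3,5,6,2], []), ([0,1,5,3,4,6,2], []), ([0,1,4,5,3,6,2], []),
      ([2,3,1,5,6,0,4], [8]), ([5,3,0,1,4,6,2], [3]), ([0,3,1,4,2], [7]), ([0,2,4,1,3], [9]),
      ([0,5,1,3,4,2], [7]), ([2,0,1,4,5,3], [2]), ([3,6,0,1,4,5,2], [3]), ([2,3,0,5,1,6,4], [8]),
      ([0,3,5,1,2,6,4], [9]), ([3,5,0,1,4,6,2], [3]), ([2,0,4,1,5,3], [2,7]), ([3,0,4,2,6,1,5],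
      [1,9]), ([1,6,4,0,2,5,3], [4,7]), ([1,3,5,0,2,4], [8,9]), ([4,0,3,6,1,2,5], [2,9]),
      ([3,0,2,5,6,4,1], [2,13]), ([1,6,2,0,4,5,3], [7,8]), ([3,0,2,5,1,6,4], [2,9]),
      ([2,4,6,0,3,5,1], [8,9,12])],
    [
      ([1,2,3,0], [])],
    [
      ([0,2,3,1], [])],
    [
      ([0,1,6,3,2,5,4], []), ([0,1,6,3,2,4,5], []), ([0,1,6,3,4,2,5], []), ([0,1,6,4,2,3,5], []),
      ([5,2,0,1,6,3,4], [2]), ([2,3,6,1,4,0,5], [12]), ([0,2,4,1,3], [13]), ([0,3,1,4,2], [6]),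
      ([0,2,5,3,4,1], [13]), ([1,2,0,5,3,4], [8]), ([2,3,6,0,4,5,1], [12]), ([2,4,0,1,6,3,5],
      [2]), ([0,3,4,1,6,2,5], [6]), ([2,3,6,0,4,1,5], [12]), ([1,3,0,5,2,4], [8,13]),
      ([1,5,3,0,2,6,4], [4,6]), ([3,0,4,6,2,5,1], [1,13]), ([3,0,4,1,5,2], [2,6]),
      ([1,4,5,2,0,6,3], [6,8]), ([1,6,2,0,5,3,4], [7,8]), ([3,0,2,6,4,5,1], [2,13]),
      ([1,4,2,0,6,3,5], [6,8]), ([3,6,0,4,1,5,2], [2,3,6])],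
    [
      ([0,1,2,4,3,6,5], []), ([0,1,2,5,6,3,4], []), ([0,1,2,4,3,5,6], []), ([0,1,2,6,3,4,5], []),
      ([0,1,2,4,5,6,3], []), ([0,1,2,5,3,4], []), ([0,1,2,4,5,3], []), ([0,1,2,4,5,3,6], []),
      ([0,1,2,5,3,4,6], []), ([2,3,4,1,5,0,6], [12]), ([5,3,0,1,2,4,6], [3]), ([0,6,3,4,1,2,5],
      [7]), ([0,4,5,2,1,6,3], [13]), ([0,3,5,1,2,4], [7]), ([2,0,1,3,4], [2]), ([0,2,3,4,1],
      [13]), ([1,2,0,3,4], [8]), ([2,3,4,0,5,6,1], [12]), ([3,6,0,1,2,4,5], [3]),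
      ([2,3,4,0,5,1,6], [12]), ([3,5,0,1,2,4,6], [3]), ([1,2,3,6,0,4,5], [12]), ([4,0,1,2,5,6,3],
      [3]), ([2,0,4,6,1,3,5], [2,7]), ([1,4,0,5,2,6,3], [8,13]), ([1,4,6,0,2,3,5], [4,7]),
      ([3,0,4,5,1,6,2], [1,13]), ([1,2,5,0,3,4], [8,11]), ([3,0,2,4,5,1], [2,13]),
      ([1,4,6,2,0,3,5], [7,8]), ([0,4,1,3,2,5], [7,14]), ([0,2,5,3,1,6,4], [11,13]),
      ([2,4,0,1,5,6,3], [2,14]), ([4,0,3,5,1,6,2], [2,13]), ([1,5,2,0,3,4], [7,8]),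
      ([0,4,1,3,5,2], [7,14]), ([2,3,0,6,1,4,5], [8,11]), ([0,4,1,3,2,5], [7,11]),
      ([3,0,5,1,4,6,2], [2,7,14]), ([1,3,6,0,4,2,5], [8,11,13]), ([3,0,5,2,4,6,1], [2,7,13]),
      ([1,6,3,0,4,2,5], [7,8,13])]]
  -- There are now 16 lower approximations, with indices below 16, and 16 upper ones with the
  -- indices 16 to 31. The index 32 reads as 0, and its complement imposes no condition.
  steps := [(0, true, [
]), (1, true, [
      (false, [6,2,3,0,1,5,4], true, 32, false), (false, [3,0,2,4,1,5,6], false, 32, false),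
      (true, [2,4,1,6,3,5,0], true, 32, false), (false, [2,5,0,4,1,6,3], true, 32, false), (true,
      [0,1,4,2,5,3,6], false, 32, false), (false, [6,2,4,1,3,5,0], true, 32, false), (true,
      [2,5,0,4,6,1,3], true, 32, false), (false, [1,4,0,3,5,2], true, 32, false), (true,
      [1,3,0,6,4,2,5], true, 32, false), (false, [6,2,0,4,1,3,5], true, 32, false), (true,
      [1,4,0,3,6,2,5], true, 32, false), (false, [2,0,4,1,6,3,5], true, 32, false), (false,
      [3,1,5,0,2,6,4], true, 32, false), (false, [1,2,0,3,4], true, 4, true), (true,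
      [2,4,0,1,6,3,5], true, 32, false), (false, [2,0,1,3], true, 32, false), (true,
      [5,1,4,2,6,3,0], true, 32, false), (false, [2,0,4,1,3,6,5], true, 10, false), (true,
      [0,2,4,3,1,5], false, 32, false), (false, [4,0,2,5,3,1], true, 32, false), (true,
      [1,4,0,6,2,5,3], true, 32, false), (false, [4,0,2,5,1,3], true, 32, false), (true,
      [0,3,1,2], true, 32, false), (false, [3,0,1,2], true, 32, false), (true, [1,3,5,6,2,4,0],
      true, 32, false), (false, [1,4,5,2,3,0,6], true, 32, false), (false, [0,4,2,5,3,6,1], true,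
      32, false), (true, [0,2,4,1,3], true, 32, false), (false, [0,4,1,3,6,2,5], true, 32,
      false), (true, [2,0,5,3,1,4,6], false, 32, false), (false, [1,4,2,0,3,5], false, 32,
      false), (true, [0,1,3,4,2], false, 32, false), (false, [1,4,0,5,2,3,6], true, 32, false)]), (4, true, [
      (false, [3,4,1,2,5,0], true, 32, false), (false, [1,4,2,0,3,5,6], false, 32, false), (true,
      [6,2,0,4,1,5,3], true, 32, false), (false, [2,4,0,6,3,1,5], true, 32, false), (true,
      [0,1,3,5,2,4,6], false, 32, false), (false, [6,3,1,4,2,5,0], true, 32, false), (false,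
      [3,1,6,4,2,5,0], true, 32, false), (false, [1,2,0,3,4], true, 1, true), (true,
      [1,3,0,4,2,5], false, 32, false), (true, [6,0,4,1,5,2,3], true, 32, false), (true,
      [1,3,5,6,0,4,2], true, 32, false), (false, [3,1,4,6,2,0,5], true, 32, false), (true,
      [1,2,4,5,0,3], true, 32, false), (false, [1,2,3,0,6,4,5], true, 32, false), (false,
      [5,0,3,4,1,2,6], true, 32, false), (true, [0,3,1,4,2], true, 32, false), (false,
      [0,3,1,6,4,2,5], true, 32, false), (false, [0,2,5,3,1,6,4], true, 32, false), (false,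
      [3,0,5,4,1,2,6], false, 32, false), (false, [1,2,3,0], true, 32, false), (true,
      [0,1,4,2,3], false, 32, false), (false, [2,0,4,5,1,3,6], true, 32, false)]), (5, true, [
      (false, [2,0,1,3,6,4,5], false, 32, false), (false, [5,3,0,4,1,6,2], true, 32, false),
      (false, [0,1,2,5,6,3,4], false, 32, false), (false, [2,1,4,6,3,5,0], true, 32, false),
      (false, [2,1,5,3,6,0,4], true, 32, false), (false, [2,0,3,1,4,5], false, 32, false),
      (false, [4,2,6,1,3,0,5], true, 32, false), (true, [0,2,5,3,1,4,6], false, 32, false),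
      (false, [1,6,0,3,5,2,4], true, 32, false), (false, [0,2,3,1], false, 0, true), (true,
      [0,3,2,4,1,5], false, 32, false), (false, [0,2,4,1,6,3,5], false, 32, false), (true,
      [0,2,3,1], true, 32, false), (false, [2,0,4,1,6,3,5], true, 32, false), (false,
      [1,3,0,5,2,6,4], true, 32, false), (false, [0,3,5,1,6,2,4], true, 32, false), (true,
      [1,3,0,5,2,4,6], false, 32, false), (false, [2,4,0,5,1,3,6], false, 32, false), (true,
      [2,0,5,3,1,4,6], false, 32, false), (false, [0,2,5,1,3,6,4], false, 32, false), (true,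
      [3,0,2,5,1,4,6], false, 32, false), (false, [5,2,0,3,6,1,4], false, 32, false), (false,
      [2,6,0,4,1,3,5], true, 2, true), (true, [2,4,0,5,3,6,1], false, 32, false), (false,
      [2,0,1,3], true, 32, false)]), (6, false, [
      (true, [0,1,2,5,6,3,4], false, 32, false), (false, [0,2,5,3,1,4,6], false, 32, false),
      (true, [0,3,1,2], true, 32, false), (false, [0,2,3,1], true, 32, false), (true,
      [1,3,5,2,6,0,4], true, 1, false), (false, [0,3,1,5,2,4], true, 25, true), (true, [0,3,1,2],
      false, 11, true), (false, [2,5,0,1,3,4], true, 1, true), (true, [1,3,0,6,4,2,5], true, 32,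
      false), (true, [5,2,4,0,3,6,1], true, 32, false), (false, [2,5,1,3,0,4], true, 32, false),
      (true, [4,0,2,3,6,1,5], true, 32, false), (true, [1,3,6,4,2,5,0], true, 32, false), (true,
      [2,1,4,6,3,5,0], true, 32, false), (false, [0,3,1,4,2,5,6], false, 32, false), (true,
      [1,3,5,2,6,0,4], true, 32, false), (false, [1,4,0,3,6,2,5], true, 32, false), (true,
      [0,3,5,1,2,6,4], true, 32, false), (false, [0,5,1,3,2,4], true, 32, false), (true,
      [2,4,0,1,5,6,3], true, 32, false), (false, [3,0,1,2], true, 32, false), (true,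
      [2,4,0,3,5,1], true, 32, false), (false, [2,3,1,5,0,4,6], true, 32, false), (true,
      [1,2,3,0], true, 32, false), (true, [1,2,0,3,4], false, 32, false)]), (9, true, [
      (true, [0,1,2,5,6,3,4], false, 32, false), (false, [0,4,2,5,1,3,6], false, 32, false),
      (true, [0,2,3,1], true, 32, false), (false, [0,5,1,4,2,6,3], false, 14, false), (true,
      [1,2,0,5,3,6,4], false, 32, false), (true, [3,0,4,2,6,1,5], true, 32, false), (true,
      [5,2,0,3,6,4,1], true, 32, false), (false, [2,4,0,3,5,1], true, 32, false), (true,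
      [3,0,1,2,4], true, 32, false), (false, [3,0,1,2], false, 32, false)])]
  -- For the listed values of the reconstructed shading one more permutation decides whether it has
  -- to be changed. Cells are coded in binary: 32768, for instance, flips the cell 15.
  corrections := [
    (5248, 32768, false, [1,2,7,4,0,6,3,5]), (5760, 32768, false, [1,2,7,4,0,6,3,5]), (5776,
    32768, false, [1,2,7,4,0,6,3,5]), (8578, 32, false, [1,3,0,5,7,2,4,6]), (8586, 32, false,
    [1,3,0,5,7,2,4,6]), (41346, 32, false, [1,3,0,5,7,2,4,6]), (41354, 32, false,
    [1,3,0,5,7,2,4,6]), (16772, 1024, false, [1,3,5,0,2,7,4,6]), (16773, 1024, false,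
    [1,3,5,0,2,7,4,6]), (20868, 1024, false, [1,3,5,0,2,7,4,6]), (20869, 1024, false,
    [1,3,5,0,2,7,4,6]), (33096, 1, false, [1,4,2,6,0,7,3,5]), (35144, 1, false,
    [1,4,2,6,0,7,3,5]), (16914, 32, false, [1,4,3,6,0,7,2,5]), (16918, 32, false,
    [1,4,3,6,0,7,2,5]), (16926, 32, false, [1,4,3,6,0,7,2,5]), (49682, 32, false,
    [1,4,3,6,0,7,2,5]), (49686, 32, false, [1,4,3,6,0,7,2,5]), (49694, 32, false,
    [1,4,3,6,0,7,2,5]), (10258, 32, false, [1,4,3,7,5,0,2,6]), (10266, 32, false,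
    [1,4,3,7,5,0,2,6]), (10270, 32, false, [1,4,3,7,5,0,2,6]), (18452, 1024, false,
    [1,5,7,2,0,4,3,6]), (22548, 1024, false, [1,5,7,2,0,4,3,6]), (30740, 1024, false,
    [1,5,7,2,0,4,3,6]), (10264, 32, false, [1,6,3,7,4,0,2,5]), (8340, 32, false,
    [2,0,5,1,6,3,7,4]), (12436, 32, false, [2,0,5,1,6,3,7,4]), (41108, 32, false,
    [2,0,5,1,6,3,7,4]), (45204, 32, false, [2,0,5,1,6,3,7,4]), (24960, 32, false,
    [2,4,0,5,7,3,6,1]), (24968, 32, false, [2,4,0,5,7,3,6,1]), (57728, 32, false,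
    [2,4,0,5,7,3,6,1]), (57736, 32, false, [2,4,0,5,7,3,6,1]), (8265, 32768, false,
    [2,4,0,6,1,5,7,3]), (8267, 32768, false, [2,4,0,6,1,5,7,3]), (18960, 1024, false,
    [2,4,0,6,5,1,7,3]), (18961, 1024, false, [2,4,0,6,5,1,7,3]), (19088, 1024, false,
    [2,4,0,6,5,1,7,3]), (19089, 1024, false, [2,4,0,6,5,1,7,3]), (19096, 1024, false,
    [2,4,0,6,5,1,7,3]), (19097, 1024, false, [2,4,0,6,5,1,7,3]), (4737, 32768, false,
    [2,4,0,7,1,5,3,6]), (4753, 32768, false, [2,4,0,7,1,5,3,6]), (296, 1, false,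
    [2,4,1,7,3,0,5,6]), (360, 1, false, [2,4,1,7,3,0,5,6]), (2408, 1, false, [2,4,1,7,3,0,5,6]),
    (10257, 32, false, [2,4,7,5,0,3,6,1]), (18498, 1024, false, [2,5,0,7,1,4,3,6]), (18499, 1024,
    false, [2,5,0,7,1,4,3,6]), (26690, 1024, false, [2,5,0,7,1,4,3,6]), (26691, 1024, false,
    [2,5,0,7,1,4,3,6]), (30786, 1024, false, [2,5,0,7,1,4,3,6]), (30787, 1024, false,
    [2,5,0,7,1,4,3,6]), (6164, 1024, false, [2,5,7,3,0,4,1,6]), (42000, 64, false,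
    [2,6,3,0,7,4,5,1]), (42001, 64, false, [2,6,3,0,7,4,5,1]), (42004, 64, false,
    [2,6,3,0,7,4,5,1]), (42005, 64, false, [2,6,3,0,7,4,5,1]), (10372, 32, false,
    [2,7,0,5,1,3,6,4]), (14468, 32, false, [2,7,0,5,1,3,6,4]), (43140, 32, false,
    [2,7,0,5,1,3,6,4]), (47236, 32, false, [2,7,0,5,1,3,6,4]), (10500, 1024, false,
    [3,0,4,1,6,2,7,5]), (10501, 1024, false, [3,0,4,1,6,2,7,5]), (10508, 1024, false,
    [3,0,4,1,6,2,7,5]), (10509, 1024, false, [3,0,4,1,6,2,7,5]), (8468, 1024, false,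
    [3,1,4,6,2,7,0,5]), (8469, 1024, false, [3,1,4,6,2,7,0,5]), (8476, 1024, false,
    [3,1,4,6,2,7,0,5]), (8477, 1024, false, [3,1,4,6,2,7,0,5]), (16673, 64, false,
    [3,6,1,2,5,7,0,4]), (16801, 64, false, [3,6,1,2,5,7,0,4]), (49441, 64, false,
    [3,6,1,2,5,7,0,4]), (49569, 64, false, [3,6,1,2,5,7,0,4]), (33922, 512, false,
    [3,7,0,2,5,6,1,4]), (33923, 512, false, [3,7,0,2,5,6,1,4]), (34178, 512, false,
    [3,7,0,2,5,6,1,4]), (34179, 512, false, [3,7,0,2,5,6,1,4]), (9224, 32768, false,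
    [4,0,1,6,3,7,5,2]), (9288, 32768, false, [4,0,1,6,3,7,5,2]), (9290, 32768, false,
    [4,0,1,6,3,7,5,2]), (37380, 1, false, [4,0,2,6,1,7,3,5]), (53764, 1, false,
    [4,0,2,6,1,7,3,5]), (18690, 1024, false, [4,0,3,6,5,1,7,2]), (18698, 1024, false,
    [4,0,3,6,5,1,7,2]), (18826, 1024, false, [4,0,3,6,5,1,7,2]), (2130, 32, false,
    [4,0,6,2,1,7,3,5]), (2386, 32, false, [4,0,6,2,1,7,3,5]), (6482, 32, false,
    [4,0,6,2,1,7,3,5]), (34898, 32, false, [4,0,6,2,1,7,3,5]), (35154, 32, false,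
    [4,0,6,2,1,7,3,5]), (39250, 32, false, [4,0,6,2,1,7,3,5]), (16650, 1024, false,
    [4,6,0,3,5,1,7,2]), (16515, 32, false, [4,7,0,5,1,3,6,2]), (16530, 32, false,
    [5,0,6,2,1,4,7,3]), (20626, 32, false, [5,0,6,2,1,4,7,3]), (20882, 32, false,
    [5,0,6,2,1,4,7,3]), (20610, 32, false, [5,0,6,2,4,7,1,3]), (49410, 1024, false,
    [5,1,4,6,2,7,0,3]), (4132, 1, false, [5,2,0,4,1,6,7,3]), (4644, 1, false, [5,2,0,4,1,6,7,3]),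
    (21028, 1, false, [5,2,0,4,1,6,7,3]), (390, 1024, false, [6,1,4,0,2,7,3,5]), (391, 1024,
    false, [6,1,4,0,2,7,3,5]), (4486, 1024, false, [6,1,4,0,2,7,3,5]), (4487, 1024, false,
    [6,1,4,0,2,7,3,5]), (34836, 1024, false, [6,1,4,7,2,0,3,5]), (2085, 512, false,
    [6,2,3,0,7,4,1,5]), (10277, 512, false, [6,2,3,0,7,4,1,5]), (34853, 512, false,
    [6,2,3,0,7,4,1,5]), (43045, 512, false, [6,2,3,0,7,4,1,5]), (8584, 32, false,
    [2,4,0,6,8,3,5,7,1]), (41352, 32, false, [2,4,0,6,8,3,5,7,1]), (8576, 32, false,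
    [2,4,0,6,8,5,3,7,1]), (41344, 32, false, [2,4,0,6,8,5,3,7,1]), (42004, 32, false,
    [2,7,3,4,0,8,5,6,1]), (12420, 32, false, [2,8,0,5,1,6,3,7,4]), (45188, 32, false,
    [2,8,0,5,1,6,3,7,4]), (8324, 32, false, [2,8,0,6,1,5,3,7,4]), (41092, 32, false,
    [2,8,0,6,1,5,3,7,4]), (16801, 1024, false, [3,7,1,2,5,6,8,0,4]), (8460, 1024, false,
    [4,1,5,2,7,3,8,0,6]), (8461, 1024, false, [4,1,5,2,7,3,8,0,6]), (8452, 1024, false,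
    [4,1,5,3,7,2,8,0,6]), (8453, 1024, false, [4,1,5,3,7,2,8,0,6]), (34178, 32, false,
    [4,8,0,2,3,6,7,1,5]), (4484, 1024, false, [7,1,3,5,0,2,8,4,6]), (4485, 1024, false,
    [7,1,3,5,0,2,8,4,6]), (388, 1024, false, [7,1,5,3,0,2,8,4,6]), (389, 1024, false,
    [7,1,5,3,0,2,8,4,6]), (10277, 1024, false, [7,2,3,0,8,4,5,1,6])]

theorem separation123_check : separation123.check 3 [0, 1, 2] representatives123 = true := by
  decide +kernel

/-- The permutations that separate the classes for the pattern `132`. -/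
def separation132 : Separation where
  rows := [[
      ([1,0,2,4,3], []), ([1,4,6,2,3,0,5], [8]), ([1,4,6,5,3,0,2], [12]), ([5,0,3,4,1,6,2], [2]),
      ([5,0,6,4,1,3,2], [3]), ([2,0,4,6,5,3,1], [12]), ([1,6,0,5,2,4,3], [3]), ([1,5,4,0,2,6,3],
      [2]), ([3,0,4,6,2,1,5], [8]), ([1,4,6,5,0,3,2], [12]), ([4,0,6,5,1,3,2], [3]),
      ([0,4,3,1,5,2], [2]), ([0,3,5,2,1,4], [8]), ([2,0,3,5,1,4], [8]), ([1,4,0,2,5,3], [2]),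
      ([1,5,2,4,0,3], [3,8]), ([4,0,2,5,3,1], [2,12]), ([1,6,2,4,3,0,5], [3,12,15]),
      ([5,0,2,4,3,6,1], [3,12,15]), ([5,0,2,4,1,6,3], [3,8,11]), ([1,4,2,6,3,0,5], [2,12,14])],
    [
      ([1,2,0,4,3], []), ([4,1,3,0,5,2], [2]), ([5,1,6,4,0,3,2], [3]), ([4,2,0,6,3,1,5], [9]),
      ([3,0,5,4,1,2], [13]), ([2,6,1,3,0,5,4], [3]), ([2,0,6,4,1,3,5], [9]), ([1,5,4,2,0,6,3],
      [2]), ([4,2,0,6,5,3,1], [13]), ([1,4,0,3,2], [3]), ([1,6,4,5,0,3,2], [3]),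
      ([2,0,6,5,3,1,4], [13]), ([3,0,5,2,1,4], [9]), ([1,4,3,0,5,2], [2]), ([1,4,2,0,5,3], [2]),
      ([1,5,0,3,2,4], [3,15]), ([1,3,0,6,4,2,5], [13,14]), ([2,0,3,6,4,1,5], [5,13,14]),
      ([1,3,0,6,4,2,5], [2,10,14]), ([2,0,5,4,1,3], [13])],
    [
      ([2,0,3,1], [])],
    [
      ([3,0,2,1], [])],
    [
      ([2,0,1,4,3], []), ([3,1,5,2,0,4], [8]), ([4,1,6,5,3,0,2], [12]), ([2,5,1,4,0,6,3], [6]),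
      ([1,4,5,0,3,2], [7]), ([4,2,0,3,6,5,1], [12]), ([1,4,0,5,3,6,2], [6]), ([4,0,3,6,2,1,5],
      [8]), ([2,6,1,5,0,4,3], [7]), ([2,0,4,3,1], [12]), ([4,0,6,5,2,3,1], [12]),
      ([1,5,0,4,6,3,2], [7]), ([1,4,3,0,5,2], [6]), ([3,0,5,2,1,4], [8]), ([3,0,2,5,1,4], [8]),
      ([2,0,4,3,5,1], [12,15]), ([2,0,5,1,4,6,3], [7,11]), ([1,5,0,2,4,6,3], [5,7,11]),
      ([2,0,5,1,4,6,3], [8,10,11]), ([1,4,0,5,3,2], [7])],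
    [
      ([0,1,4,2,3,6,5], []), ([0,3,4,2,1,6,5], []), ([0,2,4,1,3,6,5], []), ([0,2,3,1,5,4], []),
      ([0,3,1,4,2,6,5], []), ([0,4,1,3,2,6,5], []), ([0,2,4,3,1,6,5], []), ([0,4,1,5,3,6,2],
      [6]), ([0,4,6,2,3,1,5], [9]), ([0,3,5,4,1,2], [13]), ([0,5,1,4,6,3,2], [7]),
      ([1,3,2,5,0,4], [8]), ([0,5,3,1,2,6,4], [6]), ([0,4,5,1,3,2], [7]), ([0,2,6,5,3,1,4],
      [13]), ([0,3,1,4,6,2,5], [9]), ([4,0,2,1,5,3], [2]), ([0,4,3,1,5,2], [6]),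
      ([0,4,6,1,5,3,2], [7]), ([0,2,4,1,5,3], [6]), ([2,5,1,3,0,6,4], [4,6]), ([4,2,0,3,6,1,5],
      [1,9]), ([2,0,4,1,5,3], [1,6]), ([1,3,0,5,2,4], [4,9]), ([1,5,2,4,0,3], [7,8]),
      ([4,2,0,3,6,5,1], [1,13]), ([1,5,0,2,4,3], [4,7]), ([1,4,3,0,6,5,2], [4,13]),
      ([3,0,6,2,1,5,4], [1,7]), ([5,0,2,6,1,4,3], [3,7]), ([1,4,2,6,5,0,3], [12,13]),
      ([4,0,2,5,3,1], [2,13]), ([5,0,3,6,1,4,2], [3,6,7]), ([1,4,6,2,5,0,3], [9,12,13]),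
      ([1,6,2,4,3,0,5], [7,12,15]), ([5,0,2,4,3,6,1], [3,13,15]), ([0,2,6,1,3,5,4], [7]),
      ([0,3,1,4,6,5,2], [13]), ([0,2,5,3,1,4], [9]), ([0,2,5,1,3,6,4], [6]), ([1,4,3,6,0,5,2],
      [8,13]), ([4,0,6,2,1,5,3], [2,7]), ([1,3,0,6,5,2,4], [4,13]), ([2,0,5,1,6,4,3], [1,7]),
      ([0,3,1,5,2,4], [9]), ([1,5,2,4,6,0,3], [6,8]), ([5,0,2,6,3,1,4], [2,9]), ([2,0,5,1,4,6,3],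
      [1,6]), ([1,3,0,6,4,2,5], [4,9]), ([1,3,5,0,4,6,2], [8,13,15]), ([3,0,6,1,4,2,5],
      [2,7,15]), ([0,2,4,1,6,5,3], [13])],
    [
      ([0,4,5,2,3,6,1], []), ([5,2,0,4,3,6,1], [2]), ([0,2,5,3,6,1,4], [14]), ([0,5,3,1,2,6,4],
      [5]), ([2,4,0,1,5,3], [4]), ([1,4,3,5,0,2], [8]), ([0,3,2,6,1,5,4], [14]),
      ([0,3,6,1,4,2,5], [14]), ([0,5,2,4,6,1,3], [14]), ([0,2,6,1,4,3,5], [14]),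
      ([2,3,0,5,4,6,1], [2]), ([1,5,3,2,6,0,4], [5,8]), ([1,3,5,2,0,4], [12,14]), ([2,0,4,1,5,3],
      [1,5]), ([3,5,1,6,4,0,2], [4,12]), ([3,0,2,5,1,4], [2,14]), ([0,5,3,6,4,1,2], [5,13]),
      ([1,3,6,0,2,5,4], [8,14]), ([2,0,4,6,3,5,1], [1,13,14]), ([2,0,4,1,5,3], [4]),
      ([2,4,0,5,3,6,1], [2]), ([0,3,5,1,2,6,4], [5])],
    [
      ([0,5,6,3,4,2,1], []), ([0,4,3,6,5,2,1], []), ([0,4,3,5,2,1], []), ([0,3,5,4,2,1], []),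
      ([0,5,3,6,4,2,1], []), ([0,4,6,3,5,2,1], []), ([5,3,0,6,4,2,1], [3]), ([2,6,1,5,0,4,3],
      [4]), ([0,5,2,1,6,3,4], [15]), ([0,5,1,6,2,4,3], [5]), ([1,4,3,0,2], [8]), ([2,3,0,5,4,1],
      [2]), ([2,5,0,1,4,3], [4]), ([0,3,2,6,1,5,4], [5]), ([0,5,1,4,6,3,2], [5]), ([0,3,5,2,1,4],
      [15]), ([0,5,4,2,6,3,1], [6]), ([1,6,3,2,5,0,4], [5,8]), ([2,3,0,6,4,1,5], [2,15]),
      ([1,5,3,2,0,4], [12,15]), ([2,0,5,1,4,3], [1,5]), ([3,6,1,5,4,0,2], [4,12]),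
      ([4,0,2,6,1,5,3], [2,5]), ([1,5,3,0,2,6,4], [8,15]), ([0,6,3,5,4,1,2], [5,13]),
      ([3,4,0,2,6,5,1], [2,6]), ([1,4,3,0,5,2], [8,11]), ([1,5,2,4,0,6,3], [5,8,11]),
      ([3,0,2,6,4,1,5], [2,6,15]), ([3,6,0,5,4,2,1], [3]), ([2,0,5,1,4,3], [4]), ([3,0,5,2,4,1],
      [2,6]), ([0,5,4,2,6,3,1], [11])],
    [
      ([1,3,0,2], [])],
    [
      ([0,6,3,4,1,2,5], []), ([2,6,1,4,3,0,5], [8]), ([0,5,1,3,6,2,4], [11]), ([4,2,0,6,3,1,5],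
      [1]), ([0,3,4,2,6,1,5], [5]), ([4,0,5,2,1,3], [2]), ([2,3,0,5,1,4], [1]), ([0,4,2,1,6,5,3],
      [11]), ([0,3,5,1,4,6,2], [11]), ([0,5,2,6,3,1,4], [11]), ([0,3,1,5,4,6,2], [11]),
      ([2,6,0,1,4,3,5], [8]), ([5,0,3,2,6,1,4], [2,5]), ([4,0,3,1,5,2], [3,11]), ([1,3,0,5,2,4],
      [4,5]), ([5,2,6,0,4,1,3], [1,3]), ([1,4,2,0,5,3], [8,11]), ([0,5,6,2,4,1,3], [5,7]),
      ([3,0,4,1,6,5,2], [2,11]), ([1,6,0,4,2,5,3], [4,7,11]), ([1,3,0,5,2,4], [1]),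
      ([0,3,4,1,6,2,5], [5]), ([2,6,0,4,1,3,5], [8])],
    [
      ([0,4,2,3,1], []), ([2,6,1,4,5,0,3], [8]), ([2,5,0,6,3,4,1], [2]), ([0,3,6,4,2,5,1], [6]),
      ([0,6,4,1,3,5,2], [9]), ([0,6,3,5,2,1,4], [14]), ([2,6,0,4,5,1,3], [8]), ([0,5,4,2,6,3,1],
      [11]), ([5,2,0,6,4,3,1], [2]), ([1,4,3,0,2], [8]), ([5,2,3,0,6,4,1], [2]), ([0,4,2,5,3,1],
      [6]), ([0,4,2,1,3], [14]), ([0,5,2,4,1,3], [9]), ([3,6,1,2,5,0,4], [8]), ([5,3,0,6,2,4,1],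
      [2]), ([2,6,4,1,5,0,3], [8]), ([5,2,4,0,6,3,1], [2]), ([0,3,2,4,1], [11]),
      ([3,6,1,5,2,0,4], [8]), ([0,5,2,6,3,1,4], [11,14]), ([0,5,2,4,1,6,3], [9,11]),
      ([0,3,6,4,1,5,2], [6,9]), ([1,5,3,2,0,4], [12,14]), ([4,0,3,2,5,1], [3,11]),
      ([4,0,2,5,3,1], [2,6]), ([2,4,0,6,3,1,5], [2,14]), ([2,0,6,3,5,1,4], [1,9]),
      ([3,0,4,2,5,1], [2,11]), ([0,5,2,6,3,1,4], [6,14]), ([1,5,0,3,6,4,2], [4,6]),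
      ([1,5,2,4,0,3], [8,9]), ([2,5,0,4,1,6,3], [8,11]), ([1,5,3,0,2,4], [8,14]), ([3,1,5,0,4,2],
      [2,8]), ([0,4,6,2,5,1,3], [6,9]), ([0,5,3,6,1,4,2], [6,9]), ([2,5,0,4,3,1], [2,3]),
      ([2,5,0,4,3,1], [8,12]), ([4,1,5,3,0,2], [2,8]), ([2,3,0,6,1,5,4], [1,9]),
      ([2,4,0,1,6,5,3], [4,6]), ([0,5,2,4,6,1,3], [9,11]), ([3,4,0,6,1,5,2], [2,9]),
      ([2,4,6,0,1,5,3], [6,8]), ([1,5,3,0,6,4,2], [4,6]), ([3,0,6,2,5,1,4], [1,9]),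
      ([1,6,4,2,5,0,3], [8,9]), ([5,0,3,6,2,4,1], [2,6]), ([0,2,5,3,1,4], [6,14]),
      ([0,4,2,5,1,3], [11,14]), ([5,0,4,2,6,1,3], [3,11,14]), ([1,5,3,6,2,0,4], [11,12,14]),
      ([1,4,0,6,2,5,3], [4,6,9]), ([2,0,4,6,1,5,3], [1,6,9]), ([0,4,2,6,3,1,5], [6,14])],
    [
      ([0,2,5,6,3,4,1], []), ([0,2,5,4,3,1], []), ([0,2,4,6,3,5,1], []), ([0,2,5,3,6,4,1], []),
      ([0,2,4,3,6,5,1], []), ([5,3,0,2,6,4,1], [3]), ([0,2,5,1,3,4], [15]), ([3,5,1,0,6,2,4],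
      [8]), ([0,5,1,3,6,2,4], [9]), ([2,4,6,1,5,0,3], [8]), ([3,5,1,6,2,0,4], [8]),
      ([0,3,5,1,6,4,2], [9]), ([2,0,3,5,4,1], [2]), ([2,4,0,1,5,3], [8]), ([0,4,2,1,5,3], [9]),
      ([1,3,5,0,6,4,2], [8]), ([1,3,5,4,0,2], [8]), ([3,6,0,2,5,4,1], [3]), ([0,5,3,6,2,1,4],
      [9]), ([0,3,6,4,1,5,2], [9]), ([3,5,0,6,2,1,4], [8]), ([0,5,2,6,3,1,4], [9]),
      ([0,2,6,1,3,5,4], [15]), ([1,3,5,2,0,4], [12,15]), ([3,0,5,1,6,2,4], [1,9]),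
      ([2,0,3,5,1,4], [2,15]), ([1,4,2,5,0,3], [8,9]), ([4,0,5,2,1,6,3], [2,9]),
      ([2,3,0,5,1,6,4], [1,9]), ([1,4,6,2,5,0,3], [8,9]), ([0,5,3,1,4,2], [7,9]),
      ([3,0,4,6,1,5,2], [2,9]), ([3,0,4,1,6,5,2], [2,9]), ([1,6,0,4,2,5,3], [4,7,9]),
      ([0,2,5,1,3,6,4], [15])],
    [
      ([1,3,2,0], [])],
    [
      ([0,6,5,3,4,1,2], []), ([0,6,5,2,4,1,3], []), ([0,5,4,2,1,3], []), ([0,6,5,2,1,4,3], []),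
      ([0,5,4,1,3,2], []), ([0,6,5,3,1,4,2], []), ([2,6,5,1,4,0,3], [12]), ([4,2,0,6,5,3,1],
      [1]), ([0,3,2,5,6,1,4], [15]), ([0,2,4,6,5,1,3], [5]), ([3,0,4,2,1], [2]), ([2,5,0,1,4,3],
      [8]), ([2,3,0,5,4,1], [1]), ([0,4,2,1,6,5,3], [5]), ([0,2,6,5,3,1,4], [5]), ([0,4,3,1,5,2],
      [15]), ([0,6,3,5,2,1,4], [9]), ([5,0,3,2,6,4,1], [2,5]), ([2,5,0,1,4,6,3], [8,15]),
      ([4,0,3,2,5,1], [3,15]), ([1,3,0,5,4,2], [4,5]), ([5,2,6,0,4,3,1], [1,3]),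
      ([1,4,2,6,0,5,3], [5,8]), ([3,0,4,2,6,1,5], [2,15]), ([0,5,6,2,4,3,1], [5,7]),
      ([2,6,3,0,1,5,4], [8,9]), ([3,0,5,2,1,4], [2,14]), ([4,0,2,6,3,1,5], [2,5,14]),
      ([1,5,2,0,4,6,3], [8,9,15]), ([2,6,5,0,4,3,1], [12]), ([1,3,0,5,4,2], [1]), ([1,5,3,0,4,2],
      [8,9]), ([0,6,3,5,2,1,4], [14])],
    [
      ([0,6,1,4,5,2,3], []), ([0,5,1,4,3,2], []), ([0,6,1,3,5,2,4], []), ([0,6,1,4,2,5,3], []),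
      ([0,6,1,3,2,5,4], []), ([2,6,3,1,5,0,4], [12]), ([5,2,4,0,6,1,3], [2]), ([0,2,5,3,6,1,4],
      [6]), ([0,3,1,4,5,2], [15]), ([5,2,0,6,1,4,3], [2]), ([3,0,6,1,5,4,2], [2]),
      ([0,4,6,1,3,5,2], [6]), ([1,5,0,2,4,3], [8]), ([2,3,0,5,1,4], [2]), ([0,3,2,5,1,4], [6]),
      ([0,5,4,2,6,1,3], [6]), ([2,6,3,0,5,4,1], [12]), ([5,3,0,6,1,4,2], [2]), ([2,5,4,0,6,1,3],
      [2]), ([0,5,2,4,6,1,3], [6]), ([0,3,1,4,6,5,2], [15]), ([4,0,3,1,5,2], [3,15]),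
      ([1,5,3,0,6,2,4], [4,6]), ([1,4,0,2,5,3], [8,15]), ([4,0,2,5,1,3], [2,6]),
      ([1,4,3,6,0,2,5], [6,8]), ([2,4,0,1,6,3,5], [4,6]), ([5,0,3,6,1,4,2], [2,6]),
      ([0,3,5,2,4,1], [6,13]), ([1,4,6,0,2,5,3], [6,8]), ([1,3,6,0,2,5,4], [6,8]),
      ([2,0,4,6,3,5,1], [1,6,13]), ([0,3,1,4,6,2,5], [15])],
    [
      ([0,2,1,3], [])]]
  steps := [(1, false, [
      (false, [1,0,2,4,3], false, 32, false), (true, [0,5,3,4,1,2], false, 32, false), (false,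
      [4,6,1,5,2,0,3], true, 32, false), (true, [3,1,4,2,0], true, 32, false), (false,
      [5,1,6,4,0,3,2], true, 23, true), (true, [2,4,1,5,3,0,6], true, 32, false), (true,
      [1,0,2,4,3], true, 14, true), (false, [4,2,0,6,3,1,5], true, 8, true), (false, [1,0,2,4,3],
      true, 4, true), (true, [4,2,0,6,5,3,1], false, 10, true), (false, [5,2,0,6,3,1,4], true,
      32, false), (true, [2,5,0,3,6,1,4], true, 32, false), (false, [3,1,5,0,4,2], true, 32,
      false), (false, [2,0,4,3,1], true, 12, true), (true, [1,4,2,0,6,5,3], true, 12, true),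
      (true, [2,5,0,1,4,6,3], true, 11, true), (true, [4,0,3,1,5,2], true, 15, true), (true,
      [1,3,0,5,2,4,6], true, 8, true), (false, [2,4,0,6,3,5,1], false, 0, true), (true,
      [0,5,6,3,4,2,1], false, 32, false), (true, [0,2,6,3,1,5,4], false, 11, false), (false,
      [6,2,4,0,5,3,1], true, 32, false), (true, [5,1,3,0,4,2], true, 32, false), (false,
      [6,2,0,4,1,5,3], true, 32, false), (true, [2,5,1,3,0,6,4], true, 32, false), (true,
      [1,4,0,2,6,3,5], true, 8, true), (false, [0,5,3,6,4,2,1], false, 32, false), (true,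
      [1,5,0,2,4,3], false, 23, false), (false, [3,0,2,1], false, 23, false), (true,
      [4,0,2,5,1,3], true, 32, false), (false, [6,0,3,5,1,4,2], true, 32, false), (true,
      [6,3,5,0,2,1,4], true, 32, false), (false, [4,1,3,5,2,0], true, 32, false), (true,
      [3,0,2,1], true, 32, false), (true, [0,6,5,2,1,4,3], false, 32, false), (false,
      [2,4,6,0,5,3,1], true, 32, false), (false, [2,0,6,1,3,5,4], true, 8, true), (true,
      [1,4,2,0,3,5], false, 20, false), (false, [0,2,4,1,6,5,3], false, 32, false), (true,
      [0,4,2,1,6,5,3], false, 32, false), (false, [0,3,5,1,4,6,2], false, 32, false), (true,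
      [2,0,5,1,3,6,4], false, 32, false), (false, [2,6,1,3,0,5,4], false, 32, false), (true,
      [1,5,2,0,4,6,3], true, 32, false)]), (4, true, [
      (false, [1,0,2,4,3], false, 32, false), (true, [0,4,5,2,3,1], false, 32, false), (false,
      [6,2,4,0,5,3,1], true, 32, false), (true, [4,1,3,0,2], true, 32, false), (false,
      [1,0,2,4,3], true, 1, true), (true, [1,0,2,4,3], true, 11, true), (false, [4,1,6,5,3,0,2],
      true, 29, true), (true, [2,6,0,5,1,4,3], false, 10, true), (false, [2,5,1,4,6,0,3], true,
      32, false), (true, [2,5,0,3,6,1,4], true, 32, false), (false, [2,4,1,6,0,5,3], true, 32,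
      false), (true, [2,6,0,4,1,3,5], true, 32, false), (true, [1,4,0,5,3,6,2], false, 27, true),
      (false, [1,4,0,3,2], true, 3, true), (false, [2,4,0,1,5,3], true, 2, true), (true,
      [3,0,2,6,1,5,4], true, 3, true), (true, [6,2,0,4,1,5,3], true, 9, true), (true,
      [0,5,4,2,6,3,1], false, 32, false), (true, [1,3,5,2,0,4], true, 0, false), (true,
      [3,0,2,4,6,5,1], false, 0, false), (false, [0,4,1,3,6,5,2], false, 32, false), (true,
      [0,3,5,4,1,2], false, 32, false), (true, [0,2,6,5,1,4,3], false, 32, false), (false,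
      [0,3,6,5,1,4,2], false, 32, false), (true, [0,3,1,4,6,5,2], false, 32, false), (false,
      [1,3,2,5,0,4], true, 32, false), (true, [4,1,5,2,6,3,0], true, 32, false), (false,
      [5,1,6,4,2,0,3], true, 32, false), (true, [4,1,5,3,2,0], true, 32, false), (true,
      [1,5,3,0,4,2], false, 25, false), (true, [1,3,5,2,0,4], true, 32, false), (false,
      [5,1,4,2,0,3], true, 32, false), (true, [1,5,2,4,3,0], true, 32, false), (false,
      [6,2,0,3,5,4,1], true, 32, false), (false, [6,3,0,5,1,4,2], true, 32, false), (true,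
      [2,6,5,0,4,3,1], true, 32, false), (false, [2,0,5,1,4,6,3], false, 32, false), (true,
      [5,0,6,4,1,3,2], false, 32, false), (false, [4,0,3,5,1,2], false, 32, false), (true,
      [3,0,2,6,4,1,5], true, 32, false), (false, [0,6,1,3,5,2,4], true, 32, false)]), (5, true, [
      (true, [0,4,2,3,1], false, 32, false), (false, [4,0,3,1,2,6,5], false, 32, false), (false,
      [0,4,2,3,1], true, 0, true), (true, [5,3,6,1,4,0,2], true, 32, false), (true,
      [5,2,1,4,3,0,6], true, 32, false), (true, [3,1,5,0,2,6,4], true, 10, true), (true,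
      [0,5,1,3,6,4,2], false, 13, true), (true, [6,1,5,0,3,4,2], true, 11, true), (true,
      [3,1,6,4,5,2,0], true, 14, true), (false, [4,1,6,5,0,2,3], false, 29, false), (true,
      [0,6,4,1,5,3,2], false, 22, true), (true, [0,2,6,5,1,4,3], false, 13, false), (false,
      [4,1,5,6,0,3,2], false, 23, false), (true, [0,5,1,3,6,4,2], false, 25, true), (true,
      [4,2,1,6,3,0,5], true, 11, true), (false, [1,0,3,2,5,6,4], false, 32, false), (true,
      [0,3,6,5,2,4,1], false, 32, false), (true, [4,1,3,5,0,2,6], true, 32, false), (true,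
      [1,3,0,5,2,6,4], false, 26, false), (true, [0,2,6,4,3,1,5], false, 9, false), (false,
      [1,3,0,6,4,5,2], false, 26, false), (true, [1,4,6,5,0,3,2], false, 32, false), (true,
      [0,2,4,6,5,1,3], false, 32, false), (true, [4,1,5,2,0,3,6], true, 32, false), (true,
      [5,0,6,1,4,2,3], false, 22, true), (false, [2,5,3,6,1,4,0], true, 32, false), (true,
      [5,3,1,4,6,0,2], true, 32, false), (false, [0,6,4,2,5,1,3], false, 32, false), (true,
      [0,5,3,1,4,2], false, 32, false), (false, [2,0,4,1,6,5,3], false, 32, false), (false,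
      [0,5,3,6,2,4,1], false, 32, false), (true, [0,5,4,2,6,3,1], false, 32, false), (true,
      [2,4,0,6,5,1,3], false, 32, false), (false, [2,0,6,1,3,5,4], false, 32, false), (true,
      [2,0,4,6,5,1,3], false, 32, false), (true, [4,1,6,5,0,3,2], false, 32, false), (true,
      [0,5,2,6,1,4,3], false, 32, false), (true, [5,2,6,1,3,0,4], true, 32, false), (false,
      [4,0,2,5,3,1,6], true, 32, false), (false, [1,5,2,4,0,3,6], true, 32, false), (true,
      [0,2,1,3], true, 32, false), (false, [1,4,2,5,0,3], true, 32, false), (true,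
      [0,5,1,3,6,2,4], true, 32, false), (true, [0,2,5,3,6,1,4], true, 32, false), (false,
      [5,1,4,2,0,3], true, 32, false), (true, [3,6,0,5,4,2,1], true, 32, false), (false,
      [3,5,1,6,4,0,2], false, 32, false)]), (6, false, [
      (false, [0,5,4,2,6,3,1], false, 32, false), (true, [0,6,3,2,5,1,4], false, 32, false),
      (true, [5,1,4,2,6,0,3], true, 32, false), (true, [5,1,4,2,6,3,0], true, 32, false), (false,
      [0,2,1,3], true, 32, false), (true, [1,4,0,5,2,6,3], false, 27, false), (false,
      [6,1,3,2,5,0,4], true, 32, false), (true, [0,2,5,3,6,1,4], true, 32, false), (false,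
      [2,5,3,0,6,1,4], false, 25, false), (true, [6,0,2,5,3,1,4], true, 32, false), (false,
      [4,1,5,2,6,0,3], true, 32, false), (true, [1,5,3,6,2,0,4], true, 32, false), (false,
      [2,3,5,0,4,1], false, 1, false), (true, [0,1,5,3,6,2,4], true, 32, false), (false,
      [4,0,2,6,1,5,3], false, 4, false), (true, [0,4,2,5,1,3], true, 32, false), (true,
      [0,5,3,6,1,4,2], false, 11, false), (false, [1,4,0,2,5,3], false, 32, false), (true,
      [0,4,6,2,5,1,3], false, 32, false)]), (9, true, [
      (false, [0,6,3,5,2,1,4], false, 32, false), (true, [0,5,3,2,6,4,1], false, 32, false),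
      (true, [5,1,3,6,2,0,4], true, 32, false), (true, [6,1,3,5,2,0,4], true, 32, false), (false,
      [0,2,1,3], true, 32, false), (true, [2,0,4,6,1,3,5], false, 14, false), (false,
      [3,5,0,2,6,1,4], false, 32, false), (true, [3,1,5,2,0,4], false, 32, false), (false,
      [1,3,5,2,4,0], false, 32, false), (true, [0,1,5,3,6,2,4], true, 32, false), (true,
      [1,2,0,4,3], false, 32, false), (false, [0,5,3,6,1,4,2], true, 32, false)])]
  -- The last entries use permutations of size 10, the largest size allowed by `witness`.
  corrections := [
    (37440, 128, false, [0,3,7,2,6,4,1,5]), (37442, 128, false, [0,3,7,2,6,4,1,5]), (37456, 128,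
    false, [0,3,7,2,6,4,1,5]), (37696, 128, false, [0,3,7,2,6,4,1,5]), (33352, 8192, false,
    [0,6,3,1,5,7,4,2]), (33354, 8192, false, [0,6,3,1,5,7,4,2]), (33356, 8192, false,
    [0,6,3,1,5,7,4,2]), (33368, 8192, false, [0,6,3,1,5,7,4,2]), (42560, 2, false,
    [1,3,0,7,2,5,4,6]), (46656, 2, false, [1,3,0,7,2,5,4,6]), (420, 1024, false,
    [1,3,6,0,4,7,5,2]), (932, 1024, false, [1,3,6,0,4,7,5,2]), (11282, 32, false,
    [1,4,3,7,0,5,2,6]), (11294, 32, false, [1,4,3,7,0,5,2,6]), (16676, 1024, false,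
    [1,4,6,0,7,2,5,3]), (16677, 1024, false, [1,4,6,0,7,2,5,3]), (16684, 1024, false,
    [1,4,6,0,7,2,5,3]), (16685, 1024, false, [1,4,6,0,7,2,5,3]), (20772, 1024, false,
    [1,4,6,0,7,2,5,3]), (20773, 1024, false, [1,4,6,0,7,2,5,3]), (20780, 1024, false,
    [1,4,6,0,7,2,5,3]), (20781, 1024, false, [1,4,6,0,7,2,5,3]), (25618, 32, false,
    [1,5,2,7,0,4,3,6]), (25622, 32, false, [1,5,2,7,0,4,3,6]), (4690, 8192, false,
    [1,5,3,2,7,0,6,4]), (4818, 8192, false, [1,5,3,2,7,0,6,4]), (5286, 16384, false,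
    [1,5,4,0,7,2,6,3]), (5294, 16384, false, [1,5,4,0,7,2,6,3]), (5284, 16384, false,
    [1,5,4,7,0,2,6,3]), (5292, 16384, false, [1,5,4,7,0,2,6,3]), (5300, 16384, false,
    [1,5,4,7,0,2,6,3]), (5308, 16384, false, [1,5,4,7,0,2,6,3]), (9234, 32, false,
    [1,5,4,7,0,3,2,6]), (9238, 32, false, [1,5,4,7,0,3,2,6]), (9246, 32, false,
    [1,5,4,7,0,3,2,6]), (33298, 128, false, [1,6,3,2,5,0,7,4]), (33576, 1024, false,
    [1,7,0,3,6,4,2,5]), (6680, 8192, false, [1,7,2,5,0,4,6,3]), (6681, 8192, false,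
    [1,7,2,5,0,4,6,3]), (34496, 16, false, [2,0,4,1,6,5,7,3]), (34504, 16, false,
    [2,0,4,1,6,5,7,3]), (36964, 1024, false, [2,0,6,3,5,7,4,1]), (2085, 1024, false,
    [2,3,0,5,7,1,6,4]), (2093, 1024, false, [2,3,0,5,7,1,6,4]), (2341, 1024, false,
    [2,3,0,5,7,1,6,4]), (2349, 1024, false, [2,3,0,5,7,1,6,4]), (6437, 1024, false,
    [2,3,0,5,7,1,6,4]), (6445, 1024, false, [2,3,0,5,7,1,6,4]), (20521, 128, false,
    [2,4,0,3,7,5,1,6]), (8548, 1024, false, [2,4,0,7,3,6,1,5]), (42005, 64, false,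
    [2,4,7,0,3,6,5,1]), (42004, 64, false, [2,4,7,3,0,6,5,1]), (16673, 1024, false,
    [2,5,0,1,7,3,6,4]), (20769, 1024, false, [2,5,0,1,7,3,6,4]), (6185, 8192, false,
    [2,6,0,3,1,5,7,4]), (6177, 8192, false, [2,6,3,0,1,5,7,4]), (2340, 1024, false,
    [3,0,5,7,1,6,2,4]), (2348, 1024, false, [3,0,5,7,1,6,2,4]), (6436, 1024, false,
    [3,0,5,7,1,6,2,4]), (6444, 1024, false, [3,0,5,7,1,6,2,4]), (9528, 2048, false,
    [3,0,5,7,2,1,6,4]), (13624, 2048, false, [3,0,5,7,2,1,6,4]), (13608, 2048, false,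
    [3,0,6,4,7,2,1,5]), (8484, 1024, false, [3,0,7,1,4,6,2,5]), (4132, 1024, false,
    [3,1,7,4,6,0,5,2]), (16425, 128, false, [3,4,0,2,7,5,1,6]), (8512, 32, false,
    [3,5,1,7,4,6,0,2]), (8513, 512, false, [3,5,1,7,4,6,0,2]), (8640, 32, false,
    [3,5,1,7,4,6,0,2]), (8641, 512, false, [3,5,1,7,4,6,0,2]), (24832, 32, false,
    [3,5,1,7,4,6,0,2]), (24896, 32, false, [3,5,1,7,4,6,0,2]), (24960, 32, false,
    [3,5,1,7,4,6,0,2]), (25024, 32, false, [3,5,1,7,4,6,0,2]), (34179, 512, false,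
    [3,7,0,4,1,6,5,2]), (3218, 32, false, [4,0,2,6,5,1,7,3]), (3474, 32, false,
    [4,0,2,6,5,1,7,3]), (20554, 128, false, [4,0,2,7,5,3,6,1]), (20555, 128, false,
    [4,0,2,7,5,3,6,1]), (9512, 2048, false, [4,0,5,7,2,1,6,3]), (9514, 2048, false,
    [4,0,5,7,2,1,6,3]), (13610, 2048, false, [4,0,5,7,2,1,6,3]), (17554, 32, false,
    [4,0,6,2,1,5,7,3]), (21906, 32, false, [4,0,6,2,1,5,7,3]), (1170, 32, false,
    [4,0,6,5,2,1,7,3]), (1426, 32, false, [4,0,6,5,2,1,7,3]), (5522, 32, false,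
    [4,0,6,5,2,1,7,3]), (34178, 512, false, [4,7,0,3,1,6,5,2]), (602, 128, false,
    [5,0,3,2,7,1,6,4]), (8794, 128, false, [5,0,3,2,7,1,6,4]), (32850, 8192, false,
    [5,0,3,2,7,4,1,6]), (296, 1024, false, [5,1,7,0,3,6,4,2]), (33028, 1024, false,
    [6,1,5,3,7,2,0,4]), (33030, 1024, false, [6,1,5,3,7,2,0,4]), (33044, 1024, false,
    [6,1,5,3,7,2,0,4]), (33046, 1024, false, [6,1,5,3,7,2,0,4]), (33047, 1024, false,
    [6,1,5,3,7,2,0,4]), (644, 32, false, [6,2,7,0,4,1,5,3]), (645, 64, false, [6,2,7,0,4,1,5,3]),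
    (2180, 32, false, [6,2,7,0,4,1,5,3]), (2692, 32, false, [6,2,7,0,4,1,5,3]), (8836, 32, false,
    [6,2,7,0,4,1,5,3]), (8837, 64, false, [6,2,7,0,4,1,5,3]), (10372, 32, false,
    [6,2,7,0,4,1,5,3]), (10884, 32, false, [6,2,7,0,4,1,5,3]), (42004, 32, false,
    [2,5,3,8,4,0,7,6,1]), (36908, 16, false, [3,1,5,0,6,8,4,7,2]), (37028, 16, false,
    [3,1,5,0,6,8,4,7,2]), (37160, 2, false, [3,1,8,0,6,2,4,7,5]), (41256, 2, false,
    [3,1,8,0,6,2,4,7,5]), (34178, 32, false, [5,8,0,2,4,1,7,6,3]), (16690, 1024, false,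
    [6,1,8,4,2,7,5,0,3]), (16674, 1024, false, [6,1,8,4,7,2,5,0,3]), (16738, 1024, false,
    [6,1,8,4,7,2,5,0,3]), (2102, 1024, false, [7,1,4,8,3,6,0,5,2]), (2100, 1024, false,
    [7,1,5,8,3,6,0,4,2]), (2612, 1024, false, [7,1,5,8,3,6,0,4,2]), (36900, 1040, false,
    [3,1,5,8,0,6,9,4,7,2]), (36900, 1024, false, [3,1,5,8,0,9,6,4,7,2]), (36900, 16, false,
    [3,1,6,0,5,7,9,4,8,2]), (293, 1024, false, [3,4,1,6,8,0,9,2,7,5]), (301, 1024, false,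
    [3,4,1,6,8,0,9,2,7,5]), (4389, 1024, false, [3,4,1,6,8,0,9,2,7,5]), (4397, 1024, false,
    [3,4,1,6,8,0,9,2,7,5]), (292, 1024, false, [4,1,6,8,0,9,2,7,3,5]), (300, 1024, false,
    [4,1,6,8,0,9,2,7,3,5]), (4388, 1024, false, [4,1,6,8,0,9,2,7,3,5]), (4396, 1024, false,
    [4,1,6,8,0,9,2,7,3,5]), (33064, 1026, false, [4,1,9,0,7,2,5,8,3,6]), (33064, 1024, false,
    [4,1,9,0,7,2,6,5,8,3]), (33064, 2, false, [4,1,9,0,7,3,2,5,8,6])]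

theorem separation132_check : separation132.check 3 [0, 2, 1] representatives132 = true := by
  decide +kernel

end PointSet


/-! ### Underlying patterns and symmetries -/

namespace MeshPattern

/-- In the full occurrence every point of the permutation is used. A point `m` in the column `s.1`
would have to be to the right or to the left of itself. -/
theorem containedIn_underlying (p : MeshPattern) : p.ContainedIn p.underlying := by
  refine ⟨(OrderIso.refl _).toOrderEmbedding, fun a b => Iff.rfl, fun s _ m hm => ?_⟩
  rcases lt_or_ge m.val s.1.val with h | h
  · exact lt_irrefl _ (hm.1 m h)
  · exact lt_irrefl _ (hm.2.1 m h)

theorem size_le_of_containedIn {p : MeshPattern} {π : Permutation} (h : p.ContainedIn π) :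
    p.size ≤ π.1 := by
  obtain ⟨f, -⟩ := h
  simpa using Fintype.card_le_of_injective f f.injective

theorem eq_of_strictMono {n : ℕ} {f : Fin n → Fin n} (h : StrictMono f) (a : Fin n) : f a = a :=
  le_antisymm h.apply_le h.le_apply

/-- The sizes must be equal, so the occurrence uses every position and is the identity embedding.
Order isomorphism then makes the two permutations differ by a strictly monotone bijection, which is
the identity. -/
theorem underlying_eq_of_containedIn {p q : MeshPattern} (h : q.ContainedIn p.underlying)
    (hs : p.size ≤ q.size) : p.underlying = q.underlying := by
  have hs' := size_le_of_containedIn h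
  obtain ⟨k, σ, R⟩ := p
  obtain ⟨l, τ, S⟩ := q
  obtain rfl : k = l := le_antisymm hs hs'
  obtain ⟨f, hf, -⟩ := h
  have h1 : ∀ a, f a = a := eq_of_strictMono f.strictMono
  have h2 : StrictMono (σ ∘ τ.symm) := fun a b hab => by
    have := (hf (τ.symm a) (τ.symm b)).2 (by simpa using hab)
    rw [h1, h1] at this
    exact this
  have h3 : σ = τ := by
    ext a
    have := eq_of_strictMono h2 (τ a)
    simp only [Function.comp_apply, Equiv.symm_apply_apply] at this
    rw [this]
  rw [underlying, underlying, h3]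

theorem Coincident.containedIn_iff {p q : MeshPattern} (h : p.Coincident q) (π : Permutation) :
    p.ContainedIn π ↔ q.ContainedIn π :=
  not_iff_not.1 (Set.ext_iff.1 h π)

theorem coincident_iff {p q : MeshPattern} :
    p.Coincident q ↔ ∀ π, p.ContainedIn π ↔ q.ContainedIn π :=
  ⟨Coincident.containedIn_iff, fun h => Set.ext fun π => not_congr (h π)⟩

/-- Each pattern is contained in the underlying permutation of the other; this gives both size
inequalities and then equality. -/
theorem Coincident.underlying_eq {p q : MeshPattern} (h : p.Coincident q) :
    p.underlying = q.underlying := by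
  have h1 := (h.containedIn_iff _).1 p.containedIn_underlying
  have h2 := (h.containedIn_iff _).2 q.containedIn_underlying
  exact underlying_eq_of_containedIn h1 (size_le_of_containedIn h2)

/-- One of the two underlying permutations already separates, so the separating permutation is no
larger than the patterns. -/
theorem exists_of_underlying_ne {p q : MeshPattern} (h : p.underlying ≠ q.underlying) :
    ∃ π : Permutation, (π.1 = p.size ∨ π.1 = q.size) ∧ ¬ (p.ContainedIn π ↔ q.ContainedIn π) := by
  by_contra hcon
  push Not at hcon
  have h1 := (hcon p.underlying (Or.inl rfl)).1 p.containedIn_underlying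
  have h2 := (hcon q.underlying (Or.inr rfl)).2 q.containedIn_underlying
  exact h (underlying_eq_of_containedIn h1 (size_le_of_containedIn h2))

/-- Compatible symmetries of mesh patterns and permutations. -/
structure Symmetry where
  pattern : MeshPattern → MeshPattern
  perm : Permutation → Permutation
  involutive : Function.Involutive pattern
  perm_involutive : Function.Involutive perm
  size_perm : ∀ π, (perm π).1 = π.1
  underlying : ∀ p, (pattern p).underlying = perm p.underlying
  containedIn : ∀ p π, p.ContainedIn π → (pattern p).ContainedIn (perm π)

/-- Reversal sends column `i` to `k - i`, which exchanges the points to the left with those to the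
right and hence the first two conditions. The conditions on heights are unaffected. -/
theorem InSquare.reverse {k n : ℕ} {τ : Equiv.Perm (Fin k)} {π : Equiv.Perm (Fin n)}
    {f g : Fin k ↪o Fin n} (hg : ∀ a, g a = Fin.rev (f (Fin.rev a))) {i j : Fin (k + 1)} {m : Fin n}
    (h : InSquare (Fin.revPerm.trans τ) (Fin.revPerm.trans π) g (Fin.rev i) j m) :
    InSquare τ π f i j (Fin.rev m) := by
  obtain ⟨h1, h2, h3, h4⟩ := h
  simp only [hg, Fin.val_rev, Equiv.trans_apply, Fin.revPerm_apply, Fin.rev_rev] at h1 h2 h3 h4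
  refine ⟨fun a ha => ?_, fun a ha => ?_, fun a ha => ?_, fun a ha => ?_⟩
  · have := h2 (Fin.rev a) (by rw [Fin.val_rev]; omega)
    rw [Fin.rev_rev] at this
    exact Fin.lt_rev_iff.1 this
  · have := h1 (Fin.rev a) (by rw [Fin.val_rev]; omega)
    rw [Fin.rev_rev] at this
    exact Fin.rev_lt_iff.1 this
  · simpa using h3 (Fin.rev a) (by simpa using ha)
  · simpa using h4 (Fin.rev a) (by simpa using ha)

theorem InSquare.complement {k n : ℕ} {τ : Equiv.Perm (Fin k)} {π : Equiv.Perm (Fin n)}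
    {f : Fin k ↪o Fin n} {i j : Fin (k + 1)} {m : Fin n}
    (h : InSquare (τ.trans Fin.revPerm) (π.trans Fin.revPerm) f i (Fin.rev j) m) :
    InSquare τ π f i j m := by
  obtain ⟨h1, h2, h3, h4⟩ := h
  simp only [Fin.val_rev, Equiv.trans_apply, Fin.revPerm_apply, Fin.rev_lt_rev] at h3 h4
  exact ⟨h1, h2, fun a ha => h4 a (by omega), fun a ha => h3 a (by omega)⟩

/-- Reflection of the positions. -/
def reverse : Symmetry where
  pattern p := ⟨p.size, Fin.revPerm.trans p.perm, p.shading.map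
    (Equiv.prodCongr Fin.revPerm (Equiv.refl _)).toEmbedding⟩
  perm π := ⟨π.1, Fin.revPerm.trans π.2⟩
  involutive p := by
    obtain ⟨k, σ, R⟩ := p
    simp only [MeshPattern.mk.injEq, heq_eq_eq, true_and]
    refine ⟨by ext; simp, ?_⟩
    rw [Finset.map_map]
    convert Finset.map_refl
    ext <;> simp
  perm_involutive π := by
    obtain ⟨n, π⟩ := π
    simp only [Sigma.mk.injEq, heq_eq_eq, true_and]
    ext; simp
  size_perm _ := rfl
  underlying _ := rfl
  containedIn := by
    rintro ⟨k, σ, R⟩ ⟨n, π⟩ ⟨f, hf, hR⟩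
    obtain ⟨g, hg⟩ : ∃ g : Fin k ↪o Fin n, ∀ a, g a = Fin.rev (f (Fin.rev a)) :=
      ⟨OrderEmbedding.ofStrictMono (fun a => Fin.rev (f (Fin.rev a)))
        fun a b hab => Fin.rev_lt_rev.2 (f.lt_iff_lt.2 (Fin.rev_lt_rev.2 hab)), fun _ => rfl⟩
    refine ⟨g, fun a b => ?_, fun s hs m hm => ?_⟩
    · simpa [hg] using hf (Fin.rev a) (Fin.rev b)
    · obtain ⟨u, hu, rfl⟩ := Finset.mem_map.1 hs
      exact hR u hu _ (InSquare.reverse hg hm)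

/-- Reflection of the values. -/
def complement : Symmetry where
  pattern p := ⟨p.size, p.perm.trans Fin.revPerm, p.shading.map
    (Equiv.prodCongr (Equiv.refl _) Fin.revPerm).toEmbedding⟩
  perm π := ⟨π.1, π.2.trans Fin.revPerm⟩
  involutive p := by
    obtain ⟨k, σ, R⟩ := p
    simp only [MeshPattern.mk.injEq, heq_eq_eq, true_and]
    refine ⟨by ext; simp, ?_⟩
    rw [Finset.map_map]
    convert Finset.map_refl
    ext <;> simp
  perm_involutive π := by
    obtain ⟨n, π⟩ := π
    simp only [Sigma.mk.injEq, heq_eq_eq, true_and]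
    ext; simp
  size_perm _ := rfl
  underlying _ := rfl
  containedIn := by
    rintro ⟨k, σ, R⟩ ⟨n, π⟩ ⟨f, hf, hR⟩
    refine ⟨f, fun a b => ?_, fun s hs m hm => ?_⟩
    · simpa using hf b a
    · obtain ⟨u, hu, rfl⟩ := Finset.mem_map.1 hs
      exact hR u hu m (InSquare.complement hm)

namespace Symmetry

variable (S : Symmetry)

/-- The reverse implication is the forward one applied to the images, as both maps are involutions.
-/
theorem containedIn_iff (p : MeshPattern) (π : Permutation) :
    (S.pattern p).ContainedIn (S.perm π) ↔ p.ContainedIn π := by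
  refine ⟨fun h => ?_, S.containedIn p π⟩
  simpa only [S.involutive p, S.perm_involutive π] using S.containedIn _ _ h

theorem coincident_iff (p q : MeshPattern) :
    (S.pattern p).Coincident (S.pattern q) ↔ p.Coincident q := by
  rw [MeshPattern.coincident_iff, MeshPattern.coincident_iff]
  refine ⟨fun h π => ?_, fun h π => ?_⟩
  · simpa only [S.containedIn_iff] using h (S.perm π)
  · rw [← S.perm_involutive π, S.containedIn_iff, S.containedIn_iff]
    exact h _

theorem image_eq (A : Set MeshPattern) : S.pattern '' A = S.pattern ⁻¹' A :=
  congrFun (Set.image_eq_preimage_of_inverse S.involutive.leftInverse S.involutive.rightInverse) A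

theorem coincidenceClass_pattern (p : MeshPattern) :
    coincidenceClass (S.pattern p) = S.pattern '' coincidenceClass p := by
  rw [S.image_eq]
  ext q
  change (S.pattern p).Coincident q ↔ p.Coincident (S.pattern q)
  rw [← S.coincident_iff p, S.involutive q]

theorem withUnderlying_eq {k : ℕ} {σ τ : Equiv.Perm (Fin k)} (h : S.perm ⟨k, σ⟩ = ⟨k, τ⟩) :
    withUnderlying τ = S.pattern '' withUnderlying σ := by
  rw [S.image_eq]
  ext p
  change p.underlying = _ ↔ (S.pattern p).underlying = _
  rw [S.underlying, ← h, S.perm_involutive.eq_iff]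

theorem coincidenceClasses_eq {k : ℕ} {σ τ : Equiv.Perm (Fin k)} (h : S.perm ⟨k, σ⟩ = ⟨k, τ⟩) :
    coincidenceClasses τ = Set.image S.pattern '' coincidenceClasses σ := by
  rw [coincidenceClasses, coincidenceClasses, S.withUnderlying_eq h, Set.image_image, Set.image_image]
  exact Set.image_congr fun p _ => S.coincidenceClass_pattern p

/-- A symmetry carries classes to classes of the same cardinality, so every count that depends on
cardinalities only is transported. Both columns of class sizes, exact and at least, are instances.
-/
theorem encard_filter_eq {k : ℕ} {σ τ : Equiv.Perm (Fin k)} (h : S.perm ⟨k, σ⟩ = ⟨k, τ⟩)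
    (f : ℕ∞ → Prop) : {C ∈ coincidenceClasses τ | f C.encard}.encard =
      {C ∈ coincidenceClasses σ | f C.encard}.encard := by
  have hinj := S.involutive.injective
  rw [← hinj.image_injective.encard_image {C ∈ coincidenceClasses σ | f C.encard}]
  congr 1
  rw [S.coincidenceClasses_eq h]
  ext C
  constructor
  · rintro ⟨⟨D, hD, rfl⟩, h2⟩
    rw [hinj.encard_image] at h2
    exact ⟨D, ⟨hD, h2⟩, rfl⟩
  · rintro ⟨D, ⟨hD, h2⟩, rfl⟩
    exact ⟨⟨D, hD, rfl⟩, by rwa [hinj.encard_image]⟩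

end Symmetry

/-- The classification of the mesh patterns with underlying pattern `τ`: the number of classes and
the numbers of classes of the sizes `1, 2, …`; patterns that are not coincident are separated by a
permutation of size at most `10`. -/
structure Classified {k : ℕ} (τ : Equiv.Perm (Fin k)) (n : ℕ) (sizes : List ℕ) : Prop where
  patterns : (withUnderlying τ).encard = (2 ^ ((k + 1) * (k + 1)) : ℕ)
  classes : (coincidenceClasses τ).encard = n
  ofSize : ∀ j (hj : j < sizes.length), numClassesOfSize τ (j + 1) = sizes[j]
  -- With exact counts for the sizes `1, …, sizes.length`, the larger classes are what is left of
  -- the total.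
  atLeast : numClassesOfSizeAtLeast τ (sizes.length + 1) = (n - sizes.sum : ℕ)
  separated : ∀ p ∈ withUnderlying τ, ∀ q ∈ withUnderlying τ, ¬ p.Coincident q →
    ∃ π : Permutation, π.1 ≤ 10 ∧ ¬ (p.ContainedIn π ↔ q.ContainedIn π)

theorem Classified.symmetry (S : Symmetry) {k n : ℕ} {sizes : List ℕ} {σ τ : Equiv.Perm (Fin k)}
    (h : S.perm ⟨k, σ⟩ = ⟨k, τ⟩) (hσ : Classified σ n sizes) : Classified τ n sizes where
  patterns := by
    rw [S.withUnderlying_eq h, S.involutive.injective.encard_image, hσ.patterns]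
  classes := by
    rw [S.coincidenceClasses_eq h, S.involutive.injective.image_injective.encard_image, hσ.classes]
  ofSize j hj := (S.encard_filter_eq h (fun x => x = _)).trans (hσ.ofSize j hj)
  atLeast := (S.encard_filter_eq h (fun x => _ ≤ x)).trans hσ.atLeast
  separated p hp q hq hpq := by
    rw [S.withUnderlying_eq h] at hp hq
    obtain ⟨p, hp, rfl⟩ := hp
    obtain ⟨q, hq, rfl⟩ := hq
    rw [S.coincident_iff] at hpq
    obtain ⟨π, h1, h2⟩ := hσ.separated p hp q hq hpq
    refine ⟨S.perm π, by rwa [S.size_perm], ?_⟩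
    rwa [S.containedIn_iff, S.containedIn_iff]

end MeshPattern

namespace PointSet

/-! ### Counting the classes -/

theorem testBit_eq_false_of_lt {e r i : ℕ} (hr : r < 2 ^ e) (hi : e ≤ i) : r.testBit i = false :=
  Nat.testBit_lt_two_pow (hr.trans_le (Nat.pow_le_pow_right (by norm_num) hi))

/-- The cell `(i, j)` is the digit `i * (k + 1) + j`, and division with remainder recovers the cell
from the digit. This gives injectivity; equal cardinalities do the rest. -/
theorem shading_bijective (k : ℕ) :
    Function.Bijective fun r : Fin (2 ^ ((k + 1) * (k + 1))) => shading k r := by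
  rw [Fintype.bijective_iff_injective_and_card]
  refine ⟨fun r r' h => Fin.ext (Nat.eq_of_testBit_eq fun b => ?_), by simp⟩
  rcases lt_or_ge b ((k + 1) * (k + 1)) with hb | hb
  · have h1 : b / (k + 1) < k + 1 := Nat.div_lt_of_lt_mul hb
    have h2 := Finset.ext_iff.1 h (⟨b / (k + 1), h1⟩, ⟨b % (k + 1), Nat.mod_lt _ (by omega)⟩)
    simp only [shading, Finset.mem_filter, Finset.mem_univ, true_and, Nat.div_add_mod'] at h2
    exact Bool.eq_iff_iff.2 h2
  · rw [testBit_eq_false_of_lt r.isLt hb, testBit_eq_false_of_lt r'.isLt hb]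

/-- The mesh pattern with a given underlying pattern and an encoded shading. -/
def meshPattern {k : ℕ} (τ : Equiv.Perm (Fin k)) (r : ℕ) : MeshPattern := ⟨k, τ, shading k r⟩

theorem meshPattern_injOn {k : ℕ} (τ : Equiv.Perm (Fin k)) :
    Set.InjOn (meshPattern τ) (Finset.range (2 ^ ((k + 1) * (k + 1)))) := by
  intro r hr r' hr' h
  have hr : r < 2 ^ ((k + 1) * (k + 1)) := by simpa using hr
  have hr' : r' < 2 ^ ((k + 1) * (k + 1)) := by simpa using hr'
  have h1 : shading k r = shading k r' := by simpa [meshPattern] using h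
  exact Fin.ext_iff.1 ((shading_bijective k).1 (a₁ := ⟨r, hr⟩) (a₂ := ⟨r', hr'⟩) h1)

theorem withUnderlying_eq_image {k : ℕ} (τ : Equiv.Perm (Fin k)) :
    MeshPattern.withUnderlying τ =
      meshPattern τ '' (Finset.range (2 ^ ((k + 1) * (k + 1))) : Finset ℕ) := by
  ext p
  constructor
  · obtain ⟨l, σ, S⟩ := p
    intro h
    obtain ⟨rfl, h2⟩ := Sigma.mk.inj_iff.1 (h : (⟨l, σ⟩ : Permutation) = ⟨k, τ⟩)
    obtain rfl := eq_of_heq h2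
    obtain ⟨r, hr⟩ := (shading_bijective l).2 S
    exact ⟨r, by simp, congrArg (MeshPattern.mk l σ) hr⟩
  · rintro ⟨r, -, rfl⟩
    rfl

/-- Equivalence over all point sets is formally stronger than coincidence, as graphs of permutations
are special point sets. -/
theorem Equiv.coincident {k : ℕ} {τ : Equiv.Perm (Fin k)} {t : ℕ → ℕ}
    (ht : ∀ a : Fin k, t a = τ a) {r r' : ℕ} (h : Equiv k t r r') :
    (meshPattern τ r).Coincident (meshPattern τ r') := by
  rw [MeshPattern.coincident_iff]
  rintro ⟨n, π⟩
  exact (contains_ofPerm_iff τ π ht r).symm.trans ((h _).trans (contains_ofPerm_iff τ π ht r'))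

theorem testBit_contMask_iff {k : ℕ} {τ : Equiv.Perm (Fin k)} {t : List ℕ}
    (ht : ∀ a : Fin k, nth t a = τ a) (h1 : isPerm t = true) (h2 : isPattern k t = true)
    {w : List ℕ} (hw : isPerm w = true) {r : ℕ} (hr : r < 2 ^ ((k + 1) * (k + 1))) :
    (contMask k t w).testBit r = true ↔ (meshPattern τ r).ContainedIn ⟨w.length, toPerm w hw⟩ := by
  rw [isPattern, Bool.and_eq_true, allB_iff] at h2
  exact (testBit_contMask h1 (Nat.eq_of_beq_eq_true h2.1)
    (fun j hj => Nat.eq_of_beq_eq_true (h2.2 j (Nat.lt_succ_of_le hj))) hw hr).trans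
    (contains_ofPerm_iff τ _ ht r)

/-- Translates containment in permutations into the digits computed by `contMask`, for which the
separation certificates were verified. -/
theorem agree_of_containedIn_iff {k : ℕ} {τ : Equiv.Perm (Fin k)} {t : List ℕ}
    (ht : ∀ a : Fin k, nth t a = τ a) (h1 : isPerm t = true) (h2 : isPattern k t = true)
    {r r' : ℕ} (hr : r < 2 ^ ((k + 1) * (k + 1))) (hr' : r' < 2 ^ ((k + 1) * (k + 1)))
    (h : ∀ π : Permutation, π.1 ≤ 10 →
      ((meshPattern τ r).ContainedIn π ↔ (meshPattern τ r').ContainedIn π)) : Agree k t r r' := by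
  intro w hw hlen
  rw [Bool.eq_iff_iff, testBit_contMask_iff ht h1 h2 hw hr, testBit_contMask_iff ht h1 h2 hw hr']
  exact h _ hlen

/-! ### Class sizes from a system of representatives -/

/-- The map `loc` chooses representatives, in the family `rep`, of the coincidence classes. -/
structure Represents {k : ℕ} (τ : Equiv.Perm (Fin k)) (rep : ℕ) (loc : ℕ → ℕ) : Prop where
  lt : ∀ r < 2 ^ ((k + 1) * (k + 1)), loc r < 2 ^ ((k + 1) * (k + 1))
  mem : ∀ r < 2 ^ ((k + 1) * (k + 1)), rep.testBit (loc r) = true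
  eq_self : ∀ r < 2 ^ ((k + 1) * (k + 1)), rep.testBit r = true → loc r = r
  coincident_iff : ∀ r < 2 ^ ((k + 1) * (k + 1)), ∀ r' < 2 ^ ((k + 1) * (k + 1)),
    (meshPattern τ r).Coincident (meshPattern τ r') ↔ loc r = loc r'

/-- The shadings with a given representative. -/
def fibre (k : ℕ) (loc : ℕ → ℕ) (r : ℕ) : Finset ℕ :=
  (Finset.range (2 ^ ((k + 1) * (k + 1)))).filter fun r' => loc r' = r

/-- The representatives. -/
def repSet (k rep : ℕ) : Finset ℕ :=
  (Finset.range (2 ^ ((k + 1) * (k + 1)))).filter fun r => rep.testBit r = true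

theorem mem_repSet {k rep r : ℕ} :
    r ∈ repSet k rep ↔ r < 2 ^ ((k + 1) * (k + 1)) ∧ rep.testBit r = true := by
  rw [repSet, Finset.mem_filter, Finset.mem_range]

namespace Represents

variable {k rep : ℕ} {τ : Equiv.Perm (Fin k)} {loc : ℕ → ℕ}

/-- Classes are taken among mesh patterns of all sizes. By `Coincident.underlying_eq` a class does
not leave the given underlying pattern, so it consists of coded shadings, which `loc` sorts. -/
theorem coincidenceClass_eq (h : Represents τ rep loc) {r : ℕ} (hr : r ∈ repSet k rep) :
    (meshPattern τ r).coincidenceClass = meshPattern τ '' (fibre k loc r : Finset ℕ) := by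
  rw [mem_repSet] at hr
  ext q
  constructor
  · intro hq
    have hq' : q ∈ MeshPattern.withUnderlying τ := (MeshPattern.Coincident.underlying_eq hq).symm
    rw [withUnderlying_eq_image] at hq'
    obtain ⟨r', hr', rfl⟩ := hq'
    have hr'' : r' < 2 ^ ((k + 1) * (k + 1)) := by simpa using hr'
    have h1 := (h.coincident_iff r hr.1 r' hr'').1 hq
    rw [h.eq_self r hr.1 hr.2] at h1
    exact ⟨r', by simpa [fibre] using ⟨hr'', h1.symm⟩, rfl⟩
  · rintro ⟨r', hr', rfl⟩
    obtain ⟨h1, h2⟩ : r' < 2 ^ ((k + 1) * (k + 1)) ∧ loc r' = r := by simpa [fibre] using hr'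
    exact (h.coincident_iff r hr.1 r' h1).2 (by rw [h.eq_self r hr.1 hr.2, h2])

theorem encard_coincidenceClass (h : Represents τ rep loc) {r : ℕ} (hr : r ∈ repSet k rep) :
    (meshPattern τ r).coincidenceClass.encard = (fibre k loc r).card := by
  rw [h.coincidenceClass_eq hr, Set.InjOn.encard_image, Set.encard_coe_eq_coe_finsetCard]
  exact (meshPattern_injOn τ).mono (by
    rw [Finset.coe_subset]; exact Finset.filter_subset _ _)

theorem coincidenceClasses_eq (h : Represents τ rep loc) : MeshPattern.coincidenceClasses τ =
    (fun r => (meshPattern τ r).coincidenceClass) '' (repSet k rep : Finset ℕ) := by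
  rw [MeshPattern.coincidenceClasses, withUnderlying_eq_image, Set.image_image]
  ext C
  constructor
  · rintro ⟨r, hr, rfl⟩
    have hr : r < 2 ^ ((k + 1) * (k + 1)) := by simpa using hr
    refine ⟨loc r, Finset.mem_coe.2 (mem_repSet.2 ⟨h.lt r hr, h.mem r hr⟩), ?_⟩
    have h1 : (meshPattern τ (loc r)).av = (meshPattern τ r).av :=
      (h.coincident_iff _ (h.lt r hr) r hr).2 (h.eq_self _ (h.lt r hr) (h.mem r hr))
    ext q
    change _ = _ ↔ _ = _
    rw [h1]
  · rintro ⟨r, hr, rfl⟩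
    exact ⟨r, by simpa using (mem_repSet.1 (Finset.mem_coe.1 hr)).1, rfl⟩

/-- Representatives correspond bijectively to classes and fibres to their elements, so classes can
be counted by counting representatives. The predicate `g` is `f` restricted to finite cardinalities.
-/
theorem encard_filter_coincidenceClasses (h : Represents τ rep loc) (f : ℕ∞ → Prop)
    (g : ℕ → Prop) [DecidablePred g] (hfg : ∀ n : ℕ, f n ↔ g n) :
    {C ∈ MeshPattern.coincidenceClasses τ | f C.encard}.encard =
      ((repSet k rep).filter fun r => g (fibre k loc r).card).card := by
  have e : {C ∈ MeshPattern.coincidenceClasses τ | f C.encard} =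
      (fun r => (meshPattern τ r).coincidenceClass) ''
        ((repSet k rep).filter fun r => g (fibre k loc r).card : Finset ℕ) := by
    rw [h.coincidenceClasses_eq]
    ext C
    constructor
    · rintro ⟨⟨r, hr, rfl⟩, hC⟩
      have hr := Finset.mem_coe.1 hr
      rw [h.encard_coincidenceClass hr, hfg] at hC
      exact ⟨r, Finset.mem_coe.2 (Finset.mem_filter.2 ⟨hr, hC⟩), rfl⟩
    · rintro ⟨r, hr, rfl⟩
      obtain ⟨hr, hC⟩ := Finset.mem_filter.1 (Finset.mem_coe.1 hr)
      refine ⟨⟨r, Finset.mem_coe.2 hr, rfl⟩, ?_⟩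
      change f (meshPattern τ r).coincidenceClass.encard
      rwa [h.encard_coincidenceClass hr, hfg]
  rw [e, Set.InjOn.encard_image, Set.encard_coe_eq_coe_finsetCard]
  intro r hr r' hr' hrr
  have hr := mem_repSet.1 (Finset.filter_subset _ _ (Finset.mem_coe.1 hr))
  have hr' := mem_repSet.1 (Finset.filter_subset _ _ (Finset.mem_coe.1 hr'))
  have h1 : meshPattern τ r' ∈ (meshPattern τ r).coincidenceClass := by
    rw [show (meshPattern τ r).coincidenceClass = (meshPattern τ r').coincidenceClass from hrr]
    rfl
  have h2 := (h.coincident_iff r hr.1 r' hr'.1).1 h1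
  rwa [h.eq_self r hr.1 hr.2, h.eq_self r' hr'.1 hr'.2] at h2

/-- Only representatives have nonempty fibres, so the count of the certificate, which ranges over
all shadings, is a count of representatives. -/
theorem filter_card_fibre (h : Represents τ rep loc) (j : ℕ) :
    (repSet k rep).filter (fun r => (fibre k loc r).card = j + 1) =
      (Finset.range (2 ^ ((k + 1) * (k + 1)))).filter fun r => (fibre k loc r).card = j + 1 := by
  ext r
  rw [Finset.mem_filter, Finset.mem_filter, mem_repSet, Finset.mem_range]
  refine ⟨fun hr => ⟨hr.1.1, hr.2⟩, fun hr => ⟨⟨hr.1, ?_⟩, hr.2⟩⟩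
  obtain ⟨r', hr'⟩ := Finset.card_pos.1 (hr.2.symm ▸ Nat.succ_pos j : 0 < (fibre k loc r).card)
  rw [fibre, Finset.mem_filter, Finset.mem_range] at hr'
  rw [← hr'.2]
  exact h.mem r' hr'.1

end Represents

/-- All counts are positive, so subtracting those with the values `1, …, n` leaves those above `n`.
The truncated subtraction is exact because the subtracted sets are disjoint subsets. -/
theorem card_filter_le (s : Finset ℕ) (c : ℕ → ℕ) (n : ℕ) (hc : ∀ r ∈ s, 0 < c r) :
    (s.filter fun r => n + 1 ≤ c r).card =
      s.card - ∑ j ∈ Finset.range n, (s.filter fun r => c r = j + 1).card := by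
  induction n with
  | zero =>
    rw [Finset.filter_true_of_mem (show ∀ r ∈ s, 0 + 1 ≤ c r from hc)]
    simp
  | succ n ih =>
    have e : s.filter (fun r => n + 1 + 1 ≤ c r) =
        (s.filter fun r => n + 1 ≤ c r) \ s.filter fun r => c r = n + 1 := by
      ext r
      simp only [Finset.mem_filter, Finset.mem_sdiff]
      constructor
      · rintro ⟨h1, h2⟩; exact ⟨⟨h1, by omega⟩, fun h3 => by omega⟩
      · rintro ⟨⟨h1, h2⟩, h3⟩
        exact ⟨h1, by have : c r ≠ n + 1 := fun h => h3 ⟨h1, h⟩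
                      omega⟩
    rw [e, Finset.card_sdiff_of_subset, ih, Finset.sum_range_succ, Nat.sub_add_eq]
    exact Finset.monotone_filter_right _ fun r _ h => h.ge

theorem sum_range_getD (l : List ℕ) : ∑ j ∈ Finset.range l.length, l.getD j 0 = l.sum := by
  rw [Finset.sum_range, ← Fin.sum_univ_getElem]
  exact Finset.sum_congr rfl fun j _ => List.getD_eq_getElem _ _ j.isLt

/-- `hd` bounds the number of classes from above, and `hs`, which says that agreeing representatives
are equal, shows that no two representatives are equivalent. Together they identify the fibres of
`loc` with the coincidence classes. -/
theorem Distributed.classified {k : ℕ} {τ : Equiv.Perm (Fin k)} {t : List ℕ} {rep n : ℕ}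
    {sizes : List ℕ} (ht : ∀ a : Fin k, nth t a = τ a) (h1 : isPerm t = true)
    (h2 : isPattern k t = true) (hd : Distributed k (nth t) rep n sizes)
    (hs : ∀ r r', Agree k t r r' → r < 2 ^ ((k + 1) * (k + 1)) → r' < 2 ^ ((k + 1) * (k + 1)) →
      rep.testBit r = true → rep.testBit r' = true → r = r') :
    MeshPattern.Classified τ n sizes := by
  obtain ⟨loc, hloc, hcard, hsizes⟩ := hd
  have hcoin : ∀ r < 2 ^ ((k + 1) * (k + 1)),
      (meshPattern τ r).Coincident (meshPattern τ (loc r)) :=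
    fun r hr => (hloc r hr).2.1.coincident ht
  -- The representatives of `r` and `r'` inherit from them the containments in permutations of size
  -- at most 10, so they agree and are equal. Both the converse of `hcoin` and the bound 10 in the
  -- separation result from this.
  have key : ∀ r < 2 ^ ((k + 1) * (k + 1)), ∀ r' < 2 ^ ((k + 1) * (k + 1)),
      (∀ π : Permutation, π.1 ≤ 10 →
        ((meshPattern τ r).ContainedIn π ↔ (meshPattern τ r').ContainedIn π)) →
      loc r = loc r' := by
    intro r hr r' hr' h
    refine hs _ _ (agree_of_containedIn_iff ht h1 h2 (hloc r hr).1 (hloc r' hr').1 fun π hπ => ?_)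
      (hloc r hr).1 (hloc r' hr').1 (hloc r hr).2.2 (hloc r' hr').2.2
    exact ((hcoin r hr).containedIn_iff π).symm.trans
      ((h π hπ).trans ((hcoin r' hr').containedIn_iff π))
  have hiff : ∀ r < 2 ^ ((k + 1) * (k + 1)), ∀ r' < 2 ^ ((k + 1) * (k + 1)),
      ((meshPattern τ r).Coincident (meshPattern τ r') ↔ loc r = loc r') := fun r hr r' hr' =>
    ⟨fun h => key r hr r' hr' fun π _ => h.containedIn_iff π, fun h => by
      have h3 := hcoin r hr
      rw [h] at h3
      exact Eq.trans h3 (hcoin r' hr').symm⟩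
  have H : Represents τ rep loc := by
    refine ⟨fun r hr => (hloc r hr).1, fun r hr => (hloc r hr).2.2, fun r hr hrep => ?_, hiff⟩
    -- A representative and its image under `loc` are coincident and both in `rep`, hence equal. The
    -- certificate by itself does not guarantee that representatives stay in place.
    exact hs _ _ (agree_of_containedIn_iff ht h1 h2 (hloc r hr).1 hr fun π _ =>
      ((hcoin r hr).containedIn_iff π).symm) (hloc r hr).1 hr (hloc r hr).2.2 hrep
  have hsz : ∀ j < sizes.length, ((repSet k rep).filter fun r =>
      (fibre k loc r).card = j + 1).card = sizes.getD j 0 := fun j hj => by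
    rw [H.filter_card_fibre]
    exact hsizes j hj
  constructor
  · rw [withUnderlying_eq_image, (meshPattern_injOn τ).encard_image,
      Set.encard_coe_eq_coe_finsetCard, Finset.card_range]
  · have h3 := H.encard_filter_coincidenceClasses (fun _ => True) (fun _ => True) fun _ => Iff.rfl
    simp only [and_true, Finset.filter_true, Set.ofPred_mem_eq] at h3
    rw [h3, repSet, hcard]
  · intro j hj
    have h3 := H.encard_filter_coincidenceClasses (fun x => x = ((j + 1 : ℕ) : ℕ∞))
      (fun x => x = j + 1) fun n => by exact_mod_cast Iff.rfl
    rw [hsz j hj, List.getD_eq_getElem _ _ hj] at h3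
    exact h3
  · have h3 := H.encard_filter_coincidenceClasses (fun x => ((sizes.length + 1 : ℕ) : ℕ∞) ≤ x)
      (fun x => sizes.length + 1 ≤ x) fun n => by exact_mod_cast Iff.rfl
    rw [card_filter_le, Finset.sum_congr rfl fun j hj => hsz j (Finset.mem_range.1 hj),
      sum_range_getD, show (repSet k rep).card = n from hcard] at h3
    · exact h3
    · intro r hr
      rw [mem_repSet] at hr
      exact Finset.card_pos.2 ⟨r, by
        rw [fibre, Finset.mem_filter, Finset.mem_range]
        exact ⟨hr.1, H.eq_self r hr.1 hr.2⟩⟩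
  · intro p hp q hq hpq
    rw [withUnderlying_eq_image] at hp hq
    obtain ⟨r, hr, rfl⟩ := hp
    obtain ⟨r', hr', rfl⟩ := hq
    have hr : r < 2 ^ ((k + 1) * (k + 1)) := by simpa using hr
    have hr' : r' < 2 ^ ((k + 1) * (k + 1)) := by simpa using hr'
    by_contra hcon
    push Not at hcon
    exact hpq ((hiff r hr r' hr').2 (key r hr r' hr' hcon))

/-! ### The classification -/

/-- The digits of 60097 mark the shadings 0, 6, 7, 9, 11, 13, 14 and 15: no cell, the two diagonals,
the four triples and all cells. The single cells and the pairs of adjacent cells are reduced to the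
empty shading by removals that the automatic rules justify. No class sizes are counted here. -/
theorem distributed_1 : Distributed 1 (nth [0]) 60097 8 [] :=
  Certificate.check_sound (pairs := []) (fun _ h => absurd h (List.not_mem_nil))
    ⟨[], [], [], [0, 1, 2, 3, 0, 1, 2, 3], []⟩ (by decide +kernel)

/-- The permutations that separate the classes for the pattern `1`. -/
def separation1 : List (List ℕ) := [[0, 1], [1, 2, 0], [0, 2, 1], [2, 0, 1], [1, 0, 2]]

/-- With 16 shadings a direct comparison of pairs is cheap enough, so no reconstruction of cells is
needed. -/
theorem separation1_check : ∀ r < 16, ∀ r' < 16,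
    Nat.testBit 60097 r = true → Nat.testBit 60097 r' = true →
    (∀ w ∈ separation1, (contMask 1 [0] w).testBit r = (contMask 1 [0] w).testBit r') → r = r' := by
  decide +kernel

theorem classified_1 : MeshPattern.Classified (1 : Equiv.Perm (Fin 1)) 8 [] :=
  distributed_1.classified (by decide) (by decide) (by decide) fun r r' h hr hr' h1 h2 =>
    separation1_check r hr r' hr' h1 h2 fun w hw =>
      have hw' : isPerm w = true ∧ w.length ≤ 10 :=
        (by decide : ∀ w ∈ separation1, isPerm w = true ∧ w.length ≤ 10) w hw
      h w hw'.1 hw'.2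

theorem classified_12 :
    MeshPattern.Classified (1 : Equiv.Perm (Fin 2)) 220 [161, 37, 2, 11, 0, 0, 0] :=
  distributed_12.classified (by decide) (by decide) (by decide) fun _ _ =>
    separation12.eq_of_agree separation12_check

theorem classified_123 : MeshPattern.Classified (1 : Equiv.Perm (Fin 3)) 33516
    [23908, 6116, 132, 1961, 16, 172, 0] :=
  distributed_123.classified (by decide) (by decide) (by decide) fun _ _ =>
    separation123.eq_of_agree separation123_check

theorem classified_132 : MeshPattern.Classified (Equiv.swap 1 2 : Equiv.Perm (Fin 3)) 33350
    [23035, 6598, 286, 2182, 46, 164, 0] :=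
  distributed_132.classified (by decide) (by decide) (by decide) fun _ _ =>
    separation132.eq_of_agree separation132_check

end PointSet

/-! ### Transport to all underlying patterns and the theorem -/

namespace MeshPattern

theorem classified_size_two (τ : Equiv.Perm (Fin 2)) :
    Classified τ 220 [161, 37, 2, 11, 0, 0, 0] := by
  have h : ∀ τ : Equiv.Perm (Fin 2), τ = 1 ∨ τ = Fin.revPerm := by decide
  rcases h τ with rfl | rfl
  · exact PointSet.classified_12
  · exact PointSet.classified_12.symmetry reverse rfl

theorem classified_monotone {τ : Equiv.Perm (Fin 3)} (h : τ = 1 ∨ τ = Fin.revPerm) :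
    Classified τ 33516 [23908, 6116, 132, 1961, 16, 172, 0] := by
  rcases h with rfl | rfl
  · exact PointSet.classified_123
  · exact PointSet.classified_123.symmetry reverse rfl

/-- The patterns 132, 231, 312 and 213 form one orbit under reversal and complement: reversing 132
gives 231, and the complements of these two are 312 and 213. -/
theorem classified_nonmonotone {τ : Equiv.Perm (Fin 3)} (h1 : τ ≠ 1) (h2 : τ ≠ Fin.revPerm) :
    Classified τ 33350 [23035, 6598, 286, 2182, 46, 164, 0] := by
  have h : ∀ τ : Equiv.Perm (Fin 3), τ = 1 ∨ τ = Fin.revPerm ∨ τ = Equiv.swap 1 2 ∨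
      τ = Fin.revPerm.trans (Equiv.swap 1 2) ∨ τ = (Equiv.swap 1 2).trans Fin.revPerm ∨
      τ = (Fin.revPerm.trans (Equiv.swap 1 2)).trans Fin.revPerm := by decide
  have h3 := PointSet.classified_132
  have h4 := h3.symmetry reverse rfl
  rcases h τ with rfl | rfl | rfl | rfl | rfl | rfl
  · exact absurd rfl h1
  · exact absurd rfl h2
  · exact h3
  · exact h4
  · exact h3.symmetry complement rfl
  · exact h4.symmetry complement rfl

theorem exists_of_underlying_eq {p q : MeshPattern} (h1 : 1 ≤ p.size) (h3 : p.size ≤ 3)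
    (hu : p.underlying = q.underlying) (h : ¬ p.Coincident q) :
    ∃ π : Permutation, π.1 ≤ 10 ∧ ¬ (p.ContainedIn π ↔ q.ContainedIn π) := by
  suffices hc : ∃ n sizes, Classified p.perm n sizes by
    obtain ⟨n, sizes, hc⟩ := hc
    exact hc.separated p rfl q hu.symm h
  clear h hu
  obtain ⟨k, τ, R⟩ := p
  change 1 ≤ k at h1
  change k ≤ 3 at h3
  change ∃ n sizes, Classified τ n sizes
  interval_cases k
  · rw [Subsingleton.elim τ 1]
    exact ⟨_, _, PointSet.classified_1⟩
  · exact ⟨_, _, classified_size_two τ⟩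
  · by_cases h4 : τ = 1 ∨ τ = Fin.revPerm
    · exact ⟨_, _, classified_monotone h4⟩
    · push Not at h4
      exact ⟨_, _, classified_nonmonotone h4.1 h4.2⟩

end MeshPattern

theorem mainTheorem5 :
    -- coincident mesh patterns (of any sizes) have the same underlying classical pattern
    (∀ p q : MeshPattern, p.Coincident q → p.underlying = q.underlying) ∧
    -- size 1
    (MeshPattern.coincidenceClasses (1 : Equiv.Perm (Fin 1))).encard = 8 ∧
    -- size 2: underlying pattern 12 or 21
    (∀ τ : Equiv.Perm (Fin 2),
      (MeshPattern.withUnderlying τ).encard = 512 ∧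
      (MeshPattern.coincidenceClasses τ).encard = 220 ∧
      MeshPattern.numClassesOfSize τ 1 = 161 ∧
      MeshPattern.numClassesOfSize τ 2 = 37 ∧
      MeshPattern.numClassesOfSize τ 3 = 2 ∧
      MeshPattern.numClassesOfSize τ 4 = 11 ∧
      MeshPattern.numClassesOfSize τ 5 = 0 ∧
      MeshPattern.numClassesOfSize τ 6 = 0 ∧
      MeshPattern.numClassesOfSize τ 7 = 0 ∧
      MeshPattern.numClassesOfSizeAtLeast τ 8 = 9) ∧
    -- size 3: underlying pattern 123 or 321
    (∀ τ : Equiv.Perm (Fin 3), τ = 1 ∨ τ = Fin.revPerm →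
      (MeshPattern.withUnderlying τ).encard = 65536 ∧
      (MeshPattern.coincidenceClasses τ).encard = 33516 ∧
      MeshPattern.numClassesOfSize τ 1 = 23908 ∧
      MeshPattern.numClassesOfSize τ 2 = 6116 ∧
      MeshPattern.numClassesOfSize τ 3 = 132 ∧
      MeshPattern.numClassesOfSize τ 4 = 1961 ∧
      MeshPattern.numClassesOfSize τ 5 = 16 ∧
      MeshPattern.numClassesOfSize τ 6 = 172 ∧
      MeshPattern.numClassesOfSize τ 7 = 0 ∧
      MeshPattern.numClassesOfSizeAtLeast τ 8 = 1211) ∧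
    -- size 3: underlying pattern 132, 213, 231 or 312
    (∀ τ : Equiv.Perm (Fin 3), τ ≠ 1 → τ ≠ Fin.revPerm →
      (MeshPattern.withUnderlying τ).encard = 65536 ∧
      (MeshPattern.coincidenceClasses τ).encard = 33350 ∧
      MeshPattern.numClassesOfSize τ 1 = 23035 ∧
      MeshPattern.numClassesOfSize τ 2 = 6598 ∧
      MeshPattern.numClassesOfSize τ 3 = 286 ∧
      MeshPattern.numClassesOfSize τ 4 = 2182 ∧
      MeshPattern.numClassesOfSize τ 5 = 46 ∧
      MeshPattern.numClassesOfSize τ 6 = 164 ∧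
      MeshPattern.numClassesOfSize τ 7 = 0 ∧
      MeshPattern.numClassesOfSizeAtLeast τ 8 = 1039) ∧
    -- non-coincidence is witnessed by a permutation of size at most 10
    (∀ p q : MeshPattern, 1 ≤ p.size → p.size ≤ 3 → 1 ≤ q.size → q.size ≤ 3 →
      ¬ p.Coincident q →
      ∃ π : Permutation, π.1 ≤ 10 ∧ ¬ (p.ContainedIn π ↔ q.ContainedIn π)) := by
  refine ⟨fun p q h => h.underlying_eq, PointSet.classified_1.classes, fun τ => ?_, fun τ hτ => ?_,
    fun τ h1 h2 => ?_, fun p q hp hp' hq hq' hpq => ?_⟩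
  · have h := MeshPattern.classified_size_two τ
    exact ⟨h.patterns, h.classes, h.ofSize 0 (by decide), h.ofSize 1 (by decide),
      h.ofSize 2 (by decide), h.ofSize 3 (by decide), h.ofSize 4 (by decide),
      h.ofSize 5 (by decide), h.ofSize 6 (by decide), h.atLeast⟩
  · have h := MeshPattern.classified_monotone hτ
    exact ⟨h.patterns, h.classes, h.ofSize 0 (by decide), h.ofSize 1 (by decide),
      h.ofSize 2 (by decide), h.ofSize 3 (by decide), h.ofSize 4 (by decide),
      h.ofSize 5 (by decide), h.ofSize 6 (by decide), h.atLeast⟩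
  · have h := MeshPattern.classified_nonmonotone h1 h2
    exact ⟨h.patterns, h.classes, h.ofSize 0 (by decide), h.ofSize 1 (by decide),
      h.ofSize 2 (by decide), h.ofSize 3 (by decide), h.ofSize 4 (by decide),
      h.ofSize 5 (by decide), h.ofSize 6 (by decide), h.atLeast⟩
  · by_cases hu : p.underlying = q.underlying
    · exact MeshPattern.exists_of_underlying_eq hp hp' hu hpq
    · obtain ⟨π, h1, h2⟩ := MeshPattern.exists_of_underlying_ne hu
      -- The separating permutation has the size of one of the two patterns, hence at most 3.
      exact ⟨π, by omega, h2⟩
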